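/- Let $\Lambda,\Lambda_F$ be positive integers. All vector spaces are over $\mathbb C$; "finite linear combinations" is always meant. **Words.** $I,J,K,L,\dots$ denote non-empty words, and dotted symbols $\dot I,\dot J,\dots$ possibly empty words, in the letters $1,\dots,2\Lambda$ (or, in the heterix superalgebra, $1,\dots,2\Lambda+4\Lambda_F$). $\epsilon(W)\in\{0,1\}$ is the parity of the number of letters $k$ of $W$ with $\Lambda+1\le k\le 2\Lambda$. $\sum_{I_1I_2=I}$ runs over all splittings of $I$, where undotted pieces are non-empty and dotted pieces may be empty. $\delta$ is the Kronecker delta. Greek indices $\lambda_i,\rho_i$ run over $1,\dots,2\Lambda_F$. For a pair of operators with words $(I,J)$ and $(K,L)$ put $q=\epsilon(K)+\epsilon(L)$, $m=\epsilon(I)+\epsilon(J)$ and $S=(-1)^{mq}$. **The spaces.** Let $G$ be the direct sum of five spaces, with bases or generators of the first kind $\bar\Xi^{\lambda_1}_{\lambda_2}\otimes f^{\dot I}_{\dot J}\otimes\Xi^{\lambda_3}_{\lambda_4}$ (basis), second kind $\bar\Xi^{\lambda_1}_{\lambda_2}\otimes l^{\dot I}_{\dot J}$ (basis), third kind $r^{\dot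 I}_{\dot J}\otimes\Xi^{\lambda_1}_{\lambda_2}$ (basis), fourth kind $\gamma^I_J$ (basis), and fifth kind $\tilde f^I_J$ (generators, subject only to $\tilde f^{I_1I_2}_J=(-1)^{\epsilon(I_1)\epsilon(I_2)}\tilde f^{I_2I_1}_J$, $\tilde f^I_{J_1J_2}=(-1)^{\epsilon(J_1)\epsilon(J_2)}\tilde f^I_{J_2J_1}$). The grade of each generator is $\epsilon$ of its upper word plus $\epsilon$ of its lower word mod 2. Let $\mathcal T_o$ have basis $\bar\phi^{\rho_1}\otimes s^{\dot K}\otimes\phi^{\rho_2}$ and let $\mathcal T_c$ be generated by the $\Psi^K$ subject only to $\Psi^{K_1K_2}=(-1)^{\epsilon(K_1)\epsilon(K_2)}\Psi^{K_2K_1}$; the grade of these states is $\epsilon(\dot K)$ resp. $\epsilon(K)$. **The superbrackets of $G$** (the reversed order being given by super skew-symmetry $[x,y]=-(-1)^{|x||y|}[y,x]$). Operators of kinds one, two, three have zero bracket with the fifth kind, and (writing $\bar\Xi f\Xi$ without $\otimes$) - $[\bar\Xi^{\lambda_1}_{\lambda_2}f^{\dot I}_{\dot J}\Xi^{\lambda_3}_{\lambda_4},\bar\Xi^{\lambda_5}_{\lambda_6}f^{\dot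 K}_{\dot L}\Xi^{\lambda_7}_{\lambda_8}]=\delta^{\lambda_5}_{\lambda_2}\delta^{\dot K}_{\dot J}\delta^{\lambda_7}_{\lambda_4}\bar\Xi^{\lambda_1}_{\lambda_6}f^{\dot I}_{\dot L}\Xi^{\lambda_3}_{\lambda_8}-S\,\delta^{\lambda_1}_{\lambda_6}\delta^{\dot I}_{\dot L}\delta^{\lambda_3}_{\lambda_8}\bar\Xi^{\lambda_5}_{\lambda_2}f^{\dot K}_{\dot J}\Xi^{\lambda_7}_{\lambda_4}$; - $[\bar\Xi^{\lambda_1}_{\lambda_2}f^{\dot I}_{\dot J}\Xi^{\lambda_3}_{\lambda_4},\bar\Xi^{\lambda_5}_{\lambda_6}l^{\dot K}_{\dot L}]=\delta^{\lambda_5}_{\lambda_2}\sum_{\dot J_1\dot J_2=\dot J}\delta^{\dot K}_{\dot J_1}\bar\Xi^{\lambda_1}_{\lambda_6}f^{\dot I}_{\dot L\dot J_2}\Xi^{\lambda_3}_{\lambda_4}-S\,\delta^{\lambda_1}_{\lambda_6}\sum_{\dot I_1\dot I_2=\dot I}\delta^{\dot I_1}_{\dot L}\bar\Xi^{\lambda_5}_{\lambda_2}f^{\dot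 K\dot I_2}_{\dot J}\Xi^{\lambda_3}_{\lambda_4}$; - $[\bar\Xi^{\lambda_1}_{\lambda_2}f^{\dot I}_{\dot J}\Xi^{\lambda_3}_{\lambda_4},r^{\dot K}_{\dot L}\Xi^{\lambda_5}_{\lambda_6}]=\delta^{\lambda_5}_{\lambda_4}\sum_{\dot J_1\dot J_2=\dot J}(-1)^{\epsilon(\dot J_1)q}\delta^{\dot K}_{\dot J_2}\bar\Xi^{\lambda_1}_{\lambda_2}f^{\dot I}_{\dot J_1\dot L}\Xi^{\lambda_3}_{\lambda_6}-S\,\delta^{\lambda_3}_{\lambda_6}\sum_{\dot I_1\dot I_2=\dot I}(-1)^{\epsilon(\dot I_1)q}\delta^{\dot I_2}_{\dot L}\bar\Xi^{\lambda_1}_{\lambda_2}f^{\dot I_1\dot K}_{\dot J}\Xi^{\lambda_5}_{\lambda_4}$; - $[\bar\Xi^{\lambda_1}_{\lambda_2}f^{\dot I}_{\dot J}\Xi^{\lambda_3}_{\lambda_4},\gamma^K_L]=\bar\Xi^{\lambda_1}_{\lambda_2}\big(\sum_{\dot J_1J_2\dot J_3=\dot J}(-1)^{\epsilon(\dot J_1)q}\delta^K_{J_2}f^{\dot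 I}_{\dot J_1L\dot J_3}-S\sum_{\dot I_1I_2\dot I_3=\dot I}(-1)^{\epsilon(\dot I_1)q}\delta^{I_2}_Lf^{\dot I_1K\dot I_3}_{\dot J}\big)\Xi^{\lambda_3}_{\lambda_4}$; - $[\bar\Xi^{\lambda_1}_{\lambda_2}l^{\dot I}_{\dot J},\bar\Xi^{\lambda_3}_{\lambda_4}l^{\dot K}_{\dot L}]=\delta^{\lambda_3}_{\lambda_2}\bar\Xi^{\lambda_1}_{\lambda_4}\big(\delta^{\dot K}_{\dot J}l^{\dot I}_{\dot L}+\sum_{\dot J_1J_2=\dot J}\delta^{\dot K}_{\dot J_1}l^{\dot I}_{\dot LJ_2}+\sum_{\dot K_1K_2=\dot K}\delta^{\dot K_1}_{\dot J}l^{\dot IK_2}_{\dot L}\big)-S\,\delta^{\lambda_1}_{\lambda_4}\bar\Xi^{\lambda_3}_{\lambda_2}\big(\delta^{\dot I}_{\dot L}l^{\dot K}_{\dot J}+\sum_{\dot L_1L_2=\dot L}\delta^{\dot I}_{\dot L_1}l^{\dot K}_{\dot JL_2}+\sum_{\dot I_1I_2=\dot I}\delta^{\dot I_1}_{\dot L}l^{\dot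 KI_2}_{\dot J}\big)$; - $[r^{\dot I}_{\dot J}\Xi^{\lambda_1}_{\lambda_2},r^{\dot K}_{\dot L}\Xi^{\lambda_3}_{\lambda_4}]=\delta^{\lambda_3}_{\lambda_2}\big(\delta^{\dot K}_{\dot J}r^{\dot I}_{\dot L}+\sum_{J_1\dot J_2=\dot J}(-1)^{\epsilon(J_1)q}\delta^{\dot K}_{\dot J_2}r^{\dot I}_{J_1\dot L}+\sum_{K_1\dot K_2=\dot K}(-1)^{\epsilon(K_1)m}\delta^{\dot K_2}_{\dot J}r^{K_1\dot I}_{\dot L}\big)\Xi^{\lambda_1}_{\lambda_4}-S\,\delta^{\lambda_1}_{\lambda_4}\big(\delta^{\dot I}_{\dot L}r^{\dot K}_{\dot J}+\sum_{L_1\dot L_2=\dot L}(-1)^{\epsilon(L_1)m}\delta^{\dot I}_{\dot L_2}r^{\dot K}_{L_1\dot J}+\sum_{I_1\dot I_2=\dot I}(-1)^{\epsilon(I_1)q}\delta^{\dot I_2}_{\dot L}r^{I_1\dot K}_{\dot J}\big)\Xi^{\lambda_3}_{\lambda_2}$; - $[\bar\Xi^{\lambda_1}_{\lambda_2}l^{\dot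 I}_{\dot J},r^{\dot K}_{\dot L}\Xi^{\lambda_3}_{\lambda_4}]=\bar\Xi^{\lambda_1}_{\lambda_2}\big(\sum_{\dot J_1\dot J_2=\dot J,\ \dot K_1\dot K_2=\dot K}(-1)^{\epsilon(\dot J_1)q}\delta^{\dot K_1}_{\dot J_2}f^{\dot I\dot K_2}_{\dot J_1\dot L}-S\sum_{\dot I_1\dot I_2=\dot I,\ \dot L_1\dot L_2=\dot L}(-1)^{\epsilon(\dot I_1)q}\delta^{\dot I_2}_{\dot L_1}f^{\dot I_1\dot K}_{\dot J\dot L_2}\big)\Xi^{\lambda_3}_{\lambda_4}$; - $[\bar\Xi^{\lambda_1}_{\lambda_2}l^{\dot I}_{\dot J},\gamma^K_L]=\bar\Xi^{\lambda_1}_{\lambda_2}\big[\delta^K_{\dot J}l^{\dot I}_L+\sum_{K_1K_2=K}\delta^{K_1}_{\dot J}l^{\dot IK_2}_L+\sum_{J_1J_2=\dot J}(-1)^{\epsilon(J_1)q}\delta^K_{J_2}l^{\dot I}_{J_1L}+\sum_{J_1J_2=\dot J}\delta^K_{J_1}l^{\dot I}_{LJ_2}+\sum_{J_1J_2=\dot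 J,\ K_1K_2=K}(-1)^{\epsilon(J_1)q}\delta^{K_1}_{J_2}l^{\dot IK_2}_{J_1L}+\sum_{J_1J_2J_3=\dot J}(-1)^{\epsilon(J_1)q}\delta^K_{J_2}l^{\dot I}_{J_1LJ_3}-S\big(\delta^{\dot I}_Ll^K_{\dot J}+\sum_{L_1L_2=L}\delta^{\dot I}_{L_1}l^K_{\dot JL_2}+\sum_{I_1I_2=\dot I}(-1)^{\epsilon(I_1)q}\delta^{I_2}_Ll^{I_1K}_{\dot J}+\sum_{I_1I_2=\dot I}\delta^{I_1}_Ll^{KI_2}_{\dot J}+\sum_{L_1L_2=L,\ I_1I_2=\dot I}(-1)^{\epsilon(I_1)q}\delta^{I_2}_{L_1}l^{I_1K}_{\dot JL_2}+\sum_{I_1I_2I_3=\dot I}(-1)^{\epsilon(I_1)q}\delta^{I_2}_Ll^{I_1KI_3}_{\dot J}\big)\big]$; - $[r^{\dot I}_{\dot J}\Xi^{\lambda_1}_{\lambda_2},\gamma^K_L]=\big[\delta^K_{\dot J}r^{\dot I}_L+\sum_{K_1K_2=K}(-1)^{\epsilon(K_1)m}\delta^{K_2}_{\dot J}r^{K_1\dot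 I}_L+\sum_{J_1J_2=\dot J}(-1)^{\epsilon(J_1)q}\delta^K_{J_2}r^{\dot I}_{J_1L}+\sum_{J_1J_2=\dot J}\delta^K_{J_1}r^{\dot I}_{LJ_2}+\sum_{J_1J_2=\dot J,\ K_1K_2=K}(-1)^{\epsilon(K_1)m}\delta^{K_2}_{J_1}r^{K_1\dot I}_{LJ_2}+\sum_{J_1J_2J_3=\dot J}(-1)^{\epsilon(J_1)q}\delta^K_{J_2}r^{\dot I}_{J_1LJ_3}-S\big(\delta^{\dot I}_Lr^K_{\dot J}+\sum_{L_1L_2=L}(-1)^{\epsilon(L_1)m}\delta^{\dot I}_{L_2}r^K_{L_1\dot J}+\sum_{I_1I_2=\dot I}(-1)^{\epsilon(I_1)q}\delta^{I_2}_Lr^{I_1K}_{\dot J}+\sum_{I_1I_2=\dot I}\delta^{I_1}_Lr^{KI_2}_{\dot J}+\sum_{L_1L_2=L,\ I_1I_2=\dot I}(-1)^{\epsilon(L_1)m}\delta^{I_1}_{L_2}r^{KI_2}_{L_1\dot J}+\sum_{I_1I_2I_3=\dot I}(-1)^{\epsilon(I_1)q}\delta^{I_2}_Lr^{I_1KI_3}_{\dot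 J}\big)\big]\Xi^{\lambda_1}_{\lambda_2}$; - $[\tilde f^I_J,\tilde f^K_L]=\delta^K_J\tilde f^I_L+\sum_{K_1K_2=K}(-1)^{\epsilon(K_1)\epsilon(K_2)}\delta^{K_2K_1}_J\tilde f^I_L-S\,(I\leftrightarrow K,J\leftrightarrow L)$; - $[\gamma^I_J,\tilde f^K_L]=\delta^K_J\tilde f^I_L+\sum_{K_1K_2=K}\big((-1)^{\epsilon(K_1)\epsilon(K_2)}\delta^{K_2K_1}_J\tilde f^I_L+\delta^{K_1}_J\tilde f^{IK_2}_L+(-1)^{\epsilon(K_1)m}\delta^{K_2}_J\tilde f^{K_1I}_L\big)+\sum_{K_1K_2K_3=K}\big((-1)^{\epsilon(K_1)m}\delta^{K_2}_J\tilde f^{K_1IK_3}_L+(-1)^{[\epsilon(K_1)+\epsilon(K_2)]\epsilon(K_3)}\delta^{K_3K_1}_J\tilde f^{IK_2}_L\big)-S\big\{\delta^I_L\tilde f^K_J+\sum_{L_1L_2=L}\big((-1)^{\epsilon(L_1)\epsilon(L_2)}\delta^I_{L_2L_1}\tilde f^K_J+(-1)^{\epsilon(L_1)m}\delta^I_{L_2}\tilde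 f^K_{L_1J}+\delta^I_{L_1}\tilde f^K_{JL_2}\big)+\sum_{L_1L_2L_3=L}\big((-1)^{\epsilon(L_1)m}\delta^I_{L_2}\tilde f^K_{L_1JL_3}+(-1)^{\epsilon(L_3)[\epsilon(L_1)+\epsilon(L_2)]}\delta^I_{L_3L_1}\tilde f^K_{JL_2}\big)\big\}$; - $[\gamma^I_J,\gamma^K_L]=h^{I,K}_{J,L}-S\,h^{K,I}_{L,J}$, where $h^{K,I}_{L,J}$ arises from $h^{I,K}_{J,L}$ by $I\leftrightarrow K$, $J\leftrightarrow L$ (so $m\leftrightarrow q$), and, with all sums over $J_1J_2=J$ or $J_1J_2J_3=J$ and $K_1K_2=K$ or $K_1K_2K_3=K$ according to the indices that occur, $h^{I,K}_{J,L}=\delta^K_J\gamma^I_L+\sum(-1)^{\epsilon(J_1)q}\delta^K_{J_2}\gamma^I_{J_1L}+\sum\delta^{K_1}_J\gamma^{IK_2}_L+\sum(-1)^{\epsilon(J_1)q}\delta^{K_1}_{J_2}\gamma^{IK_2}_{J_1L}+\sum\delta^K_{J_1}\gamma^I_{LJ_2}+\sum(-1)^{\epsilon(K_1)m}\delta^{K_2}_J\gamma^{K_1I}_L+\sum(-1)^{\epsilon(K_1)m}\delta^{K_2}_{J_1}\gamma^{K_1I}_{LJ_2}+\sum_{J_1J_2J_3=J}(-1)^{\epsilon(J_1)q}\delta^K_{J_2}\gamma^I_{J_1LJ_3}+\sum_{K_1K_2K_3=K}(-1)^{\epsilon(K_1)m}\delta^{K_2}_J\gamma^{K_1IK_3}_L+\sum_{J_1J_2=J,\,K_1K_2=K}(-1)^{\epsilon(J_1)\epsilon(K_1)}\delta^{K_1}_{J_2}\delta^{K_2}_{J_1}\tilde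 f^I_L+\sum_{J_1J_2J_3=J,\,K_1K_2=K}(-1)^{[\epsilon(J_1)+\epsilon(J_2)]\epsilon(K_1)}\delta^{K_1}_{J_3}\delta^{K_2}_{J_1}\tilde f^I_{LJ_2}+\sum_{J_1J_2=J,\,K_1K_2K_3=K}(-1)^{\epsilon(J_1)[\epsilon(K_1)+\epsilon(K_2)]}\delta^{K_1}_{J_2}\delta^{K_3}_{J_1}\tilde f^{IK_2}_L+\sum_{J_1J_2J_3=J,\,K_1K_2K_3=K}(-1)^{[\epsilon(J_1)+\epsilon(J_2)][\epsilon(K_1)+\epsilon(K_2)]}\delta^{K_1}_{J_3}\delta^{K_3}_{J_1}\tilde f^{IK_2}_{LJ_2}$. **The heterix superalgebra** $H$ is the space spanned in the same way by $\gamma'^I_J$ (basis) and $\tilde f'^I_J$ (modulo the same cyclic relations) for non-empty words in the letters $1,\dots,2\Lambda+4\Lambda_F$, with the last three brackets above. Its singlet states have basis $s'^K$ ($K$ non-empty) and generators $\Psi'^K$ (modulo the cyclic relations above), again for words in the letters $1,\dots,2\Lambda+4\Lambda_F$ and graded by $\epsilon(K)$. In $H$ put $l'^I_J=\gamma'^I_J-\sum_i(-1)^{\epsilon(i)m}\gamma'^{iI}_{iJ}-\tilde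 f'^I_J$, $r'^I_J=\gamma'^I_J-\sum_j\gamma'^{Ij}_{Jj}-\tilde f'^I_J$, $f'^I_J=l'^I_J-\sum_jl'^{Ij}_{Jj}$, with $i,j$ running over all $2\Lambda+4\Lambda_F$ letters. **Actions on $\mathcal T_o\oplus\mathcal T_c$.** The first three kinds annihilate $\mathcal T_c$, the fifth annihilates $\mathcal T_o$, and $\bar\Xi^{\lambda_1}_{\lambda_2}f^{\dot I}_{\dot J}\Xi^{\lambda_3}_{\lambda_4}(\bar\phi^{\lambda_5}s^{\dot K}\phi^{\lambda_6})=\delta^{\lambda_5}_{\lambda_2}\delta^{\dot K}_{\dot J}\delta^{\lambda_6}_{\lambda_4}\bar\phi^{\lambda_1}s^{\dot I}\phi^{\lambda_3}$; $\bar\Xi^{\lambda_1}_{\lambda_2}l^{\dot I}_{\dot J}(\bar\phi^{\lambda_3}s^{\dot K}\phi^{\lambda_4})=\delta^{\lambda_3}_{\lambda_2}\sum_{\dot K_1\dot K_2=\dot K}\delta^{\dot K_1}_{\dot J}\bar\phi^{\lambda_1}s^{\dot I\dot K_2}\phi^{\lambda_4}$; $r^{\dot I}_{\dot J}\Xi^{\lambda_1}_{\lambda_2}(\bar\phi^{\lambda_3}s^{\dot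 K}\phi^{\lambda_4})=\delta^{\lambda_4}_{\lambda_2}\sum_{\dot K_1\dot K_2=\dot K}(-1)^{\epsilon(\dot K_1)m}\delta^{\dot K_2}_{\dot J}\bar\phi^{\lambda_3}s^{\dot K_1\dot I}\phi^{\lambda_1}$; $\gamma^I_J(\bar\phi^{\lambda_1}s^{\dot K}\phi^{\lambda_2})=\sum_{\dot K_1K_2\dot K_3=\dot K}(-1)^{\epsilon(\dot K_1)m}\delta^{K_2}_J\bar\phi^{\lambda_1}s^{\dot K_1I\dot K_3}\phi^{\lambda_2}$; $\gamma^I_J\Psi^K=\delta^K_J\Psi^I+\sum_{K_1K_2=K}\big((-1)^{\epsilon(K_1)\epsilon(K_2)}\delta^{K_2K_1}_J\Psi^I+\delta^{K_1}_J\Psi^{IK_2}+(-1)^{\epsilon(K_1)\epsilon(K_2)}\delta^{K_2}_J\Psi^{IK_1}\big)+\sum_{K_1K_2K_3=K}(-1)^{\epsilon(K_1)[\epsilon(K_2)+\epsilon(K_3)]}\delta^{K_2}_J\Psi^{IK_3K_1}+\sum_{J_1J_2=J,\,K_1K_2K_3=K}(-1)^{\epsilon(K_3)[\epsilon(K_1)+\epsilon(K_2)]}\delta^{K_3}_{J_1}\delta^{K_1}_{J_2}\Psi^{IK_2}$;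 $\tilde f^I_J\Psi^K=\delta^K_J\Psi^I+\sum_{J_1J_2=J}(-1)^{\epsilon(J_1)\epsilon(J_2)}\delta^K_{J_2J_1}\Psi^I$. $H$ acts on the $s'^K$ and $\Psi'^K$ by the same formulas for $\gamma'$ and $\tilde f'$ (omitting $\bar\phi,\phi$). **Theorem.** 1. These formulas (with super skew-symmetry) define unique bilinear brackets on $G$ and $H$ and unique bilinear actions on the singlet states; with them $G$ (the *grand string superalgebra*) and $H$ are Lie superalgebras. 2. The assignment $\gamma^I_J\mapsto\gamma'^I_J$, $\tilde f^I_J\mapsto\tilde f'^I_J$, $\bar\Xi^{\lambda_1}_{\lambda_2}\otimes l^{\dot I}_{\dot J}\mapsto l'^{\lambda_1+2\Lambda,\dot I}_{\lambda_2+2\Lambda,\dot J}$, $r^{\dot I}_{\dot J}\otimes\Xi^{\lambda_3}_{\lambda_4}\mapsto r'^{\dot I,\lambda_3+2\Lambda+2\Lambda_F}_{\dot J,\lambda_4+2\Lambda+2\Lambda_F}$, $\bar\Xi^{\lambda_1}_{\lambda_2}\otimes f^{\dot I}_{\dot J}\otimes\Xi^{\lambda_3}_{\lambda_4}\mapsto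 f'^{\lambda_1+2\Lambda,\dot I,\lambda_3+2\Lambda+2\Lambda_F}_{\lambda_2+2\Lambda,\dot J,\lambda_4+2\Lambda+2\Lambda_F}$ is a well-defined injective grade-preserving homomorphism $\iota:G\to H$; hence $G$ is a sub-superalgebra of $H$. 3. $\mathcal T_o\oplus\mathcal T_c$ is a (graded) representation of $G$, and the singlet states of $H$ are one of $H$. The map $\kappa$ with $\bar\phi^{\rho_1}\otimes s^{\dot K}\otimes\phi^{\rho_2}\mapsto s'^{\rho_1+2\Lambda,\dot K,\rho_2+2\Lambda+2\Lambda_F}$, $\Psi^K\mapsto\Psi'^K$ is well defined, injective, grade-preserving, and $\kappa(xv)=\iota(x)\kappa(v)$. 4. The operators of the second kind form a sub-superalgebra of $G$, and so do those of the third kind. The operators of the first kind form a non-zero proper ideal of $G$, properly contained in the span of the operators of the first three kinds; the latter span is a proper ideal of $G$; the operators of the fifth kind form a non-zero proper ideal of $G$. -/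

import Mathlib

namespace GrandString

noncomputable section

/-! ### Words, grades, Kronecker deltas and splittings -/

/-- Words (possibly empty sequences) in the letters `0, …, n - 1`. The paper's integer `k` is the
letter `k - 1` here. -/
abbrev Word (n : ℕ) := List (Fin n)

/-- Non-empty words. -/
abbrev NWord (n : ℕ) := {W : Word n // W ≠ []}

/-- Concatenation of non-empty words. -/
def NWord.cat {n : ℕ} (A B : NWord n) : NWord n :=
  ⟨A.1 ++ B.1, fun h => A.2 (List.append_eq_nil_iff.1 h).1⟩

/-- The grade of a word: the parity of the number of its fermionic letters, which are
the letters `Λ, …, 2 Λ - 1`. All other letters are bosonic. -/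
def eps (Λ : ℕ) {n : ℕ} (W : Word n) : ℕ :=
  (W.countP fun k => decide (Λ ≤ k.val ∧ k.val < 2 * Λ)) % 2

/-- The sign `(-1) ^ m`. -/
def sgn (m : ℕ) : ℂ := (-1) ^ m

/-- The Kronecker delta. -/
def kd {α : Type} [DecidableEq α] (x y : α) : ℂ := if x = y then 1 else 0

/-- All ways of writing a word as a concatenation of two possibly empty words. -/
def cutsDD {n : ℕ} (W : Word n) : Finset (Word n × Word n) :=
  (Finset.range (W.length + 1)).image fun k => (W.take k, W.drop k)

theorem mem_cutsDD {n : ℕ} {W : Word n} {p : Word n × Word n} :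
    p ∈ cutsDD W ↔ p.1 ++ p.2 = W := by
  simp only [cutsDD, Finset.mem_image, Finset.mem_range]
  constructor
  · rintro ⟨k, -, rfl⟩
    simp
  · rintro rfl
    exact ⟨p.1.length, by simp, by simp⟩

/-- Splittings `A B = W` with `A`, `B` both non-empty. -/
def cuts {n : ℕ} (W : Word n) : Finset (Word n × Word n) :=
  (cutsDD W).filter fun p => p.1 ≠ [] ∧ p.2 ≠ []

/-- Splittings `A B = W` with `A` possibly empty and `B` non-empty. -/
def cutsDN {n : ℕ} (W : Word n) : Finset (Word n × Word n) :=
  (cutsDD W).filter fun p => p.2 ≠ []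

/-- Splittings `A B = W` with `A` non-empty and `B` possibly empty. -/
def cutsND {n : ℕ} (W : Word n) : Finset (Word n × Word n) :=
  (cutsDD W).filter fun p => p.1 ≠ []

/-- All ways of writing a word as a concatenation of three possibly empty words. -/
def cuts3DDD {n : ℕ} (W : Word n) : Finset (Word n × Word n × Word n) :=
  (cutsDD W).biUnion fun p => (cutsDD p.2).image fun q => (p.1, q)

theorem mem_cuts3DDD {n : ℕ} {W : Word n} {p : Word n × Word n × Word n} :
    p ∈ cuts3DDD W ↔ p.1 ++ p.2.1 ++ p.2.2 = W := by
  obtain ⟨a, b, c⟩ := p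
  simp only [cuts3DDD, Finset.mem_biUnion, Finset.mem_image, mem_cutsDD, Prod.exists,
    Prod.mk.injEq]
  constructor
  · rintro ⟨x, y, rfl, u, v, rfl, rfl, rfl, rfl⟩
    simp
  · rintro rfl
    exact ⟨a, b ++ c, by simp, b, c, rfl, rfl, rfl, rfl⟩

/-- Splittings `A B C = W` with `A`, `B`, `C` all non-empty. -/
def cuts3 {n : ℕ} (W : Word n) : Finset (Word n × Word n × Word n) :=
  (cuts3DDD W).filter fun p => p.1 ≠ [] ∧ p.2.1 ≠ [] ∧ p.2.2 ≠ []

/-- Splittings `A B C = W` with `B` non-empty and `A`, `C` possibly empty. -/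
def cuts3DND {n : ℕ} (W : Word n) : Finset (Word n × Word n × Word n) :=
  (cuts3DDD W).filter fun p => p.2.1 ≠ []

/-! ### Lie superalgebras, their ideals and representations -/

section Super

variable {V : Type} [AddCommGroup V] [Module ℂ V] {S : Type} [AddCommGroup S] [Module ℂ S]

/-- `(-1) ^ (a b)` for grades `a`, `b`. -/
def sgn2 (a b : ZMod 2) : ℂ := sgn (a.val * b.val)

/-- `br` is super skew-symmetric with respect to the grading `gr`. -/
def SuperSkew (gr : ZMod 2 → Submodule ℂ V) (br : V →ₗ[ℂ] V →ₗ[ℂ] V) : Prop :=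
  ∀ a b : ZMod 2, ∀ x ∈ gr a, ∀ y ∈ gr b, br x y = -(sgn2 a b • br y x)

/-- `V`, with the grading `gr` and the bilinear bracket `br`, is a Lie superalgebra over `ℂ`. -/
structure IsLieSuperalgebra (gr : ZMod 2 → Submodule ℂ V) (br : V →ₗ[ℂ] V →ₗ[ℂ] V) : Prop where
  graded : DirectSum.IsInternal gr
  bracket_mem : ∀ a b : ZMod 2, ∀ x ∈ gr a, ∀ y ∈ gr b, br x y ∈ gr (a + b)
  skew : SuperSkew gr br
  jacobi : ∀ a b : ZMod 2, ∀ x ∈ gr a, ∀ y ∈ gr b, ∀ z : V,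
    br x (br y z) = br (br x y) z + sgn2 a b • br y (br x z)

/-- A sub-superalgebra: a graded subspace closed under the bracket. -/
structure IsSubsuperalgebra (gr : ZMod 2 → Submodule ℂ V) (br : V →ₗ[ℂ] V →ₗ[ℂ] V)
    (I : Submodule ℂ V) : Prop where
  graded : I = ⨆ a, I ⊓ gr a
  bracket_mem : ∀ x ∈ I, ∀ y ∈ I, br x y ∈ I

/-- A (two-sided) ideal: a graded subspace absorbing brackets with arbitrary elements. -/
structure IsSuperideal (gr : ZMod 2 → Submodule ℂ V) (br : V →ₗ[ℂ] V →ₗ[ℂ] V)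
    (I : Submodule ℂ V) : Prop where
  graded : I = ⨆ a, I ⊓ gr a
  bracket_mem_left : ∀ x : V, ∀ y ∈ I, br x y ∈ I
  bracket_mem_right : ∀ x ∈ I, ∀ y : V, br x y ∈ I

/-- `ρ` is a representation of the Lie superalgebra `(V, gr, br)` on the graded space `(S, grS)`. -/
structure IsSuperRepresentation (gr : ZMod 2 → Submodule ℂ V) (br : V →ₗ[ℂ] V →ₗ[ℂ] V)
    (grS : ZMod 2 → Submodule ℂ S) (ρ : V →ₗ[ℂ] S →ₗ[ℂ] S) : Prop where
  graded : DirectSum.IsInternal grS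
  action_mem : ∀ a b : ZMod 2, ∀ x ∈ gr a, ∀ v ∈ grS b, ρ x v ∈ grS (a + b)
  map_bracket : ∀ a b : ZMod 2, ∀ x ∈ gr a, ∀ y ∈ gr b, ∀ v : S,
    ρ (br x y) v = ρ x (ρ y v) - sgn2 a b • ρ y (ρ x v)

end Super

/-! ### Closed singlet states and operators of the fifth kind

Both carry the relation that a cyclic permutation of a word changes the vector by a sign. -/

/-- The relations `Ψ^{A B} = (-1)^{ε(A) ε(B)} Ψ^{B A}`. -/
def closedRel (Λ n : ℕ) : Submodule ℂ (NWord n →₀ ℂ) :=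
  Submodule.span ℂ {x | ∃ A B : NWord n,
    x = Finsupp.single (A.cat B) 1
      - sgn (eps Λ A.1 * eps Λ B.1) • Finsupp.single (B.cat A) 1}

/-- Closed singlet states: finite linear combinations of the `Ψ^K`, `K` non-empty. -/
abbrev ClosedState (Λ n : ℕ) := (NWord n →₀ ℂ) ⧸ closedRel Λ n

/-- `Ψ^K`. It is meant for non-empty `K` only and has the value `0` otherwise. -/
def psi (Λ : ℕ) {n : ℕ} (K : Word n) : ClosedState Λ n :=
  if h : K ≠ [] then Submodule.Quotient.mk (Finsupp.single ⟨K, h⟩ 1) else 0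

/-- The relations `f̃^{A B}_J = (-1)^{ε(A) ε(B)} f̃^{B A}_J` and
`f̃^I_{A B} = (-1)^{ε(A) ε(B)} f̃^I_{B A}`. -/
def fifthRel (Λ n : ℕ) : Submodule ℂ (NWord n × NWord n →₀ ℂ) :=
  Submodule.span ℂ
    ({x | ∃ A B J : NWord n,
        x = Finsupp.single (A.cat B, J) 1
          - sgn (eps Λ A.1 * eps Λ B.1) • Finsupp.single (B.cat A, J) 1} ∪
     {x | ∃ I A B : NWord n,
        x = Finsupp.single (I, A.cat B) 1
          - sgn (eps Λ A.1 * eps Λ B.1) • Finsupp.single (I, B.cat A) 1})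

/-- Operators of the fifth kind: finite linear combinations of the `f̃^I_J`. -/
abbrev FifthKind (Λ n : ℕ) := (NWord n × NWord n →₀ ℂ) ⧸ fifthRel Λ n

/-- The vector `f̃^I_J`. It is meant for non-empty `I`, `J` only and has the value `0`
otherwise. -/
def fifthVec (Λ : ℕ) {n : ℕ} (I J : Word n) : FifthKind Λ n :=
  if h : I ≠ [] ∧ J ≠ [] then
    Submodule.Quotient.mk (Finsupp.single (⟨I, h.1⟩, ⟨J, h.2⟩) 1) else 0

/-- Operators of the fourth kind: finite linear combinations of the `γ^I_J`. -/
abbrev FourthKind (n : ℕ) := NWord n × NWord n →₀ ℂ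

/-- The vector `γ^I_J`. It is meant for non-empty `I`, `J` only and has the value `0`
otherwise. -/
def fourthVec {n : ℕ} (I J : Word n) : FourthKind n :=
  if h : I ≠ [] ∧ J ≠ [] then Finsupp.single (⟨I, h.1⟩, ⟨J, h.2⟩) 1 else 0

/-! ### Brackets and actions of the operators of the fourth and fifth kinds

These formulas are shared by the heterix and the grand string superalgebra. Here `γ I J`, `f I J`,
`s K` and `Ψ K` stand for `γ^I_J`, `f̃^I_J`, `s^K` and `Ψ^K` in the respective space. -/

section Formulas

variable {M : Type} [AddCommGroup M] [Module ℂ M] {n : ℕ}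

/-- The part of `[γ^I_J, γ^K_L]` without the terms obtained by
`I ↔ K`, `J ↔ L`. -/
def gammaGammaHalf (Λ : ℕ) (γ f : Word n → Word n → M) (I J K L : Word n) : M :=
  kd K J • γ I L
  + ∑ j ∈ cuts J, (sgn (eps Λ j.1 * (eps Λ K + eps Λ L)) * kd K j.2) • γ I (j.1 ++ L)
  + ∑ k ∈ cuts K, kd k.1 J • γ (I ++ k.2) L
  + ∑ j ∈ cuts J, ∑ k ∈ cuts K,
      (sgn (eps Λ j.1 * (eps Λ K + eps Λ L)) * kd k.1 j.2) • γ (I ++ k.2) (j.1 ++ L)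
  + ∑ j ∈ cuts J, kd K j.1 • γ I (L ++ j.2)
  + ∑ k ∈ cuts K, (sgn (eps Λ k.1 * (eps Λ I + eps Λ J)) * kd k.2 J) • γ (k.1 ++ I) L
  + ∑ j ∈ cuts J, ∑ k ∈ cuts K,
      (sgn (eps Λ k.1 * (eps Λ I + eps Λ J)) * kd k.2 j.1) • γ (k.1 ++ I) (L ++ j.2)
  + ∑ j ∈ cuts3 J,
      (sgn (eps Λ j.1 * (eps Λ K + eps Λ L)) * kd K j.2.1) • γ I (j.1 ++ L ++ j.2.2)
  + ∑ k ∈ cuts3 K,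
      (sgn (eps Λ k.1 * (eps Λ I + eps Λ J)) * kd k.2.1 J) • γ (k.1 ++ I ++ k.2.2) L
  + ∑ j ∈ cuts J, ∑ k ∈ cuts K,
      (sgn (eps Λ j.1 * eps Λ k.1) * kd k.1 j.2 * kd k.2 j.1) • f I L
  + ∑ j ∈ cuts3 J, ∑ k ∈ cuts K,
      (sgn ((eps Λ j.1 + eps Λ j.2.1) * eps Λ k.1) * kd k.1 j.2.2 * kd k.2 j.1) •
        f I (L ++ j.2.1)
  + ∑ j ∈ cuts J, ∑ k ∈ cuts3 K,
      (sgn (eps Λ j.1 * (eps Λ k.1 + eps Λ k.2.1)) * kd k.1 j.2 * kd k.2.2 j.1) •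
        f (I ++ k.2.1) L
  + ∑ j ∈ cuts3 J, ∑ k ∈ cuts3 K,
      (sgn ((eps Λ j.1 + eps Λ j.2.1) * (eps Λ k.1 + eps Λ k.2.1)) *
          kd k.1 j.2.2 * kd k.2.2 j.1) •
        f (I ++ k.2.1) (L ++ j.2.1)

/-- `[γ^I_J, γ^K_L]`. -/
def gammaGamma (Λ : ℕ) (γ f : Word n → Word n → M) (I J K L : Word n) : M :=
  gammaGammaHalf Λ γ f I J K L
  - sgn ((eps Λ I + eps Λ J) * (eps Λ K + eps Λ L)) • gammaGammaHalf Λ γ f K L I J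

/-- `[γ^I_J, f̃^K_L]`. -/
def gammaFifth (Λ : ℕ) (f : Word n → Word n → M) (I J K L : Word n) : M :=
  (kd K J • f I L
    + ∑ k ∈ cuts K, (sgn (eps Λ k.1 * eps Λ k.2) * kd (k.2 ++ k.1) J) • f I L
    + ∑ k ∈ cuts K, kd k.1 J • f (I ++ k.2) L
    + ∑ k ∈ cuts3 K,
        (kd k.2.1 J * sgn (eps Λ k.1 * (eps Λ I + eps Λ J))) • f (k.1 ++ I ++ k.2.2) L
    + ∑ k ∈ cuts K, (kd k.2 J * sgn (eps Λ k.1 * (eps Λ I + eps Λ J))) • f (k.1 ++ I) L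
    + ∑ k ∈ cuts3 K,
        (kd (k.2.2 ++ k.1) J * sgn ((eps Λ k.1 + eps Λ k.2.1) * eps Λ k.2.2)) •
          f (I ++ k.2.1) L)
  - sgn ((eps Λ I + eps Λ J) * (eps Λ K + eps Λ L)) •
    (kd I L • f K J
      + ∑ l ∈ cuts L, (sgn (eps Λ l.1 * eps Λ l.2) * kd I (l.2 ++ l.1)) • f K J
      + ∑ l ∈ cuts L, (sgn (eps Λ l.1 * (eps Λ I + eps Λ J)) * kd I l.2) • f K (l.1 ++ J)
      + ∑ l ∈ cuts3 L,
          (sgn (eps Λ l.1 * (eps Λ I + eps Λ J)) * kd I l.2.1) • f K (l.1 ++ J ++ l.2.2)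
      + ∑ l ∈ cuts L, kd I l.1 • f K (J ++ l.2)
      + ∑ l ∈ cuts3 L,
          (sgn (eps Λ l.2.2 * (eps Λ l.1 + eps Λ l.2.1)) * kd I (l.2.2 ++ l.1)) •
            f K (J ++ l.2.1))

/-- The part of `[f̃^I_J, f̃^K_L]` without the terms obtained by
`I ↔ K`, `J ↔ L`. -/
def fifthFifthHalf (Λ : ℕ) (f : Word n → Word n → M) (I J K L : Word n) : M :=
  kd K J • f I L
  + ∑ k ∈ cuts K, (sgn (eps Λ k.1 * eps Λ k.2) * kd (k.2 ++ k.1) J) • f I L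

/-- `[f̃^I_J, f̃^K_L]`. -/
def fifthFifth (Λ : ℕ) (f : Word n → Word n → M) (I J K L : Word n) : M :=
  fifthFifthHalf Λ f I J K L
  - sgn ((eps Λ I + eps Λ J) * (eps Λ K + eps Λ L)) • fifthFifthHalf Λ f K L I J

/-- The action of `γ^I_J` on `s^K`. -/
def gammaOpen (Λ : ℕ) (s : Word n → M) (I J K : Word n) : M :=
  ∑ k ∈ cuts3DND K,
    (sgn (eps Λ k.1 * (eps Λ I + eps Λ J)) * kd k.2.1 J) • s (k.1 ++ I ++ k.2.2)

/-- The action of `γ^I_J` on `Ψ^K`. -/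
def gammaClosed (Λ : ℕ) (Ψ : Word n → M) (I J K : Word n) : M :=
  kd K J • Ψ I
  + ∑ k ∈ cuts K, (sgn (eps Λ k.1 * eps Λ k.2) * kd (k.2 ++ k.1) J) • Ψ I
  + ∑ k ∈ cuts K, kd k.1 J • Ψ (I ++ k.2)
  + ∑ k ∈ cuts3 K,
      (sgn (eps Λ k.1 * (eps Λ k.2.1 + eps Λ k.2.2)) * kd k.2.1 J) • Ψ (I ++ k.2.2 ++ k.1)
  + ∑ k ∈ cuts K, (sgn (eps Λ k.1 * eps Λ k.2) * kd k.2 J) • Ψ (I ++ k.1)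
  + ∑ j ∈ cuts J, ∑ k ∈ cuts3 K,
      (sgn (eps Λ k.2.2 * (eps Λ k.1 + eps Λ k.2.1)) * kd k.2.2 j.1 * kd k.1 j.2) •
        Ψ (I ++ k.2.1)

/-- The action of `f̃^I_J` on `Ψ^K`. -/
def fifthClosed (Λ : ℕ) (Ψ : Word n → M) (I J K : Word n) : M :=
  kd K J • Ψ I
  + ∑ j ∈ cuts J, (sgn (eps Λ j.1 * eps Λ j.2) * kd K (j.2 ++ j.1)) • Ψ I

end Formulas

/-! ### The heterix superalgebra and its singlet states -/

/-- The vector space of the heterix superalgebra, over the letters `0, …, n - 1`: finite linear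
combinations of the `γ'^I_J` and the `f̃'^I_J`. -/
abbrev Heterix (Λ n : ℕ) := FourthKind n × FifthKind Λ n

/-- `γ'^I_J`. -/
def hetGamma (Λ : ℕ) {n : ℕ} (I J : Word n) : Heterix Λ n := (fourthVec I J, 0)

/-- `f̃'^I_J`. -/
def hetFifth (Λ : ℕ) {n : ℕ} (I J : Word n) : Heterix Λ n := (0, fifthVec Λ I J)

/-- The grading of the heterix superalgebra. -/
def hetGrading (Λ n : ℕ) (a : ZMod 2) : Submodule ℂ (Heterix Λ n) :=
  Submodule.span ℂ {x | ∃ I J : Word n, I ≠ [] ∧ J ≠ [] ∧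
    ((eps Λ I + eps Λ J : ℕ) : ZMod 2) = a ∧ (x = hetGamma Λ I J ∨ x = hetFifth Λ I J)}

/-- `br` is given by the defining superbrackets of the heterix superalgebra. -/
structure IsHeterixBracket (Λ n : ℕ)
    (br : Heterix Λ n →ₗ[ℂ] Heterix Λ n →ₗ[ℂ] Heterix Λ n) : Prop where
  skew : SuperSkew (hetGrading Λ n) br
  gamma_gamma : ∀ I J K L : Word n, I ≠ [] → J ≠ [] → K ≠ [] → L ≠ [] →
    br (hetGamma Λ I J) (hetGamma Λ K L) = gammaGamma Λ (hetGamma Λ) (hetFifth Λ) I J K L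
  gamma_fifth : ∀ I J K L : Word n, I ≠ [] → J ≠ [] → K ≠ [] → L ≠ [] →
    br (hetGamma Λ I J) (hetFifth Λ K L) = gammaFifth Λ (hetFifth Λ) I J K L
  fifth_fifth : ∀ I J K L : Word n, I ≠ [] → J ≠ [] → K ≠ [] → L ≠ [] →
    br (hetFifth Λ I J) (hetFifth Λ K L) = fifthFifth Λ (hetFifth Λ) I J K L

/-- Open plus closed singlet states of the heterix superalgebra. -/
abbrev HetState (Λ n : ℕ) := (NWord n →₀ ℂ) × ClosedState Λ n

/-- `s'^K`. It is meant for non-empty `K` only and has the value `0` otherwise. -/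
def hetOpen (Λ : ℕ) {n : ℕ} (K : Word n) : HetState Λ n :=
  if h : K ≠ [] then (Finsupp.single ⟨K, h⟩ 1, 0) else 0

/-- `Ψ'^K`. -/
def hetClosed (Λ : ℕ) {n : ℕ} (K : Word n) : HetState Λ n := (0, psi Λ K)

/-- The grading of the singlet states. -/
def hetStateGrading (Λ n : ℕ) (a : ZMod 2) : Submodule ℂ (HetState Λ n) :=
  Submodule.span ℂ {x | ∃ K : Word n, K ≠ [] ∧ ((eps Λ K : ℕ) : ZMod 2) = a ∧
    (x = hetOpen Λ K ∨ x = hetClosed Λ K)}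

/-- `ρ` is given by the defining actions of the heterix superalgebra on singlet states. -/
structure IsHeterixAction (Λ n : ℕ)
    (ρ : Heterix Λ n →ₗ[ℂ] HetState Λ n →ₗ[ℂ] HetState Λ n) : Prop where
  gamma_open : ∀ I J K : Word n, I ≠ [] → J ≠ [] → K ≠ [] →
    ρ (hetGamma Λ I J) (hetOpen Λ K) = gammaOpen Λ (hetOpen Λ) I J K
  gamma_closed : ∀ I J K : Word n, I ≠ [] → J ≠ [] → K ≠ [] →
    ρ (hetGamma Λ I J) (hetClosed Λ K) = gammaClosed Λ (hetClosed Λ) I J K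
  fifth_open : ∀ I J K : Word n, I ≠ [] → J ≠ [] → K ≠ [] →
    ρ (hetFifth Λ I J) (hetOpen Λ K) = 0
  fifth_closed : ∀ I J K : Word n, I ≠ [] → J ≠ [] → K ≠ [] →
    ρ (hetFifth Λ I J) (hetClosed Λ K) = fifthClosed Λ (hetClosed Λ) I J K

/-- `l'^I_J`. -/
def hetL (Λ : ℕ) {n : ℕ} (I J : Word n) : Heterix Λ n :=
  hetGamma Λ I J
  - ∑ i : Fin n, sgn (eps Λ [i] * (eps Λ I + eps Λ J)) • hetGamma Λ (i :: I) (i :: J)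
  - hetFifth Λ I J

/-- `r'^I_J`. -/
def hetR (Λ : ℕ) {n : ℕ} (I J : Word n) : Heterix Λ n :=
  hetGamma Λ I J - ∑ j : Fin n, hetGamma Λ (I ++ [j]) (J ++ [j]) - hetFifth Λ I J

/-- `f'^I_J`. -/
def hetF (Λ : ℕ) {n : ℕ} (I J : Word n) : Heterix Λ n :=
  hetL Λ I J - ∑ j : Fin n, hetL Λ (I ++ [j]) (J ++ [j])

/-! ### The grand string superalgebra and its singlet states -/

/-- The vector space of the grand string superalgebra: finite linear combinations of the operators
of the first, second, third, fourth and fifth kinds, in this order. -/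
abbrev Grand (Λ ΛF : ℕ) :=
  (Fin (2 * ΛF) × Fin (2 * ΛF) × Word (2 * Λ) × Word (2 * Λ) × Fin (2 * ΛF) × Fin (2 * ΛF) →₀ ℂ) ×
  (Fin (2 * ΛF) × Fin (2 * ΛF) × Word (2 * Λ) × Word (2 * Λ) →₀ ℂ) ×
  (Word (2 * Λ) × Word (2 * Λ) × Fin (2 * ΛF) × Fin (2 * ΛF) →₀ ℂ) ×
  FourthKind (2 * Λ) × FifthKind Λ (2 * Λ)

section Generators

variable {Λ ΛF : ℕ}

/-- First kind: `Ξ̄^a_b ⊗ f^I_J ⊗ Ξ^c_d`. -/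
def op1 (a b : Fin (2 * ΛF)) (I J : Word (2 * Λ)) (c d : Fin (2 * ΛF)) : Grand Λ ΛF :=
  (Finsupp.single (a, b, I, J, c, d) 1, 0, 0, 0, 0)

/-- Second kind: `Ξ̄^a_b ⊗ l^I_J`. -/
def op2 (a b : Fin (2 * ΛF)) (I J : Word (2 * Λ)) : Grand Λ ΛF :=
  (0, Finsupp.single (a, b, I, J) 1, 0, 0, 0)

/-- Third kind: `r^I_J ⊗ Ξ^c_d`. -/
def op3 (I J : Word (2 * Λ)) (c d : Fin (2 * ΛF)) : Grand Λ ΛF :=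
  (0, 0, Finsupp.single (I, J, c, d) 1, 0, 0)

/-- Fourth kind: `γ^I_J`, for non-empty `I`, `J`. -/
def op4 (I J : Word (2 * Λ)) : Grand Λ ΛF := (0, 0, 0, fourthVec I J, 0)

/-- Fifth kind: `f̃^I_J`, for non-empty `I`, `J`. -/
def op5 (I J : Word (2 * Λ)) : Grand Λ ΛF := (0, 0, 0, 0, fifthVec Λ I J)

end Generators

/-- All operators of the first kind. -/
def firstKind (Λ ΛF : ℕ) : Submodule ℂ (Grand Λ ΛF) :=
  Submodule.span ℂ {x | ∃ a b I J c d, x = op1 a b I J c d}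

/-- All operators of the second kind. -/
def secondKind (Λ ΛF : ℕ) : Submodule ℂ (Grand Λ ΛF) :=
  Submodule.span ℂ {x | ∃ a b I J, x = op2 a b I J}

/-- All operators of the third kind. -/
def thirdKind (Λ ΛF : ℕ) : Submodule ℂ (Grand Λ ΛF) :=
  Submodule.span ℂ {x | ∃ I J c d, x = op3 I J c d}

/-- All operators of the fifth kind. -/
def fifthKind (Λ ΛF : ℕ) : Submodule ℂ (Grand Λ ΛF) :=
  Submodule.span ℂ {x | ∃ I J, I ≠ [] ∧ J ≠ [] ∧ x = op5 I J}

/-- The grading of the grand string superalgebra. -/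
def grandGrading (Λ ΛF : ℕ) (a : ZMod 2) : Submodule ℂ (Grand Λ ΛF) :=
  Submodule.span ℂ {x | ∃ I J : Word (2 * Λ), ((eps Λ I + eps Λ J : ℕ) : ZMod 2) = a ∧
    ((∃ p q r t, x = op1 p q I J r t) ∨ (∃ p q, x = op2 p q I J) ∨ (∃ r t, x = op3 I J r t) ∨
      (I ≠ [] ∧ J ≠ [] ∧ (x = op4 I J ∨ x = op5 I J)))}

/-- `br` is given by the defining superbrackets of the grand string superalgebra. -/
structure IsGrandBracket (Λ ΛF : ℕ)
    (br : Grand Λ ΛF →ₗ[ℂ] Grand Λ ΛF →ₗ[ℂ] Grand Λ ΛF) : Prop where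
  skew : SuperSkew (grandGrading Λ ΛF) br
  first_fifth : ∀ a b (I J : Word (2 * Λ)) c d (K L : Word (2 * Λ)), K ≠ [] → L ≠ [] →
    br (op1 a b I J c d) (op5 K L) = 0
  second_fifth : ∀ a b (I J : Word (2 * Λ)) (K L : Word (2 * Λ)), K ≠ [] → L ≠ [] →
    br (op2 a b I J) (op5 K L) = 0
  third_fifth : ∀ (I J : Word (2 * Λ)) a b (K L : Word (2 * Λ)), K ≠ [] → L ≠ [] →
    br (op3 I J a b) (op5 K L) = 0
  first_first : ∀ l₁ l₂ (I J : Word (2 * Λ)) l₃ l₄ l₅ l₆ (K L : Word (2 * Λ)) l₇ l₈,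
    br (op1 l₁ l₂ I J l₃ l₄) (op1 l₅ l₆ K L l₇ l₈) =
      (kd l₅ l₂ * kd K J * kd l₇ l₄) • op1 l₁ l₆ I L l₃ l₈
      - (sgn ((eps Λ I + eps Λ J) * (eps Λ K + eps Λ L)) * kd l₁ l₆ * kd I L * kd l₃ l₈) •
        op1 l₅ l₂ K J l₇ l₄
  first_second : ∀ l₁ l₂ (I J : Word (2 * Λ)) l₃ l₄ l₅ l₆ (K L : Word (2 * Λ)),
    br (op1 l₁ l₂ I J l₃ l₄) (op2 l₅ l₆ K L) =
      kd l₅ l₂ • ∑ j ∈ cutsDD J, kd K j.1 • op1 l₁ l₆ I (L ++ j.2) l₃ l₄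
      - (sgn ((eps Λ I + eps Λ J) * (eps Λ K + eps Λ L)) * kd l₁ l₆) •
        ∑ i ∈ cutsDD I, kd i.1 L • op1 l₅ l₂ (K ++ i.2) J l₃ l₄
  first_third : ∀ l₁ l₂ (I J : Word (2 * Λ)) l₃ l₄ (K L : Word (2 * Λ)) l₅ l₆,
    br (op1 l₁ l₂ I J l₃ l₄) (op3 K L l₅ l₆) =
      kd l₅ l₄ • ∑ j ∈ cutsDD J,
        (sgn (eps Λ j.1 * (eps Λ K + eps Λ L)) * kd K j.2) • op1 l₁ l₂ I (j.1 ++ L) l₃ l₆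
      - (sgn ((eps Λ I + eps Λ J) * (eps Λ K + eps Λ L)) * kd l₃ l₆) •
        ∑ i ∈ cutsDD I,
          (sgn (eps Λ i.1 * (eps Λ K + eps Λ L)) * kd i.2 L) • op1 l₁ l₂ (i.1 ++ K) J l₅ l₄
  first_fourth : ∀ l₁ l₂ (I J : Word (2 * Λ)) l₃ l₄ (K L : Word (2 * Λ)), K ≠ [] → L ≠ [] →
    br (op1 l₁ l₂ I J l₃ l₄) (op4 K L) =
      ∑ j ∈ cuts3DND J,
        (sgn (eps Λ j.1 * (eps Λ K + eps Λ L)) * kd K j.2.1) •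
          op1 l₁ l₂ I (j.1 ++ L ++ j.2.2) l₃ l₄
      - sgn ((eps Λ I + eps Λ J) * (eps Λ K + eps Λ L)) •
        ∑ i ∈ cuts3DND I,
          (sgn (eps Λ i.1 * (eps Λ K + eps Λ L)) * kd i.2.1 L) •
            op1 l₁ l₂ (i.1 ++ K ++ i.2.2) J l₃ l₄
  second_second : ∀ l₁ l₂ (I J : Word (2 * Λ)) l₃ l₄ (K L : Word (2 * Λ)),
    br (op2 l₁ l₂ I J) (op2 l₃ l₄ K L) =
      kd l₃ l₂ •
        (kd K J • op2 l₁ l₄ I L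
          + ∑ j ∈ cutsDN J, kd K j.1 • op2 l₁ l₄ I (L ++ j.2)
          + ∑ k ∈ cutsDN K, kd k.1 J • op2 l₁ l₄ (I ++ k.2) L)
      - (sgn ((eps Λ I + eps Λ J) * (eps Λ K + eps Λ L)) * kd l₁ l₄) •
        (kd I L • op2 l₃ l₂ K J
          + ∑ l ∈ cutsDN L, kd I l.1 • op2 l₃ l₂ K (J ++ l.2)
          + ∑ i ∈ cutsDN I, kd i.1 L • op2 l₃ l₂ (K ++ i.2) J)
  third_third : ∀ (I J : Word (2 * Λ)) l₁ l₂ (K L : Word (2 * Λ)) l₃ l₄,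
    br (op3 I J l₁ l₂) (op3 K L l₃ l₄) =
      kd l₃ l₂ •
        (kd K J • op3 I L l₁ l₄
          + ∑ j ∈ cutsND J,
              (sgn (eps Λ j.1 * (eps Λ K + eps Λ L)) * kd K j.2) • op3 I (j.1 ++ L) l₁ l₄
          + ∑ k ∈ cutsND K,
              (sgn (eps Λ k.1 * (eps Λ I + eps Λ J)) * kd k.2 J) • op3 (k.1 ++ I) L l₁ l₄)
      - (sgn ((eps Λ I + eps Λ J) * (eps Λ K + eps Λ L)) * kd l₁ l₄) •
        (kd I L • op3 K J l₃ l₂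
          + ∑ l ∈ cutsND L,
              (sgn (eps Λ l.1 * (eps Λ I + eps Λ J)) * kd I l.2) • op3 K (l.1 ++ J) l₃ l₂
          + ∑ i ∈ cutsND I,
              (sgn (eps Λ i.1 * (eps Λ K + eps Λ L)) * kd i.2 L) • op3 (i.1 ++ K) J l₃ l₂)
  second_third : ∀ l₁ l₂ (I J K L : Word (2 * Λ)) l₃ l₄,
    br (op2 l₁ l₂ I J) (op3 K L l₃ l₄) =
      ∑ j ∈ cutsDD J, ∑ k ∈ cutsDD K,
        (sgn (eps Λ j.1 * (eps Λ K + eps Λ L)) * kd k.1 j.2) •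
          op1 l₁ l₂ (I ++ k.2) (j.1 ++ L) l₃ l₄
      - sgn ((eps Λ I + eps Λ J) * (eps Λ K + eps Λ L)) •
        ∑ i ∈ cutsDD I, ∑ l ∈ cutsDD L,
          (sgn (eps Λ i.1 * (eps Λ K + eps Λ L)) * kd i.2 l.1) •
            op1 l₁ l₂ (i.1 ++ K) (J ++ l.2) l₃ l₄
  second_fourth : ∀ l₁ l₂ (I J K L : Word (2 * Λ)), K ≠ [] → L ≠ [] →
    br (op2 l₁ l₂ I J) (op4 K L) =
      (kd K J • op2 l₁ l₂ I L
        + ∑ k ∈ cuts K, kd k.1 J • op2 l₁ l₂ (I ++ k.2) L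
        + ∑ j ∈ cuts J,
            (sgn (eps Λ j.1 * (eps Λ K + eps Λ L)) * kd K j.2) • op2 l₁ l₂ I (j.1 ++ L)
        + ∑ j ∈ cuts J, kd K j.1 • op2 l₁ l₂ I (L ++ j.2)
        + ∑ j ∈ cuts J, ∑ k ∈ cuts K,
            (sgn (eps Λ j.1 * (eps Λ K + eps Λ L)) * kd k.1 j.2) •
              op2 l₁ l₂ (I ++ k.2) (j.1 ++ L)
        + ∑ j ∈ cuts3 J,
            (sgn (eps Λ j.1 * (eps Λ K + eps Λ L)) * kd K j.2.1) •
              op2 l₁ l₂ I (j.1 ++ L ++ j.2.2))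
      - sgn ((eps Λ I + eps Λ J) * (eps Λ K + eps Λ L)) •
        (kd I L • op2 l₁ l₂ K J
          + ∑ l ∈ cuts L, kd I l.1 • op2 l₁ l₂ K (J ++ l.2)
          + ∑ i ∈ cuts I,
              (sgn (eps Λ i.1 * (eps Λ K + eps Λ L)) * kd i.2 L) • op2 l₁ l₂ (i.1 ++ K) J
          + ∑ i ∈ cuts I, kd i.1 L • op2 l₁ l₂ (K ++ i.2) J
          + ∑ l ∈ cuts L, ∑ i ∈ cuts I,
              (sgn (eps Λ i.1 * (eps Λ K + eps Λ L)) * kd i.2 l.1) •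
                op2 l₁ l₂ (i.1 ++ K) (J ++ l.2)
          + ∑ i ∈ cuts3 I,
              (sgn (eps Λ i.1 * (eps Λ K + eps Λ L)) * kd i.2.1 L) •
                op2 l₁ l₂ (i.1 ++ K ++ i.2.2) J)
  third_fourth : ∀ (I J : Word (2 * Λ)) l₁ l₂ (K L : Word (2 * Λ)), K ≠ [] → L ≠ [] →
    br (op3 I J l₁ l₂) (op4 K L) =
      (kd K J • op3 I L l₁ l₂
        + ∑ k ∈ cuts K,
            (sgn (eps Λ k.1 * (eps Λ I + eps Λ J)) * kd k.2 J) • op3 (k.1 ++ I) L l₁ l₂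
        + ∑ j ∈ cuts J,
            (sgn (eps Λ j.1 * (eps Λ K + eps Λ L)) * kd K j.2) • op3 I (j.1 ++ L) l₁ l₂
        + ∑ j ∈ cuts J, kd K j.1 • op3 I (L ++ j.2) l₁ l₂
        + ∑ j ∈ cuts J, ∑ k ∈ cuts K,
            (sgn (eps Λ k.1 * (eps Λ I + eps Λ J)) * kd k.2 j.1) •
              op3 (k.1 ++ I) (L ++ j.2) l₁ l₂
        + ∑ j ∈ cuts3 J,
            (sgn (eps Λ j.1 * (eps Λ K + eps Λ L)) * kd K j.2.1) •
              op3 I (j.1 ++ L ++ j.2.2) l₁ l₂)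
      - sgn ((eps Λ I + eps Λ J) * (eps Λ K + eps Λ L)) •
        (kd I L • op3 K J l₁ l₂
          + ∑ l ∈ cuts L,
              (sgn (eps Λ l.1 * (eps Λ I + eps Λ J)) * kd I l.2) • op3 K (l.1 ++ J) l₁ l₂
          + ∑ i ∈ cuts I,
              (sgn (eps Λ i.1 * (eps Λ K + eps Λ L)) * kd i.2 L) • op3 (i.1 ++ K) J l₁ l₂
          + ∑ i ∈ cuts I, kd i.1 L • op3 (K ++ i.2) J l₁ l₂
          + ∑ l ∈ cuts L, ∑ i ∈ cuts I,
              (sgn (eps Λ l.1 * (eps Λ I + eps Λ J)) * kd i.1 l.2) •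
                op3 (K ++ i.2) (l.1 ++ J) l₁ l₂
          + ∑ i ∈ cuts3 I,
              (sgn (eps Λ i.1 * (eps Λ K + eps Λ L)) * kd i.2.1 L) •
                op3 (i.1 ++ K ++ i.2.2) J l₁ l₂)
  fifth_fifth : ∀ I J K L : Word (2 * Λ), I ≠ [] → J ≠ [] → K ≠ [] → L ≠ [] →
    br (op5 I J) (op5 K L) = fifthFifth Λ op5 I J K L
  fourth_fifth : ∀ I J K L : Word (2 * Λ), I ≠ [] → J ≠ [] → K ≠ [] → L ≠ [] →
    br (op4 I J) (op5 K L) = gammaFifth Λ op5 I J K L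
  fourth_fourth : ∀ I J K L : Word (2 * Λ), I ≠ [] → J ≠ [] → K ≠ [] → L ≠ [] →
    br (op4 I J) (op4 K L) = gammaGamma Λ op4 op5 I J K L

/-- Open plus closed singlet states: finite linear combinations of the states
`φ̄^a ⊗ s^K ⊗ φ^b`, `K` possibly empty, and of the states `Ψ^K`, `K` non-empty. -/
abbrev GrandState (Λ ΛF : ℕ) :=
  (Fin (2 * ΛF) × Word (2 * Λ) × Fin (2 * ΛF) →₀ ℂ) × ClosedState Λ (2 * Λ)

/-- `φ̄^a ⊗ s^K ⊗ φ^b`. -/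
def openState {Λ ΛF : ℕ} (a : Fin (2 * ΛF)) (K : Word (2 * Λ)) (b : Fin (2 * ΛF)) :
    GrandState Λ ΛF :=
  (Finsupp.single (a, K, b) 1, 0)

/-- `Ψ^K`. -/
def closedState {Λ ΛF : ℕ} (K : Word (2 * Λ)) : GrandState Λ ΛF := (0, psi Λ K)

/-- The grading of the singlet states. -/
def grandStateGrading (Λ ΛF : ℕ) (e : ZMod 2) : Submodule ℂ (GrandState Λ ΛF) :=
  Submodule.span ℂ {x | ∃ K : Word (2 * Λ), ((eps Λ K : ℕ) : ZMod 2) = e ∧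
    ((∃ a b, x = openState a K b) ∨ (K ≠ [] ∧ x = closedState K))}

/-- `ρ` is given by the defining actions of the five kinds of operators on singlet states. -/
structure IsGrandAction (Λ ΛF : ℕ)
    (ρ : Grand Λ ΛF →ₗ[ℂ] GrandState Λ ΛF →ₗ[ℂ] GrandState Λ ΛF) : Prop where
  first_open : ∀ l₁ l₂ (I J : Word (2 * Λ)) l₃ l₄ l₅ (K : Word (2 * Λ)) l₆,
    ρ (op1 l₁ l₂ I J l₃ l₄) (openState l₅ K l₆) =
      (kd l₅ l₂ * kd K J * kd l₆ l₄) • openState l₁ I l₃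
  first_closed : ∀ l₁ l₂ (I J : Word (2 * Λ)) l₃ l₄ (K : Word (2 * Λ)), K ≠ [] →
    ρ (op1 l₁ l₂ I J l₃ l₄) (closedState K) = 0
  second_open : ∀ l₁ l₂ (I J : Word (2 * Λ)) l₃ (K : Word (2 * Λ)) l₄,
    ρ (op2 l₁ l₂ I J) (openState l₃ K l₄) =
      kd l₃ l₂ • ∑ k ∈ cutsDD K, kd k.1 J • openState l₁ (I ++ k.2) l₄
  second_closed : ∀ l₁ l₂ (I J K : Word (2 * Λ)), K ≠ [] →
    ρ (op2 l₁ l₂ I J) (closedState K) = 0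
  third_open : ∀ (I J : Word (2 * Λ)) l₁ l₂ l₃ (K : Word (2 * Λ)) l₄,
    ρ (op3 I J l₁ l₂) (openState l₃ K l₄) =
      kd l₄ l₂ • ∑ k ∈ cutsDD K,
        (sgn (eps Λ k.1 * (eps Λ I + eps Λ J)) * kd k.2 J) • openState l₃ (k.1 ++ I) l₁
  third_closed : ∀ (I J : Word (2 * Λ)) l₁ l₂ (K : Word (2 * Λ)), K ≠ [] →
    ρ (op3 I J l₁ l₂) (closedState K) = 0
  fourth_open : ∀ (I J : Word (2 * Λ)) l₁ (K : Word (2 * Λ)) l₂, I ≠ [] → J ≠ [] →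
    ρ (op4 I J) (openState l₁ K l₂) = gammaOpen Λ (fun W => openState l₁ W l₂) I J K
  fourth_closed : ∀ I J K : Word (2 * Λ), I ≠ [] → J ≠ [] → K ≠ [] →
    ρ (op4 I J) (closedState K) = gammaClosed Λ closedState I J K
  fifth_open : ∀ (I J : Word (2 * Λ)) l₁ (K : Word (2 * Λ)) l₂, I ≠ [] → J ≠ [] →
    ρ (op5 I J) (openState l₁ K l₂) = 0
  fifth_closed : ∀ I J K : Word (2 * Λ), I ≠ [] → J ≠ [] → K ≠ [] →
    ρ (op5 I J) (closedState K) = fifthClosed Λ closedState I J K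

/-! ### Realization inside the heterix superalgebra with `2 Λ + 4 Λ_F` letters -/

section Realization

variable {Λ ΛF : ℕ}

/-- A word in the letters `0, …, 2 Λ - 1` as a word in all `2 Λ + 4 Λ_F` letters. -/
def emb (W : Word (2 * Λ)) : Word (2 * Λ + 4 * ΛF) := W.map (Fin.castAdd (4 * ΛF))

/-- The letter standing for a quantum state of a conjugate parton. -/
def leftLetter (a : Fin (2 * ΛF)) : Fin (2 * Λ + 4 * ΛF) := ⟨2 * Λ + a.val, by omega⟩

/-- The letter standing for a quantum state of a fundamental parton. -/
def rightLetter (a : Fin (2 * ΛF)) : Fin (2 * Λ + 4 * ΛF) := ⟨2 * Λ + 2 * ΛF + a.val, by omega⟩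

end Realization

/-- `ι` identifies the operators of the five kinds with elements of the heterix superalgebra. -/
structure IsRealization (Λ ΛF : ℕ)
    (ι : Grand Λ ΛF →ₗ[ℂ] Heterix Λ (2 * Λ + 4 * ΛF)) : Prop where
  first : ∀ a b (I J : Word (2 * Λ)) c d,
    ι (op1 a b I J c d) =
      hetF Λ (leftLetter a :: (emb I ++ [rightLetter c])) (leftLetter b :: (emb J ++ [rightLetter d]))
  second : ∀ a b (I J : Word (2 * Λ)),
    ι (op2 a b I J) = hetL Λ (leftLetter a :: emb I) (leftLetter b :: emb J)
  third : ∀ (I J : Word (2 * Λ)) c d,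
    ι (op3 I J c d) = hetR Λ (emb I ++ [rightLetter c]) (emb J ++ [rightLetter d])
  fourth : ∀ I J : Word (2 * Λ), I ≠ [] → J ≠ [] → ι (op4 I J) = hetGamma Λ (emb I) (emb J)
  fifth : ∀ I J : Word (2 * Λ), I ≠ [] → J ≠ [] → ι (op5 I J) = hetFifth Λ (emb I) (emb J)

/-- `κ` identifies the singlet states with singlet states of the heterix superalgebra. -/
structure IsStateRealization (Λ ΛF : ℕ)
    (κ : GrandState Λ ΛF →ₗ[ℂ] HetState Λ (2 * Λ + 4 * ΛF)) : Prop where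
  opened : ∀ a (K : Word (2 * Λ)) b,
    κ (openState a K b) = hetOpen Λ (leftLetter a :: (emb K ++ [rightLetter b]))
  closed : ∀ K : Word (2 * Λ), K ≠ [] → κ (closedState K) = hetClosed Λ (emb K)

end

end GrandString

open GrandString

/-!
Every superbracket of the theorem is the supercommutator of explicit operators on cyclic words. On
the closed states, whose words are taken up to signed rotation, `gOp I J` replaces in turn every
occurrence of `J` in the cyclic word by `I`, and `fOp I J` replaces a cyclic word that is equal to
`J` by `I`. In the product of two such operators the word replaced second may overlap the word
inserted first in several ways: the terms with an overlap are those of the half bracket, and the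
terms without overlap cancel in the supercommutator (`gOp_gOp_commutator`).

An open string is a special cyclic word: it is closed by a new bosonic letter, the marker
(`IsMarker`, `hetClosing`). Since the marker occurs only once, no two rotations of the closed string
agree, and a word without marker can only occur inside the open string; so the same operators `gOp`
and `fOp` yield the action on open strings, and one computation of supercommutators covers open and
closed strings. The operators with values `gOp` and `fOp` represent the heterix superalgebra
faithfully (`IsMarker.het_eq_zero`): on open strings the `γ` are triangular with respect to the
length of their lower word, and the `f̃`, which vanish on open strings, are separated by the pairing
of cyclic words. A bracket that a faithful graded representation turns into the supercommutator is
unique and makes the space a Lie superalgebra (`isLieSuperalgebra`), so skew-symmetry and the Jacobi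
identity need no computation, and the singlet states form a representation.

The elements `l'`, `r'` and `f'` of the heterix superalgebra are the operators `γ` and `f̃` on words
that contain the marker. Summing `γ^{iI}_{iJ}` over all letters `i` including the marker gives back
`γ^I_J`, except where `J` is the whole cyclic word, and that exception is `f̃^I_J`
(`gOp_eq_sum_left`, `gOp_eq_sum_right`). Hence `l'^I_J`, which is `γ^I_J` minus `f̃^I_J` and the sum
over the other letters, is the operator with the marker in front: it acts on the left end of an open
string only (`markedRep_hetL`). Likewise `r'` acts on the right end (`markedRep_hetR`), and `f'` on
whole open strings (`markedRep_hetF`). Their supercommutators, for words that begin or end with the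
letters `leftLetter` and `rightLetter`, are the remaining superbrackets of the grand string
superalgebra (the lemmas on `stateComm`). Therefore the map `grandIota` into the heterix
superalgebra transports everything, once it is injective (`grandIota_injective`): on closed strings
only the fourth and fifth kinds act; open strings that end in a `leftLetter` or begin with a
`rightLetter` are annihilated by all remaining kinds but the second or the third, respectively; and
the triangularity argument applies to each of these kinds in turn.
-/

namespace GrandString

noncomputable section

/-! ### Signs, Kronecker deltas and sums over splittings -/

theorem sgn_congr {m n : ℕ} (h : (m : ZMod 2) = n) : sgn m = sgn n := by
  have h2 : m % 2 = n % 2 := (ZMod.natCast_eq_natCast_iff m n 2).1 h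
  unfold sgn
  rw [neg_one_pow_eq_pow_mod_two, h2, ← neg_one_pow_eq_pow_mod_two]

theorem sgn_mul (m n : ℕ) : sgn m * sgn n = sgn (m + n) := by simp [sgn, pow_add]

@[simp] theorem sgn_zero : sgn 0 = 1 := by simp [sgn]

theorem sgn_mul_self (m : ℕ) : sgn m * sgn m = 1 := by
  rw [sgn_mul, sgn_congr (n := 0), sgn_zero]
  push_cast
  grind

theorem cast_eps_append (Λ : ℕ) {n : ℕ} (A B : Word n) :
    (eps Λ (A ++ B) : ZMod 2) = eps Λ A + eps Λ B := by
  simp [eps, ZMod.natCast_mod]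

@[simp] theorem eps_nil (Λ : ℕ) {n : ℕ} : eps Λ ([] : Word n) = 0 := by simp [eps]

section Kd

variable {α β : Type} [DecidableEq α] [DecidableEq β]

@[simp] theorem kd_self (x : α) : kd x x = 1 := by simp [kd]

theorem kd_of_ne {x y : α} (h : x ≠ y) : kd x y = 0 := by simp [kd, h]

theorem kd_comm (x y : α) : kd x y = kd y x := by simp [kd, eq_comm]

theorem kd_congr_iff {x y : α} {z w : β} (h : x = y ↔ z = w) : kd x y = kd z w := by
  simp [kd, h]

variable {M : Type} [AddCommGroup M] [Module ℂ M]

/-- A Kronecker delta in front of a vector allows one to use the equality it expresses. -/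
theorem kd_smul_congr {x y : α} {a b : M} (h : x = y → a = b) : kd x y • a = kd x y • b := by
  by_cases hxy : x = y
  · rw [h hxy]
  · simp [kd_of_ne hxy]

theorem mul_kd_congr {x y : α} {s t : ℂ} (h : x = y → s = t) : s * kd x y = t * kd x y := by
  rw [mul_comm, mul_comm t]
  exact kd_smul_congr (M := ℂ) h

end Kd

section Kd

variable {n : ℕ}

@[simp] theorem kd_cons (x y : Fin n) (A B : Word n) :
    kd (x :: A) (y :: B) = kd x y * kd A B := by
  by_cases h : x = y <;> by_cases h' : A = B <;> simp [kd, h, h']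

@[simp] theorem kd_nil_cons (y : Fin n) (B : Word n) : kd [] (y :: B) = 0 := by simp [kd]

@[simp] theorem kd_cons_nil (y : Fin n) (B : Word n) : kd (y :: B) [] = 0 := by simp [kd]

end Kd

section Cuts

variable {M : Type} [AddCommGroup M] {n : ℕ}

theorem cutsDD_nil : cutsDD ([] : Word n) = {([], [])} := by
  ext ⟨a, b⟩
  simp [mem_cutsDD]

theorem cutsDD_cons (x : Fin n) (W : Word n) :
    cutsDD (x :: W) = insert ([], x :: W) ((cutsDD W).image fun p => (x :: p.1, p.2)) := by
  ext ⟨a, b⟩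
  simp only [mem_cutsDD, Finset.mem_insert, Finset.mem_image, Prod.exists, Prod.mk.injEq]
  rcases a with - | ⟨y, a⟩
  · simp
  · simp only [List.cons_append, List.cons.injEq, reduceCtorEq, false_and, false_or]
    constructor
    · rintro ⟨rfl, rfl⟩
      exact ⟨a, b, rfl, ⟨rfl, rfl⟩, rfl⟩
    · rintro ⟨a', b', rfl, ⟨rfl, rfl⟩, rfl⟩
      exact ⟨rfl, rfl⟩

theorem sum_cutsDD_nil (F : Word n × Word n → M) : ∑ p ∈ cutsDD [], F p = F ([], []) := by
  simp [cutsDD_nil]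

theorem sum_cutsDD_cons (x : Fin n) (W : Word n) (F : Word n × Word n → M) :
    ∑ p ∈ cutsDD (x :: W), F p = F ([], x :: W) + ∑ p ∈ cutsDD W, F (x :: p.1, p.2) := by
  rw [cutsDD_cons, Finset.sum_insert (by simp), Finset.sum_image]
  rintro ⟨a, b⟩ - ⟨c, d⟩ - h
  simpa using h

theorem sum_cutsDN_nil (F : Word n × Word n → M) : ∑ p ∈ cutsDN [], F p = 0 := by
  simp [cutsDN, cutsDD_nil, Finset.sum_filter]

theorem sum_cutsDN_cons (x : Fin n) (W : Word n) (F : Word n × Word n → M) :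
    ∑ p ∈ cutsDN (x :: W), F p = F ([], x :: W) + ∑ p ∈ cutsDN W, F (x :: p.1, p.2) := by
  simp [cutsDN, Finset.sum_filter, sum_cutsDD_cons]

theorem sum_cutsND_nil (F : Word n × Word n → M) : ∑ p ∈ cutsND [], F p = 0 := by
  simp [cutsND, cutsDD_nil, Finset.sum_filter]

theorem sum_cutsND_cons (x : Fin n) (W : Word n) (F : Word n × Word n → M) :
    ∑ p ∈ cutsND (x :: W), F p = ∑ p ∈ cutsDD W, F (x :: p.1, p.2) := by
  simp [cutsND, Finset.sum_filter, sum_cutsDD_cons]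

theorem sum_cuts_nil (F : Word n × Word n → M) : ∑ p ∈ cuts [], F p = 0 := by
  simp [cuts, cutsDD_nil, Finset.sum_filter]

theorem sum_cuts_cons (x : Fin n) (W : Word n) (F : Word n × Word n → M) :
    ∑ p ∈ cuts (x :: W), F p = ∑ p ∈ cutsDN W, F (x :: p.1, p.2) := by
  simp [cuts, cutsDN, Finset.sum_filter, sum_cutsDD_cons]

theorem sum_cutsDD_eq_ND (W : Word n) (F : Word n × Word n → M) :
    ∑ p ∈ cutsDD W, F p = F ([], W) + ∑ p ∈ cutsND W, F p := by
  cases W with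
  | nil => simp [sum_cutsDD_nil, sum_cutsND_nil]
  | cons x W => rw [sum_cutsDD_cons, sum_cutsND_cons]

theorem sum_cutsDD_eq_DN (W : Word n) (F : Word n × Word n → M) :
    ∑ p ∈ cutsDD W, F p = ∑ p ∈ cutsDN W, F p + F (W, []) := by
  induction W generalizing F with
  | nil => simp [sum_cutsDD_nil, sum_cutsDN_nil]
  | cons x W ih => rw [sum_cutsDD_cons, sum_cutsDN_cons, ih, add_assoc]

theorem sum_cutsDN {W : Word n} (hW : W ≠ []) (F : Word n × Word n → M) :
    ∑ p ∈ cutsDN W, F p = F ([], W) + ∑ p ∈ cuts W, F p := by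
  cases W with
  | nil => exact absurd rfl hW
  | cons x W => rw [sum_cutsDN_cons, sum_cuts_cons]

theorem sum_cutsND {W : Word n} (hW : W ≠ []) (F : Word n × Word n → M) :
    ∑ p ∈ cutsND W, F p = ∑ p ∈ cuts W, F p + F (W, []) := by
  cases W with
  | nil => exact absurd rfl hW
  | cons x W => rw [sum_cutsND_cons, sum_cuts_cons, sum_cutsDD_eq_DN]

theorem sum_cutsDD {W : Word n} (hW : W ≠ []) (F : Word n × Word n → M) :
    ∑ p ∈ cutsDD W, F p = F ([], W) + ∑ p ∈ cuts W, F p + F (W, []) := by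
  rw [sum_cutsDD_eq_ND, sum_cutsND hW, add_assoc]

theorem sum_cutsDD_append (U V : Word n) (F : Word n × Word n → M) :
    ∑ p ∈ cutsDD (U ++ V), F p =
      ∑ u ∈ cutsDD U, F (u.1, u.2 ++ V) + ∑ v ∈ cutsND V, F (U ++ v.1, v.2) := by
  induction U generalizing F with
  | nil => rw [sum_cutsDD_nil, List.nil_append, sum_cutsDD_eq_ND]; simp
  | cons x U ih => simp [sum_cutsDD_cons, ih, add_assoc]

theorem sum_cutsDN_append (U V : Word n) (F : Word n × Word n → M) :
    ∑ p ∈ cutsDN (U ++ V), F p =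
      ∑ u ∈ cutsDN U, F (u.1, u.2 ++ V) + ∑ v ∈ cutsDN V, F (U ++ v.1, v.2) := by
  induction U generalizing F with
  | nil => simp [sum_cutsDN_nil]
  | cons x U ih => simp [sum_cutsDN_cons, ih, add_assoc]

theorem sum_cutsND_append (U V : Word n) (F : Word n × Word n → M) :
    ∑ p ∈ cutsND (U ++ V), F p =
      ∑ u ∈ cutsND U, F (u.1, u.2 ++ V) + ∑ v ∈ cutsND V, F (U ++ v.1, v.2) := by
  cases U with
  | nil => simp [sum_cutsND_nil]
  | cons x U => simp [sum_cutsND_cons, sum_cutsDD_append]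

theorem sum_cuts_append {V : Word n} (hV : V ≠ []) (U : Word n) (F : Word n × Word n → M) :
    ∑ p ∈ cuts (U ++ V), F p =
      ∑ u ∈ cutsND U, F (u.1, u.2 ++ V) + ∑ v ∈ cuts V, F (U ++ v.1, v.2) := by
  cases U with
  | nil => simp [sum_cutsND_nil]
  | cons x U =>
    simp [sum_cutsND_cons, sum_cuts_cons, sum_cutsDN_append, sum_cutsDN hV,
      sum_cutsDD_eq_DN U, add_assoc]

theorem mem_cuts {W : Word n} {p : Word n × Word n} :
    p ∈ cuts W ↔ p.1 ++ p.2 = W ∧ p.1 ≠ [] ∧ p.2 ≠ [] := by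
  simp [cuts, mem_cutsDD]

theorem mem_cutsDN {W : Word n} {p : Word n × Word n} :
    p ∈ cutsDN W ↔ p.1 ++ p.2 = W ∧ p.2 ≠ [] := by
  simp [cutsDN, mem_cutsDD]

theorem mem_cutsND {W : Word n} {p : Word n × Word n} :
    p ∈ cutsND W ↔ p.1 ++ p.2 = W ∧ p.1 ≠ [] := by
  simp [cutsND, mem_cutsDD]

theorem sum_cuts3DDD (W : Word n) (F : Word n × Word n × Word n → M) :
    ∑ p ∈ cuts3DDD W, F p = ∑ p ∈ cutsDD W, ∑ q ∈ cutsDD p.2, F (p.1, q) := by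
  rw [cuts3DDD, Finset.sum_biUnion]
  · refine Finset.sum_congr rfl fun p _ => Finset.sum_image ?_
    rintro a - b - h
    simpa using h
  · rintro ⟨a, b⟩ hp ⟨c, d⟩ hq hpq
    rw [Function.onFun, Finset.disjoint_left]
    rintro ⟨x, y⟩ hx hy
    simp only [Finset.mem_image, Prod.mk.injEq] at hx hy
    obtain ⟨u, -, rfl, -⟩ := hx
    obtain ⟨v, -, rfl, -⟩ := hy
    simp only [Finset.mem_coe, mem_cutsDD] at hp hq
    exact hpq (Prod.ext rfl (List.append_cancel_left (hp.trans hq.symm)))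

theorem sum_cuts3 (W : Word n) (F : Word n × Word n × Word n → M) :
    ∑ p ∈ cuts3 W, F p = ∑ p ∈ cuts W, ∑ q ∈ cuts p.2, F (p.1, q) := by
  simp only [cuts3, cuts, Finset.sum_filter, sum_cuts3DDD]
  refine Finset.sum_congr rfl fun p hp => ?_
  by_cases h1 : p.1 = []
  · simp [h1]
  by_cases h2 : p.2 = []
  · simp [h1, h2, sum_cutsDD_nil]
  · simp [h1, h2]

theorem sum_cuts3DND (W : Word n) (F : Word n × Word n × Word n → M) :
    ∑ p ∈ cuts3DND W, F p = ∑ p ∈ cutsDD W, ∑ q ∈ cutsND p.2, F (p.1, q) := by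
  simp only [cuts3DND, cutsND, Finset.sum_filter, sum_cuts3DDD]

/-- Coassociativity of deconcatenation: the two ways of cutting a word into three pieces. -/
theorem sum_cutsDD_cutsDD (W : Word n) (F : Word n → Word n → Word n → M) :
    ∑ p ∈ cutsDD W, ∑ q ∈ cutsDD p.2, F p.1 q.1 q.2 =
      ∑ p ∈ cutsDD W, ∑ q ∈ cutsDD p.1, F q.1 q.2 p.2 := by
  induction W generalizing F with
  | nil => simp [sum_cutsDD_nil]
  | cons x W ih =>
    simp [sum_cutsDD_cons, ih fun a b c => F (x :: a) b c, Finset.sum_add_distrib, add_assoc,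
      sum_cutsDD_nil]

theorem sum_cuts_cuts (W : Word n) (F : Word n → Word n → Word n → M) :
    ∑ p ∈ cuts W, ∑ q ∈ cuts p.2, F p.1 q.1 q.2 =
      ∑ p ∈ cuts W, ∑ q ∈ cuts p.1, F q.1 q.2 p.2 := by
  have h := sum_cutsDD_cutsDD W
    fun a b c => if a ≠ [] ∧ b ≠ [] ∧ c ≠ [] then F a b c else 0
  simp only [cuts, Finset.sum_filter]
  convert h using 1
  · refine Finset.sum_congr rfl fun p hp => ?_
    by_cases h1 : p.1 = []
    · simp [h1]
    by_cases h2 : p.2 = []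
    · simp [h1, h2, sum_cutsDD_nil]
    · simp [h1, h2]
  · refine Finset.sum_congr rfl fun p hp => ?_
    by_cases h1 : p.1 = []
    · simp [h1, sum_cutsDD_nil]
    by_cases h2 : p.2 = []
    · simp [h1, h2]
    · simp only [ne_eq, h1, not_false_eq_true, h2, and_self, ↓reduceIte, and_true]

theorem sum_cuts3' (W : Word n) (F : Word n × Word n × Word n → M) :
    ∑ p ∈ cuts3 W, F p = ∑ p ∈ cuts W, ∑ q ∈ cuts p.1, F (q.1, q.2, p.2) := by
  rw [sum_cuts3]
  exact sum_cuts_cuts W fun a b c => F (a, b, c)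

theorem mem_cuts3 {W : Word n} {p : Word n × Word n × Word n} :
    p ∈ cuts3 W ↔ p.1 ++ p.2.1 ++ p.2.2 = W ∧ p.1 ≠ [] ∧ p.2.1 ≠ [] ∧ p.2.2 ≠ [] := by
  simp [cuts3, mem_cuts3DDD]

theorem kd_append_left (A B J : Word n) :
    kd (A ++ B) J = ∑ j ∈ cutsDD J, kd A j.1 * kd B j.2 := by
  rw [Finset.sum_congr rfl (g := fun j => if j = (A, B) then kd (A ++ B) J else 0)]
  · by_cases h : A ++ B = J
    · simp [mem_cutsDD, h]
    · simp [kd_of_ne h]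
  · rintro ⟨a, b⟩ hj
    simp only [mem_cutsDD] at hj
    subst hj
    rcases eq_or_ne A a with rfl | h1
    · rcases eq_or_ne B b with rfl | h2
      · simp
      · simp [kd_of_ne h2, h2.symm]
    · simp [kd_of_ne h1, h1.symm]

end Cuts

section Strip

variable {M : Type} [AddCommGroup M] [Module ℂ M] {n : ℕ}

/-- `strip J φ V` is `φ R` if `V = J R`, and `0` if `V` does not start with `J`. -/
def strip (J : Word n) (φ : Word n → M) (V : Word n) : M :=
  ∑ p ∈ cutsDD V, kd p.1 J • φ p.2

theorem strip_nil (φ : Word n → M) (V : Word n) : strip [] φ V = φ V := by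
  cases V <;> simp [strip, sum_cutsDD_nil, sum_cutsDD_cons]

@[simp] theorem strip_cons_cons (x y : Fin n) (J : Word n) (φ : Word n → M) (V : Word n) :
    strip (x :: J) φ (y :: V) = kd y x • strip J φ V := by
  simp [strip, sum_cutsDD_cons, mul_smul, Finset.smul_sum]

@[simp] theorem strip_cons_nil (x : Fin n) (J : Word n) (φ : Word n → M) :
    strip (x :: J) φ [] = 0 := by
  simp [strip, sum_cutsDD_nil]

theorem strip_append (A B : Word n) (φ : Word n → M) (V : Word n) :
    strip (A ++ B) φ V = strip A (strip B φ) V := by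
  induction A generalizing V with
  | nil => simp [strip_nil]
  | cons x A ih => cases V <;> simp [ih]

theorem strip_kd (J K V : Word n) (m : M) :
    strip J (fun R => kd R K • m) V = kd V (J ++ K) • m := by
  induction J generalizing V with
  | nil => simp [strip_nil]
  | cons x J ih => cases V <;> simp [ih, mul_smul]

theorem strip_congr {J : Word n} {φ ψ : Word n → M} {V : Word n}
    (h : ∀ R, V = J ++ R → φ R = ψ R) : strip J φ V = strip J ψ V := by
  refine Finset.sum_congr rfl fun p hp => kd_smul_congr fun hJ => h _ ?_
  rw [← hJ, mem_cutsDD.1 hp]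

theorem strip_add (J : Word n) (φ ψ : Word n → M) (V : Word n) :
    strip J (fun R => φ R + ψ R) V = strip J φ V + strip J ψ V := by
  simp [strip, Finset.sum_add_distrib]

theorem strip_smul (J : Word n) (c : ℂ) (φ : Word n → M) (V : Word n) :
    strip J (fun R => c • φ R) V = c • strip J φ V := by
  simp [strip, Finset.smul_sum, smul_comm c]

theorem strip_sum {ι : Type} (s : Finset ι) (J : Word n) (φ : ι → Word n → M) (V : Word n) :
    strip J (fun R => ∑ i ∈ s, φ i R) V = ∑ i ∈ s, strip J (φ i) V := by
  simp only [strip, Finset.smul_sum]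
  exact Finset.sum_comm

/-- Either `K` is at least as long as `J`, and `J` is a prefix of `K`, or `K` is a proper
prefix of `J`. -/
theorem strip_append_right (J K D : Word n) (φ : Word n → M) :
    strip J φ (K ++ D) = ∑ k ∈ cutsDD K, kd k.1 J • φ (k.2 ++ D)
      + ∑ j ∈ cutsDN J, kd K j.1 • strip j.2 φ D := by
  induction K generalizing J with
  | nil =>
    cases J <;> simp [strip_nil, sum_cutsDD_nil, sum_cutsDN_nil, sum_cutsDN_cons]
  | cons x K ih =>
    cases J with
    | nil => simp [strip_nil, sum_cutsDD_cons, sum_cutsDN_nil]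
    | cons y J =>
      simp [sum_cutsDD_cons, ih, sum_cutsDN_cons, mul_smul, Finset.smul_sum, smul_add]

end Strip

/-! ### Closed states and sums over cyclic rotations -/

section Closed

variable (Λ : ℕ) {n : ℕ} {M M' : Type} [AddCommGroup M] [Module ℂ M] [AddCommGroup M']
  [Module ℂ M']

theorem psi_nil : psi Λ ([] : Word n) = 0 := by simp [psi]

theorem psi_append_comm (A B : Word n) :
    psi Λ (A ++ B) = sgn (eps Λ A * eps Λ B) • psi Λ (B ++ A) := by
  rcases eq_or_ne A [] with rfl | hA
  · simp
  rcases eq_or_ne B [] with rfl | hB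
  · simp
  have h1 : A ++ B ≠ [] := by simp [hA]
  have h2 : B ++ A ≠ [] := by simp [hA]
  rw [psi, psi, dif_pos h1, dif_pos h2, ← Submodule.Quotient.mk_smul, Submodule.Quotient.eq]
  exact Submodule.subset_span ⟨⟨A, hA⟩, ⟨B, hB⟩, rfl⟩

/-- The linear map on closed states determined by a function on words that transforms under
cyclic rotations with the right signs. -/
def closedLift (φ : Word n → M)
    (h : ∀ A B, φ (A ++ B) = sgn (eps Λ A * eps Λ B) • φ (B ++ A)) : ClosedState Λ n →ₗ[ℂ] M :=
  (closedRel Λ n).liftQ (Finsupp.lift M ℂ (NWord n) fun W => φ W.1) (by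
    rw [closedRel, Submodule.span_le]
    rintro x ⟨A, B, rfl⟩
    rw [SetLike.mem_coe, LinearMap.mem_ker, map_sub, map_smul]
    simp [NWord.cat, h A.1 B.1])

theorem closedLift_psi (φ : Word n → M)
    (h : ∀ A B, φ (A ++ B) = sgn (eps Λ A * eps Λ B) • φ (B ++ A)) {W : Word n} (hW : W ≠ []) :
    closedLift Λ φ h (psi Λ W) = φ W := by
  rw [psi, dif_pos hW, closedLift]
  erw [Submodule.liftQ_apply]
  simp

variable {Λ} in
theorem closed_ext {F G : ClosedState Λ n →ₗ[ℂ] M}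
    (h : ∀ W : Word n, W ≠ [] → F (psi Λ W) = G (psi Λ W)) : F = G := by
  refine Submodule.linearMap_qext _ (Finsupp.lhom_ext' fun W => LinearMap.ext_ring ?_)
  have := h W.1 W.2
  rwa [psi, dif_pos W.2] at this

/-- The sum of `h` over the cyclic rotations of a word, with the sign of the rotation. -/
def cyc (h : Word n → M) (W : Word n) : M :=
  ∑ p ∈ cutsDN W, sgn (eps Λ p.1 * eps Λ p.2) • h (p.2 ++ p.1)

theorem cyc_nil (h : Word n → M) : cyc Λ h [] = 0 := by simp [cyc, sum_cutsDN_nil]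

/-- A sum over rotations depends on the cyclic word only, up to the sign of the rotation. -/
theorem cyc_append_comm (h : Word n → M) (A B : Word n) :
    cyc Λ h (A ++ B) = sgn (eps Λ A * eps Λ B) • cyc Λ h (B ++ A) := by
  simp only [cyc, sum_cutsDN_append, smul_add, Finset.smul_sum, smul_smul, sgn_mul]
  rw [add_comm]
  congr 1 <;> refine Finset.sum_congr rfl fun p hp => ?_ <;>
    obtain ⟨rfl, -⟩ := mem_cutsDN.1 hp <;> simp only [List.append_assoc] <;> congr 1 <;>
    refine sgn_congr ?_ <;> simp only [Nat.cast_add, Nat.cast_mul, cast_eps_append] <;> grind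

/-- The linear map `Ψ^W ↦ cyc h W`. -/
def cycMap : (Word n → M) →ₗ[ℂ] (ClosedState Λ n →ₗ[ℂ] M) where
  toFun h := closedLift Λ (cyc Λ h) (cyc_append_comm Λ h)
  map_add' g h := closed_ext fun W hW => by
    simp [closedLift_psi Λ _ _ hW, cyc, Finset.sum_add_distrib]
  map_smul' c h := closed_ext fun W hW => by
    simp [closedLift_psi Λ _ _ hW, cyc, Finset.smul_sum, smul_comm c]

@[simp] theorem cycMap_psi (h : Word n → M) (W : Word n) :
    cycMap Λ h (psi Λ W) = cyc Λ h W := by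
  rcases eq_or_ne W [] with rfl | hW
  · simp [psi_nil, cyc_nil]
  · exact closedLift_psi Λ _ (cyc_append_comm Λ h) hW

theorem map_cyc (F : M →ₗ[ℂ] M') (h : Word n → M) (W : Word n) :
    F (cyc Λ h W) = cyc Λ (fun V => F (h V)) W := by
  simp [cyc]

theorem cycMap_comp (F : M →ₗ[ℂ] M') (h : Word n → M) :
    F ∘ₗ cycMap Λ h = cycMap Λ fun V => F (h V) :=
  closed_ext fun W _ => by simp [map_cyc]

theorem cyc_sum {ι : Type} (s : Finset ι) (h : ι → Word n → M) (W : Word n) :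
    cyc Λ (fun V => ∑ i ∈ s, h i V) W = ∑ i ∈ s, cyc Λ (h i) W := by
  simp only [cyc, Finset.smul_sum]
  exact Finset.sum_comm

theorem cyc_add (g h : Word n → M) (W : Word n) :
    cyc Λ (fun V => g V + h V) W = cyc Λ g W + cyc Λ h W := by
  simp [cyc, Finset.sum_add_distrib]

theorem cyc_smul (c : ℂ) (h : Word n → M) (W : Word n) :
    cyc Λ (fun V => c • h V) W = c • cyc Λ h W := by
  simp [cyc, Finset.smul_sum, smul_comm c]

theorem cyc_smul_const (c : Word n → ℂ) (m : M) (W : Word n) :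
    cyc Λ (fun V => c V • m) W = cyc Λ c W • m := by
  simp [cyc, Finset.sum_smul, smul_smul]

/-- Since all rotations of a word are summed over, the two parts of a cut may be interchanged. -/
theorem cyc_cuts_swap (G : Word n → Word n → M) (W : Word n) :
    cyc Λ (fun V => ∑ p ∈ cuts V, G p.1 p.2) W =
      cyc Λ (fun V => ∑ p ∈ cuts V, sgn (eps Λ p.1 * eps Λ p.2) • G p.2 p.1) W := by
  rcases eq_or_ne W [] with rfl | hW
  · simp [cyc_nil]
  have key : ∀ H : Word n → Word n → M, cyc Λ (fun V => ∑ p ∈ cuts V, H p.1 p.2) W =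
      ∑ p ∈ cuts W, H p.1 p.2
      + ∑ p ∈ cuts W, sgn (eps Λ p.1 * eps Λ p.2) • H p.2 p.1
      + ∑ p ∈ cuts W, ∑ q ∈ cuts p.2, sgn (eps Λ p.1 * eps Λ p.2) • H q.1 (q.2 ++ p.1)
      + ∑ p ∈ cuts W, ∑ q ∈ cuts p.1, sgn (eps Λ p.1 * eps Λ p.2) • H (p.2 ++ q.1) q.2 := by
    intro H
    rw [cyc, sum_cutsDN hW]
    simp only [← Finset.sum_add_distrib, add_assoc]
    simp only [eps_nil, zero_mul, sgn_zero, one_smul, List.append_nil]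
    rw [Finset.sum_add_distrib]
    congr 1
    refine Finset.sum_congr rfl fun p hp => ?_
    obtain ⟨-, h1, h2⟩ := mem_cuts.1 hp
    rw [sum_cuts_append h1, sum_cutsND h2]
    simp only [smul_add, Finset.smul_sum, List.nil_append]
    abel
  rw [key, key fun a b => sgn (eps Λ a * eps Λ b) • G b a]
  have e1 : ∀ p : Word n × Word n, sgn (eps Λ p.1 * eps Λ p.2) •
      sgn (eps Λ p.2 * eps Λ p.1) • G p.1 p.2 = G p.1 p.2 := fun p => by
    rw [smul_smul, mul_comm (eps Λ p.2), sgn_mul_self, one_smul]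
  have e2 : ∀ p ∈ cuts W, ∀ q ∈ cuts p.2, sgn (eps Λ p.1 * eps Λ p.2) • G q.1 (q.2 ++ p.1) =
      sgn (eps Λ p.1 * (eps Λ q.1 + eps Λ q.2)) • G q.1 (q.2 ++ p.1) := fun p hp q hq => by
    congr 1
    refine sgn_congr ?_
    rw [← (mem_cuts.1 hq).1]
    simp only [Nat.cast_add, Nat.cast_mul, cast_eps_append]
  have e3 : ∀ p ∈ cuts W, ∀ q ∈ cuts p.1, sgn (eps Λ p.1 * eps Λ p.2) • G (p.2 ++ q.1) q.2 =
      sgn ((eps Λ q.1 + eps Λ q.2) * eps Λ p.2) • G (p.2 ++ q.1) q.2 := fun p hp q hq => by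
    congr 1
    refine sgn_congr ?_
    rw [← (mem_cuts.1 hq).1]
    simp only [Nat.cast_add, Nat.cast_mul, cast_eps_append]
  have e4 : ∀ p ∈ cuts W, ∀ q ∈ cuts p.2, sgn (eps Λ p.1 * eps Λ p.2) •
      sgn (eps Λ q.1 * eps Λ (q.2 ++ p.1)) • G (q.2 ++ p.1) q.1 =
      sgn ((eps Λ p.1 + eps Λ q.1) * eps Λ q.2) • G (q.2 ++ p.1) q.1 := fun p hp q hq => by
    rw [smul_smul, sgn_mul]
    congr 1
    refine sgn_congr ?_
    rw [← (mem_cuts.1 hq).1]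
    simp only [Nat.cast_add, Nat.cast_mul, cast_eps_append]
    grind
  have e5 : ∀ p ∈ cuts W, ∀ q ∈ cuts p.1, sgn (eps Λ p.1 * eps Λ p.2) •
      sgn (eps Λ (p.2 ++ q.1) * eps Λ q.2) • G q.2 (p.2 ++ q.1) =
      sgn (eps Λ q.1 * (eps Λ q.2 + eps Λ p.2)) • G q.2 (p.2 ++ q.1) := fun p hp q hq => by
    rw [smul_smul, sgn_mul]
    congr 1
    refine sgn_congr ?_
    rw [← (mem_cuts.1 hq).1]
    simp only [Nat.cast_add, Nat.cast_mul, cast_eps_append]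
    grind
  simp only [e1]
  rw [Finset.sum_congr rfl fun p hp => Finset.sum_congr rfl (e2 p hp),
    Finset.sum_congr rfl fun p hp => Finset.sum_congr rfl (e3 p hp),
    Finset.sum_congr rfl fun p hp => Finset.sum_congr rfl (e4 p hp),
    Finset.sum_congr rfl fun p hp => Finset.sum_congr rfl (e5 p hp),
    sum_cuts_cuts W fun a b c => sgn (eps Λ a * (eps Λ b + eps Λ c)) • G b (c ++ a),
    sum_cuts_cuts W fun a b c => sgn ((eps Λ a + eps Λ b) * eps Λ c) • G (c ++ a) b]
  abel

theorem kd_append_cuts {A B : Word n} (hA : A ≠ []) (hB : B ≠ []) (V : Word n) :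
    kd (A ++ B) V = ∑ p ∈ cuts V, kd A p.1 * kd B p.2 := by
  rw [kd_append_left]
  simp only [cuts, Finset.sum_filter]
  refine Finset.sum_congr rfl fun p _ => ?_
  split_ifs with h
  · rfl
  · rw [not_and_or, not_not, not_not] at h
    rcases h with h | h
    · rw [h, kd_of_ne hA, zero_mul]
    · rw [h, kd_of_ne hB, mul_zero]

/-- The pairing of words: the signed number of rotations of `W` that are equal to `V`. -/
def pair (W V : Word n) : ℂ := cyc Λ (fun U => kd U V) W

theorem pair_append_comm_right (W A B : Word n) :
    pair Λ W (A ++ B) = sgn (eps Λ A * eps Λ B) • pair Λ W (B ++ A) := by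
  rcases eq_or_ne A [] with rfl | hA
  · simp
  rcases eq_or_ne B [] with rfl | hB
  · simp
  simp only [pair, kd_comm _ (A ++ B), kd_comm _ (B ++ A), kd_append_cuts hA hB,
    kd_append_cuts hB hA]
  rw [cyc_cuts_swap Λ fun a b => kd A a * kd B b, ← cyc_smul]
  congr 1
  funext V
  rw [Finset.smul_sum]
  refine Finset.sum_congr rfl fun p _ => ?_
  by_cases h1 : p.1 = B
  · by_cases h2 : p.2 = A
    · rw [h1, h2, mul_comm (eps Λ B)]
      simp
    · simp [kd_of_ne (Ne.symm h2)]
  · simp [kd_of_ne (Ne.symm h1)]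

/-- A rotation is either trivial, or cuts `W` and `V` into the same two pieces in opposite order. -/
theorem pair_eq {W : Word n} (hW : W ≠ []) (V : Word n) :
    pair Λ W V = kd W V + ∑ p ∈ cuts W, ∑ q ∈ cuts V,
      sgn (eps Λ p.1 * eps Λ p.2) * (kd p.2 q.1 * kd p.1 q.2) := by
  rw [pair, cyc, sum_cutsDN hW]
  simp only [eps_nil, zero_mul, sgn_zero, one_mul, List.append_nil, smul_eq_mul]
  congr 1
  refine Finset.sum_congr rfl fun p hp => ?_
  obtain ⟨-, h1, h2⟩ := mem_cuts.1 hp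
  rw [kd_append_cuts h2 h1, Finset.mul_sum]

theorem pair_comm (W V : Word n) : pair Λ W V = pair Λ V W := by
  rcases eq_or_ne W [] with rfl | hW <;> rcases eq_or_ne V [] with rfl | hV
  · rfl
  · rw [pair_eq Λ hV]
    simp [pair, cyc_nil, sum_cuts_nil, kd_of_ne hV]
  · rw [pair_eq Λ hW]
    simp [pair, cyc_nil, sum_cuts_nil, kd_of_ne hW]
  · rw [pair_eq Λ hW, pair_eq Λ hV, kd_comm, Finset.sum_comm]
    congr 1
    refine Finset.sum_congr rfl fun q _ => Finset.sum_congr rfl fun p _ => ?_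
    by_cases h1 : p.2 = q.1
    · by_cases h2 : p.1 = q.2
      · simp [h1, h2, mul_comm]
      · simp [kd_of_ne h2, kd_of_ne (Ne.symm h2)]
    · simp [kd_of_ne h1, kd_of_ne (Ne.symm h1)]

/-- The functional `Ψ^W ↦ pair W U`. -/
def pairL (U : Word n) : ClosedState Λ n →ₗ[ℂ] ℂ := cycMap Λ fun V => kd V U

@[simp] theorem pairL_psi (U W : Word n) : pairL Λ U (psi Λ W) = pair Λ W U := cycMap_psi _ _ _

theorem card_cutsDN (W : Word n) : (cutsDN W).card = W.length := by
  induction W with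
  | nil => simp [cutsDN, cutsDD_nil, Finset.filter_singleton]
  | cons x W ih =>
    have := sum_cutsDN_cons x W fun _ => (1 : ℤ)
    simp only [Finset.sum_const, ih] at this
    simp only [nsmul_eq_mul, mul_one] at this
    simp only [List.length_cons]
    omega

/-- The average over rotations of a function with the right transformation behaviour is the
function itself. -/
theorem cyc_average {h : Word n → M}
    (hh : ∀ A B, h (A ++ B) = sgn (eps Λ A * eps Λ B) • h (B ++ A)) {W : Word n} (hW : W ≠ []) :
    cyc Λ (fun V => (V.length : ℂ)⁻¹ • h V) W = h W := by
  have : ∀ p ∈ cutsDN W, sgn (eps Λ p.1 * eps Λ p.2) •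
      (((p.2 ++ p.1).length : ℂ)⁻¹ • h (p.2 ++ p.1)) = (W.length : ℂ)⁻¹ • h W := fun p hp => by
    obtain ⟨rfl, -⟩ := mem_cutsDN.1 hp
    rw [hh p.1 p.2, smul_comm, List.length_append, List.length_append, add_comm]
  rw [cyc, Finset.sum_congr rfl this, Finset.sum_const, card_cutsDN, ← Nat.cast_smul_eq_nsmul ℂ,
    smul_smul, mul_inv_cancel₀, one_smul]
  simpa using hW

/-- The functionals `pairL U` separate closed states: `Ψ^W` is recovered from the sum of all its
signed rotations by averaging. -/
theorem closed_eq_zero {v : ClosedState Λ n} (hv : ∀ U, pairL Λ U v = 0) : v = 0 := by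
  let N : ClosedState Λ n →ₗ[ℂ] (Word n →₀ ℂ) := cycMap Λ fun V => Finsupp.single V 1
  let A : (Word n →₀ ℂ) →ₗ[ℂ] ClosedState Λ n :=
    Finsupp.lift _ ℂ _ fun V => (V.length : ℂ)⁻¹ • psi Λ V
  have hAN : A ∘ₗ N = LinearMap.id := closed_ext fun W hW => by
    simp only [N, A, LinearMap.comp_apply, cycMap_psi, map_cyc]
    simpa using cyc_average Λ (psi_append_comm Λ) hW
  have hN : N v = 0 := by
    ext U
    have : Finsupp.lapply U ∘ₗ N = pairL Λ U := by
      rw [cycMap_comp, pairL]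
      congr 1
      funext V
      simp [Finsupp.single_apply, kd]
    rw [← Finsupp.lapply_apply (R := ℂ), ← LinearMap.comp_apply, this, hv]
    rfl
  rw [← LinearMap.id_apply (R := ℂ) v, ← hAN, LinearMap.comp_apply, hN, map_zero]

end Closed

/-! ### Products of operators on closed states -/

section Operators

variable (Λ : ℕ) {n : ℕ} {M M' : Type} [AddCommGroup M] [Module ℂ M] [AddCommGroup M']
  [Module ℂ M']

/-- The operator `γ^I_J` on closed states: in all rotations of a word that start with `J`, this
prefix is replaced by `I`. -/
def gOp (I J : Word n) : Module.End ℂ (ClosedState Λ n) :=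
  cycMap Λ (strip J fun R => psi Λ (I ++ R))

/-- The operator `f̃^I_J` on closed states: the rotations of a word that are equal to `J` are
replaced by `I`. -/
def fOp (I J : Word n) : Module.End ℂ (ClosedState Λ n) :=
  cycMap Λ fun V => kd V J • psi Λ I

theorem gOp_psi (I J W : Word n) :
    gOp Λ I J (psi Λ W) = cyc Λ (strip J fun R => psi Λ (I ++ R)) W := cycMap_psi _ _ _

theorem fOp_psi (I J W : Word n) : fOp Λ I J (psi Λ W) = pair Λ W J • psi Λ I := by
  rw [fOp, cycMap_psi, cyc_smul_const]
  rfl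

theorem fOp_append_comm_left (A B J : Word n) :
    fOp Λ (A ++ B) J = sgn (eps Λ A * eps Λ B) • fOp Λ (B ++ A) J :=
  closed_ext fun W _ => by
    rw [LinearMap.smul_apply, fOp_psi, fOp_psi, psi_append_comm, smul_comm]

theorem fOp_append_comm_right (I A B : Word n) :
    fOp Λ I (A ++ B) = sgn (eps Λ A * eps Λ B) • fOp Λ I (B ++ A) :=
  closed_ext fun W _ => by
    rw [LinearMap.smul_apply, fOp_psi, fOp_psi, pair_append_comm_right, smul_assoc]

theorem map_strip (F : M →ₗ[ℂ] M') (J : Word n) (φ : Word n → M) (V : Word n) :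
    F (strip J φ V) = strip J (fun R => F (φ R)) V := by
  simp [strip]

theorem strip_apply (J : Word n) (F : Word n → Module.End ℂ M) (V : Word n) (v : M) :
    strip J F V v = strip J (fun R => F R v) V := by
  simp [strip, LinearMap.sum_apply]

theorem cyc_apply (F : Word n → Module.End ℂ M) (W : Word n) (v : M) :
    cyc Λ F W v = cyc Λ (fun V => F V v) W := by
  simp [cyc, LinearMap.sum_apply]

/-- The rotations of `K` that start with `J`, according to the place where `K` is cut. -/
theorem cyc_strip {J : Word n} (hJ : J ≠ []) (φ : Word n → M) (K : Word n) :
    cyc Λ (strip J φ) K = kd K J • φ []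
      + ∑ k ∈ cuts K, (sgn (eps Λ k.1 * eps Λ k.2) * kd (k.2 ++ k.1) J) • φ []
      + ∑ k ∈ cuts K, kd k.1 J • φ k.2
      + ∑ k ∈ cuts3 K,
          (sgn (eps Λ k.1 * (eps Λ k.2.1 + eps Λ k.2.2)) * kd k.2.1 J) • φ (k.2.2 ++ k.1)
      + ∑ k ∈ cuts K, (sgn (eps Λ k.1 * eps Λ k.2) * kd k.2 J) • φ k.1
      + ∑ k ∈ cuts3 K,
          (sgn ((eps Λ k.1 + eps Λ k.2.1) * eps Λ k.2.2) * kd (k.2.2 ++ k.1) J) • φ k.2.1 := by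
  rcases eq_or_ne K [] with rfl | hK
  · simp [cyc_nil, sum_cuts_nil, sum_cuts3, kd_of_ne hJ.symm]
  rw [cyc, sum_cutsDN hK, strip, List.append_nil, sum_cutsDD hK, kd_of_ne hJ.symm]
  have : ∀ k ∈ cuts K, sgn (eps Λ k.1 * eps Λ k.2) • strip J φ (k.2 ++ k.1) =
      (sgn (eps Λ k.1 * eps Λ k.2) * kd (k.2 ++ k.1) J) • φ []
      + ∑ q ∈ cuts k.2,
          (sgn (eps Λ k.1 * (eps Λ q.1 + eps Λ q.2)) * kd q.1 J) • φ (q.2 ++ k.1)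
      + (sgn (eps Λ k.1 * eps Λ k.2) * kd k.2 J) • φ k.1
      + ∑ q ∈ cuts k.1,
          (sgn ((eps Λ q.1 + eps Λ q.2) * eps Λ k.2) * kd (k.2 ++ q.1) J) • φ q.2 := by
    intro k hk
    obtain ⟨-, h1, h2⟩ := mem_cuts.1 hk
    rw [strip, sum_cutsDD_append, sum_cutsDD h2, sum_cutsND h1, kd_of_ne hJ.symm]
    have e1 : ∀ q ∈ cuts k.2, sgn (eps Λ k.1 * (eps Λ q.1 + eps Λ q.2)) =
        sgn (eps Λ k.1 * eps Λ k.2) := fun q hq => sgn_congr <| by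
      rw [← (mem_cuts.1 hq).1]
      simp only [Nat.cast_add, Nat.cast_mul, cast_eps_append]
    have e2 : ∀ q ∈ cuts k.1, sgn ((eps Λ q.1 + eps Λ q.2) * eps Λ k.2) =
        sgn (eps Λ k.1 * eps Λ k.2) := fun q hq => sgn_congr <| by
      rw [← (mem_cuts.1 hq).1]
      simp only [Nat.cast_add, Nat.cast_mul, cast_eps_append]
    have e3 : ∑ q ∈ cuts k.2,
        (sgn (eps Λ k.1 * (eps Λ q.1 + eps Λ q.2)) * kd q.1 J) • φ (q.2 ++ k.1) =
        sgn (eps Λ k.1 * eps Λ k.2) • ∑ q ∈ cuts k.2, kd q.1 J • φ (q.2 ++ k.1) := by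
      rw [Finset.smul_sum]
      exact Finset.sum_congr rfl fun q hq => by rw [e1 q hq, mul_smul]
    have e4 : ∑ q ∈ cuts k.1,
        (sgn ((eps Λ q.1 + eps Λ q.2) * eps Λ k.2) * kd (k.2 ++ q.1) J) • φ q.2 =
        sgn (eps Λ k.1 * eps Λ k.2) • ∑ q ∈ cuts k.1, kd (k.2 ++ q.1) J • φ q.2 := by
      rw [Finset.smul_sum]
      exact Finset.sum_congr rfl fun q hq => by rw [e2 q hq, mul_smul]
    rw [e3, e4]
    simp only [zero_smul, smul_add, List.nil_append, mul_smul, smul_zero]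
    abel
  rw [Finset.sum_congr rfl this]
  simp only [Finset.sum_add_distrib, eps_nil, zero_mul, sgn_zero, one_smul, zero_smul]
  rw [sum_cuts3, sum_cuts3']
  abel

/-- Comparison with the explicit sum over the splittings of `K` and `J`. -/
theorem gOp_psi_eq_gammaClosed {J K : Word n} (I : Word n) (hJ : J ≠ []) :
    gOp Λ I J (psi Λ K) = gammaClosed Λ (psi Λ) I J K := by
  rw [gOp_psi, cyc_strip Λ hJ, gammaClosed, Finset.sum_comm (s := cuts J)]
  simp only [List.append_nil, ← List.append_assoc]
  congr 1
  refine Finset.sum_congr rfl fun k hk => ?_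
  obtain ⟨-, h1, -, h3⟩ := mem_cuts3.1 hk
  rw [kd_append_cuts h3 h1, Finset.mul_sum, Finset.sum_smul]
  refine Finset.sum_congr rfl fun j _ => ?_
  rw [mul_assoc, mul_comm (eps Λ k.2.2)]

theorem fOp_psi_eq_fifthClosed {J K : Word n} (I : Word n) (hJ : J ≠ []) :
    fOp Λ I J (psi Λ K) = fifthClosed Λ (psi Λ) I J K := by
  rw [fOp_psi, pair_comm, pair, cyc, sum_cutsDN hJ, add_smul, Finset.sum_smul, fifthClosed]
  simp only [eps_nil, zero_mul, sgn_zero, one_mul, List.append_nil, smul_eq_mul, kd_comm K]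

theorem fOp_mul_fOp (I J : Word n) {K : Word n} (hK : K ≠ []) (L : Word n) :
    fOp Λ I J * fOp Λ K L = fifthFifthHalf Λ (fOp Λ) I J K L :=
  closed_ext fun W _ => by
    have h : pair Λ K J = kd K J + ∑ k ∈ cuts K,
        sgn (eps Λ k.1 * eps Λ k.2) * kd (k.2 ++ k.1) J := by
      rw [pair, cyc, sum_cutsDN hK]
      simp
    rw [Module.End.mul_apply, fOp_psi, map_smul, fOp_psi, fifthFifthHalf, h]
    simp only [LinearMap.add_apply, LinearMap.sum_apply, LinearMap.smul_apply, fOp_psi]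
    rw [add_smul, smul_add, Finset.sum_smul, Finset.smul_sum, smul_comm]
    congr 1
    exact Finset.sum_congr rfl fun k _ => smul_comm _ _ _

theorem gOp_mul_fOp (I J K L : Word n) :
    gOp Λ I J * fOp Λ K L = cyc Λ (strip J fun R => fOp Λ (I ++ R) L) K :=
  closed_ext fun W _ => by
    rw [Module.End.mul_apply, fOp_psi, map_smul, gOp_psi, cyc_apply, ← cyc_smul]
    simp only [strip_apply, fOp_psi, strip_smul]

theorem fOp_mul_gOp (I J K L : Word n) :
    fOp Λ I J * gOp Λ K L = cyc Λ (strip K fun R => fOp Λ I (L ++ R)) J :=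
  closed_ext fun W _ => by
    rw [Module.End.mul_apply, gOp_psi, map_cyc, cyc_apply]
    simp only [map_strip, strip_apply, fOp_psi, pair_comm Λ _ J]
    have : ∀ V, strip L (fun R => pair Λ J (K ++ R) • psi Λ I) V =
        cyc Λ (fun U => strip K (fun R => kd V (L ++ R) • psi Λ I) U) J := fun V => by
      simp only [pair, ← cyc_smul_const, ← strip_kd]
      rw [strip, ← Finset.sum_congr rfl fun p _ => cyc_smul Λ _ _ J, ← cyc_sum]
      congr 1
      funext U
      rw [← Finset.sum_congr rfl fun p _ => strip_smul K _ _ U, ← strip_sum]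
      congr 1
      funext R
      exact Finset.sum_congr rfl fun p _ => by rw [kd_comm R]
    simp only [this]
    rw [cyc]
    simp only [← cyc_smul, ← cyc_sum]
    congr 1
    funext U
    simp only [← strip_smul, ← strip_sum]
    congr 1
    funext R
    rw [pair, ← cyc_smul_const]
    rfl

/-- The commutator `[γ^I_J, f̃^K_L]` on closed states. -/
theorem gOp_fOp_commutator {I J : Word n} (hI : I ≠ []) (hJ : J ≠ []) (K L : Word n) :
    gOp Λ I J * fOp Λ K L
      - sgn ((eps Λ I + eps Λ J) * (eps Λ K + eps Λ L)) • (fOp Λ K L * gOp Λ I J) =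
    gammaFifth Λ (fOp Λ) I J K L := by
  rw [gOp_mul_fOp, fOp_mul_gOp, cyc_strip Λ hJ, cyc_strip Λ hI, gammaFifth]
  have s1 : ∀ A B : Word n, ∀ c : ℂ,
      (sgn (eps Λ A * (eps Λ J + eps Λ B)) * c) • fOp Λ (I ++ (B ++ A)) L =
      (c * sgn (eps Λ A * (eps Λ I + eps Λ J))) • fOp Λ (A ++ I ++ B) L := fun A B c => by
    rw [← List.append_assoc, fOp_append_comm_left, smul_smul, mul_right_comm, sgn_mul,
      mul_comm, List.append_assoc]
    congr 2
    refine sgn_congr ?_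
    simp only [Nat.cast_add, Nat.cast_mul, cast_eps_append]
    grind
  have s2 : ∀ A B : Word n, ∀ c : ℂ,
      (sgn (eps Λ A * (eps Λ I + eps Λ B)) * c) • fOp Λ K (J ++ (B ++ A)) =
      (sgn (eps Λ A * (eps Λ I + eps Λ J)) * c) • fOp Λ K (A ++ J ++ B) := fun A B c => by
    rw [← List.append_assoc, fOp_append_comm_right, smul_smul, mul_right_comm, sgn_mul,
      List.append_assoc]
    congr 2
    refine sgn_congr ?_
    simp only [Nat.cast_add, Nat.cast_mul, cast_eps_append]
    grind
  congr 1
  · simp only [List.append_nil]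
    have e1 : ∀ k : Word n × Word n × Word n,
        (sgn (eps Λ k.1 * (eps Λ k.2.1 + eps Λ k.2.2)) * kd k.2.1 J) •
          fOp Λ (I ++ (k.2.2 ++ k.1)) L =
        (kd k.2.1 J * sgn (eps Λ k.1 * (eps Λ I + eps Λ J))) •
          fOp Λ (k.1 ++ I ++ k.2.2) L := fun k => by
      rw [← s1]
      exact congrArg (· • _) (mul_kd_congr fun h : k.2.1 = J => by rw [h])
    have e2 : ∀ k : Word n × Word n, (sgn (eps Λ k.1 * eps Λ k.2) * kd k.2 J) •
        fOp Λ (I ++ k.1) L = (kd k.2 J * sgn (eps Λ k.1 * (eps Λ I + eps Λ J))) •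
          fOp Λ (k.1 ++ I) L := fun k => by
      have := s1 k.1 [] (kd k.2 J)
      simp only [List.append_nil, List.nil_append, eps_nil, add_zero] at this
      rw [← this]
      exact congrArg (· • _) (mul_kd_congr fun h : k.2 = J => by rw [h])
    have e3 : ∀ k : Word n × Word n × Word n,
        sgn ((eps Λ k.1 + eps Λ k.2.1) * eps Λ k.2.2) * kd (k.2.2 ++ k.1) J =
        kd (k.2.2 ++ k.1) J * sgn ((eps Λ k.1 + eps Λ k.2.1) * eps Λ k.2.2) :=
      fun k => mul_comm _ _
    simp only [e1, e2, e3]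
  · congr 1
    simp only [List.append_nil]
    have e1 : ∀ k : Word n × Word n × Word n,
        (sgn (eps Λ k.1 * (eps Λ k.2.1 + eps Λ k.2.2)) * kd k.2.1 I) •
          fOp Λ K (J ++ (k.2.2 ++ k.1)) =
        (sgn (eps Λ k.1 * (eps Λ I + eps Λ J)) * kd I k.2.1) •
          fOp Λ K (k.1 ++ J ++ k.2.2) := fun k => by
      rw [← s2, kd_comm I]
      exact congrArg (· • _) (mul_kd_congr fun h : k.2.1 = I => by rw [h])
    have e2 : ∀ k : Word n × Word n, (sgn (eps Λ k.1 * eps Λ k.2) * kd k.2 I) •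
        fOp Λ K (J ++ k.1) = (sgn (eps Λ k.1 * (eps Λ I + eps Λ J)) * kd I k.2) •
          fOp Λ K (k.1 ++ J) := fun k => by
      have := s2 k.1 [] (kd I k.2)
      simp only [List.append_nil, List.nil_append, eps_nil, add_zero] at this
      rw [← this, kd_comm I]
      exact congrArg (· • _) (mul_kd_congr fun h : k.2 = I => by rw [h])
    have e3 : ∀ k : Word n × Word n × Word n,
        (eps Λ k.1 + eps Λ k.2.1) * eps Λ k.2.2 = eps Λ k.2.2 * (eps Λ k.1 + eps Λ k.2.1) :=
      fun k => mul_comm _ _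
    simp only [e1, e2, e3, kd_comm I]
    abel

end Operators

section GammaGamma

variable (Λ : ℕ) {n : ℕ} {M : Type} [AddCommGroup M] [Module ℂ M]

/-- The formula for the half bracket with the terms grouped by the relative position of `K` and
`J`: either `J` does not begin before `K` (first two sums) or it does (next two sums), and either
it does not end after `K` or it does; in the last sum the words overlap at both ends. -/
theorem gammaGammaHalf_eq (γ f : Word n → Word n → M) (I : Word n) {J K : Word n} (hJ : J ≠ [])
    (hK : K ≠ []) (L : Word n) :
    gammaGammaHalf Λ γ f I J K L =
      ∑ k ∈ cutsDN K, ∑ k' ∈ cutsDD k.2,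
        (sgn (eps Λ k.1 * (eps Λ I + eps Λ J)) * kd k'.1 J) • γ (k.1 ++ I ++ k'.2) L
      + ∑ k ∈ cutsDN K, ∑ j ∈ cutsDN J,
        (sgn (eps Λ k.1 * (eps Λ I + eps Λ J)) * kd k.2 j.1) • γ (k.1 ++ I) (L ++ j.2)
      + ∑ j ∈ cuts J, ∑ k ∈ cutsDD K,
        (sgn (eps Λ j.1 * (eps Λ K + eps Λ L)) * kd k.1 j.2) • γ (I ++ k.2) (j.1 ++ L)
      + ∑ j ∈ cuts J, ∑ j' ∈ cutsDN j.2,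
        (sgn (eps Λ j.1 * (eps Λ K + eps Λ L)) * kd K j'.1) • γ I (j.1 ++ L ++ j'.2)
      + ∑ j ∈ cuts J, ∑ k ∈ cuts K, ∑ j' ∈ cutsDN j.2, ∑ k' ∈ cutsND k.1,
        (sgn ((eps Λ j.1 + eps Λ j'.1) * (eps Λ k'.1 + eps Λ k'.2)) * kd k'.1 j'.2 * kd k.2 j.1) •
          f (I ++ k'.2) (L ++ j'.1) := by
  have a1 : ∑ k ∈ cutsDN K, ∑ k' ∈ cutsDD k.2,
        (sgn (eps Λ k.1 * (eps Λ I + eps Λ J)) * kd k'.1 J) • γ (k.1 ++ I ++ k'.2) L =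
      kd K J • γ I L + ∑ k ∈ cuts K, kd k.1 J • γ (I ++ k.2) L
      + ∑ k ∈ cuts K, (sgn (eps Λ k.1 * (eps Λ I + eps Λ J)) * kd k.2 J) • γ (k.1 ++ I) L
      + ∑ k ∈ cuts3 K,
        (sgn (eps Λ k.1 * (eps Λ I + eps Λ J)) * kd k.2.1 J) • γ (k.1 ++ I ++ k.2.2) L := by
    rw [sum_cutsDN hK, sum_cutsDD hK, sum_cuts3]
    have : ∀ k ∈ cuts K, ∑ k' ∈ cutsDD k.2,
        (sgn (eps Λ k.1 * (eps Λ I + eps Λ J)) * kd k'.1 J) • γ (k.1 ++ I ++ k'.2) L =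
        ∑ k' ∈ cuts k.2,
          (sgn (eps Λ k.1 * (eps Λ I + eps Λ J)) * kd k'.1 J) • γ (k.1 ++ I ++ k'.2) L
        + (sgn (eps Λ k.1 * (eps Λ I + eps Λ J)) * kd k.2 J) • γ (k.1 ++ I) L := fun k hk => by
      rw [sum_cutsDD (mem_cuts.1 hk).2.2, kd_of_ne hJ.symm]
      simp
    rw [Finset.sum_congr rfl this, kd_of_ne hJ.symm, Finset.sum_add_distrib]
    simp only [eps_nil, zero_mul, sgn_zero, one_mul, mul_zero, zero_smul, List.nil_append,
      List.append_nil, zero_add]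
    abel
  have a2 : ∑ k ∈ cutsDN K, ∑ j ∈ cutsDN J,
        (sgn (eps Λ k.1 * (eps Λ I + eps Λ J)) * kd k.2 j.1) • γ (k.1 ++ I) (L ++ j.2) =
      ∑ j ∈ cuts J, kd K j.1 • γ I (L ++ j.2)
      + ∑ j ∈ cuts J, ∑ k ∈ cuts K,
        (sgn (eps Λ k.1 * (eps Λ I + eps Λ J)) * kd k.2 j.1) • γ (k.1 ++ I) (L ++ j.2) := by
    rw [sum_cutsDN hK, sum_cutsDN hJ, Finset.sum_comm (s := cuts J), kd_of_ne hK]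
    have : ∀ k ∈ cuts K, ∑ j ∈ cutsDN J,
        (sgn (eps Λ k.1 * (eps Λ I + eps Λ J)) * kd k.2 j.1) • γ (k.1 ++ I) (L ++ j.2) =
        ∑ j ∈ cuts J,
        (sgn (eps Λ k.1 * (eps Λ I + eps Λ J)) * kd k.2 j.1) • γ (k.1 ++ I) (L ++ j.2) :=
      fun k hk => by
        rw [sum_cutsDN hJ, kd_of_ne (mem_cuts.1 hk).2.2]
        simp
    rw [Finset.sum_congr rfl this]
    simp
  have a3 : ∑ j ∈ cuts J, ∑ k ∈ cutsDD K,
        (sgn (eps Λ j.1 * (eps Λ K + eps Λ L)) * kd k.1 j.2) • γ (I ++ k.2) (j.1 ++ L) =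
      ∑ j ∈ cuts J, (sgn (eps Λ j.1 * (eps Λ K + eps Λ L)) * kd K j.2) • γ I (j.1 ++ L)
      + ∑ j ∈ cuts J, ∑ k ∈ cuts K,
        (sgn (eps Λ j.1 * (eps Λ K + eps Λ L)) * kd k.1 j.2) • γ (I ++ k.2) (j.1 ++ L) := by
    rw [← Finset.sum_add_distrib]
    refine Finset.sum_congr rfl fun j hj => ?_
    rw [sum_cutsDD hK, kd_of_ne (mem_cuts.1 hj).2.2.symm]
    simp only [mul_zero, zero_smul, zero_add, List.append_nil]
    abel
  have a4 : ∑ j ∈ cuts J, ∑ j' ∈ cutsDN j.2,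
        (sgn (eps Λ j.1 * (eps Λ K + eps Λ L)) * kd K j'.1) • γ I (j.1 ++ L ++ j'.2) =
      ∑ j ∈ cuts3 J,
        (sgn (eps Λ j.1 * (eps Λ K + eps Λ L)) * kd K j.2.1) • γ I (j.1 ++ L ++ j.2.2) := by
    rw [sum_cuts3]
    refine Finset.sum_congr rfl fun j hj => ?_
    rw [sum_cutsDN (mem_cuts.1 hj).2.2, kd_of_ne hK]
    simp
  have a5 : ∑ j ∈ cuts J, ∑ k ∈ cuts K, ∑ j' ∈ cutsDN j.2, ∑ k' ∈ cutsND k.1,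
        (sgn ((eps Λ j.1 + eps Λ j'.1) * (eps Λ k'.1 + eps Λ k'.2)) * kd k'.1 j'.2 * kd k.2 j.1) •
          f (I ++ k'.2) (L ++ j'.1) =
      ∑ j ∈ cuts J, ∑ k ∈ cuts K,
        (sgn (eps Λ j.1 * eps Λ k.1) * kd k.1 j.2 * kd k.2 j.1) • f I L
      + ∑ j ∈ cuts3 J, ∑ k ∈ cuts K,
        (sgn ((eps Λ j.1 + eps Λ j.2.1) * eps Λ k.1) * kd k.1 j.2.2 * kd k.2 j.1) •
          f I (L ++ j.2.1)
      + ∑ j ∈ cuts J, ∑ k ∈ cuts3 K,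
        (sgn (eps Λ j.1 * (eps Λ k.1 + eps Λ k.2.1)) * kd k.1 j.2 * kd k.2.2 j.1) •
          f (I ++ k.2.1) L
      + ∑ j ∈ cuts3 J, ∑ k ∈ cuts3 K,
        (sgn ((eps Λ j.1 + eps Λ j.2.1) * (eps Λ k.1 + eps Λ k.2.1)) *
            kd k.1 j.2.2 * kd k.2.2 j.1) •
          f (I ++ k.2.1) (L ++ j.2.1) := by
    simp only [sum_cuts3 J, sum_cuts3' K]
    rw [← Finset.sum_add_distrib, ← Finset.sum_add_distrib, ← Finset.sum_add_distrib]
    refine Finset.sum_congr rfl fun j hj => ?_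
    rw [Finset.sum_comm (s := cuts j.2), Finset.sum_comm (s := cuts j.2),
      ← Finset.sum_add_distrib, ← Finset.sum_add_distrib, ← Finset.sum_add_distrib]
    refine Finset.sum_congr rfl fun k hk => ?_
    rw [sum_cutsDN (mem_cuts.1 hj).2.2, sum_cutsND (mem_cuts.1 hk).2.1]
    have : ∀ j' ∈ cuts j.2, ∑ k' ∈ cutsND k.1,
        (sgn ((eps Λ j.1 + eps Λ j'.1) * (eps Λ k'.1 + eps Λ k'.2)) * kd k'.1 j'.2 * kd k.2 j.1) •
          f (I ++ k'.2) (L ++ j'.1) = ∑ k' ∈ cuts k.1,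
        (sgn ((eps Λ j.1 + eps Λ j'.1) * (eps Λ k'.1 + eps Λ k'.2)) * kd k'.1 j'.2 * kd k.2 j.1) •
          f (I ++ k'.2) (L ++ j'.1) +
        (sgn ((eps Λ j.1 + eps Λ j'.1) * eps Λ k.1) * kd k.1 j'.2 * kd k.2 j.1) •
          f I (L ++ j'.1) := fun j' _ => by
      rw [sum_cutsND (mem_cuts.1 hk).2.1]
      simp
    rw [Finset.sum_congr rfl this, Finset.sum_add_distrib]
    simp only [eps_nil, add_zero, List.append_nil]
    abel
  rw [a1, a2, a3, a4, a5, gammaGammaHalf]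
  abel

/-- The part of `γ^I_J γ^K_L` in which the words `L` and `J` that are replaced do not overlap,
as a function on words. -/
def disjointPart (I J K L V : Word n) : ClosedState Λ n :=
  ∑ p ∈ cuts V, sgn (eps Λ p.1 * (eps Λ K + eps Λ L)) •
    strip L (fun D => strip J (fun B => psi Λ (I ++ B ++ K ++ D)) p.1) p.2

/-- Replacements at disjoint places supercommute, because `cyc` allows the two places to be
interchanged. -/
theorem cyc_disjointPart_comm (I J K L W : Word n) :
    cyc Λ (disjointPart Λ K L I J) W =
      sgn ((eps Λ I + eps Λ J) * (eps Λ K + eps Λ L)) • cyc Λ (disjointPart Λ I J K L) W := by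
  rw [← cyc_smul]
  unfold disjointPart
  rw [cyc_cuts_swap Λ fun a b => sgn (eps Λ a * (eps Λ I + eps Λ J)) •
    strip J (fun D => strip L (fun B => psi Λ (K ++ B ++ I ++ D)) a) b]
  congr 1
  funext V
  rw [Finset.smul_sum]
  refine Finset.sum_congr rfl fun p _ => ?_
  simp only [strip, Finset.smul_sum]
  rw [Finset.sum_comm]
  refine Finset.sum_congr rfl fun d hd => Finset.sum_congr rfl fun b hb => ?_
  rw [← mem_cutsDD.1 hd, ← mem_cutsDD.1 hb]
  by_cases h1 : d.1 = L
  · by_cases h2 : b.1 = J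
    · rw [h1, h2]
      simp only [kd_self, one_smul, smul_smul, sgn_mul]
      rw [List.append_assoc (K ++ d.2), psi_append_comm, smul_smul, sgn_mul,
        ← List.append_assoc (I ++ b.2)]
      congr 1
      refine sgn_congr ?_
      simp only [Nat.cast_add, Nat.cast_mul, cast_eps_append]
      grind
    · simp [kd_of_ne h2]
  · simp [kd_of_ne h1]

theorem strip_psi_append (I J K : Word n) (V : Word n) :
    sgn (eps Λ K * eps Λ V) • strip J (fun R => psi Λ (I ++ (R ++ K))) V =
      sgn (eps Λ K * (eps Λ I + eps Λ J)) • strip J (fun R => psi Λ (K ++ I ++ R)) V := by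
  rw [← strip_smul, ← strip_smul]
  refine strip_congr fun R hV => ?_
  rw [hV, ← List.append_assoc, psi_append_comm, smul_smul, sgn_mul, ← List.append_assoc]
  congr 1
  refine sgn_congr ?_
  simp only [Nat.cast_add, Nat.cast_mul, cast_eps_append]
  grind

theorem cyc_strip_cutsDN {L : Word n} (hL : L ≠ []) (G : Word n → Word n → M) (W : Word n) :
    cyc Λ (strip L fun D => ∑ d ∈ cutsDN D, G d.1 d.2) W =
      cyc Λ (fun V => ∑ p ∈ cuts V, sgn (eps Λ p.1 * eps Λ p.2) •
        strip L (fun d => G d p.1) p.2) W := by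
  rw [← cyc_cuts_swap Λ fun a b => strip L (fun d => G d b) a]
  congr 1
  funext V
  induction L generalizing V G with
  | nil => exact absurd rfl hL
  | cons x L ih =>
    cases V with
    | nil => simp [sum_cuts_nil]
    | cons y V =>
      rw [strip_cons_cons, sum_cuts_cons]
      simp only [strip_cons_cons, ← Finset.smul_sum]
      congr 1
      rcases eq_or_ne L [] with rfl | hL'
      · simp [strip_nil]
      · rw [ih hL']
        rcases eq_or_ne V [] with rfl | hV
        · simp [sum_cuts_nil, sum_cutsDN_nil]
        · obtain ⟨z, L, rfl⟩ := List.exists_cons_of_ne_nil hL'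
          rw [sum_cutsDN hV]
          simp

section CycStrip

variable (L : Word n) (W : Word n)

theorem cyc_strip_add (φ ψ : Word n → M) :
    cyc Λ (strip L fun D => φ D + ψ D) W = cyc Λ (strip L φ) W + cyc Λ (strip L ψ) W := by
  rw [← cyc_add]
  exact congrArg (cyc Λ · W) (funext fun V => strip_add L φ ψ V)

theorem cyc_strip_sum {ι : Type} (s : Finset ι) (φ : ι → Word n → M) :
    cyc Λ (strip L fun D => ∑ i ∈ s, φ i D) W = ∑ i ∈ s, cyc Λ (strip L (φ i)) W := by
  rw [← cyc_sum]
  exact congrArg (cyc Λ · W) (funext fun V => strip_sum s L φ V)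

theorem cyc_strip_smul (c : ℂ) (φ : Word n → M) :
    cyc Λ (strip L fun D => c • φ D) W = c • cyc Λ (strip L φ) W := by
  rw [← cyc_smul]
  exact congrArg (cyc Λ · W) (funext fun V => strip_smul L c φ V)

theorem cyc_strip_append (A : Word n) (φ : Word n → M) :
    cyc Λ (strip (L ++ A) φ) W = cyc Λ (strip L fun D => strip A φ D) W :=
  congrArg (cyc Λ · W) (funext fun V => strip_append L A φ V)

theorem cyc_strip_kd (A : Word n) (m : M) :
    cyc Λ (strip L fun D => kd D A • m) W = pair Λ W (L ++ A) • m := by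
  rw [pair, ← cyc_smul_const]
  exact congrArg (cyc Λ · W) (funext fun V => strip_kd L A V m)

end CycStrip

/-- The rotations of `K D` that cut `K` into `k.1` and `k.2`: their prefix `J` may end in `k.2`,
in `D` or in `k.1`. -/
theorem strip_rotation_left (I J D : Word n) (k : Word n × Word n) :
    sgn (eps Λ k.1 * eps Λ (k.2 ++ D)) • strip J (fun R => psi Λ (I ++ R)) (k.2 ++ (D ++ k.1)) =
      ∑ k' ∈ cutsDD k.2, (sgn (eps Λ k.1 * (eps Λ I + eps Λ J)) * kd k'.1 J) •
        psi Λ (k.1 ++ I ++ k'.2 ++ D)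
      + ∑ j ∈ cutsDN J, (sgn (eps Λ k.1 * (eps Λ I + eps Λ J)) * kd k.2 j.1) •
        strip j.2 (fun R => psi Λ (k.1 ++ I ++ R)) D
      + ∑ j ∈ cutsDN J, ∑ j' ∈ cutsDN j.2, ∑ k' ∈ cutsDD k.1,
        (sgn ((eps Λ j.1 + eps Λ j'.1) * (eps Λ k'.1 + eps Λ k'.2)) *
          kd k'.1 j'.2 * kd k.2 j.1) • kd D j'.1 • psi Λ (I ++ k'.2) := by
  simp only [strip_append_right J k.2, strip_append_right _ D k.1, smul_add, Finset.smul_sum,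
    Finset.sum_add_distrib, ← add_assoc]
  refine congrArg₂ _ (congrArg₂ _ ?_ ?_) ?_
  · refine Finset.sum_congr rfl fun k' hk' => ?_
    rw [← mem_cutsDD.1 hk', ← List.append_assoc, ← List.append_assoc,
      psi_append_comm Λ (I ++ k'.2 ++ D), ← List.append_assoc, ← List.append_assoc]
    by_cases h : k'.1 = J
    · rw [h]
      simp only [kd_self, mul_one, one_mul, smul_smul, sgn_mul]
      congr 1
      refine sgn_congr ?_
      simp only [Nat.cast_add, Nat.cast_mul, cast_eps_append]
      grind
    · simp [kd_of_ne h]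
  · refine Finset.sum_congr rfl fun j hj => ?_
    by_cases h : k.2 = j.1
    · have := strip_psi_append Λ I j.2 k.1 D
      simp only [strip] at this
      rw [← (mem_cutsDN.1 hj).1, h]
      simp only [strip, kd_self, one_smul, mul_one, ← Finset.smul_sum]
      rw [sgn_congr (n := eps Λ k.1 * eps Λ j.1 + eps Λ k.1 * eps Λ D), ← sgn_mul, mul_smul, this,
        smul_smul, sgn_mul]
      · congr 1
        refine sgn_congr ?_
        simp only [Nat.cast_add, Nat.cast_mul, cast_eps_append]
        grind
      · simp only [Nat.cast_add, Nat.cast_mul, cast_eps_append]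
        grind
    · simp [kd_of_ne h]
  · refine Finset.sum_congr rfl fun j hj => Finset.sum_congr rfl fun j' hj' => ?_
    rw [strip]
    simp only [Finset.smul_sum]
    refine Finset.sum_congr rfl fun k' hk' => ?_
    by_cases h : k.2 = j.1
    · by_cases h' : D = j'.1
      · rw [h, h', ← mem_cutsDD.1 hk']
        simp only [kd_self, one_mul, mul_one, smul_smul]
        congr 2
        refine sgn_congr ?_
        simp only [Nat.cast_add, Nat.cast_mul, cast_eps_append]
        grind
      · simp [kd_of_ne h']
    · simp [kd_of_ne h]

/-- The rotations of `K D` that begin in `D`, after the part `P` of `D` in front has been moved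
to the other side. -/
theorem strip_rotation_right (I J K L P V : Word n) :
    sgn (eps Λ P * eps Λ V) • strip L (fun D => sgn (eps Λ (K ++ D) * eps Λ P) •
        strip J (fun R => psi Λ (I ++ R)) (P ++ (K ++ D))) V =
      sgn (eps Λ P * (eps Λ K + eps Λ L)) • strip L (fun D =>
        strip J (fun R => psi Λ (I ++ R ++ K ++ D)) P
        + ∑ j ∈ cutsDN J, kd P j.1 • (∑ k ∈ cutsDD K, kd k.1 j.2 • psi Λ (I ++ k.2 ++ D)
            + ∑ j' ∈ cutsDN j.2, kd K j'.1 • strip j'.2 (fun R => psi Λ (I ++ R)) D)) V := by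
  rw [← strip_smul, ← strip_smul]
  refine strip_congr fun D hV => ?_
  rw [strip_append_right J P]
  simp only [strip_append_right _ K]
  rw [smul_smul, sgn_mul, hV]
  congr 1
  · refine sgn_congr ?_
    simp only [Nat.cast_add, Nat.cast_mul, cast_eps_append]
    grind
  · simp only [strip, List.append_assoc]

theorem sum_cuts_kd_strip {A : Word n} (hA : A ≠ []) {L : Word n} (hL : L ≠ [])
    (c : Word n → ℂ) (ψ : Word n → M) (V : Word n) :
    ∑ p ∈ cuts V, c p.1 • kd p.1 A • strip L ψ p.2 = c A • strip (A ++ L) ψ V := by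
  rw [strip_append, strip, cuts, Finset.sum_filter, Finset.smul_sum]
  refine Finset.sum_congr rfl fun p _ => ?_
  split_ifs with h
  · by_cases h1 : p.1 = A
    · rw [h1]
    · simp [kd_of_ne h1]
  · by_cases h1 : p.1 = A
    · obtain ⟨x, L, rfl⟩ := List.exists_cons_of_ne_nil hL
      have h2 : p.2 = [] := by simpa [h1, hA] using h
      rw [h2]
      simp
    · simp [kd_of_ne h1]

/-- Replacing first `L` by `K` and then `J` by `I`. -/
theorem gOp_gOp_psi (I : Word n) {J K L : Word n} (hJ : J ≠ []) (hK : K ≠ []) (hL : L ≠ [])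
    (W : Word n) :
    gOp Λ I J (gOp Λ K L (psi Λ W)) =
      gammaGammaHalf Λ (gOp Λ) (fOp Λ) I J K L (psi Λ W)
        + cyc Λ (disjointPart Λ I J K L) W := by
  -- The rotations of `K D` begin in `K` or in `D`.
  have split : gOp Λ I J (gOp Λ K L (psi Λ W)) =
      ∑ k ∈ cutsDN K, cyc Λ (strip L fun D => sgn (eps Λ k.1 * eps Λ (k.2 ++ D)) •
        strip J (fun R => psi Λ (I ++ R)) (k.2 ++ (D ++ k.1))) W
      + cyc Λ (strip L fun D => ∑ d ∈ cutsDN D, sgn (eps Λ (K ++ d.1) * eps Λ d.2) •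
        strip J (fun R => psi Λ (I ++ R)) (d.2 ++ (K ++ d.1))) W := by
    rw [gOp_psi, map_cyc, ← cyc_sum, ← cyc_add]
    congr 1
    funext V
    rw [← strip_sum, ← strip_add, map_strip]
    congr 1
    funext D
    rw [gOp_psi, cyc, sum_cutsDN_append]
    simp only [List.append_assoc]
  rw [split, cyc_strip_cutsDN Λ hL fun a b => sgn (eps Λ (K ++ a) * eps Λ b) •
    strip J (fun R => psi Λ (I ++ R)) (b ++ (K ++ a))]
  simp only [strip_rotation_left Λ I J, strip_rotation_right]
  -- The rotations of `K D` that begin in `D`: the prefix `J` ends before `K` or reaches into it.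
  have right : ∀ Z : Word n × Word n → Word n → ClosedState Λ n,
      cyc Λ (fun V => ∑ p ∈ cuts V, sgn (eps Λ p.1 * (eps Λ K + eps Λ L)) •
        strip L (fun D => strip J (fun R => psi Λ (I ++ R ++ K ++ D)) p.1
          + ∑ j ∈ cutsDN J, kd p.1 j.1 • Z j D) p.2) W =
      cyc Λ (disjointPart Λ I J K L) W
      + ∑ j ∈ cuts J, sgn (eps Λ j.1 * (eps Λ K + eps Λ L)) •
          cyc Λ (strip (j.1 ++ L) (Z j)) W := by
    intro Z
    rw [← Finset.sum_congr rfl fun j _ => cyc_smul Λ _ _ W, ← cyc_sum, ← cyc_add]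
    congr 1
    funext V
    simp only [strip_add _ (fun _ => strip J _ _), smul_add, Finset.sum_add_distrib, strip_sum,
      strip_smul, Finset.smul_sum]
    refine congrArg₂ _ rfl ?_
    rw [Finset.sum_comm, sum_cutsDN hJ, Finset.sum_eq_zero fun p hp => ?_, zero_add]
    · refine Finset.sum_congr rfl fun j hj => ?_
      exact sum_cuts_kd_strip (mem_cuts.1 hj).2.1 hL
        (fun P => sgn (eps Λ P * (eps Λ K + eps Λ L))) _ V
    · rw [kd_of_ne (mem_cuts.1 hp).2.1, zero_smul, smul_zero]
  rw [right fun j D => ∑ k ∈ cutsDD K, kd k.1 j.2 • psi Λ (I ++ k.2 ++ D)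
    + ∑ j' ∈ cutsDN j.2, kd K j'.1 • strip j'.2 (fun R => psi Λ (I ++ R)) D,
    gammaGammaHalf_eq Λ _ _ I hJ hK]
  simp only [cyc_strip_add, cyc_strip_sum, cyc_strip_smul, ← cyc_strip_append, cyc_strip_kd,
    LinearMap.add_apply, LinearMap.sum_apply, LinearMap.smul_apply, gOp_psi, fOp_psi,
    Finset.sum_add_distrib, smul_add, Finset.smul_sum]
  simp only [smul_smul]
  have extra : ∑ k ∈ cutsDN K, ∑ j ∈ cutsDN J, ∑ j' ∈ cutsDN j.2, ∑ k' ∈ cutsDD k.1,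
        (sgn ((eps Λ j.1 + eps Λ j'.1) * (eps Λ k'.1 + eps Λ k'.2)) *
          kd k'.1 j'.2 * kd k.2 j.1 * pair Λ W (L ++ j'.1)) • psi Λ (I ++ k'.2) =
      ∑ j ∈ cuts J, ∑ k ∈ cuts K, ∑ j' ∈ cutsDN j.2, ∑ k' ∈ cutsND k.1,
        (sgn ((eps Λ j.1 + eps Λ j'.1) * (eps Λ k'.1 + eps Λ k'.2)) *
          kd k'.1 j'.2 * kd k.2 j.1 * pair Λ W (L ++ j'.1)) • psi Λ (I ++ k'.2) := by
    have drop : ∀ (k j : Word n × Word n), ∑ j' ∈ cutsDN j.2, ∑ k' ∈ cutsDD k.1,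
        (sgn ((eps Λ j.1 + eps Λ j'.1) * (eps Λ k'.1 + eps Λ k'.2)) *
          kd k'.1 j'.2 * kd k.2 j.1 * pair Λ W (L ++ j'.1)) • psi Λ (I ++ k'.2) =
        ∑ j' ∈ cutsDN j.2, ∑ k' ∈ cutsND k.1,
        (sgn ((eps Λ j.1 + eps Λ j'.1) * (eps Λ k'.1 + eps Λ k'.2)) *
          kd k'.1 j'.2 * kd k.2 j.1 * pair Λ W (L ++ j'.1)) • psi Λ (I ++ k'.2) :=
      fun k j => Finset.sum_congr rfl fun j' hj' => by
        rw [sum_cutsDD_eq_ND, kd_of_ne (mem_cutsDN.1 hj').2.symm]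
        simp
    simp only [drop]
    rw [sum_cutsDN hK]
    simp only [sum_cutsND_nil, Finset.sum_const_zero, zero_add]
    rw [Finset.sum_comm, sum_cutsDN hJ, Finset.sum_eq_zero fun k hk => ?_, zero_add]
    simp [kd_of_ne (mem_cuts.1 hk).2.2]
  rw [extra]
  simp only [List.append_assoc]
  abel

/-- The commutator `[γ^I_J, γ^K_L]` on closed states. -/
theorem gOp_gOp_commutator {I J K L : Word n} (hI : I ≠ []) (hJ : J ≠ []) (hK : K ≠ [])
    (hL : L ≠ []) :
    gOp Λ I J * gOp Λ K L
      - sgn ((eps Λ I + eps Λ J) * (eps Λ K + eps Λ L)) • (gOp Λ K L * gOp Λ I J) =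
    gammaGamma Λ (gOp Λ) (fOp Λ) I J K L :=
  closed_ext fun W _ => by
    rw [gammaGamma, LinearMap.sub_apply, LinearMap.sub_apply, LinearMap.smul_apply,
      LinearMap.smul_apply, Module.End.mul_apply, Module.End.mul_apply,
      gOp_gOp_psi Λ I hJ hK hL, gOp_gOp_psi Λ K hL hI hJ, cyc_disjointPart_comm Λ I J K L,
      smul_add, smul_smul, sgn_mul_self, one_smul]
    abel

end GammaGamma

/-! ### Lie superalgebras of operators -/

section Super

variable {X Y S V : Type} [AddCommGroup X] [Module ℂ X] [AddCommGroup Y] [Module ℂ Y]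
  [AddCommGroup S] [Module ℂ S] [AddCommGroup V] [Module ℂ V]

/-- A bilinear map with values in the range of an injective linear map factors through it. -/
theorem exists_bilinear_lift {j : S →ₗ[ℂ] V} (hj : Function.Injective j)
    (B : X →ₗ[ℂ] Y →ₗ[ℂ] V) (h : ∀ x y, B x y ∈ LinearMap.range j) :
    ∃ ρ : X →ₗ[ℂ] Y →ₗ[ℂ] S, ∀ x y, j (ρ x y) = B x y := by
  choose f hf using h
  exact ⟨LinearMap.mk₂ ℂ f (fun _ _ _ => hj (by simp [hf])) (fun _ _ _ => hj (by simp [hf]))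
    (fun _ _ _ => hj (by simp [hf])) (fun _ _ _ => hj (by simp [hf])), hf⟩

theorem exists_linear_lift {j : S →ₗ[ℂ] V} (hj : Function.Injective j)
    (B : X →ₗ[ℂ] V) (h : ∀ x, B x ∈ LinearMap.range j) :
    ∃ ρ : X →ₗ[ℂ] S, ∀ x, j (ρ x) = B x := by
  choose f hf using h
  exact ⟨{ toFun := f, map_add' := fun _ _ => hj (by simp [hf]),
           map_smul' := fun _ _ => hj (by simp [hf]) }, hf⟩

theorem sgn2_natCast (m q : ℕ) : sgn2 (m : ZMod 2) (q : ZMod 2) = sgn (m * q) :=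
  sgn_congr (by simp)

theorem sgn_val_natCast (m : ℕ) : sgn (m : ZMod 2).val = sgn m := sgn_congr (by simp)

@[simp] theorem sgn_one : sgn 1 = -1 := by simp [sgn]

theorem sgn_val_add (a b : ZMod 2) : sgn (a + b).val = sgn a.val * sgn b.val := by
  rw [sgn_mul]
  exact sgn_congr (by simp)

theorem forall_zmod_two {p : ZMod 2 → Prop} : (∀ a, p a) ↔ p 0 ∧ p 1 := Fin.forall_fin_two

theorem iSup_zmod_two (gr : ZMod 2 → Submodule ℂ V) : ⨆ a, gr a = gr 0 ⊔ gr 1 := by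
  refine le_antisymm (iSup_le ?_) (sup_le (le_iSup gr 0) (le_iSup gr 1))
  exact forall_zmod_two.2 ⟨le_sup_left, le_sup_right⟩

theorem isInternal_zmod_two {gr : ZMod 2 → Submodule ℂ V}
    (h0 : ∀ x ∈ gr 0, x ∈ gr 1 → x = 0) (htop : ⨆ a, gr a = ⊤) : DirectSum.IsInternal gr := by
  refine (DirectSum.isInternal_submodule_iff_isCompl gr (i := 0) (j := 1) (by decide) ?_).2
    ⟨?_, ?_⟩
  · ext a
    revert a
    decide
  · rw [Submodule.disjoint_def]
    exact h0
  · rw [codisjoint_iff, ← iSup_zmod_two, htop]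

/-- The span of homogeneous elements is a graded subspace. -/
theorem span_eq_iSup_inf {gr : ZMod 2 → Submodule ℂ V} {s : Set V}
    (hs : ∀ x ∈ s, ∃ a, x ∈ gr a) :
    Submodule.span ℂ s = ⨆ a, Submodule.span ℂ s ⊓ gr a := by
  refine le_antisymm (Submodule.span_le.2 fun x hx => ?_) (iSup_le fun a => inf_le_left)
  obtain ⟨a, ha⟩ := hs x hx
  exact le_iSup (fun a => Submodule.span ℂ s ⊓ gr a) a ⟨Submodule.subset_span hx, ha⟩

/-- The supercommutator of operators on a space with parity operator `P`. On homogeneous operators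
it is `A B - (-1)^{|A| |B|} B A`; note that `P B P = (-1)^{|B|} B`. -/
def superComm (P : Module.End ℂ S) :
    Module.End ℂ S →ₗ[ℂ] Module.End ℂ S →ₗ[ℂ] Module.End ℂ S :=
  LinearMap.mul ℂ _ - (1 / 2 : ℂ) • LinearMap.mk₂ ℂ
    (fun A B => (B + P * B * P) * A + (B - P * B * P) * (P * A * P))
    (fun A A' B => by simp only [mul_add, add_mul]; abel)
    (fun c A B => by simp only [mul_smul_comm, smul_mul_assoc, smul_add])
    (fun A B B' => by simp only [mul_add, add_mul, sub_mul]; abel)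
    (fun c A B => by
      simp only [mul_smul_comm, smul_mul_assoc, smul_add, add_mul, sub_mul, smul_sub])

/-- `A` is an operator of degree `a`. -/
def HasDegree (P : Module.End ℂ S) (a : ZMod 2) (A : Module.End ℂ S) : Prop :=
  P * A = sgn a.val • (A * P)

variable {P : Module.End ℂ S}

theorem HasDegree.conj (hP : P * P = 1) {a : ZMod 2} {A : Module.End ℂ S}
    (hA : HasDegree P a A) : P * A * P = sgn a.val • A := by
  rw [hA, smul_mul_assoc, mul_assoc, hP, mul_one]

theorem superComm_of_degree (hP : P * P = 1) {a b : ZMod 2} {A B : Module.End ℂ S}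
    (hA : HasDegree P a A) (hB : HasDegree P b B) :
    superComm P A B = A * B - sgn2 a b • (B * A) := by
  simp only [superComm, LinearMap.sub_apply, LinearMap.smul_apply, LinearMap.mk₂_apply,
    LinearMap.mul_apply', hA.conj hP, hB.conj hP, sgn2, mul_smul_comm, add_mul, sub_mul,
    smul_mul_assoc, smul_sub, smul_add, smul_smul]
  congr 1
  revert a b
  rw [forall_zmod_two]
  constructor <;> rw [forall_zmod_two] <;> constructor <;> intro _ _ <;>
    simp only [ZMod.val_zero, ZMod.val_one, mul_zero, mul_one, sgn_zero, sgn_one,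
      ← add_smul, ← sub_smul] <;> norm_num

theorem HasDegree.mul {a b : ZMod 2} {A B : Module.End ℂ S}
    (hA : HasDegree P a A) (hB : HasDegree P b B) : HasDegree P (a + b) (A * B) := by
  rw [HasDegree, ← mul_assoc, hA, smul_mul_assoc, mul_assoc, hB, mul_smul_comm, smul_smul,
    sgn_val_add, mul_assoc]

theorem HasDegree.superComm (hP : P * P = 1) {a b : ZMod 2} {A B : Module.End ℂ S}
    (hA : HasDegree P a A) (hB : HasDegree P b B) :
    HasDegree P (a + b) (superComm P A B) := by
  have h := hB.mul hA
  rw [add_comm b] at h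
  rw [superComm_of_degree hP hA hB, HasDegree, mul_sub, sub_mul, hA.mul hB, mul_smul_comm, h,
    smul_mul_assoc, smul_sub, smul_comm (sgn2 a b)]

/-- The operators of degree `a`. -/
def degreeSpace (P : Module.End ℂ S) (a : ZMod 2) : Submodule ℂ (Module.End ℂ S) where
  carrier := {A | HasDegree P a A}
  add_mem' {A B} hA hB := by
    change P * (A + B) = _
    rw [mul_add, hA, hB, add_mul, smul_add]
  zero_mem' := by simp [HasDegree]
  smul_mem' c A hA := by
    change P * (c • A) = _
    rw [mul_smul_comm, hA, smul_mul_assoc, smul_comm]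

/-- `Θ` is a faithful linear representation of a graded space by operators on `S`, such that
elements of degree `a` act by operators of degree `a`. -/
structure IsFaithfulGraded (P : Module.End ℂ S) (gr : ZMod 2 → Submodule ℂ X)
    (Θ : X →ₗ[ℂ] Module.End ℂ S) : Prop where
  parity : P * P = 1
  injective : Function.Injective Θ
  degree : ∀ a, ∀ x ∈ gr a, HasDegree P a (Θ x)
  iSup_eq_top : ⨆ a, gr a = ⊤

namespace IsFaithfulGraded

variable {gr : ZMod 2 → Submodule ℂ X} {Θ : X →ₗ[ℂ] Module.End ℂ S}

theorem eq_zero_of_degrees (hP : P * P = 1) {A : Module.End ℂ S} (h0 : HasDegree P 0 A)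
    (h1 : HasDegree P 1 A) : A = 0 := by
  have h := (h0.conj hP).symm.trans (h1.conj hP)
  simp only [ZMod.val_zero, ZMod.val_one, sgn_zero, sgn_one, one_smul, neg_smul] at h
  have h2 : (2 : ℂ) • A = 0 := by
    rw [two_smul]
    nth_rewrite 2 [h]
    exact add_neg_cancel A
  exact (smul_eq_zero.1 h2).resolve_left two_ne_zero

theorem isInternal (H : IsFaithfulGraded P gr Θ) : DirectSum.IsInternal gr :=
  isInternal_zmod_two (fun x h0 h1 => H.injective <| by
    rw [map_zero, eq_zero_of_degrees H.parity (H.degree 0 x h0) (H.degree 1 x h1)])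
    H.iSup_eq_top

/-- The degree of an element can be read off from the operator representing it. -/
theorem mem_of_degree (H : IsFaithfulGraded P gr Θ) {a : ZMod 2} {x : X}
    (hx : HasDegree P a (Θ x)) : x ∈ gr a := by
  have hx' : x ∈ gr 0 ⊔ gr 1 := by rw [← iSup_zmod_two, H.iSup_eq_top]; trivial
  obtain ⟨u, hu, v, hv, rfl⟩ := Submodule.mem_sup.1 hx'
  have key : ∀ b c : ZMod 2, b ≠ c → ∀ u ∈ gr b, ∀ v ∈ gr c, HasDegree P b (Θ (u + v)) →
      v = 0 := by
    intro b c hbc u hu v hv h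
    refine H.injective ?_
    have h1 : Θ v ∈ degreeSpace P b := by
      have := (degreeSpace P b).sub_mem (x := Θ (u + v)) (y := Θ u) h (H.degree b u hu)
      simpa using this
    have h2 : HasDegree P c (Θ v) := H.degree c v hv
    rw [map_zero]
    revert b c
    rw [forall_zmod_two]
    constructor <;> rw [forall_zmod_two] <;> constructor
    · exact fun h => absurd rfl h
    · exact fun _ _ _ _ h1 h2 => eq_zero_of_degrees H.parity h1 h2
    · exact fun _ _ _ _ h1 h2 => eq_zero_of_degrees H.parity h2 h1
    · exact fun h => absurd rfl h
  revert a
  rw [forall_zmod_two]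
  constructor
  · intro h
    rw [key 0 1 (by decide) u hu v hv h, add_zero]
    exact hu
  · intro h
    rw [add_comm] at h
    rw [key 1 0 (by decide) v hv u hu h, zero_add]
    exact hv

/-- A bracket that a faithful representation turns into the supercommutator makes the space a Lie
superalgebra. -/
theorem isLieSuperalgebra (H : IsFaithfulGraded P gr Θ) {br : X →ₗ[ℂ] X →ₗ[ℂ] X}
    (hbr : ∀ x y, Θ (br x y) = superComm P (Θ x) (Θ y)) : IsLieSuperalgebra gr br where
  graded := H.isInternal
  bracket_mem a b x hx y hy := H.mem_of_degree <| by
    rw [hbr]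
    exact (H.degree a x hx).superComm H.parity (H.degree b y hy)
  skew a b x hx y hy := H.injective <| by
    have hA := H.degree a x hx
    have hB := H.degree b y hy
    rw [map_neg, map_smul, hbr, hbr, superComm_of_degree H.parity hA hB,
      superComm_of_degree H.parity hB hA, sgn2, sgn2, mul_comm b.val, smul_sub, smul_smul,
      sgn_mul_self, one_smul, neg_sub]
  jacobi a b x hx y hy z := by
    have hz : z ∈ gr 0 ⊔ gr 1 := by rw [← iSup_zmod_two, H.iSup_eq_top]; trivial
    obtain ⟨u, hu, v, hv, rfl⟩ := Submodule.mem_sup.1 hz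
    have key : ∀ c, ∀ z ∈ gr c,
        br x (br y z) = br (br x y) z + sgn2 a b • br y (br x z) := by
      intro c z hz
      refine H.injective ?_
      have hA := H.degree a x hx
      have hB := H.degree b y hy
      have hC := H.degree c z hz
      have hP := H.parity
      rw [map_add, map_smul, hbr, hbr, hbr, hbr, hbr, hbr,
        superComm_of_degree hP hA (hB.superComm hP hC),
        superComm_of_degree hP (hA.superComm hP hB) hC,
        superComm_of_degree hP hB (hA.superComm hP hC),
        superComm_of_degree hP hA hB, superComm_of_degree hP hA hC,
        superComm_of_degree hP hB hC]
      have e1 : sgn2 a (b + c) = sgn2 a b * sgn2 a c := by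
        rw [sgn2, sgn2, sgn2, sgn_mul]
        exact sgn_congr (by simp; ring)
      have e2 : sgn2 (a + b) c = sgn2 a c * sgn2 b c := by
        rw [sgn2, sgn2, sgn2, sgn_mul]
        exact sgn_congr (by simp; ring)
      have e3 : sgn2 b (a + c) = sgn2 a b * sgn2 b c := by
        rw [sgn2, sgn2, sgn2, sgn_mul]
        exact sgn_congr (by simp; ring)
      have e4 : sgn2 a b * sgn2 a b = 1 := sgn_mul_self _
      rw [e1, e2, e3]
      simp only [mul_sub, sub_mul, smul_sub, mul_smul_comm, smul_mul_assoc, smul_smul, ← mul_assoc,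
        e4, one_mul]
      rw [mul_comm (sgn2 b c) (sgn2 a c), mul_comm (sgn2 a c * sgn2 b c)]
      simp only [mul_assoc]
      abel
    rw [map_add, map_add, map_add, map_add, map_add, key 0 u hu, key 1 v hv, smul_add]
    abel

end IsFaithfulGraded

end Super

/-! ### Enlarging the alphabet, and a marker letter -/

section LetterMap

variable (Λ : ℕ) {n n' : ℕ} {M : Type} [AddCommGroup M] {φ : Fin n → Fin n'}

theorem eps_map (hφ : ∀ x, (φ x).val = x.val) (W : Word n) : eps Λ (W.map φ) = eps Λ W := by
  simp [eps, List.countP_map, Function.comp_def, hφ]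

theorem injective_of_val (hφ : ∀ x, (φ x).val = x.val) : Function.Injective φ := fun x y h =>
  Fin.ext (by rw [← hφ x, ← hφ y, h])

theorem kd_map (hφ : Function.Injective φ) (A B : Word n) :
    kd (A.map φ) (B.map φ) = kd A B :=
  kd_congr_iff (List.map_injective_iff.2 hφ).eq_iff

theorem sum_cutsDD_map (W : Word n) (F : Word n' × Word n' → M) :
    ∑ p ∈ cutsDD (W.map φ), F p = ∑ p ∈ cutsDD W, F (p.1.map φ, p.2.map φ) := by
  induction W generalizing F with
  | nil => simp [sum_cutsDD_nil]
  | cons x W ih => simp [sum_cutsDD_cons, ih]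

theorem sum_cutsDN_map (W : Word n) (F : Word n' × Word n' → M) :
    ∑ p ∈ cutsDN (W.map φ), F p = ∑ p ∈ cutsDN W, F (p.1.map φ, p.2.map φ) := by
  simp [cutsDN, Finset.sum_filter, sum_cutsDD_map]

theorem sum_cutsND_map (W : Word n) (F : Word n' × Word n' → M) :
    ∑ p ∈ cutsND (W.map φ), F p = ∑ p ∈ cutsND W, F (p.1.map φ, p.2.map φ) := by
  simp [cutsND, Finset.sum_filter, sum_cutsDD_map]

theorem sum_cuts_map (W : Word n) (F : Word n' × Word n' → M) :
    ∑ p ∈ cuts (W.map φ), F p = ∑ p ∈ cuts W, F (p.1.map φ, p.2.map φ) := by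
  simp [cuts, Finset.sum_filter, sum_cutsDD_map]

theorem sum_cuts3_map (W : Word n) (F : Word n' × Word n' × Word n' → M) :
    ∑ p ∈ cuts3 (W.map φ), F p =
      ∑ p ∈ cuts3 W, F (p.1.map φ, p.2.1.map φ, p.2.2.map φ) := by
  simp [sum_cuts3, sum_cuts_map]

variable [Module ℂ M]

theorem cyc_map (hφ : ∀ x, (φ x).val = x.val) (h : Word n' → M) (W : Word n) :
    cyc Λ h (W.map φ) = cyc Λ (fun V => h (V.map φ)) W := by
  simp [cyc, sum_cutsDN_map, eps_map Λ hφ]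

theorem pair_map (hφ : ∀ x, (φ x).val = x.val) (W V : Word n) :
    pair Λ (W.map φ) (V.map φ) = pair Λ W V := by
  simp [pair, cyc_map Λ hφ, kd_map (injective_of_val hφ)]

theorem gammaGamma_map (hφ : ∀ x, (φ x).val = x.val) (γ f : Word n' → Word n' → M)
    (I J K L : Word n) :
    gammaGamma Λ γ f (I.map φ) (J.map φ) (K.map φ) (L.map φ) =
      gammaGamma Λ (fun A B => γ (A.map φ) (B.map φ)) (fun A B => f (A.map φ) (B.map φ))
        I J K L := by
  simp only [gammaGamma, gammaGammaHalf, sum_cuts_map, sum_cuts3_map, eps_map Λ hφ,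
    kd_map (injective_of_val hφ), List.map_append]

theorem gammaFifth_map (hφ : ∀ x, (φ x).val = x.val) (f : Word n' → Word n' → M)
    (I J K L : Word n) :
    gammaFifth Λ f (I.map φ) (J.map φ) (K.map φ) (L.map φ) =
      gammaFifth Λ (fun A B => f (A.map φ) (B.map φ)) I J K L := by
  simp only [gammaFifth, sum_cuts_map, sum_cuts3_map, eps_map Λ hφ,
    kd_map (injective_of_val hφ), ← List.map_append]

theorem fifthFifth_map (hφ : ∀ x, (φ x).val = x.val) (f : Word n' → Word n' → M)
    (I J K L : Word n) :
    fifthFifth Λ f (I.map φ) (J.map φ) (K.map φ) (L.map φ) =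
      fifthFifth Λ (fun A B => f (A.map φ) (B.map φ)) I J K L := by
  simp only [fifthFifth, fifthFifthHalf, sum_cuts_map, eps_map Λ hφ,
    kd_map (injective_of_val hφ), ← List.map_append]

theorem gammaClosed_map (hφ : ∀ x, (φ x).val = x.val) (Ψ : Word n' → M) (I J K : Word n) :
    gammaClosed Λ Ψ (I.map φ) (J.map φ) (K.map φ) =
      gammaClosed Λ (fun A => Ψ (A.map φ)) I J K := by
  simp only [gammaClosed, sum_cuts_map, sum_cuts3_map, eps_map Λ hφ,
    kd_map (injective_of_val hφ), ← List.map_append]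

theorem fifthClosed_map (hφ : ∀ x, (φ x).val = x.val) (Ψ : Word n' → M) (I J K : Word n) :
    fifthClosed Λ Ψ (I.map φ) (J.map φ) (K.map φ) =
      fifthClosed Λ (fun A => Ψ (A.map φ)) I J K := by
  simp only [fifthClosed, sum_cuts_map, eps_map Λ hφ,
    kd_map (injective_of_val hφ), ← List.map_append]

end LetterMap

section FormulaMap

variable (Λ : ℕ) {n : ℕ} {M M' : Type} [AddCommGroup M] [Module ℂ M] [AddCommGroup M']
  [Module ℂ M'] (F : M →ₗ[ℂ] M')

theorem map_gammaGamma (γ f : Word n → Word n → M) (I J K L : Word n) :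
    F (gammaGamma Λ γ f I J K L) =
      gammaGamma Λ (fun A B => F (γ A B)) (fun A B => F (f A B)) I J K L := by
  simp only [gammaGamma, gammaGammaHalf, map_sub, map_add, map_sum, map_smul]

theorem map_gammaFifth (f : Word n → Word n → M) (I J K L : Word n) :
    F (gammaFifth Λ f I J K L) = gammaFifth Λ (fun A B => F (f A B)) I J K L := by
  simp only [gammaFifth, map_sub, map_add, map_sum, map_smul]

theorem map_fifthFifth (f : Word n → Word n → M) (I J K L : Word n) :
    F (fifthFifth Λ f I J K L) = fifthFifth Λ (fun A B => F (f A B)) I J K L := by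
  simp only [fifthFifth, fifthFifthHalf, map_sub, map_add, map_sum, map_smul]

theorem map_gammaOpen (s : Word n → M) (I J K : Word n) :
    F (gammaOpen Λ s I J K) = gammaOpen Λ (fun A => F (s A)) I J K := by
  simp only [gammaOpen, map_sum, map_smul]

theorem map_gammaClosed (Ψ : Word n → M) (I J K : Word n) :
    F (gammaClosed Λ Ψ I J K) = gammaClosed Λ (fun A => F (Ψ A)) I J K := by
  simp only [gammaClosed, map_add, map_sum, map_smul]

theorem map_fifthClosed (Ψ : Word n → M) (I J K : Word n) :
    F (fifthClosed Λ Ψ I J K) = fifthClosed Λ (fun A => F (Ψ A)) I J K := by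
  simp only [fifthClosed, map_add, map_sum, map_smul]

end FormulaMap

section Marker

variable {Λ n m : ℕ} {M : Type} [AddCommGroup M] [Module ℂ M]

/-- The letter map `φ` enlarges the alphabet by at least the bosonic letter `z`, which marks the
ends of an open string when it is closed to a cyclic word. -/
structure IsMarker (Λ : ℕ) (φ : Fin n → Fin m) (z : Fin m) : Prop where
  val : ∀ x, (φ x).val = x.val
  ne : ∀ x, φ x ≠ z
  le : 2 * Λ ≤ z.val

namespace IsMarker

variable {φ : Fin n → Fin m} {z : Fin m}

theorem inj (H : IsMarker Λ φ z) : Function.Injective φ := injective_of_val H.val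

theorem eps_map (H : IsMarker Λ φ z) (W : Word n) : eps Λ (W.map φ) = eps Λ W :=
  GrandString.eps_map Λ H.val W

theorem kd_map (H : IsMarker Λ φ z) (A B : Word n) : kd (A.map φ) (B.map φ) = kd A B :=
  GrandString.kd_map H.inj A B

theorem notMem (H : IsMarker Λ φ z) (A : Word n) : z ∉ A.map φ := by
  simpa using fun x _ => H.ne x

theorem kd_map_cons (H : IsMarker Λ φ z) (A : Word n) (B : Word m) :
    kd (A.map φ) (z :: B) = 0 := by
  cases A with
  | nil => simp
  | cons x A => simp [kd_cons, kd_of_ne (H.ne x)]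

theorem eps_cons (H : IsMarker Λ φ z) (W : Word m) : eps Λ (z :: W) = eps Λ W := by
  have := H.le
  have : ¬ z.val < 2 * Λ := by omega
  simp [eps, this]

theorem eps_append_cons (H : IsMarker Λ φ z) (A B : Word m) :
    eps Λ (A ++ z :: B) = eps Λ (A ++ B) := by
  have := H.le
  have : ¬ z.val < 2 * Λ := by omega
  simp [eps, this]

/-- The rotations of a word with one marker. -/
theorem cyc_cons (H : IsMarker Λ φ z) (h : Word m → M) (K : Word n) :
    cyc Λ h (z :: K.map φ) = ∑ p ∈ cutsDD K,
      sgn (eps Λ p.1 * eps Λ p.2) • h (p.2.map φ ++ z :: p.1.map φ) := by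
  rw [cyc, sum_cutsDN_cons, sum_cutsDD_eq_DN, sum_cutsDN_map, add_comm]
  simp only [H.eps_cons, H.eps_map]
  simp

theorem strip_map_cons (H : IsMarker Λ φ z) (J A : Word n) (B : Word m) (ψ : Word m → M) :
    strip (J.map φ) ψ (A.map φ ++ z :: B) = strip J (fun R => ψ (R.map φ ++ z :: B)) A := by
  rw [strip_append_right, sum_cutsDD_map, sum_cutsDN_map, Finset.sum_eq_zero
    (s := cutsDN J), add_zero]
  · simp [strip, H.kd_map]
  · intro j hj
    obtain ⟨x, W, h⟩ := List.exists_cons_of_ne_nil (mem_cutsDN.1 hj).2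
    simp [h, kd_of_ne (H.ne x).symm]

theorem strip_cons_map_cons (H : IsMarker Λ φ z) (J A : Word n) (B : Word m) (ψ : Word m → M) :
    strip (z :: J.map φ) ψ (A.map φ ++ z :: B) = kd A [] • strip (J.map φ) ψ B := by
  cases A with
  | nil => simp
  | cons x A => simp [kd_of_ne (H.ne x)]

theorem psi_map_cons (H : IsMarker Λ φ z) (A B : Word n) :
    psi Λ (A.map φ ++ z :: B.map φ) =
      sgn (eps Λ A * eps Λ B) • psi Λ (z :: (B ++ A).map φ) := by
  rw [psi_append_comm, H.eps_cons, H.eps_map, H.eps_map, List.map_append, List.cons_append]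

/-- An open string is not cyclic: no occurrence of `J` reaches across the marker. -/
theorem gOp_psi_cons (H : IsMarker Λ φ z) (I : Word n) {J : Word n} (hJ : J ≠ []) (K : Word n) :
    gOp Λ (I.map φ) (J.map φ) (psi Λ (z :: K.map φ)) =
      gammaOpen Λ (fun W => psi Λ (z :: W.map φ)) I J K := by
  rw [gOp_psi, H.cyc_cons, gammaOpen, sum_cuts3DND]
  refine Finset.sum_congr rfl fun p _ => ?_
  rw [H.strip_map_cons, strip, sum_cutsDD_eq_ND, kd_of_ne hJ.symm, zero_smul, zero_add,
    Finset.smul_sum]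
  refine Finset.sum_congr rfl fun q hq => ?_
  rw [← (mem_cutsND.1 hq).1, ← List.append_assoc, ← List.map_append, H.psi_map_cons, smul_smul,
    smul_smul, ← List.append_assoc]
  refine congrArg (· • _) ?_
  rw [mul_right_comm, sgn_mul]
  exact mul_kd_congr fun h : q.1 = J => sgn_congr <| by
    rw [h]
    simp only [Nat.cast_add, Nat.cast_mul, cast_eps_append]
    grind

theorem pair_cons_map (H : IsMarker Λ φ z) (J K : Word n) :
    pair Λ (z :: K.map φ) (J.map φ) = 0 := by
  rw [pair, H.cyc_cons]
  refine Finset.sum_eq_zero fun p _ => ?_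
  rw [kd_of_ne, smul_zero]
  intro h
  exact H.notMem J (h ▸ by simp)

/-- The marker makes all rotations of a word different. -/
theorem pair_cons_cons (H : IsMarker Λ φ z) (J K : Word n) :
    pair Λ (z :: K.map φ) (z :: J.map φ) = kd K J := by
  rw [pair, H.cyc_cons, sum_cutsDD_eq_DN, Finset.sum_eq_zero, zero_add]
  · simp [H.kd_map]
  · intro p hp
    obtain ⟨x, W, h⟩ := List.exists_cons_of_ne_nil (mem_cutsDN.1 hp).2
    simp [h, kd_of_ne (H.ne x)]

theorem pair_map_of_mem (H : IsMarker Λ φ z) (K : Word n) {J : Word m} (hJ : z ∈ J) :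
    pair Λ (K.map φ) J = 0 := by
  rw [pair, cyc_map Λ H.val]
  refine Finset.sum_eq_zero fun p _ => ?_
  dsimp only
  rw [kd_of_ne, smul_zero]
  intro h
  exact H.notMem (p.2 ++ p.1) (h ▸ hJ)

theorem gOp_psi_map_of_mem (H : IsMarker Λ φ z) (I : Word m) (K : Word n) {J : Word m}
    (hJ : z ∈ J) : gOp Λ I J (psi Λ (K.map φ)) = 0 := by
  rw [gOp_psi, cyc_map Λ H.val]
  refine Finset.sum_eq_zero fun p _ => ?_
  dsimp only
  rw [strip, sum_cutsDD_map, Finset.sum_eq_zero, smul_zero]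
  intro q _
  dsimp only
  rw [kd_of_ne, zero_smul]
  intro h
  exact H.notMem q.1 (h ▸ hJ)

/-- With a marker in front, `γ` replaces prefixes only. -/
theorem gOp_cons_cons (H : IsMarker Λ φ z) (I J K : Word n) :
    gOp Λ (z :: I.map φ) (z :: J.map φ) (psi Λ (z :: K.map φ)) =
      ∑ k ∈ cutsDD K, kd k.1 J • psi Λ (z :: (I ++ k.2).map φ) := by
  rw [gOp_psi, H.cyc_cons, sum_cutsDD_eq_DN, Finset.sum_eq_zero, zero_add]
  · rw [H.strip_cons_map_cons]
    simp [strip, sum_cutsDD_map, H.kd_map]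
  · intro p hp
    rw [H.strip_cons_map_cons, kd_of_ne (mem_cutsDN.1 hp).2, zero_smul, smul_zero]

/-- With a marker at the end, `γ` replaces suffixes only. -/
theorem gOp_append_append (H : IsMarker Λ φ z) (I J K : Word n) :
    gOp Λ (I.map φ ++ [z]) (J.map φ ++ [z]) (psi Λ (z :: K.map φ)) =
      ∑ k ∈ cutsDD K, (sgn (eps Λ k.1 * (eps Λ I + eps Λ J)) * kd k.2 J) •
        psi Λ (z :: (k.1 ++ I).map φ) := by
  rw [gOp_psi, H.cyc_cons]
  refine Finset.sum_congr rfl fun p _ => ?_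
  rw [strip_append, H.strip_map_cons, strip, sum_cutsDD_eq_DN, Finset.sum_eq_zero, zero_add]
  · simp only [List.map_nil, List.nil_append, strip_cons_cons, kd_self, one_smul, strip_nil,
      List.append_assoc, List.cons_append]
    rw [H.psi_map_cons, smul_smul, smul_smul]
    refine congrArg (· • _) ?_
    rw [mul_right_comm, sgn_mul]
    exact mul_kd_congr fun h : p.2 = J => sgn_congr <| by
      rw [h]
      simp only [Nat.cast_add, Nat.cast_mul]
      grind
  · intro q hq
    obtain ⟨x, W, h⟩ := List.exists_cons_of_ne_nil (mem_cutsDN.1 hq).2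
    simp [h, kd_of_ne (H.ne x)]

theorem fOp_cons_cons (H : IsMarker Λ φ z) (I : Word m) (J K : Word n) :
    fOp Λ I (z :: J.map φ) (psi Λ (z :: K.map φ)) = kd K J • psi Λ I := by
  rw [fOp_psi, H.pair_cons_cons]

theorem fOp_map_cons (H : IsMarker Λ φ z) (I : Word m) (J K : Word n) :
    fOp Λ I (J.map φ) (psi Λ (z :: K.map φ)) = 0 := by
  rw [fOp_psi, H.pair_cons_map, zero_smul]

theorem fOp_psi_map_of_mem (H : IsMarker Λ φ z) (I : Word m) (K : Word n) {J : Word m}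
    (hJ : z ∈ J) : fOp Λ I J (psi Λ (K.map φ)) = 0 := by
  rw [fOp_psi, H.pair_map_of_mem K hJ, zero_smul]

end IsMarker

end Marker

/-! ### The heterix superalgebra as operators on cyclic words -/

section Lift

variable {Λ n : ℕ} {M : Type} [AddCommGroup M] [Module ℂ M]

theorem fourthVec_of_ne {I J : Word n} (hI : I ≠ []) (hJ : J ≠ []) :
    fourthVec I J = Finsupp.single (⟨I, hI⟩, ⟨J, hJ⟩) 1 := dif_pos ⟨hI, hJ⟩

theorem fifth_ext {F G : FifthKind Λ n →ₗ[ℂ] M}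
    (h : ∀ I J : Word n, I ≠ [] → J ≠ [] → F (fifthVec Λ I J) = G (fifthVec Λ I J)) : F = G := by
  refine Submodule.linearMap_qext _ (Finsupp.lhom_ext' fun W => LinearMap.ext_ring ?_)
  have := h W.1.1 W.2.1 W.1.2 W.2.2
  rwa [fifthVec, dif_pos ⟨W.1.2, W.2.2⟩] at this

theorem fourth_ext {F G : FourthKind n →ₗ[ℂ] M}
    (h : ∀ I J : Word n, I ≠ [] → J ≠ [] → F (fourthVec I J) = G (fourthVec I J)) : F = G := by
  refine Finsupp.lhom_ext' fun W => LinearMap.ext_ring ?_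
  have := h W.1.1 W.2.1 W.1.2 W.2.2
  rwa [fourthVec_of_ne W.1.2 W.2.2] at this

theorem het_ext {F G : Heterix Λ n →ₗ[ℂ] M}
    (hg : ∀ I J : Word n, I ≠ [] → J ≠ [] → F (hetGamma Λ I J) = G (hetGamma Λ I J))
    (hf : ∀ I J : Word n, I ≠ [] → J ≠ [] → F (hetFifth Λ I J) = G (hetFifth Λ I J)) : F = G :=
  LinearMap.prod_ext (fourth_ext hg) (fifth_ext hf)

/-- The linear map on operators of the fifth kind determined by a function of two words that
transforms under rotations of either word with the right signs. -/
def fifthLift (f : Word n → Word n → M)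
    (hl : ∀ A B J, f (A ++ B) J = sgn (eps Λ A * eps Λ B) • f (B ++ A) J)
    (hr : ∀ I A B, f I (A ++ B) = sgn (eps Λ A * eps Λ B) • f I (B ++ A)) :
    FifthKind Λ n →ₗ[ℂ] M :=
  (fifthRel Λ n).liftQ (Finsupp.lift M ℂ (NWord n × NWord n) fun W => f W.1.1 W.2.1) (by
    rw [fifthRel, Submodule.span_le]
    rintro x (⟨A, B, J, rfl⟩ | ⟨I, A, B, rfl⟩) <;>
      rw [SetLike.mem_coe, LinearMap.mem_ker, map_sub, map_smul]
    · simp [NWord.cat, hl A.1 B.1]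
    · simp [NWord.cat, hr _ A.1 B.1])

theorem fifthLift_fifthVec {f : Word n → Word n → M}
    (hl : ∀ A B J, f (A ++ B) J = sgn (eps Λ A * eps Λ B) • f (B ++ A) J)
    (hr : ∀ I A B, f I (A ++ B) = sgn (eps Λ A * eps Λ B) • f I (B ++ A))
    {I J : Word n} (hI : I ≠ []) (hJ : J ≠ []) :
    fifthLift f hl hr (fifthVec Λ I J) = f I J := by
  rw [fifthVec, dif_pos ⟨hI, hJ⟩, fifthLift]
  erw [Submodule.liftQ_apply]
  simp

/-- The linear map on operators of the fourth kind with values `g I J` on the basis. -/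
def fourthLift (g : Word n → Word n → M) : FourthKind n →ₗ[ℂ] M :=
  Finsupp.lift M ℂ (NWord n × NWord n) fun W => g W.1.1 W.2.1

theorem fourthLift_fourthVec (g : Word n → Word n → M) {I J : Word n} (hI : I ≠ [])
    (hJ : J ≠ []) : fourthLift g (fourthVec I J) = g I J := by
  rw [fourthVec_of_ne hI hJ, fourthLift]
  simp

theorem fifthVec_append_comm_left (A B J : Word n) :
    fifthVec Λ (A ++ B) J = sgn (eps Λ A * eps Λ B) • fifthVec Λ (B ++ A) J := by
  rcases eq_or_ne A [] with rfl | hA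
  · simp
  rcases eq_or_ne B [] with rfl | hB
  · simp
  rcases eq_or_ne J [] with rfl | hJ
  · simp [fifthVec]
  have h1 : A ++ B ≠ [] := by simp [hA]
  have h2 : B ++ A ≠ [] := by simp [hA]
  rw [fifthVec, fifthVec, dif_pos ⟨h1, hJ⟩, dif_pos ⟨h2, hJ⟩, ← Submodule.Quotient.mk_smul,
    Submodule.Quotient.eq]
  exact Submodule.subset_span (Or.inl ⟨⟨A, hA⟩, ⟨B, hB⟩, ⟨J, hJ⟩, rfl⟩)

theorem fifthVec_append_comm_right (I A B : Word n) :
    fifthVec Λ I (A ++ B) = sgn (eps Λ A * eps Λ B) • fifthVec Λ I (B ++ A) := by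
  rcases eq_or_ne A [] with rfl | hA
  · simp
  rcases eq_or_ne B [] with rfl | hB
  · simp
  rcases eq_or_ne I [] with rfl | hI
  · simp [fifthVec]
  have h1 : A ++ B ≠ [] := by simp [hA]
  have h2 : B ++ A ≠ [] := by simp [hA]
  rw [fifthVec, fifthVec, dif_pos ⟨hI, h1⟩, dif_pos ⟨hI, h2⟩, ← Submodule.Quotient.mk_smul,
    Submodule.Quotient.eq]
  exact Submodule.subset_span (Or.inr ⟨⟨I, hI⟩, ⟨A, hA⟩, ⟨B, hB⟩, rfl⟩)

/-- Operators of the fifth kind are separated by the products of pairings: `f̃^I_J` is recovered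
from the sum of its signed rotations by averaging. -/
theorem fifth_eq_zero {T : Word n → Word n → FifthKind Λ n →ₗ[ℂ] ℂ}
    (hT : ∀ U V I J : Word n, I ≠ [] → J ≠ [] →
      T U V (fifthVec Λ I J) = pair Λ I U * pair Λ J V)
    {x : FifthKind Λ n} (hx : ∀ U V, T U V x = 0) : x = 0 := by
  let s : Word n → Word n → (Word n × Word n →₀ ℂ) := fun I J => Finsupp.single (I, J) 1
  let N : FifthKind Λ n →ₗ[ℂ] (Word n × Word n →₀ ℂ) :=
    fifthLift (fun I J => cyc Λ (fun I' => cyc Λ (s I') J) I)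
      (fun A B J => cyc_append_comm Λ _ A B)
      (fun I A B => by
        rw [← cyc_smul]
        congr 1
        funext I'
        exact cyc_append_comm Λ _ A B)
  let A : (Word n × Word n →₀ ℂ) →ₗ[ℂ] FifthKind Λ n := Finsupp.lift _ ℂ _ fun p =>
    (p.1.length : ℂ)⁻¹ • (p.2.length : ℂ)⁻¹ • fifthVec Λ p.1 p.2
  have hAN : A ∘ₗ N = LinearMap.id := fifth_ext fun I J hI hJ => by
    have h1 : ∀ I', cyc Λ (fun J' => A (s I' J')) J = (I'.length : ℂ)⁻¹ • fifthVec Λ I' J := by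
      intro I'
      simp only [A, s, Finsupp.lift_apply, zero_smul, Finsupp.sum_single_index, one_smul]
      rw [cyc_smul, cyc_average Λ (fun A B => fifthVec_append_comm_right I' A B) hJ]
    rw [LinearMap.comp_apply, fifthLift_fifthVec _ _ hI hJ, map_cyc]
    simp only [map_cyc, h1]
    exact cyc_average Λ (fun A B => fifthVec_append_comm_left A B J) hI
  -- The coefficients of `N x` are the values `T U V x`.
  have hN : N x = 0 := by
    ext ⟨U, V⟩
    have h : Finsupp.lapply (U, V) ∘ₗ N = T U V := fifth_ext fun I J hI hJ => by
      rw [hT U V I J hI hJ, LinearMap.comp_apply, fifthLift_fifthVec _ _ hI hJ, map_cyc]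
      simp only [map_cyc]
      have : ∀ I' J', Finsupp.lapply (R := ℂ) (U, V) (s I' J') = kd I' U • kd J' V := by
        intro I' J'
        by_cases h1 : I' = U <;> by_cases h2 : J' = V <;> simp [s, kd, h1, h2]
      simp only [this, cyc_smul, pair]
      rw [← smul_eq_mul, ← cyc_smul_const]
    rw [← Finsupp.lapply_apply (R := ℂ), ← LinearMap.comp_apply, h, hx]
    rfl
  rw [← LinearMap.id_apply (R := ℂ) x, ← hAN, LinearMap.comp_apply, hN, map_zero]

/-- A linear combination vanishes if functionals that are triangular with respect to some length
vanish on it. -/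
theorem finsupp_eq_zero_of_triangular {X : Type} (ℓ : X → ℕ) {F : X → (X →₀ ℂ) →ₗ[ℂ] ℂ}
    (hd : ∀ x, F x (Finsupp.single x 1) = 1)
    (ht : ∀ x y, ℓ y ≤ ℓ x → x ≠ y → F y (Finsupp.single x 1) = 0)
    {g : X →₀ ℂ} (hg : ∀ y, F y g = 0) : g = 0 := by
  by_contra h
  -- The term of least length in the support is the only one that the functional `F y` sees.
  obtain ⟨y, hy, hmin⟩ := Finset.exists_min_image g.support ℓ (Finsupp.support_nonempty_iff.2 h)
  refine Finsupp.mem_support_iff.1 hy ?_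
  have h1 := hg y
  have h2 : ∀ x, Finsupp.single x (g x) = g x • Finsupp.single x (1 : ℂ) := by simp
  rw [← Finsupp.sum_single g, Finsupp.sum, map_sum, Finset.sum_eq_single y] at h1
  · rwa [h2, map_smul, hd, smul_eq_mul, mul_one] at h1
  · intro x hx hxy
    rw [h2, map_smul, ht x y (hmin x hx) hxy, smul_zero]
  · exact fun h => absurd hy h

end Lift

section Rep

variable {Λ n m : ℕ} {φ : Fin n → Fin m}

/-- The operators of the heterix superalgebra on closed states over a larger alphabet. -/
def hetRep (hφ : ∀ x, (φ x).val = x.val) : Heterix Λ n →ₗ[ℂ] Module.End ℂ (ClosedState Λ m) :=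
  LinearMap.coprod (fourthLift fun I J => gOp Λ (I.map φ) (J.map φ))
    (fifthLift (fun I J => fOp Λ (I.map φ) (J.map φ))
      (fun A B J => by
        rw [List.map_append, fOp_append_comm_left, eps_map Λ hφ, eps_map Λ hφ, List.map_append])
      (fun I A B => by
        rw [List.map_append, fOp_append_comm_right, eps_map Λ hφ, eps_map Λ hφ,
          List.map_append]))

variable {hφ : ∀ x, (φ x).val = x.val}

theorem hetRep_gamma {I J : Word n} (hI : I ≠ []) (hJ : J ≠ []) :
    hetRep hφ (hetGamma Λ I J) = gOp Λ (I.map φ) (J.map φ) := by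
  simp [hetRep, hetGamma, fourthLift_fourthVec _ hI hJ]

theorem hetRep_fifth {I J : Word n} (hI : I ≠ []) (hJ : J ≠ []) :
    hetRep hφ (hetFifth Λ I J) = fOp Λ (I.map φ) (J.map φ) := by
  simp [hetRep, hetFifth, fifthLift_fifthVec _ _ hI hJ]

variable {z : Fin m}

/-- The coefficient of the open string `U` in `γ^I_J` applied to the open string `K`, when `K` is
not longer than `J`. -/
theorem IsMarker.pairL_gOp (H : IsMarker Λ φ z) {I J : Word n} (hJ : J ≠ []) {K : Word n}
    (hK : K.length ≤ J.length) (U : Word n) :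
    pairL Λ (z :: U.map φ) (gOp Λ (I.map φ) (J.map φ) (psi Λ (z :: K.map φ))) =
      kd K J * kd I U := by
  rw [H.gOp_psi_cons _ hJ, map_gammaOpen, gammaOpen]
  simp only [pairL_psi, H.pair_cons_cons]
  rw [Finset.sum_eq_single ([], K, [])]
  · simp
  · intro p hp hne
    rw [kd_of_ne (x := p.2.1), mul_zero, zero_smul]
    intro h
    have h1 : p.1 ++ p.2.1 ++ p.2.2 = K := by
      simp only [cuts3DND, Finset.mem_filter, mem_cuts3DDD] at hp
      exact hp.1
    have h2 := congrArg List.length h1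
    simp only [List.length_append, h] at h2
    have h3 : p.1 = [] := List.length_eq_zero_iff.1 (by omega)
    have h4 : p.2.2 = [] := List.length_eq_zero_iff.1 (by omega)
    refine hne (Prod.ext h3 (Prod.ext ?_ h4))
    rw [← h1, h3, h4]
    simp
  · intro h
    have : K = [] := by
      by_contra hK
      exact h (by simp [cuts3DND, mem_cuts3DDD, hK])
    simp [this, kd_of_ne hJ.symm]

/-- Elements of the heterix superalgebra are determined by their action on open and closed
strings. -/
theorem IsMarker.het_eq_zero (H : IsMarker Λ φ z) {x : Heterix Λ n}
    (ho : ∀ W : Word n, W ≠ [] → hetRep H.val x (psi Λ (z :: W.map φ)) = 0)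
    (hc : ∀ W : Word n, W ≠ [] → hetRep H.val x (psi Λ (W.map φ)) = 0) : x = 0 := by
  obtain ⟨g, f⟩ := x
  have hf : ∀ W : Word n, ∀ f : FifthKind Λ n,
      hetRep H.val (0, f) (psi Λ (z :: W.map φ)) = 0 := by
    intro W f
    have : (LinearMap.applyₗ (psi Λ (z :: W.map φ))) ∘ₗ (hetRep H.val (Λ := Λ)) ∘ₗ
        LinearMap.inr ℂ _ _ = 0 := fifth_ext fun I J hI hJ => by
      change hetRep H.val (hetFifth Λ I J) _ = 0
      rw [hetRep_fifth hI hJ, H.fOp_map_cons]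
    exact LinearMap.congr_fun this f
  -- Among the `γ` whose lower words are not shorter than `J`, only those with lower word `J` act on
  -- the open string `J`.
  have hg : g = 0 := by
    refine finsupp_eq_zero_of_triangular (fun p : NWord n × NWord n => p.2.1.length)
      (F := fun p => pairL Λ (z :: p.1.1.map φ) ∘ₗ
        (LinearMap.applyₗ (psi Λ (z :: p.2.1.map φ))) ∘ₗ (hetRep H.val (Λ := Λ)) ∘ₗ
        LinearMap.inl ℂ _ _) ?_ ?_ ?_
    · intro p
      rw [← fourthVec_of_ne p.1.2 p.2.2]
      change pairL Λ _ (hetRep H.val (hetGamma Λ p.1.1 p.2.1) _) = 1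
      rw [hetRep_gamma p.1.2 p.2.2, H.pairL_gOp p.2.2 le_rfl, kd_self, kd_self, one_mul]
    · intro p q hpq hne
      rw [← fourthVec_of_ne p.1.2 p.2.2]
      change pairL Λ _ (hetRep H.val (hetGamma Λ p.1.1 p.2.1) _) = 0
      rw [hetRep_gamma p.1.2 p.2.2, H.pairL_gOp p.2.2 hpq]
      by_cases h1 : q.2.1 = p.2.1
      · rw [kd_of_ne (x := p.1.1), mul_zero]
        exact fun h2 => hne (Prod.ext (Subtype.ext h2) (Subtype.ext h1.symm))
      · rw [kd_of_ne h1, zero_mul]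
    · intro p
      have h := ho p.2.1 p.2.2
      have h' : ((g, f) : Heterix Λ n) = (g, 0) + (0, f) := by simp
      rw [h', map_add, LinearMap.add_apply, hf, add_zero] at h
      change pairL Λ _ (hetRep H.val (g, 0) _) = 0
      rw [h, map_zero]
  subst hg
  have : f = 0 := by
    refine fifth_eq_zero (T := fun U V => pairL Λ (U.map φ) ∘ₗ
        (LinearMap.applyₗ (psi Λ (V.map φ))) ∘ₗ (hetRep H.val (Λ := Λ)) ∘ₗ
        LinearMap.inr ℂ _ _) ?_ ?_
    · intro U V I J hI hJ
      change pairL Λ _ (hetRep H.val (hetFifth Λ I J) _) = _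
      rw [hetRep_fifth hI hJ, fOp_psi, map_smul, pairL_psi, pair_map Λ H.val, pair_map Λ H.val,
        pair_comm Λ V, smul_eq_mul, mul_comm]
    · intro U V
      change pairL Λ _ (hetRep H.val (0, f) _) = 0
      rcases eq_or_ne V [] with rfl | hV
      · simp [psi_nil]
      · rw [hc V hV, map_zero]
  rw [this]
  rfl

end Rep

/-! ### Extending both words of an operator by a letter -/

section Extension

variable {Λ n : ℕ} {M : Type} [AddCommGroup M] [Module ℂ M]

theorem sum_kd_smul (x : Fin n) (f : Fin n → M) : ∑ i, kd x i • f i = f x := by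
  rw [Finset.sum_eq_single x]
  · simp
  · intro y _ hy
    rw [kd_of_ne hy.symm, zero_smul]
  · simp

theorem strip_eq_add_sum (J : Word n) (ψ : Word n → M) (V : Word n) :
    strip J ψ V = kd V J • ψ [] + ∑ j, strip (J ++ [j]) (fun R => ψ (j :: R)) V := by
  induction J generalizing V with
  | nil =>
    cases V with
    | nil => simp [strip_nil]
    | cons x V =>
      simp only [strip_nil, List.nil_append, strip_cons_cons, kd_cons_nil, zero_smul, zero_add]
      rw [sum_kd_smul x fun y => ψ (y :: V)]
  | cons y J ih =>
    cases V with
    | nil => simp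
    | cons x V => simp [ih V, mul_smul, Finset.smul_sum]

/-- `γ^I_J` is the sum of the `γ^{Ij}_{Jj}` over all letters `j`, except where `J` is the whole
word. -/
theorem gOp_eq_sum_right (I J : Word n) :
    gOp Λ I J = ∑ j, gOp Λ (I ++ [j]) (J ++ [j]) + fOp Λ I J := by
  refine closed_ext fun W _ => ?_
  rw [LinearMap.add_apply, LinearMap.sum_apply, fOp_psi, add_comm]
  simp only [gOp_psi]
  rw [pair, ← cyc_smul_const, ← cyc_sum, ← cyc_add]
  congr 1
  funext V
  rw [strip_eq_add_sum]
  simp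

theorem strip_eq_add_sum_cuts {J : Word n} (hJ : J ≠ []) (ψ : Word n → M) (V : Word n) :
    strip J ψ V = kd V J • ψ [] +
      ∑ p ∈ cuts V, ∑ i, kd p.2 [i] • strip J (fun R => ψ (R ++ [i])) p.1 := by
  rcases V.eq_nil_or_concat' with rfl | ⟨V, x, rfl⟩
  · simp [strip, sum_cutsDD_nil, sum_cuts_nil]
  · rw [sum_cuts_append (by simp), sum_cuts_cons, sum_cutsDN_nil, add_zero]
    have : ∀ u ∈ cutsND V, (∑ i, kd (u.2 ++ [x]) [i] •
        strip J (fun R => ψ (R ++ [i])) u.1) =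
        if u.2 = [] then strip J (fun R => ψ (R ++ [x])) u.1 else 0 := by
      intro u _
      cases h : u.2 with
      | nil => simp [sum_kd_smul x fun i => strip J (fun R => ψ (R ++ [i])) u.1]
      | cons y U =>
        have : U ++ [x] ≠ [] := by simp
        simp [kd_of_ne this]
    rw [Finset.sum_congr rfl this, strip, sum_cutsDD_append, sum_cutsND_cons, sum_cutsDD_nil,
      add_comm]
    congr 1
    rcases eq_or_ne V [] with rfl | hV
    · simp [sum_cutsDD_nil, sum_cutsND_nil, kd_of_ne hJ.symm]
    · rw [sum_cutsND hV, Finset.sum_eq_zero (s := cuts V), zero_add, if_pos rfl, strip]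
      intro u hu
      rw [if_neg (mem_cuts.1 hu).2.2]

/-- `γ^I_J` is the signed sum of the `γ^{iI}_{iJ}` over all letters `i`, except where `J` is the
whole word: in a cyclic word the letter before `J` is the last letter after `J`. -/
theorem gOp_eq_sum_left (I : Word n) {J : Word n} (hJ : J ≠ []) :
    gOp Λ I J =
      ∑ i, sgn (eps Λ [i] * (eps Λ I + eps Λ J)) • gOp Λ (i :: I) (i :: J) + fOp Λ I J := by
  refine closed_ext fun W _ => ?_
  rw [LinearMap.add_apply, LinearMap.sum_apply, fOp_psi, add_comm]
  simp only [LinearMap.smul_apply, gOp_psi]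
  rw [pair, ← cyc_smul_const]
  simp only [← cyc_smul]
  rw [← cyc_sum]
  have h1 := cyc_cuts_swap Λ (fun A B => ∑ i, kd B [i] •
    strip J (fun R => psi Λ (I ++ (R ++ [i]))) A) W
  have h2 : cyc Λ (strip J fun R => psi Λ (I ++ R)) W =
      cyc Λ (fun V => kd V J • psi Λ I + ∑ p ∈ cuts V, ∑ i, kd p.2 [i] •
        strip J (fun R => psi Λ (I ++ (R ++ [i]))) p.1) W := by
    congr 1
    funext V
    rw [strip_eq_add_sum_cuts hJ, List.append_nil]
  rw [h2, cyc_add, h1]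
  congr 2
  funext V
  cases V with
  | nil => simp [sum_cuts_nil]
  | cons x V =>
    simp only [sum_cuts_cons, strip_cons_cons, kd_cons, smul_comm (sgn _) (kd x _)]
    rcases eq_or_ne V [] with rfl | hV
    · simp [sum_cutsDN_nil, strip, sum_cutsDD_nil, kd_of_ne hJ.symm]
    rw [sum_kd_smul x fun i => sgn (eps Λ [i] * (eps Λ I + eps Λ J)) •
      strip J (fun R => psi Λ (i :: I ++ R)) V, sum_cutsDN hV,
      Finset.sum_eq_zero (s := cuts V), add_zero]
    · simp only [kd_self, mul_one]
      rw [sum_kd_smul x fun i => strip J (fun R => psi Λ (I ++ (R ++ [i]))) V, strip, strip,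
        Finset.smul_sum, Finset.smul_sum]
      refine Finset.sum_congr rfl fun p hp => ?_
      rw [mem_cutsDD] at hp
      rw [← List.append_assoc, psi_append_comm, smul_smul, smul_smul, smul_smul]
      refine congrArg (· • _) ?_
      rw [mul_right_comm, sgn_mul]
      refine mul_kd_congr fun h : p.1 = J => sgn_congr ?_
      rw [← hp, h]
      simp only [Nat.cast_add, Nat.cast_mul, cast_eps_append]
      grind
    · intro p hp
      obtain ⟨y, U, h⟩ := List.exists_cons_of_ne_nil (mem_cuts.1 hp).2.1
      simp [h]

end Extension

section Count

variable {Λ n : ℕ} (x : Fin n)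

theorem gOp_psi_eq_zero {J W : Word n} (h : W.count x < J.count x) (I : Word n) :
    gOp Λ I J (psi Λ W) = 0 := by
  rw [gOp_psi]
  refine Finset.sum_eq_zero fun p hp => ?_
  rw [strip, Finset.sum_eq_zero, smul_zero]
  intro q hq
  rw [mem_cutsDD] at hq
  rw [kd_of_ne, zero_smul]
  intro hJ
  have h1 := congrArg (List.count x) (mem_cutsDN.1 hp).1
  have h2 := congrArg (List.count x) hq
  simp only [List.count_append, hJ] at h1 h2
  omega

end Count

/-! ### The heterix superalgebra is a Lie superalgebra -/

section Parity

variable (Λ : ℕ) {n : ℕ}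

/-- The parity operator on closed states. -/
def closedParity (Λ n : ℕ) : Module.End ℂ (ClosedState Λ n) :=
  closedLift Λ (fun W => sgn (eps Λ W) • psi Λ W) fun A B => by
    rw [psi_append_comm, smul_comm]
    refine congrArg (_ • · • _) (sgn_congr ?_)
    simp only [cast_eps_append]
    ring

theorem closedParity_psi (W : Word n) :
    closedParity Λ n (psi Λ W) = sgn (eps Λ W) • psi Λ W := by
  rcases eq_or_ne W [] with rfl | hW
  · simp [psi_nil]
  · exact closedLift_psi Λ _ _ hW

theorem hasDegree_gOp (I J : Word n) :
    HasDegree (closedParity Λ n) ((eps Λ I + eps Λ J : ℕ) : ZMod 2) (gOp Λ I J) :=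
  closed_ext fun W _ => by
    rw [Module.End.mul_apply, LinearMap.smul_apply, Module.End.mul_apply, closedParity_psi,
      map_smul, smul_smul, gOp_psi, cyc, map_sum, Finset.smul_sum]
    refine Finset.sum_congr rfl fun p hp => ?_
    rw [strip, smul_comm _ (sgn (eps Λ p.1 * eps Λ p.2)), map_smul, map_sum]
    refine congrArg _ ?_
    rw [Finset.smul_sum]
    refine Finset.sum_congr rfl fun q hq => ?_
    rw [map_smul, closedParity_psi, smul_smul, smul_smul, mul_comm (kd _ _), sgn_val_natCast,
      sgn_mul]
    refine congrArg (· • _) (mul_kd_congr fun h : q.1 = J => sgn_congr ?_)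
    rw [mem_cutsDD] at hq
    have hW : (eps Λ W : ZMod 2) = eps Λ J + eps Λ q.2 := by
      rw [← (mem_cutsDN.1 hp).1, cast_eps_append, add_comm, ← cast_eps_append, ← hq, h,
        cast_eps_append]
    simp only [Nat.cast_add, cast_eps_append, hW]
    grind

theorem pair_congr_eps (W V : Word n) :
    sgn (eps Λ W) * pair Λ W V = sgn (eps Λ V) * pair Λ W V := by
  rw [pair, cyc, Finset.mul_sum, Finset.mul_sum]
  refine Finset.sum_congr rfl fun p hp => ?_
  rw [smul_eq_mul, ← mul_assoc, ← mul_assoc]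
  have hW : (eps Λ W : ZMod 2) = eps Λ (p.2 ++ p.1) := by
    rw [← (mem_cutsDN.1 hp).1, cast_eps_append, add_comm, ← cast_eps_append]
  refine mul_kd_congr fun h => ?_
  rw [sgn_congr hW, h]

theorem hasDegree_fOp (I J : Word n) :
    HasDegree (closedParity Λ n) ((eps Λ I + eps Λ J : ℕ) : ZMod 2) (fOp Λ I J) :=
  closed_ext fun W _ => by
    rw [Module.End.mul_apply, LinearMap.smul_apply, Module.End.mul_apply, closedParity_psi,
      map_smul, smul_smul, fOp_psi, map_smul, closedParity_psi, smul_smul, smul_smul, mul_assoc,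
      pair_congr_eps, sgn_val_natCast, ← mul_assoc, sgn_mul, mul_comm]
    refine congrArg (fun c => (c * _) • _) (sgn_congr ?_)
    simp only [Nat.cast_add]
    grind

end Parity

section Nonempty

variable (Λ : ℕ) {n : ℕ} {M : Type} [AddCommGroup M] [Module ℂ M]
  {γ γ' f f' : Word n → Word n → M}

theorem gammaGamma_congr (hγ : ∀ A B : Word n, A ≠ [] → B ≠ [] → γ A B = γ' A B)
    (hf : ∀ A B : Word n, A ≠ [] → B ≠ [] → f A B = f' A B) {I J K L : Word n} (hI : I ≠ [])
    (hJ : J ≠ []) (hK : K ≠ []) (hL : L ≠ []) :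
    gammaGamma Λ γ f I J K L = gammaGamma Λ γ' f' I J K L := by
  simp [gammaGamma, gammaGammaHalf, hγ, hf, hI, hJ, hK, hL]

theorem gammaFifth_congr (hf : ∀ A B : Word n, A ≠ [] → B ≠ [] → f A B = f' A B)
    {I J K L : Word n} (hI : I ≠ []) (hJ : J ≠ []) (hK : K ≠ []) (hL : L ≠ []) :
    gammaFifth Λ f I J K L = gammaFifth Λ f' I J K L := by
  simp [gammaFifth, hf, hI, hJ, hK, hL]

theorem fifthFifth_congr (hf : ∀ A B : Word n, A ≠ [] → B ≠ [] → f A B = f' A B)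
    {I J K L : Word n} (hI : I ≠ []) (hJ : J ≠ []) (hK : K ≠ []) (hL : L ≠ []) :
    fifthFifth Λ f I J K L = fifthFifth Λ f' I J K L := by
  simp [fifthFifth, fifthFifthHalf, hf, hI, hJ, hK, hL]

theorem gammaOpen_congr {s s' : Word n → M} (hs : ∀ A : Word n, A ≠ [] → s A = s' A)
    {I : Word n} (hI : I ≠ []) (J K : Word n) : gammaOpen Λ s I J K = gammaOpen Λ s' I J K := by
  simp [gammaOpen, hs, hI]

end Nonempty

section HetState

variable {Λ n : ℕ} {M : Type} [AddCommGroup M] [Module ℂ M]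

theorem hetState_ext {F G : HetState Λ n →ₗ[ℂ] M}
    (ho : ∀ K : Word n, K ≠ [] → F (hetOpen Λ K) = G (hetOpen Λ K))
    (hc : ∀ K : Word n, K ≠ [] → F (hetClosed Λ K) = G (hetClosed Λ K)) : F = G := by
  refine LinearMap.prod_ext (Finsupp.lhom_ext' fun W => LinearMap.ext_ring ?_) (closed_ext hc)
  have := ho W.1 W.2
  rwa [hetOpen, dif_pos W.2] at this

theorem hetState_mem {R : Submodule ℂ M} {F : HetState Λ n →ₗ[ℂ] M}
    (ho : ∀ K : Word n, K ≠ [] → F (hetOpen Λ K) ∈ R)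
    (hc : ∀ K : Word n, K ≠ [] → F (hetClosed Λ K) ∈ R) (v : HetState Λ n) : F v ∈ R := by
  have : R.mkQ ∘ₗ F = 0 := hetState_ext (fun K hK => by simpa using ho K hK)
    fun K hK => by simpa using hc K hK
  simpa using LinearMap.congr_fun this v

theorem het_mem {R : Submodule ℂ M} {F : Heterix Λ n →ₗ[ℂ] M}
    (hg : ∀ I J : Word n, I ≠ [] → J ≠ [] → F (hetGamma Λ I J) ∈ R)
    (hf : ∀ I J : Word n, I ≠ [] → J ≠ [] → F (hetFifth Λ I J) ∈ R) (x : Heterix Λ n) :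
    F x ∈ R := by
  have : R.mkQ ∘ₗ F = 0 := het_ext (fun I J hI hJ => by simpa using hg I J hI hJ)
    fun I J hI hJ => by simpa using hf I J hI hJ
  simpa using LinearMap.congr_fun this x

/-- Closing an open string by a marker letter: the states of the heterix superalgebra as cyclic
words over an alphabet with one more letter. -/
def hetClosing (Λ n : ℕ) : HetState Λ n →ₗ[ℂ] ClosedState Λ (n + 1) :=
  LinearMap.coprod
    (Finsupp.lift _ ℂ (NWord n) fun K => psi Λ (Fin.last n :: K.1.map Fin.castSucc))
    (closedLift Λ (fun K => psi Λ (K.map Fin.castSucc)) fun A B => by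
      rw [List.map_append, psi_append_comm, eps_map Λ (φ := Fin.castSucc) (fun _ => rfl),
        eps_map Λ (φ := Fin.castSucc) (fun _ => rfl), List.map_append])

theorem hetClosing_open {K : Word n} (hK : K ≠ []) :
    hetClosing Λ n (hetOpen Λ K) = psi Λ (Fin.last n :: K.map Fin.castSucc) := by
  simp [hetClosing, hetOpen, hK]

theorem hetClosing_closed {K : Word n} (hK : K ≠ []) :
    hetClosing Λ n (hetClosed Λ K) = psi Λ (K.map Fin.castSucc) := by
  simp [hetClosing, hetClosed, closedLift_psi Λ _ _ hK]

/-- The action of the heterix superalgebra on cyclic words over an alphabet with a marker. -/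
abbrev markedRep (Λ n : ℕ) : Heterix Λ n →ₗ[ℂ] Module.End ℂ (ClosedState Λ (n + 1)) :=
  hetRep (φ := Fin.castSucc) fun _ => rfl

section Marked

theorem isMarker_last (hn : 2 * Λ ≤ n) :
    IsMarker Λ (Fin.castSucc : Fin n → Fin (n + 1)) (Fin.last n) where
  val _ := rfl
  ne x := (Fin.castSucc_lt_last x).ne
  le := hn

/-- Open and closed states are recovered from their closures by the pairing of cyclic words, which
vanishes between a word with and a word without the marker. -/
theorem hetClosing_injective (hn : 2 * Λ ≤ n) : Function.Injective (hetClosing Λ n) := by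
  have H := isMarker_last hn
  rw [← LinearMap.ker_eq_bot, LinearMap.ker_eq_bot']
  rintro v hv
  have h1 : ∀ U : NWord n, pairL Λ (Fin.last n :: U.1.map Fin.castSucc) ∘ₗ hetClosing Λ n =
      Finsupp.lapply U ∘ₗ LinearMap.fst ℂ _ _ := fun U => hetState_ext
    (fun K hK => by
      rw [LinearMap.comp_apply, hetClosing_open hK, pairL_psi, H.pair_cons_cons]
      simp [hetOpen, hK, kd, Finsupp.single_apply, Subtype.ext_iff])
    (fun K hK => by
      rw [LinearMap.comp_apply, hetClosing_closed hK, pairL_psi, H.pair_map_of_mem _ (by simp)]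
      simp [hetClosed])
  have h2 : ∀ U : Word n, pairL Λ (U.map Fin.castSucc) ∘ₗ hetClosing Λ n =
      pairL Λ U ∘ₗ LinearMap.snd ℂ _ _ := fun U => hetState_ext
    (fun K hK => by
      rw [LinearMap.comp_apply, hetClosing_open hK, pairL_psi, H.pair_cons_map]
      simp [hetOpen, hK])
    (fun K hK => by
      rw [LinearMap.comp_apply, hetClosing_closed hK, pairL_psi, pair_map Λ H.val]
      simp [hetClosed])
  refine Prod.ext (Finsupp.ext fun U => ?_) (closed_eq_zero Λ fun U => ?_)
  · have := LinearMap.congr_fun (h1 U) v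
    rw [LinearMap.comp_apply, hv, map_zero] at this
    exact this.symm
  · have := LinearMap.congr_fun (h2 U) v
    rw [LinearMap.comp_apply, hv, map_zero] at this
    exact this.symm

theorem markedRep_gamma_open (hn : 2 * Λ ≤ n) {I J K : Word n} (hI : I ≠ []) (hJ : J ≠ [])
    (hK : K ≠ []) :
    markedRep Λ n (hetGamma Λ I J) (hetClosing Λ n (hetOpen Λ K)) =
      hetClosing Λ n (gammaOpen Λ (hetOpen Λ) I J K) := by
  rw [hetRep_gamma hI hJ, hetClosing_open hK, (isMarker_last hn).gOp_psi_cons _ hJ,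
    map_gammaOpen]
  exact gammaOpen_congr Λ (fun A hA => (hetClosing_open hA).symm) hI _ _

theorem gammaClosed_congr {s s' : Word n → M} (hs : ∀ A : Word n, A ≠ [] → s A = s' A)
    {I : Word n} (hI : I ≠ []) (J K : Word n) :
    gammaClosed Λ s I J K = gammaClosed Λ s' I J K := by
  simp [gammaClosed, hs, hI]

theorem markedRep_gamma_closed {I J K : Word n} (hI : I ≠ []) (hJ : J ≠ []) (hK : K ≠ []) :
    markedRep Λ n (hetGamma Λ I J) (hetClosing Λ n (hetClosed Λ K)) =
      hetClosing Λ n (gammaClosed Λ (hetClosed Λ) I J K) := by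
  rw [hetRep_gamma hI hJ, hetClosing_closed hK, gOp_psi_eq_gammaClosed Λ _ (by simpa using hJ),
    gammaClosed_map Λ (φ := Fin.castSucc) (fun _ => rfl), map_gammaClosed]
  exact gammaClosed_congr (fun A hA => (hetClosing_closed hA).symm) hI _ _

theorem markedRep_fifth_open (hn : 2 * Λ ≤ n) {I J K : Word n} (hI : I ≠ []) (hJ : J ≠ [])
    (hK : K ≠ []) : markedRep Λ n (hetFifth Λ I J) (hetClosing Λ n (hetOpen Λ K)) = 0 := by
  rw [hetRep_fifth hI hJ, hetClosing_open hK, (isMarker_last hn).fOp_map_cons]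

theorem markedRep_fifth_closed {I J K : Word n} (hI : I ≠ []) (hJ : J ≠ []) (hK : K ≠ []) :
    markedRep Λ n (hetFifth Λ I J) (hetClosing Λ n (hetClosed Λ K)) =
      hetClosing Λ n (fifthClosed Λ (hetClosed Λ) I J K) := by
  rw [hetRep_fifth hI hJ, hetClosing_closed hK, fOp_psi_eq_fifthClosed Λ _ (by simpa using hJ),
    fifthClosed_map Λ (φ := Fin.castSucc) (fun _ => rfl), map_fifthClosed]
  simp only [fifthClosed, hetClosing_closed hI]

/-- The states obtained by closing open strings are stable under the marked representation. -/
theorem exists_hetAct (hn : 2 * Λ ≤ n) :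
    ∃ ρ : Heterix Λ n →ₗ[ℂ] HetState Λ n →ₗ[ℂ] HetState Λ n,
      ∀ x v, hetClosing Λ n (ρ x v) = markedRep Λ n x (hetClosing Λ n v) := by
  refine exists_bilinear_lift (hetClosing_injective hn)
    ((markedRep Λ n).compl₂ (hetClosing Λ n)) fun x v => ?_
  refine het_mem (F := ((markedRep Λ n).compl₂ (hetClosing Λ n)).flip v) (fun I J hI hJ => ?_)
    (fun I J hI hJ => ?_) x
  · refine hetState_mem (F := (markedRep Λ n).compl₂ (hetClosing Λ n) (hetGamma Λ I J))
      (fun K hK => ?_) (fun K hK => ?_) v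
    · exact ⟨_, (markedRep_gamma_open hn hI hJ hK).symm⟩
    · exact ⟨_, (markedRep_gamma_closed hI hJ hK).symm⟩
  · refine hetState_mem (F := (markedRep Λ n).compl₂ (hetClosing Λ n) (hetFifth Λ I J))
      (fun K hK => ?_) (fun K hK => ?_) v
    · exact ⟨0, (map_zero _).trans (markedRep_fifth_open hn hI hJ hK).symm⟩
    · exact ⟨_, (markedRep_fifth_closed hI hJ hK).symm⟩

/-- The action of the heterix superalgebra on its singlet states. -/
def hetAct (hn : 2 * Λ ≤ n) : Heterix Λ n →ₗ[ℂ] Module.End ℂ (HetState Λ n) :=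
  (exists_hetAct hn).choose

theorem hetClosing_hetAct (hn : 2 * Λ ≤ n) (x : Heterix Λ n) (v : HetState Λ n) :
    hetClosing Λ n (hetAct hn x v) = markedRep Λ n x (hetClosing Λ n v) :=
  (exists_hetAct hn).choose_spec x v

theorem isHeterixAction_hetAct (hn : 2 * Λ ≤ n) : IsHeterixAction Λ n (hetAct hn) where
  gamma_open I J K hI hJ hK := hetClosing_injective hn <| by
    rw [hetClosing_hetAct, markedRep_gamma_open hn hI hJ hK]
  gamma_closed I J K hI hJ hK := hetClosing_injective hn <| by
    rw [hetClosing_hetAct, markedRep_gamma_closed hI hJ hK]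
  fifth_open I J K hI hJ hK := hetClosing_injective hn <| by
    rw [hetClosing_hetAct, markedRep_fifth_open hn hI hJ hK, map_zero]
  fifth_closed I J K hI hJ hK := hetClosing_injective hn <| by
    rw [hetClosing_hetAct, markedRep_fifth_closed hI hJ hK]

theorem IsHeterixAction.unique {ρ ρ' : Heterix Λ n →ₗ[ℂ] HetState Λ n →ₗ[ℂ] HetState Λ n}
    (h : IsHeterixAction Λ n ρ) (h' : IsHeterixAction Λ n ρ') : ρ = ρ' :=
  het_ext
    (fun I J hI hJ => hetState_ext
      (fun K hK => by rw [h.gamma_open I J K hI hJ hK, h'.gamma_open I J K hI hJ hK])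
      fun K hK => by rw [h.gamma_closed I J K hI hJ hK, h'.gamma_closed I J K hI hJ hK])
    (fun I J hI hJ => hetState_ext
      (fun K hK => by rw [h.fifth_open I J K hI hJ hK, h'.fifth_open I J K hI hJ hK])
      fun K hK => by rw [h.fifth_closed I J K hI hJ hK, h'.fifth_closed I J K hI hJ hK])

/-- Faithfulness of the action on singlet states. -/
theorem hetAct_injective (hn : 2 * Λ ≤ n) : Function.Injective (hetAct (Λ := Λ) hn) := by
  rw [injective_iff_map_eq_zero]
  intro x hx
  refine (isMarker_last hn).het_eq_zero (fun W hW => ?_) fun W hW => ?_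
  · rw [← hetClosing_open hW]
    exact (hetClosing_hetAct hn x _).symm.trans (by rw [hx]; simp)
  · rw [← hetClosing_closed hW]
    exact (hetClosing_hetAct hn x _).symm.trans (by rw [hx]; simp)

/-- The parity operator on the singlet states of the heterix superalgebra. -/
def hetParity (Λ n : ℕ) : Module.End ℂ (HetState Λ n) :=
  LinearMap.prodMap
    (Finsupp.lift _ ℂ (NWord n) fun K => Finsupp.single K (sgn (eps Λ K.1)))
    (closedParity Λ n)

theorem hetParity_open (K : Word n) :
    hetParity Λ n (hetOpen Λ K) = sgn (eps Λ K) • hetOpen Λ K := by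
  rw [hetOpen]
  split_ifs with h
  · refine Prod.ext (Finsupp.ext fun U => ?_) (by simp [hetParity])
    simp only [hetParity, LinearMap.prodMap_apply, Finsupp.lift_apply]
    rw [Finsupp.sum_single_index (by simp)]
    simp
  · simp

theorem hetParity_closed (K : Word n) :
    hetParity Λ n (hetClosed Λ K) = sgn (eps Λ K) • hetClosed Λ K := by
  simp [hetParity, hetClosed, closedParity_psi]

theorem hetClosing_hetParity (hn : 2 * Λ ≤ n) (v : HetState Λ n) :
    hetClosing Λ n (hetParity Λ n v) = closedParity Λ (n + 1) (hetClosing Λ n v) := by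
  have H := isMarker_last hn
  refine LinearMap.congr_fun (f := hetClosing Λ n ∘ₗ hetParity Λ n)
    (g := closedParity Λ (n + 1) ∘ₗ hetClosing Λ n) (hetState_ext (fun K hK => ?_)
      fun K hK => ?_) v
  · rw [LinearMap.comp_apply, LinearMap.comp_apply, hetParity_open, map_smul, hetClosing_open hK,
      closedParity_psi, H.eps_cons, H.eps_map]
  · rw [LinearMap.comp_apply, LinearMap.comp_apply, hetParity_closed, map_smul,
      hetClosing_closed hK, closedParity_psi, H.eps_map]

theorem hetParity_mul_self (Λ n : ℕ) : hetParity Λ n * hetParity Λ n = 1 := by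
  refine hetState_ext (fun K _ => ?_) fun K _ => ?_
  · rw [Module.End.mul_apply, hetParity_open, map_smul, hetParity_open, smul_smul, sgn_mul,
      Module.End.one_apply, sgn_congr (n := 0) (by simp; grind), sgn_zero, one_smul]
  · rw [Module.End.mul_apply, hetParity_closed, map_smul, hetParity_closed, smul_smul, sgn_mul,
      Module.End.one_apply, sgn_congr (n := 0) (by simp; grind), sgn_zero, one_smul]

/-- Closing a string does not change its parity, since the marker is bosonic. -/
theorem hasDegree_hetAct_of_markedRep (hn : 2 * Λ ≤ n) {a : ZMod 2} {x : Heterix Λ n}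
    (h : HasDegree (closedParity Λ (n + 1)) a (markedRep Λ n x)) :
    HasDegree (hetParity Λ n) a (hetAct hn x) := by
  refine LinearMap.ext fun v => hetClosing_injective hn ?_
  rw [Module.End.mul_apply, hetClosing_hetParity hn, hetClosing_hetAct, LinearMap.smul_apply,
    map_smul, Module.End.mul_apply, hetClosing_hetAct, hetClosing_hetParity hn]
  exact LinearMap.congr_fun h _

theorem hasDegree_hetAct (hn : 2 * Λ ≤ n) (a : ZMod 2) :
    ∀ x ∈ hetGrading Λ n a, HasDegree (hetParity Λ n) a (hetAct hn x) := by
  intro x hx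
  refine Submodule.span_induction (p := fun x _ => hetAct hn x ∈ degreeSpace (hetParity Λ n) a)
    ?_ (by simp [(degreeSpace _ a).zero_mem]) ?_ ?_ hx
  · rintro x ⟨I, J, hI, hJ, rfl, rfl | rfl⟩
    · refine hasDegree_hetAct_of_markedRep hn ?_
      rw [hetRep_gamma hI hJ, ← (isMarker_last hn).eps_map I, ← (isMarker_last hn).eps_map J]
      exact hasDegree_gOp Λ _ _
    · refine hasDegree_hetAct_of_markedRep hn ?_
      rw [hetRep_fifth hI hJ, ← (isMarker_last hn).eps_map I, ← (isMarker_last hn).eps_map J]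
      exact hasDegree_fOp Λ _ _
  · intro x y _ _ hx hy
    rw [map_add]
    exact add_mem hx hy
  · intro c x _ hx
    rw [map_smul]
    exact Submodule.smul_mem _ c hx

theorem hetGamma_mem {I J : Word n} (hI : I ≠ []) (hJ : J ≠ []) :
    hetGamma Λ I J ∈ hetGrading Λ n ((eps Λ I + eps Λ J : ℕ) : ZMod 2) :=
  Submodule.subset_span ⟨I, J, hI, hJ, rfl, Or.inl rfl⟩

theorem hetFifth_mem {I J : Word n} (hI : I ≠ []) (hJ : J ≠ []) :
    hetFifth Λ I J ∈ hetGrading Λ n ((eps Λ I + eps Λ J : ℕ) : ZMod 2) :=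
  Submodule.subset_span ⟨I, J, hI, hJ, rfl, Or.inr rfl⟩

theorem isFaithfulGraded_hetAct (hn : 2 * Λ ≤ n) :
    IsFaithfulGraded (hetParity Λ n) (hetGrading Λ n) (hetAct hn) where
  parity := hetParity_mul_self Λ n
  injective := hetAct_injective hn
  degree := hasDegree_hetAct hn
  iSup_eq_top := eq_top_iff.2 fun x _ => het_mem (F := LinearMap.id)
    (fun _ _ hI hJ => Submodule.mem_iSup_of_mem _ (hetGamma_mem hI hJ))
    (fun _ _ hI hJ => Submodule.mem_iSup_of_mem _ (hetFifth_mem hI hJ)) x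

/-- Supercommutators may be computed on cyclic words with a marker. -/
theorem superComm_hetAct (hn : 2 * Λ ≤ n) {x y z : Heterix Λ n} {a b : ℕ}
    (hx : x ∈ hetGrading Λ n a) (hy : y ∈ hetGrading Λ n b)
    (h : ∀ v, markedRep Λ n x (markedRep Λ n y (hetClosing Λ n v))
      - sgn (a * b) • markedRep Λ n y (markedRep Λ n x (hetClosing Λ n v)) =
        markedRep Λ n z (hetClosing Λ n v)) :
    superComm (hetParity Λ n) (hetAct hn x) (hetAct hn y) = hetAct hn z := by
  refine LinearMap.ext fun v => hetClosing_injective hn ?_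
  rw [superComm_of_degree (hetParity_mul_self Λ n) (hasDegree_hetAct hn _ x hx)
    (hasDegree_hetAct hn _ y hy), sgn2_natCast, LinearMap.sub_apply, LinearMap.smul_apply,
    Module.End.mul_apply, Module.End.mul_apply, map_sub, map_smul]
  simp only [hetClosing_hetAct]
  exact h v

theorem superComm_gamma_gamma (hn : 2 * Λ ≤ n) {I J K L : Word n} (hI : I ≠ []) (hJ : J ≠ [])
    (hK : K ≠ []) (hL : L ≠ []) :
    superComm (hetParity Λ n) (hetAct hn (hetGamma Λ I J)) (hetAct hn (hetGamma Λ K L)) =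
      hetAct hn (gammaGamma Λ (hetGamma Λ) (hetFifth Λ) I J K L) := by
  refine superComm_hetAct hn (hetGamma_mem hI hJ) (hetGamma_mem hK hL) fun v => ?_
  have H := isMarker_last hn
  have h := gOp_gOp_commutator Λ (I := I.map Fin.castSucc) (J := J.map Fin.castSucc)
    (K := K.map Fin.castSucc) (L := L.map Fin.castSucc)
    (by simpa using hI) (by simpa using hJ) (by simpa using hK) (by simpa using hL)
  rw [gammaGamma_map Λ H.val, H.eps_map, H.eps_map, H.eps_map, H.eps_map] at h
  rw [map_gammaGamma, gammaGamma_congr Λ (fun A B hA hB => hetRep_gamma hA hB)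
    (fun A B hA hB => hetRep_fifth hA hB) hI hJ hK hL, ← h, hetRep_gamma hI hJ,
    hetRep_gamma hK hL]
  rfl

theorem superComm_gamma_fifth (hn : 2 * Λ ≤ n) {I J K L : Word n} (hI : I ≠ []) (hJ : J ≠ [])
    (hK : K ≠ []) (hL : L ≠ []) :
    superComm (hetParity Λ n) (hetAct hn (hetGamma Λ I J)) (hetAct hn (hetFifth Λ K L)) =
      hetAct hn (gammaFifth Λ (hetFifth Λ) I J K L) := by
  refine superComm_hetAct hn (hetGamma_mem hI hJ) (hetFifth_mem hK hL) fun v => ?_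
  have H := isMarker_last hn
  have h := gOp_fOp_commutator Λ (I := I.map Fin.castSucc) (J := J.map Fin.castSucc)
    (by simpa using hI) (by simpa using hJ) (K.map Fin.castSucc) (L.map Fin.castSucc)
  rw [gammaFifth_map Λ H.val, H.eps_map, H.eps_map, H.eps_map, H.eps_map] at h
  rw [map_gammaFifth, gammaFifth_congr Λ (fun A B hA hB => hetRep_fifth hA hB) hI hJ hK hL, ← h,
    hetRep_gamma hI hJ, hetRep_fifth hK hL]
  rfl

theorem superComm_fifth_fifth (hn : 2 * Λ ≤ n) {I J K L : Word n} (hI : I ≠ []) (hJ : J ≠ [])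
    (hK : K ≠ []) (hL : L ≠ []) :
    superComm (hetParity Λ n) (hetAct hn (hetFifth Λ I J)) (hetAct hn (hetFifth Λ K L)) =
      hetAct hn (fifthFifth Λ (hetFifth Λ) I J K L) := by
  refine superComm_hetAct hn (hetFifth_mem hI hJ) (hetFifth_mem hK hL) fun v => ?_
  have H := isMarker_last hn
  have h : fOp Λ (I.map Fin.castSucc) (J.map Fin.castSucc) *
      fOp Λ (K.map Fin.castSucc) (L.map Fin.castSucc) -
      sgn ((eps Λ (I.map Fin.castSucc) + eps Λ (J.map Fin.castSucc)) *
        (eps Λ (K.map Fin.castSucc) + eps Λ (L.map Fin.castSucc))) •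
        (fOp Λ (K.map Fin.castSucc) (L.map Fin.castSucc) *
          fOp Λ (I.map Fin.castSucc) (J.map Fin.castSucc)) =
      fifthFifth Λ (fOp Λ) (I.map (Fin.castSucc : Fin n → Fin (n + 1))) (J.map Fin.castSucc)
        (K.map Fin.castSucc) (L.map Fin.castSucc) := by
    rw [fOp_mul_fOp Λ _ _ (by simpa using hK), fOp_mul_fOp Λ _ _ (by simpa using hI), fifthFifth]
  rw [fifthFifth_map Λ H.val, H.eps_map, H.eps_map, H.eps_map, H.eps_map] at h
  rw [map_fifthFifth, fifthFifth_congr Λ (fun A B hA hB => hetRep_fifth hA hB) hI hJ hK hL, ← h,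
    hetRep_fifth hI hJ, hetRep_fifth hK hL]
  rfl

end Marked

end HetState

section Representation

variable {X S : Type} [AddCommGroup X] [Module ℂ X] [AddCommGroup S] [Module ℂ S]
  {P : Module.End ℂ S}

theorem superComm_skew (hP : P * P = 1) {a b : ZMod 2} {A B : Module.End ℂ S}
    (hA : HasDegree P a A) (hB : HasDegree P b B) :
    superComm P A B = -(sgn2 a b • superComm P B A) := by
  rw [superComm_of_degree hP hA hB, superComm_of_degree hP hB hA, sgn2, sgn2, mul_comm b.val,
    smul_sub, smul_smul, sgn_mul_self, one_smul, neg_sub]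

/-- A grading given by the eigenspaces of a parity operator `P`. -/
theorem isInternal_of_parity {grS : ZMod 2 → Submodule ℂ S}
    (hgr : ∀ a, ∀ v ∈ grS a, P v = sgn a.val • v) (htop : ⨆ a, grS a = ⊤) :
    DirectSum.IsInternal grS := by
  refine isInternal_zmod_two (fun v h0 h1 => ?_) htop
  have h := (hgr 0 v h0).symm.trans (hgr 1 v h1)
  simp only [ZMod.val_zero, ZMod.val_one, sgn_zero, sgn_one, one_smul, neg_smul] at h
  have h2 : (2 : ℂ) • v = 0 := by
    rw [two_smul]
    nth_rewrite 2 [h]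
    exact add_neg_cancel v
  exact (smul_eq_zero.1 h2).resolve_left two_ne_zero

/-- The summands of such a grading are exactly the eigenspaces. -/
theorem mem_of_parity {grS : ZMod 2 → Submodule ℂ S}
    (hgr : ∀ a, ∀ v ∈ grS a, P v = sgn a.val • v) (htop : ⨆ a, grS a = ⊤) {a : ZMod 2} {v : S}
    (hv : P v = sgn a.val • v) : v ∈ grS a := by
  have hv' : v ∈ grS 0 ⊔ grS 1 := by rw [← iSup_zmod_two, htop]; trivial
  obtain ⟨u, hu, w, hw, rfl⟩ := Submodule.mem_sup.1 hv'
  rw [map_add, hgr 0 u hu, hgr 1 w hw] at hv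
  revert a
  simp only [forall_zmod_two, ZMod.val_zero, ZMod.val_one, sgn_zero, sgn_one, one_smul, neg_smul,
    neg_add]
  have h2 : ∀ x : S, -x = x → x = 0 := fun x hx => by
    have h2 : (2 : ℂ) • x = 0 := by
      rw [two_smul]
      nth_rewrite 1 [← hx]
      exact neg_add_cancel x
    exact (smul_eq_zero.1 h2).resolve_left two_ne_zero
  constructor
  · intro h
    rw [h2 w (add_left_cancel h), add_zero]
    exact hu
  · intro h
    rw [h2 u (add_right_cancel h).symm, zero_add]
    exact hw

/-- Operators of the right degrees whose supercommutators represent the bracket form a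
representation. -/
theorem isSuperRepresentation_of_parity (hP : P * P = 1) {gr : ZMod 2 → Submodule ℂ X}
    {br : X →ₗ[ℂ] X →ₗ[ℂ] X} {grS : ZMod 2 → Submodule ℂ S} {ρ : X →ₗ[ℂ] S →ₗ[ℂ] S}
    (hgr : ∀ a, ∀ v ∈ grS a, P v = sgn a.val • v) (htop : ⨆ a, grS a = ⊤)
    (hdeg : ∀ a, ∀ x ∈ gr a, HasDegree P a (ρ x))
    (hbr : ∀ x y, ρ (br x y) = superComm P (ρ x) (ρ y)) :
    IsSuperRepresentation gr br grS ρ where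
  graded := isInternal_of_parity hgr htop
  action_mem a b x hx v hv := mem_of_parity hgr htop <| by
    have h := LinearMap.congr_fun (hdeg a x hx) v
    rw [Module.End.mul_apply, LinearMap.smul_apply, Module.End.mul_apply, hgr b v hv, map_smul,
      smul_smul] at h
    rw [h, sgn_val_add]
  map_bracket a b x hx y hy v := by
    rw [hbr, superComm_of_degree hP (hdeg a x hx) (hdeg b y hy)]
    rfl

end Representation

section Bracket

variable {Λ n : ℕ}

/-- Bilinear maps are determined by their values on pairs of generators. -/
theorem het_ext₂ {M : Type} [AddCommGroup M] [Module ℂ M]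
    {F G : Heterix Λ n →ₗ[ℂ] Heterix Λ n →ₗ[ℂ] M}
    (hgg : ∀ I J K L : Word n, I ≠ [] → J ≠ [] → K ≠ [] → L ≠ [] →
      F (hetGamma Λ I J) (hetGamma Λ K L) = G (hetGamma Λ I J) (hetGamma Λ K L))
    (hgf : ∀ I J K L : Word n, I ≠ [] → J ≠ [] → K ≠ [] → L ≠ [] →
      F (hetGamma Λ I J) (hetFifth Λ K L) = G (hetGamma Λ I J) (hetFifth Λ K L))
    (hfg : ∀ I J K L : Word n, I ≠ [] → J ≠ [] → K ≠ [] → L ≠ [] →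
      F (hetFifth Λ I J) (hetGamma Λ K L) = G (hetFifth Λ I J) (hetGamma Λ K L))
    (hff : ∀ I J K L : Word n, I ≠ [] → J ≠ [] → K ≠ [] → L ≠ [] →
      F (hetFifth Λ I J) (hetFifth Λ K L) = G (hetFifth Λ I J) (hetFifth Λ K L)) : F = G :=
  het_ext
    (fun I J hI hJ => het_ext (fun K L hK hL => hgg I J K L hI hJ hK hL)
      fun K L hK hL => hgf I J K L hI hJ hK hL)
    (fun I J hI hJ => het_ext (fun K L hK hL => hfg I J K L hI hJ hK hL)
      fun K L hK hL => hff I J K L hI hJ hK hL)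

theorem superComm_fifth_gamma (hn : 2 * Λ ≤ n) {I J K L : Word n} (hI : I ≠ []) (hJ : J ≠ [])
    (hK : K ≠ []) (hL : L ≠ []) :
    superComm (hetParity Λ n) (hetAct hn (hetFifth Λ I J)) (hetAct hn (hetGamma Λ K L)) =
      hetAct hn (-(sgn2 ((eps Λ I + eps Λ J : ℕ) : ZMod 2) ((eps Λ K + eps Λ L : ℕ) : ZMod 2) •
        gammaFifth Λ (hetFifth Λ) K L I J)) := by
  rw [superComm_skew (hetParity_mul_self Λ n) (hasDegree_hetAct hn _ _ (hetFifth_mem hI hJ))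
    (hasDegree_hetAct hn _ _ (hetGamma_mem hK hL)), superComm_gamma_fifth hn hK hL hI hJ,
    map_neg, map_smul]

/-- The defining superbrackets are the supercommutators of the operators on singlet states. -/
theorem isHeterixBracket_iff (hn : 2 * Λ ≤ n)
    {br : Heterix Λ n →ₗ[ℂ] Heterix Λ n →ₗ[ℂ] Heterix Λ n} :
    IsHeterixBracket Λ n br ↔
      ∀ x y, hetAct hn (br x y) = superComm (hetParity Λ n) (hetAct hn x) (hetAct hn y) := by
  constructor
  · intro h x y
    refine LinearMap.congr_fun₂ (f := br.compr₂ (hetAct hn))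
      (g := (superComm (hetParity Λ n)).compl₁₂ (hetAct hn) (hetAct hn))
      (het_ext₂ (M := Module.End ℂ (HetState Λ n)) ?_ ?_ ?_ ?_) x y <;> intro I J K L hI hJ hK hL
    · rw [LinearMap.compr₂_apply, LinearMap.compl₁₂_apply, h.gamma_gamma I J K L hI hJ hK hL,
        superComm_gamma_gamma hn hI hJ hK hL]
    · rw [LinearMap.compr₂_apply, LinearMap.compl₁₂_apply, h.gamma_fifth I J K L hI hJ hK hL,
        superComm_gamma_fifth hn hI hJ hK hL]
    · rw [LinearMap.compr₂_apply, LinearMap.compl₁₂_apply,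
        h.skew _ _ _ (hetFifth_mem hI hJ) _ (hetGamma_mem hK hL),
        h.gamma_fifth K L I J hK hL hI hJ, superComm_fifth_gamma hn hI hJ hK hL]
    · rw [LinearMap.compr₂_apply, LinearMap.compl₁₂_apply, h.fifth_fifth I J K L hI hJ hK hL,
        superComm_fifth_fifth hn hI hJ hK hL]
  · intro h
    have hL := (isFaithfulGraded_hetAct hn).isLieSuperalgebra h
    exact
      { skew := hL.skew
        gamma_gamma := fun I J K L hI hJ hK hL => hetAct_injective hn <| by
          rw [h, superComm_gamma_gamma hn hI hJ hK hL]
        gamma_fifth := fun I J K L hI hJ hK hL => hetAct_injective hn <| by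
          rw [h, superComm_gamma_fifth hn hI hJ hK hL]
        fifth_fifth := fun I J K L hI hJ hK hL => hetAct_injective hn <| by
          rw [h, superComm_fifth_fifth hn hI hJ hK hL] }

theorem existsUnique_isHeterixBracket (hn : 2 * Λ ≤ n) : ∃! br, IsHeterixBracket Λ n br := by
  let B := (superComm (hetParity Λ n)).compl₁₂ (hetAct hn) (hetAct (Λ := Λ) hn)
  have hB : ∀ x y, B x y ∈ LinearMap.range (hetAct (Λ := Λ) hn) := by
    intro x y
    refine het_mem (M := Module.End ℂ (HetState Λ n)) (F := B.flip y)
      (fun I J hI hJ => het_mem (M := Module.End ℂ (HetState Λ n)) (F := B (hetGamma Λ I J))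
        (fun K L hK hL => ?_) (fun K L hK hL => ?_) y)
      (fun I J hI hJ => het_mem (M := Module.End ℂ (HetState Λ n)) (F := B (hetFifth Λ I J))
        (fun K L hK hL => ?_) (fun K L hK hL => ?_) y) x
    · exact ⟨_, (superComm_gamma_gamma hn hI hJ hK hL).symm⟩
    · exact ⟨_, (superComm_gamma_fifth hn hI hJ hK hL).symm⟩
    · exact ⟨_, (superComm_fifth_gamma hn hI hJ hK hL).symm⟩
    · exact ⟨_, (superComm_fifth_fifth hn hI hJ hK hL).symm⟩
  obtain ⟨br, hbr⟩ := exists_bilinear_lift (V := Module.End ℂ (HetState Λ n))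
    (hetAct_injective hn) B hB
  refine ⟨br, (isHeterixBracket_iff hn).2 hbr, fun br' h => ?_⟩
  refine LinearMap.ext₂ fun x y => hetAct_injective hn ?_
  rw [(isHeterixBracket_iff hn).1 h, hbr]
  rfl

theorem hetParity_of_mem (a : ZMod 2) :
    ∀ v ∈ hetStateGrading Λ n a, hetParity Λ n v = sgn a.val • v := by
  intro v hv
  refine Submodule.span_induction (p := fun v _ => hetParity Λ n v = sgn a.val • v)
    ?_ (by simp) ?_ ?_ hv
  · rintro v ⟨K, hK, rfl, rfl | rfl⟩
    · rw [hetParity_open, sgn_val_natCast]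
    · rw [hetParity_closed, sgn_val_natCast]
  · intro x y _ _ hx hy
    rw [map_add, hx, hy, smul_add]
  · intro c x _ hx
    rw [map_smul, hx, smul_comm]

theorem hetOpen_mem {K : Word n} (hK : K ≠ []) :
    hetOpen Λ K ∈ hetStateGrading Λ n ((eps Λ K : ℕ) : ZMod 2) :=
  Submodule.subset_span ⟨K, hK, rfl, Or.inl rfl⟩

theorem hetClosed_mem {K : Word n} (hK : K ≠ []) :
    hetClosed Λ K ∈ hetStateGrading Λ n ((eps Λ K : ℕ) : ZMod 2) :=
  Submodule.subset_span ⟨K, hK, rfl, Or.inr rfl⟩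

theorem hetStateGrading_iSup : ⨆ a, hetStateGrading Λ n a = ⊤ :=
  eq_top_iff.2 fun v _ => hetState_mem (F := LinearMap.id)
    (fun _ hK => Submodule.mem_iSup_of_mem _ (hetOpen_mem hK))
    (fun _ hK => Submodule.mem_iSup_of_mem _ (hetClosed_mem hK)) v

theorem isSuperRepresentation_hetAct (hn : 2 * Λ ≤ n)
    {br : Heterix Λ n →ₗ[ℂ] Heterix Λ n →ₗ[ℂ] Heterix Λ n} (h : IsHeterixBracket Λ n br) :
    IsSuperRepresentation (hetGrading Λ n) br (hetStateGrading Λ n) (hetAct hn) :=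
  isSuperRepresentation_of_parity (hetParity_mul_self Λ n) hetParity_of_mem hetStateGrading_iSup
    (hasDegree_hetAct hn) ((isHeterixBracket_iff hn).1 h)

end Bracket

/-! ### Operators on the ends of open strings -/

section Ends

variable {Λ n : ℕ}

/-- `l'^I_J` replaces `J` by `I` at the left end of an open string. -/
theorem markedRep_hetL (hn : 2 * Λ ≤ n) {I J : Word n} (hI : I ≠ []) (hJ : J ≠ []) :
    markedRep Λ n (hetL Λ I J) =
      gOp Λ (Fin.last n :: I.map Fin.castSucc) (Fin.last n :: J.map Fin.castSucc) := by
  have H := isMarker_last hn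
  have he : ∀ i : Fin n, eps Λ [i.castSucc] = eps Λ [i] := fun i => H.eps_map [i]
  rw [hetL, map_sub, map_sub, map_sum, hetRep_fifth hI hJ, hetRep_gamma hI hJ,
    gOp_eq_sum_left (I.map Fin.castSucc) (by simpa using hJ), Fin.sum_univ_castSucc,
    H.eps_cons [], H.eps_map, H.eps_map]
  have h : ∀ i : Fin n, hetRep (φ := Fin.castSucc) (fun _ => rfl)
      (sgn (eps Λ [i] * (eps Λ I + eps Λ J)) • hetGamma Λ (i :: I) (i :: J)) =
      sgn (eps Λ [i.castSucc] * (eps Λ I + eps Λ J)) •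
        gOp Λ (i.castSucc :: I.map Fin.castSucc) (i.castSucc :: J.map Fin.castSucc) :=
    fun i => by
      rw [map_smul, hetRep_gamma (by simp) (by simp), he]
      rfl
  simp only [h, eps_nil, zero_mul, sgn_zero, one_smul]
  abel

/-- `r'^I_J` replaces `J` by `I` at the right end of an open string. -/
theorem markedRep_hetR {I J : Word n} (hI : I ≠ []) (hJ : J ≠ []) :
    markedRep Λ n (hetR Λ I J) =
      gOp Λ (I.map Fin.castSucc ++ [Fin.last n]) (J.map Fin.castSucc ++ [Fin.last n]) := by
  rw [hetR, map_sub, map_sub, map_sum, hetRep_fifth hI hJ, hetRep_gamma hI hJ,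
    gOp_eq_sum_right (I.map Fin.castSucc), Fin.sum_univ_castSucc]
  have h : ∀ i : Fin n, hetRep (φ := Fin.castSucc) (fun _ => rfl)
      (hetGamma Λ (I ++ [i]) (J ++ [i])) =
      gOp Λ (I.map Fin.castSucc ++ [i.castSucc]) (J.map Fin.castSucc ++ [i.castSucc]) :=
    fun i => by
      rw [hetRep_gamma (by simp) (by simp)]
      simp
  simp only [h]
  abel

/-- `f'^I_J` replaces the open string `J` by `I`. -/
theorem markedRep_hetF (hn : 2 * Λ ≤ n) {I J : Word n} (hI : I ≠ []) (hJ : J ≠ [])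
    (v : HetState Λ n) :
    markedRep Λ n (hetF Λ I J) (hetClosing Λ n v) =
      fOp Λ (Fin.last n :: I.map Fin.castSucc) (Fin.last n :: J.map Fin.castSucc)
        (hetClosing Λ n v) := by
  have H := isMarker_last hn
  have h : ∀ i : Fin n, hetRep (φ := Fin.castSucc) (fun _ => rfl)
      (hetL Λ (I ++ [i]) (J ++ [i])) =
      gOp Λ ((Fin.last n :: I.map Fin.castSucc) ++ [i.castSucc])
        ((Fin.last n :: J.map Fin.castSucc) ++ [i.castSucc]) :=
    fun i => by
      refine (markedRep_hetL hn (by simp) (by simp)).trans ?_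
      simp
  -- A singlet state contains at most one marker.
  have h0 : gOp Λ ((Fin.last n :: I.map Fin.castSucc) ++ [Fin.last n])
      ((Fin.last n :: J.map Fin.castSucc) ++ [Fin.last n]) (hetClosing Λ n v) = 0 := by
    have hc : ∀ K : Word n, (K.map Fin.castSucc).count (Fin.last n) = 0 := fun K =>
      List.count_eq_zero.2 (H.notMem K)
    refine LinearMap.congr_fun (f := gOp Λ _ _ ∘ₗ hetClosing Λ n) (g := 0)
      (hetState_ext (fun K hK => ?_) fun K hK => ?_) v
    · rw [LinearMap.comp_apply, hetClosing_open hK, gOp_psi_eq_zero (Fin.last n)]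
      · rfl
      · simp [hc]
    · rw [LinearMap.comp_apply, hetClosing_closed hK, gOp_psi_eq_zero (Fin.last n)]
      · rfl
      · simp [hc]
  rw [hetF, map_sub, map_sum, markedRep_hetL hn hI hJ,
    gOp_eq_sum_right (Fin.last n :: I.map Fin.castSucc), Fin.sum_univ_castSucc]
  simp only [h]
  simp only [LinearMap.sub_apply, LinearMap.add_apply, h0, add_zero]
  abel

theorem hetL_mem (hn : 2 * Λ ≤ n) {I J : Word n} (hI : I ≠ []) (hJ : J ≠ []) :
    hetL Λ I J ∈ hetGrading Λ n ((eps Λ I + eps Λ J : ℕ) : ZMod 2) := by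
  have H := isMarker_last hn
  have h : ∀ W : Word n, eps Λ W = eps Λ (Fin.last n :: W.map Fin.castSucc) := fun W => by
    rw [H.eps_cons, H.eps_map]
  refine (isFaithfulGraded_hetAct hn).mem_of_degree (hasDegree_hetAct_of_markedRep hn ?_)
  rw [markedRep_hetL hn hI hJ, h I, h J]
  exact hasDegree_gOp Λ _ _

theorem hetR_mem (hn : 2 * Λ ≤ n) {I J : Word n} (hI : I ≠ []) (hJ : J ≠ []) :
    hetR Λ I J ∈ hetGrading Λ n ((eps Λ I + eps Λ J : ℕ) : ZMod 2) := by
  have H := isMarker_last hn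
  have h : ∀ W : Word n, eps Λ W = eps Λ (W.map Fin.castSucc ++ [Fin.last n]) := fun W => by
    rw [H.eps_append_cons, List.append_nil, H.eps_map]
  refine (isFaithfulGraded_hetAct hn).mem_of_degree (hasDegree_hetAct_of_markedRep hn ?_)
  rw [markedRep_hetR hI hJ, h I, h J]
  exact hasDegree_gOp Λ _ _

theorem hetF_mem (hn : 2 * Λ ≤ n) {I J : Word n} (hI : I ≠ []) (hJ : J ≠ []) :
    hetF Λ I J ∈ hetGrading Λ n ((eps Λ I + eps Λ J : ℕ) : ZMod 2) := by
  refine sub_mem (hetL_mem hn hI hJ) (sum_mem fun i _ => ?_)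
  have := hetL_mem hn (I := I ++ [i]) (J := J ++ [i]) (by simp) (by simp)
  have e : ((eps Λ (I ++ [i]) + eps Λ (J ++ [i]) : ℕ) : ZMod 2) =
      ((eps Λ I + eps Λ J : ℕ) : ZMod 2) := by
    simp only [Nat.cast_add, cast_eps_append]
    grind
  rwa [e] at this

end Ends

/-! ### Brackets of operators acting on the ends of open strings -/

theorem sum_cuts_append_singleton {M : Type} [AddCommGroup M] {n : ℕ} (x : Fin n) (W : Word n)
    (F : Word n × Word n → M) :
    ∑ p ∈ cuts (W ++ [x]), F p = ∑ p ∈ cutsND W, F (p.1, p.2 ++ [x]) := by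
  rw [sum_cuts_append (by simp), sum_cuts_cons, sum_cutsDN_nil, add_zero]

section HalfBrackets

variable {Λ n m : ℕ} {M : Type} [AddCommGroup M] [Module ℂ M] {φ : Fin n → Fin m} {z : Fin m}

theorem IsMarker.kd_cons_map (H : IsMarker Λ φ z) (A : Word n) (B : Word m) :
    kd (z :: B) (A.map φ) = 0 := by
  rw [kd_comm, H.kd_map_cons]

theorem IsMarker.kd_map_append (H : IsMarker Λ φ z) (A : Word n) (B : Word m) :
    kd (A.map φ) (B ++ [z]) = 0 :=
  kd_of_ne fun h => H.notMem A (h ▸ by simp)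

theorem IsMarker.kd_append_map (H : IsMarker Λ φ z) (A : Word n) (B : Word m) :
    kd (B ++ [z]) (A.map φ) = 0 := by
  rw [kd_comm, H.kd_map_append]

theorem kd_append_append (A B C : Word n) : kd (A ++ C) (B ++ C) = kd A B :=
  kd_congr_iff (List.append_left_inj C)

theorem IsMarker.eps_append_singleton (H : IsMarker Λ φ z) (W : Word m) :
    eps Λ (W ++ [z]) = eps Λ W := by
  rw [H.eps_append_cons, List.append_nil]

variable (γ f : Word m → Word m → M) (A B C D : Word n)

/-- The half bracket simplifies if words contain the marker, since most overlaps become impossible.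
In the following lemmas the words `A`, `B`, `C`, `D` carry the marker and `K`, `L` do not. -/
theorem IsMarker.half_left_left (H : IsMarker Λ φ z) :
    gammaGammaHalf Λ γ f (z :: A.map φ) (z :: B.map φ) (z :: C.map φ) (z :: D.map φ) =
      kd C B • γ (z :: A.map φ) (z :: D.map φ)
      + ∑ j ∈ cutsDN B, kd C j.1 • γ (z :: A.map φ) (z :: (D ++ j.2).map φ)
      + ∑ k ∈ cutsDN C, kd k.1 B • γ (z :: (A ++ k.2).map φ) (z :: D.map φ) := by
  simp only [gammaGammaHalf, sum_cuts3, sum_cuts_cons, sum_cutsDN_map, sum_cuts_map, kd_cons,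
    kd_self, one_mul, H.kd_map, H.kd_map_cons, H.kd_cons_map, mul_zero, zero_smul,
    Finset.sum_const_zero, add_zero, List.map_append, List.cons_append]
  abel

theorem IsMarker.half_right_right (H : IsMarker Λ φ z) :
    gammaGammaHalf Λ γ f (A.map φ ++ [z]) (B.map φ ++ [z]) (C.map φ ++ [z]) (D.map φ ++ [z]) =
      kd C B • γ (A.map φ ++ [z]) (D.map φ ++ [z])
      + ∑ j ∈ cutsND B, (sgn (eps Λ j.1 * (eps Λ C + eps Λ D)) * kd C j.2) •
          γ (A.map φ ++ [z]) ((j.1 ++ D).map φ ++ [z])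
      + ∑ k ∈ cutsND C, (sgn (eps Λ k.1 * (eps Λ A + eps Λ B)) * kd k.2 B) •
          γ ((k.1 ++ A).map φ ++ [z]) (D.map φ ++ [z]) := by
  simp only [gammaGammaHalf, sum_cuts3', sum_cuts_append_singleton, sum_cutsND_map, sum_cuts_map,
    kd_append_append, H.eps_append_singleton, H.eps_map, H.kd_map, H.kd_map_append,
    H.kd_append_map, mul_zero, zero_mul, zero_smul,
    Finset.sum_const_zero, add_zero, List.map_append, List.append_assoc]

theorem IsMarker.half_left_inner (H : IsMarker Λ φ z) (K L : Word n) :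
    gammaGammaHalf Λ γ f (z :: A.map φ) (z :: B.map φ) (K.map φ) (L.map φ) =
      ∑ j ∈ cutsDN B,
        ((sgn (eps Λ j.1 * (eps Λ K + eps Λ L)) * kd K j.2) •
            γ (z :: A.map φ) (z :: (j.1 ++ L).map φ)
          + ∑ k ∈ cuts K, (sgn (eps Λ j.1 * (eps Λ K + eps Λ L)) * kd k.1 j.2) •
              γ (z :: (A ++ k.2).map φ) (z :: (j.1 ++ L).map φ)
          + ∑ p ∈ cuts j.2, (sgn (eps Λ j.1 * (eps Λ K + eps Λ L)) * kd K p.1) •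
              γ (z :: A.map φ) (z :: (j.1 ++ L ++ p.2).map φ)) := by
  simp only [gammaGammaHalf, sum_cuts3, sum_cuts_cons, sum_cutsDN_map, sum_cuts_map,
    H.eps_cons, H.eps_map, Finset.sum_add_distrib,
    H.kd_map, H.kd_map_cons, mul_zero, zero_smul,
    Finset.sum_const_zero, add_zero, zero_add, List.map_append, List.cons_append]

theorem IsMarker.half_inner_left (H : IsMarker Λ φ z) (K L : Word n) :
    gammaGammaHalf Λ γ f (K.map φ) (L.map φ) (z :: A.map φ) (z :: B.map φ) =
      ∑ i ∈ cutsDN A,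
        ((sgn (eps Λ i.1 * (eps Λ K + eps Λ L)) * kd i.2 L) •
            γ (z :: (i.1 ++ K).map φ) (z :: B.map φ)
          + ∑ l ∈ cuts L, (sgn (eps Λ i.1 * (eps Λ K + eps Λ L)) * kd i.2 l.1) •
              γ (z :: (i.1 ++ K).map φ) (z :: (B ++ l.2).map φ)
          + ∑ p ∈ cuts i.2, (sgn (eps Λ i.1 * (eps Λ K + eps Λ L)) * kd p.1 L) •
              γ (z :: (i.1 ++ K ++ p.2).map φ) (z :: B.map φ)) := by
  simp only [gammaGammaHalf, sum_cuts3, sum_cuts_cons, sum_cutsDN_map, sum_cuts_map,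
    H.eps_cons, H.eps_map, Finset.sum_add_distrib,
    H.kd_map, H.kd_cons_map, mul_zero, zero_mul, zero_smul,
    Finset.sum_const_zero, add_zero, zero_add, List.map_append, List.cons_append]
  rw [Finset.sum_comm (s := cuts L)]

theorem IsMarker.half_right_inner (H : IsMarker Λ φ z) (K L : Word n) :
    gammaGammaHalf Λ γ f (A.map φ ++ [z]) (B.map φ ++ [z]) (K.map φ) (L.map φ) =
      ∑ j ∈ cutsND B,
        (kd K j.1 • γ (A.map φ ++ [z]) ((L ++ j.2).map φ ++ [z])
          + ∑ k ∈ cuts K, (sgn (eps Λ k.1 * (eps Λ A + eps Λ B)) * kd k.2 j.1) •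
              γ ((k.1 ++ A).map φ ++ [z]) ((L ++ j.2).map φ ++ [z])
          + ∑ p ∈ cuts j.1, (sgn (eps Λ p.1 * (eps Λ K + eps Λ L)) * kd K p.2) •
              γ (A.map φ ++ [z]) ((p.1 ++ L ++ j.2).map φ ++ [z])) := by
  simp only [gammaGammaHalf, sum_cuts3', sum_cuts_append_singleton, sum_cutsND_map, sum_cuts_map,
    H.eps_append_singleton, H.eps_map, H.kd_map, H.kd_map_append, Finset.sum_add_distrib,
    mul_zero, zero_mul, zero_smul,
    Finset.sum_const_zero, add_zero, zero_add, List.map_append, List.append_assoc]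

theorem IsMarker.half_inner_right (H : IsMarker Λ φ z) (K L : Word n) :
    gammaGammaHalf Λ γ f (K.map φ) (L.map φ) (A.map φ ++ [z]) (B.map φ ++ [z]) =
      ∑ i ∈ cutsND A,
        (kd i.1 L • γ ((K ++ i.2).map φ ++ [z]) (B.map φ ++ [z])
          + ∑ l ∈ cuts L, (sgn (eps Λ l.1 * (eps Λ A + eps Λ B)) * kd i.1 l.2) •
              γ ((K ++ i.2).map φ ++ [z]) ((l.1 ++ B).map φ ++ [z])
          + ∑ p ∈ cuts i.1, (sgn (eps Λ p.1 * (eps Λ K + eps Λ L)) * kd p.2 L) •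
              γ ((p.1 ++ K ++ i.2).map φ ++ [z]) (B.map φ ++ [z])) := by
  simp only [gammaGammaHalf, sum_cuts3', sum_cuts_append_singleton, sum_cutsND_map, sum_cuts_map,
    H.eps_append_singleton, H.eps_map, H.kd_map, Finset.sum_add_distrib,
    H.kd_append_map, mul_zero, zero_smul,
    Finset.sum_const_zero, add_zero, zero_add, List.map_append, List.append_assoc]
  rw [Finset.sum_comm (s := cuts L)]

end HalfBrackets

section EndBrackets

variable {Λ n : ℕ}

theorem superComm_left_left (hn : 2 * Λ ≤ n) {A B C D : Word n} (hA : A ≠ []) (hB : B ≠ [])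
    (hC : C ≠ []) (hD : D ≠ []) :
    superComm (hetParity Λ n) (hetAct hn (hetL Λ A B)) (hetAct hn (hetL Λ C D)) =
      hetAct hn
        ((kd C B • hetL Λ A D
          + ∑ j ∈ cutsDN B, kd C j.1 • hetL Λ A (D ++ j.2)
          + ∑ k ∈ cutsDN C, kd k.1 B • hetL Λ (A ++ k.2) D)
        - sgn ((eps Λ A + eps Λ B) * (eps Λ C + eps Λ D)) •
          (kd A D • hetL Λ C B
          + ∑ j ∈ cutsDN D, kd A j.1 • hetL Λ C (B ++ j.2)
          + ∑ k ∈ cutsDN A, kd k.1 D • hetL Λ (C ++ k.2) B)) := by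
  have H := isMarker_last hn
  refine superComm_hetAct hn (hetL_mem hn hA hB) (hetL_mem hn hC hD) fun v => ?_
  have h := gOp_gOp_commutator Λ (I := Fin.last n :: A.map Fin.castSucc)
    (J := Fin.last n :: B.map Fin.castSucc) (K := Fin.last n :: C.map Fin.castSucc)
    (L := Fin.last n :: D.map Fin.castSucc) (by simp) (by simp) (by simp) (by simp)
  rw [gammaGamma, H.half_left_left, H.half_left_left] at h
  simp only [H.eps_cons, H.eps_map] at h
  simp only [map_sub, map_add, map_sum, map_smul, markedRep_hetL hn, hA, hB, hC, hD, ne_eq,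
    List.append_eq_nil_iff, false_and, not_false_eq_true]
  rw [← h]
  rfl

theorem superComm_right_right (hn : 2 * Λ ≤ n) {A B C D : Word n} (hA : A ≠ []) (hB : B ≠ [])
    (hC : C ≠ []) (hD : D ≠ []) :
    superComm (hetParity Λ n) (hetAct hn (hetR Λ A B)) (hetAct hn (hetR Λ C D)) =
      hetAct hn
        ((kd C B • hetR Λ A D
          + ∑ j ∈ cutsND B, (sgn (eps Λ j.1 * (eps Λ C + eps Λ D)) * kd C j.2) •
              hetR Λ A (j.1 ++ D)
          + ∑ k ∈ cutsND C, (sgn (eps Λ k.1 * (eps Λ A + eps Λ B)) * kd k.2 B) •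
              hetR Λ (k.1 ++ A) D)
        - sgn ((eps Λ A + eps Λ B) * (eps Λ C + eps Λ D)) •
          (kd A D • hetR Λ C B
          + ∑ j ∈ cutsND D, (sgn (eps Λ j.1 * (eps Λ A + eps Λ B)) * kd A j.2) •
              hetR Λ C (j.1 ++ B)
          + ∑ k ∈ cutsND A, (sgn (eps Λ k.1 * (eps Λ C + eps Λ D)) * kd k.2 D) •
              hetR Λ (k.1 ++ C) B)) := by
  have H := isMarker_last hn
  refine superComm_hetAct hn (hetR_mem hn hA hB) (hetR_mem hn hC hD) fun v => ?_
  have h := gOp_gOp_commutator Λ (I := A.map Fin.castSucc ++ [Fin.last n])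
    (J := B.map Fin.castSucc ++ [Fin.last n]) (K := C.map Fin.castSucc ++ [Fin.last n])
    (L := D.map Fin.castSucc ++ [Fin.last n]) (by simp) (by simp) (by simp) (by simp)
  rw [gammaGamma, H.half_right_right, H.half_right_right] at h
  simp only [H.eps_append_singleton, H.eps_map] at h
  simp only [map_sub, map_add, map_sum, map_smul, markedRep_hetR, hA, hB, hC, hD, ne_eq,
    List.append_eq_nil_iff, and_false, not_false_eq_true]
  rw [← h]
  rfl

theorem superComm_left_inner (hn : 2 * Λ ≤ n) {A B K L : Word n} (hA : A ≠ []) (hB : B ≠ [])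
    (hK : K ≠ []) (hL : L ≠ []) :
    superComm (hetParity Λ n) (hetAct hn (hetL Λ A B)) (hetAct hn (hetGamma Λ K L)) =
      hetAct hn
        (∑ j ∈ cutsDN B,
          ((sgn (eps Λ j.1 * (eps Λ K + eps Λ L)) * kd K j.2) • hetL Λ A (j.1 ++ L)
            + ∑ k ∈ cuts K, (sgn (eps Λ j.1 * (eps Λ K + eps Λ L)) * kd k.1 j.2) •
                hetL Λ (A ++ k.2) (j.1 ++ L)
            + ∑ p ∈ cuts j.2, (sgn (eps Λ j.1 * (eps Λ K + eps Λ L)) * kd K p.1) •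
                hetL Λ A (j.1 ++ L ++ p.2))
        - sgn ((eps Λ A + eps Λ B) * (eps Λ K + eps Λ L)) • ∑ i ∈ cutsDN A,
          ((sgn (eps Λ i.1 * (eps Λ K + eps Λ L)) * kd i.2 L) • hetL Λ (i.1 ++ K) B
            + ∑ l ∈ cuts L, (sgn (eps Λ i.1 * (eps Λ K + eps Λ L)) * kd i.2 l.1) •
                hetL Λ (i.1 ++ K) (B ++ l.2)
            + ∑ p ∈ cuts i.2, (sgn (eps Λ i.1 * (eps Λ K + eps Λ L)) * kd p.1 L) •
                hetL Λ (i.1 ++ K ++ p.2) B)) := by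
  have H := isMarker_last hn
  refine superComm_hetAct hn (hetL_mem hn hA hB) (hetGamma_mem hK hL) fun v => ?_
  have h := gOp_gOp_commutator Λ (I := Fin.last n :: A.map Fin.castSucc)
    (J := Fin.last n :: B.map Fin.castSucc) (K := K.map Fin.castSucc)
    (L := L.map Fin.castSucc) (by simp) (by simp) (by simpa using hK) (by simpa using hL)
  rw [gammaGamma, H.half_left_inner, H.half_inner_left] at h
  simp only [H.eps_cons, H.eps_map] at h
  simp only [map_sub, map_add, map_sum, map_smul, markedRep_hetL hn, hA, hB, hK, hL, ne_eq,
    List.append_eq_nil_iff, false_and, and_false, not_false_eq_true, hetRep_gamma]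
  rw [← h]
  rfl

theorem superComm_right_inner (hn : 2 * Λ ≤ n) {A B K L : Word n} (hA : A ≠ []) (hB : B ≠ [])
    (hK : K ≠ []) (hL : L ≠ []) :
    superComm (hetParity Λ n) (hetAct hn (hetR Λ A B)) (hetAct hn (hetGamma Λ K L)) =
      hetAct hn
        (∑ j ∈ cutsND B,
          (kd K j.1 • hetR Λ A (L ++ j.2)
            + ∑ k ∈ cuts K, (sgn (eps Λ k.1 * (eps Λ A + eps Λ B)) * kd k.2 j.1) •
                hetR Λ (k.1 ++ A) (L ++ j.2)
            + ∑ p ∈ cuts j.1, (sgn (eps Λ p.1 * (eps Λ K + eps Λ L)) * kd K p.2) •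
                hetR Λ A (p.1 ++ L ++ j.2))
        - sgn ((eps Λ A + eps Λ B) * (eps Λ K + eps Λ L)) • ∑ i ∈ cutsND A,
          (kd i.1 L • hetR Λ (K ++ i.2) B
            + ∑ l ∈ cuts L, (sgn (eps Λ l.1 * (eps Λ A + eps Λ B)) * kd i.1 l.2) •
                hetR Λ (K ++ i.2) (l.1 ++ B)
            + ∑ p ∈ cuts i.1, (sgn (eps Λ p.1 * (eps Λ K + eps Λ L)) * kd p.2 L) •
                hetR Λ (p.1 ++ K ++ i.2) B)) := by
  have H := isMarker_last hn
  refine superComm_hetAct hn (hetR_mem hn hA hB) (hetGamma_mem hK hL) fun v => ?_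
  have h := gOp_gOp_commutator Λ (I := A.map Fin.castSucc ++ [Fin.last n])
    (J := B.map Fin.castSucc ++ [Fin.last n]) (K := K.map Fin.castSucc)
    (L := L.map Fin.castSucc) (by simp) (by simp) (by simpa using hK) (by simpa using hL)
  rw [gammaGamma, H.half_right_inner, H.half_inner_right] at h
  simp only [H.eps_append_singleton, H.eps_map] at h
  simp only [map_sub, map_add, map_sum, map_smul, markedRep_hetR, hA, hB, hK, hL, ne_eq,
    List.append_eq_nil_iff, false_and, and_false, not_false_eq_true, hetRep_gamma]
  rw [← h]
  rfl

end EndBrackets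

section Deconcatenation

variable {Λ n : ℕ} {M : Type} [AddCommGroup M]

theorem sum_cutsDD_append' (U V : Word n) (F : Word n × Word n → M) :
    ∑ p ∈ cutsDD (U ++ V), F p =
      ∑ u ∈ cutsDN U, F (u.1, u.2 ++ V) + ∑ v ∈ cutsDD V, F (U ++ v.1, v.2) := by
  rw [sum_cutsDD_append, sum_cutsDD_eq_DN, sum_cutsDD_eq_ND V]
  simp [add_assoc]

theorem sum_cutsDD_cutsND (W : Word n) (F : Word n → Word n → Word n → M) :
    ∑ p ∈ cutsDD W, ∑ q ∈ cutsND p.2, F p.1 q.1 q.2 =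
      ∑ p ∈ cutsDD W, ∑ q ∈ cutsDN p.1, F q.1 q.2 p.2 := by
  simp only [cutsND, cutsDN, Finset.sum_filter]
  exact sum_cutsDD_cutsDD W fun a b c => if b ≠ [] then F a b c else 0

/-- A string `W` that ends in `D`, and becomes `B` when this end is replaced by `C`. -/
theorem sum_kd_kd_append (D C B W : Word n) (c : Word n → ℂ) :
    ∑ w ∈ cutsDD W, c w.1 * kd w.2 D * kd (w.1 ++ C) B =
      ∑ j ∈ cutsDD B, c j.1 * kd C j.2 * kd W (j.1 ++ D) := by
  simp only [kd_append_left, kd_comm W, Finset.mul_sum]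
  rw [Finset.sum_comm]
  refine Finset.sum_congr rfl fun j _ => Finset.sum_congr rfl fun w _ => ?_
  by_cases h : w.1 = j.1
  · rw [h, kd_comm D, kd_self]
    ring
  · rw [kd_of_ne h, kd_of_ne (Ne.symm h)]
    ring

theorem kd_append_append_left {A B C : Word n} (hB : B ≠ []) (V : Word n) :
    kd (A ++ B ++ C) V = ∑ p ∈ cuts3DND V, kd A p.1 * kd B p.2.1 * kd C p.2.2 := by
  rw [sum_cuts3DND, List.append_assoc, kd_append_left]
  refine Finset.sum_congr rfl fun p _ => ?_
  rw [kd_append_left, sum_cutsDD_eq_ND, kd_of_ne hB, zero_mul, zero_add, Finset.mul_sum]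
  exact Finset.sum_congr rfl fun q _ => by ring

end Deconcatenation

section OpenAction

variable {Λ n : ℕ}

theorem hetL_open (hn : 2 * Λ ≤ n) {A B W : Word n} (hA : A ≠ []) (hB : B ≠ []) (hW : W ≠ []) :
    hetAct hn (hetL Λ A B) (hetOpen Λ W) =
      ∑ w ∈ cutsDD W, kd w.1 B • hetOpen Λ (A ++ w.2) := by
  refine hetClosing_injective hn ?_
  rw [hetClosing_hetAct, markedRep_hetL hn hA hB, hetClosing_open hW,
    (isMarker_last hn).gOp_cons_cons]
  simp [hetClosing_open, hA]

theorem hetR_open (hn : 2 * Λ ≤ n) {A B W : Word n} (hA : A ≠ []) (hB : B ≠ []) (hW : W ≠ []) :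
    hetAct hn (hetR Λ A B) (hetOpen Λ W) =
      ∑ w ∈ cutsDD W, (sgn (eps Λ w.1 * (eps Λ A + eps Λ B)) * kd w.2 B) •
        hetOpen Λ (w.1 ++ A) := by
  refine hetClosing_injective hn ?_
  rw [hetClosing_hetAct, markedRep_hetR hA hB, hetClosing_open hW,
    (isMarker_last hn).gOp_append_append]
  simp [hetClosing_open, hA]

theorem hetF_open (hn : 2 * Λ ≤ n) {A B W : Word n} (hA : A ≠ []) (hB : B ≠ []) (hW : W ≠ []) :
    hetAct hn (hetF Λ A B) (hetOpen Λ W) = kd W B • hetOpen Λ A := by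
  refine hetClosing_injective hn ?_
  rw [hetClosing_hetAct, markedRep_hetF hn hA hB, hetClosing_open hW,
    (isMarker_last hn).fOp_cons_cons, map_smul, hetClosing_open hA]

theorem hetL_closed (hn : 2 * Λ ≤ n) {A B W : Word n} (hA : A ≠ []) (hB : B ≠ [])
    (hW : W ≠ []) : hetAct hn (hetL Λ A B) (hetClosed Λ W) = 0 := by
  refine hetClosing_injective hn ?_
  rw [hetClosing_hetAct, markedRep_hetL hn hA hB, hetClosing_closed hW,
    (isMarker_last hn).gOp_psi_map_of_mem _ _ (by simp), map_zero]

theorem hetR_closed (hn : 2 * Λ ≤ n) {A B W : Word n} (hA : A ≠ []) (hB : B ≠ [])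
    (hW : W ≠ []) : hetAct hn (hetR Λ A B) (hetClosed Λ W) = 0 := by
  refine hetClosing_injective hn ?_
  rw [hetClosing_hetAct, markedRep_hetR hA hB, hetClosing_closed hW,
    (isMarker_last hn).gOp_psi_map_of_mem _ _ (by simp), map_zero]

theorem hetF_closed (hn : 2 * Λ ≤ n) {A B W : Word n} (hA : A ≠ []) (hB : B ≠ [])
    (hW : W ≠ []) : hetAct hn (hetF Λ A B) (hetClosed Λ W) = 0 := by
  refine hetClosing_injective hn ?_
  rw [hetClosing_hetAct, markedRep_hetF hn hA hB, hetClosing_closed hW,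
    (isMarker_last hn).fOp_psi_map_of_mem _ _ (by simp), map_zero]

/-- Supercommutators may be computed on generating states. -/
theorem superComm_hetAct_of_states (hn : 2 * Λ ≤ n) {x y z : Heterix Λ n} {a b : ℕ}
    (hx : x ∈ hetGrading Λ n a) (hy : y ∈ hetGrading Λ n b)
    (ho : ∀ W : Word n, W ≠ [] → hetAct hn x (hetAct hn y (hetOpen Λ W))
      - sgn (a * b) • hetAct hn y (hetAct hn x (hetOpen Λ W)) = hetAct hn z (hetOpen Λ W))
    (hc : ∀ W : Word n, W ≠ [] → hetAct hn x (hetAct hn y (hetClosed Λ W))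
      - sgn (a * b) • hetAct hn y (hetAct hn x (hetClosed Λ W)) = hetAct hn z (hetClosed Λ W)) :
    superComm (hetParity Λ n) (hetAct hn x) (hetAct hn y) = hetAct hn z := by
  rw [superComm_of_degree (hetParity_mul_self Λ n) (hasDegree_hetAct hn _ x hx)
    (hasDegree_hetAct hn _ y hy), sgn2_natCast]
  exact hetState_ext ho hc

theorem superComm_full_full (hn : 2 * Λ ≤ n) {A B C D : Word n} (hA : A ≠ []) (hB : B ≠ [])
    (hC : C ≠ []) (hD : D ≠ []) :
    superComm (hetParity Λ n) (hetAct hn (hetF Λ A B)) (hetAct hn (hetF Λ C D)) =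
      hetAct hn (kd C B • hetF Λ A D
        - sgn ((eps Λ A + eps Λ B) * (eps Λ C + eps Λ D)) • kd A D • hetF Λ C B) := by
  refine superComm_hetAct_of_states hn (hetF_mem hn hA hB) (hetF_mem hn hC hD)
    (fun W hW => ?_) fun W hW => ?_
  · simp only [hetF_open hn, hA, hB, hC, hD, hW, map_sub, map_smul, LinearMap.sub_apply,
      LinearMap.smul_apply, ne_eq, not_false_eq_true]
    rw [smul_comm (kd C B), smul_comm (kd A D)]
  · simp [hetF_closed hn, hA, hB, hC, hD, hW]

theorem superComm_full_left (hn : 2 * Λ ≤ n) {A B C D : Word n} (hA : A ≠ []) (hB : B ≠ [])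
    (hC : C ≠ []) (hD : D ≠ []) :
    superComm (hetParity Λ n) (hetAct hn (hetF Λ A B)) (hetAct hn (hetL Λ C D)) =
      hetAct hn (∑ j ∈ cutsDD B, kd C j.1 • hetF Λ A (D ++ j.2)
        - sgn ((eps Λ A + eps Λ B) * (eps Λ C + eps Λ D)) •
          ∑ i ∈ cutsDD A, kd i.1 D • hetF Λ (C ++ i.2) B) := by
  refine superComm_hetAct_of_states hn (hetF_mem hn hA hB) (hetL_mem hn hC hD)
    (fun W hW => ?_) fun W hW => ?_
  · simp only [hetF_open hn, hetL_open hn, hA, hB, hC, hD, hW, map_sub, map_smul, map_sum,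
      LinearMap.sub_apply, LinearMap.smul_apply, LinearMap.sum_apply, ne_eq, not_false_eq_true,
      List.append_eq_nil_iff, false_and, smul_smul]
    rw [← Finset.sum_smul, ← Finset.sum_smul]
    refine congrArg₂ (· - ·) (congrArg (· • _) ?_) ?_
    · simp only [kd_append_left, kd_comm W, Finset.mul_sum]
      rw [Finset.sum_comm]
      refine Finset.sum_congr rfl fun j _ => Finset.sum_congr rfl fun w _ => ?_
      rw [kd_comm D, kd_comm j.2]
      ring
    · rw [Finset.smul_sum, Finset.smul_sum]
      refine Finset.sum_congr rfl fun i _ => ?_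
      rw [smul_smul, smul_smul]
      exact congrArg (· • _) (by ring)
  · simp [hetF_closed hn, hetL_closed hn, hA, hB, hC, hD, hW]

theorem superComm_full_right (hn : 2 * Λ ≤ n) {A B C D : Word n} (hA : A ≠ []) (hB : B ≠ [])
    (hC : C ≠ []) (hD : D ≠ []) :
    superComm (hetParity Λ n) (hetAct hn (hetF Λ A B)) (hetAct hn (hetR Λ C D)) =
      hetAct hn (∑ j ∈ cutsDD B, (sgn (eps Λ j.1 * (eps Λ C + eps Λ D)) * kd C j.2) •
          hetF Λ A (j.1 ++ D)
        - sgn ((eps Λ A + eps Λ B) * (eps Λ C + eps Λ D)) •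
          ∑ i ∈ cutsDD A, (sgn (eps Λ i.1 * (eps Λ C + eps Λ D)) * kd i.2 D) •
            hetF Λ (i.1 ++ C) B) := by
  refine superComm_hetAct_of_states hn (hetF_mem hn hA hB) (hetR_mem hn hC hD)
    (fun W hW => ?_) fun W hW => ?_
  · simp only [hetF_open hn, hetR_open hn, hA, hB, hC, hD, hW, map_sub, map_smul, map_sum,
      LinearMap.sub_apply, LinearMap.smul_apply, LinearMap.sum_apply, ne_eq, not_false_eq_true,
      List.append_eq_nil_iff, and_false, smul_smul]
    rw [← Finset.sum_smul, ← Finset.sum_smul, sum_kd_kd_append D C B W fun w =>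
      sgn (eps Λ w * (eps Λ C + eps Λ D)), Finset.smul_sum, Finset.smul_sum]
    refine congrArg₂ (· - ·) rfl (Finset.sum_congr rfl fun i _ => ?_)
    rw [smul_smul, smul_smul]
    exact congrArg (· • _) (by ring)
  · simp [hetF_closed hn, hetR_closed hn, hA, hB, hC, hD, hW]

theorem superComm_full_inner (hn : 2 * Λ ≤ n) {A B K L : Word n} (hA : A ≠ []) (hB : B ≠ [])
    (hK : K ≠ []) (hL : L ≠ []) :
    superComm (hetParity Λ n) (hetAct hn (hetF Λ A B)) (hetAct hn (hetGamma Λ K L)) =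
      hetAct hn (∑ j ∈ cuts3DND B, (sgn (eps Λ j.1 * (eps Λ K + eps Λ L)) * kd K j.2.1) •
          hetF Λ A (j.1 ++ L ++ j.2.2)
        - sgn ((eps Λ A + eps Λ B) * (eps Λ K + eps Λ L)) •
          ∑ i ∈ cuts3DND A, (sgn (eps Λ i.1 * (eps Λ K + eps Λ L)) * kd i.2.1 L) •
            hetF Λ (i.1 ++ K ++ i.2.2) B) := by
  refine superComm_hetAct_of_states hn (hetF_mem hn hA hB) (hetGamma_mem hK hL)
    (fun W hW => ?_) fun W hW => ?_
  · simp only [hetF_open hn, (isHeterixAction_hetAct hn).gamma_open, gammaOpen, hA, hB, hK, hL,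
      hW, map_sub, map_smul, map_sum, LinearMap.sub_apply, LinearMap.smul_apply,
      LinearMap.sum_apply, ne_eq, not_false_eq_true, List.append_eq_nil_iff, and_false, false_and,
      smul_smul]
    rw [← Finset.sum_smul, ← Finset.sum_smul]
    refine congrArg₂ (· - ·) (congrArg (· • _) ?_) ?_
    · simp only [kd_append_append_left hK, kd_comm W, kd_append_append_left hL, Finset.mul_sum]
      rw [Finset.sum_comm]
      refine Finset.sum_congr rfl fun j _ => Finset.sum_congr rfl fun w _ => ?_
      by_cases h : w.1 = j.1
      · rw [h, kd_comm L, kd_comm j.2.2]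
        ring
      · rw [kd_of_ne h, kd_of_ne (Ne.symm h)]
        ring
    · rw [Finset.smul_sum, Finset.smul_sum]
      refine Finset.sum_congr rfl fun i _ => ?_
      rw [smul_smul, smul_smul]
      exact congrArg (· • _) (by ring)
  · have h : hetAct hn (hetF Λ A B) (gammaClosed Λ (hetClosed Λ) K L W) = 0 := by
      rw [map_gammaClosed, gammaClosed_congr (s' := fun _ => 0)
        (fun V hV => hetF_closed hn hA hB hV) hK]
      simp [gammaClosed]
    simp [hetF_closed hn, (isHeterixAction_hetAct hn).gamma_closed, h, hA, hB, hK, hL, hW]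

/-- Both operators change a given open string independently as long as the parts they replace do not
overlap. An overlap determines the whole string, which leaves operators `f'`. -/
theorem superComm_left_right (hn : 2 * Λ ≤ n) {A B C D : Word n} (hA : A ≠ []) (hB : B ≠ [])
    (hC : C ≠ []) (hD : D ≠ []) :
    superComm (hetParity Λ n) (hetAct hn (hetL Λ A B)) (hetAct hn (hetR Λ C D)) =
      hetAct hn
        (∑ j ∈ cutsDD B, ∑ k ∈ cutsDD C, (sgn (eps Λ j.1 * (eps Λ C + eps Λ D)) * kd k.1 j.2) •
          hetF Λ (A ++ k.2) (j.1 ++ D)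
        - sgn ((eps Λ A + eps Λ B) * (eps Λ C + eps Λ D)) •
          ∑ i ∈ cutsDD A, ∑ l ∈ cutsDD D, (sgn (eps Λ i.1 * (eps Λ C + eps Λ D)) * kd i.2 l.1) •
            hetF Λ (i.1 ++ C) (B ++ l.2)) := by
  refine superComm_hetAct_of_states hn (hetL_mem hn hA hB) (hetR_mem hn hC hD)
    (fun W hW => ?_) fun W hW => ?_
  · simp only [hetF_open hn, hetL_open hn, hetR_open hn, hA, hB, hC, hD, hW, map_sub, map_smul,
      map_sum, LinearMap.sub_apply, LinearMap.smul_apply, LinearMap.sum_apply, ne_eq,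
      not_false_eq_true, List.append_eq_nil_iff, and_false, false_and, smul_smul]
    -- Where the two ends do not overlap, the operators supercommute.
    have h1 : ∑ w ∈ cutsDD W, (sgn (eps Λ w.1 * (eps Λ C + eps Λ D)) * kd w.2 D) •
        ∑ v ∈ cutsDD (w.1 ++ C), kd v.1 B • hetOpen Λ (A ++ v.2) =
        ∑ w ∈ cutsDD W, ∑ u ∈ cutsDN w.1,
          (sgn (eps Λ (u.1 ++ u.2) * (eps Λ C + eps Λ D)) * kd w.2 D * kd u.1 B) •
            hetOpen Λ (A ++ (u.2 ++ C)) +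
        ∑ j ∈ cutsDD B, ∑ k ∈ cutsDD C, (sgn (eps Λ j.1 * (eps Λ C + eps Λ D)) * kd k.1 j.2 *
          kd W (j.1 ++ D)) • hetOpen Λ (A ++ k.2) := by
      rw [Finset.sum_comm (s := cutsDD B)]
      have : ∀ k ∈ cutsDD C, ∑ j ∈ cutsDD B, (sgn (eps Λ j.1 * (eps Λ C + eps Λ D)) *
          kd k.1 j.2 * kd W (j.1 ++ D)) • hetOpen Λ (A ++ k.2) =
          ∑ w ∈ cutsDD W, (sgn (eps Λ w.1 * (eps Λ C + eps Λ D)) * kd w.2 D *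
            kd (w.1 ++ k.1) B) • hetOpen Λ (A ++ k.2) := fun k _ => by
        rw [← Finset.sum_smul, ← Finset.sum_smul, sum_kd_kd_append D k.1 B W fun w =>
          sgn (eps Λ w * (eps Λ C + eps Λ D))]
      rw [Finset.sum_congr rfl this, Finset.sum_comm (s := cutsDD C), ← Finset.sum_add_distrib]
      refine Finset.sum_congr rfl fun w _ => ?_
      rw [sum_cutsDD_append', smul_add, Finset.smul_sum, Finset.smul_sum]
      congr 1
      · refine Finset.sum_congr rfl fun u hu => ?_
        rw [smul_smul, (mem_cutsDN.1 hu).1]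
      · exact Finset.sum_congr rfl fun u hu => by rw [smul_smul]
    have h2 : sgn ((eps Λ A + eps Λ B) * (eps Λ C + eps Λ D)) •
        ∑ w ∈ cutsDD W, kd w.1 B • ∑ v ∈ cutsDD (A ++ w.2),
          (sgn (eps Λ v.1 * (eps Λ C + eps Λ D)) * kd v.2 D) • hetOpen Λ (v.1 ++ C) =
        ∑ w ∈ cutsDD W, ∑ u ∈ cutsDN w.1,
          (sgn (eps Λ (u.1 ++ u.2) * (eps Λ C + eps Λ D)) * kd w.2 D * kd u.1 B) •
            hetOpen Λ (A ++ (u.2 ++ C)) +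
        sgn ((eps Λ A + eps Λ B) * (eps Λ C + eps Λ D)) •
          ∑ i ∈ cutsDD A, ∑ l ∈ cutsDD D, (sgn (eps Λ i.1 * (eps Λ C + eps Λ D)) *
            kd i.2 l.1 * kd W (B ++ l.2)) • hetOpen Λ (i.1 ++ C) := by
      rw [← sum_cutsDD_cutsND W fun a b c =>
        (sgn (eps Λ (a ++ b) * (eps Λ C + eps Λ D)) * kd c D * kd a B) •
          hetOpen Λ (A ++ (b ++ C))]
      have : ∀ i ∈ cutsDD A, ∑ l ∈ cutsDD D, (sgn (eps Λ i.1 * (eps Λ C + eps Λ D)) *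
          kd i.2 l.1 * kd W (B ++ l.2)) • hetOpen Λ (i.1 ++ C) =
          ∑ w ∈ cutsDD W, (kd w.1 B * (sgn (eps Λ i.1 * (eps Λ C + eps Λ D)) *
            kd (i.2 ++ w.2) D)) • hetOpen Λ (i.1 ++ C) := fun i _ => by
        rw [← Finset.sum_smul, ← Finset.sum_smul]
        congr 1
        simp only [kd_append_left, kd_comm W, Finset.mul_sum]
        rw [Finset.sum_comm]
        refine Finset.sum_congr rfl fun w _ => Finset.sum_congr rfl fun l _ => ?_
        rw [kd_comm B, kd_comm l.2]
        ring
      rw [Finset.sum_congr rfl this, Finset.sum_comm (s := cutsDD A), Finset.smul_sum,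
        Finset.smul_sum, ← Finset.sum_add_distrib]
      refine Finset.sum_congr rfl fun w _ => ?_
      rw [sum_cutsDD_append, smul_add, smul_add, Finset.smul_sum, Finset.smul_sum,
        Finset.smul_sum, Finset.smul_sum, Finset.smul_sum, add_comm]
      congr 1
      · refine Finset.sum_congr rfl fun u hu => ?_
        rw [smul_smul, smul_smul, List.append_assoc]
        refine congrArg (· • _) ?_
        by_cases h : w.1 = B
        · rw [h, kd_self, mul_one, mul_one, ← mul_assoc, sgn_mul]
          refine congrArg (· * _) (sgn_congr ?_)
          simp only [Nat.cast_add, Nat.cast_mul, cast_eps_append]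
          grind
        · rw [kd_of_ne h]
          ring
      · exact Finset.sum_congr rfl fun u hu => by
          rw [smul_smul, smul_smul, smul_smul, mul_assoc]
    rw [h1, h2]
    simp only [Finset.smul_sum]
    abel
  · simp [hetF_closed hn, hetL_closed hn, hetR_closed hn, hA, hB, hC, hD, hW]

end OpenAction

/-! ### Realization of the grand string superalgebra -/

section Letters

variable {Λ ΛF : ℕ}

/-- For words in the first `2 * Λ` letters, every additional letter can serve as a marker. -/
theorem isMarker_left (a : Fin (2 * ΛF)) :
    IsMarker Λ (Fin.castAdd (4 * ΛF) : Fin (2 * Λ) → _) (leftLetter a) where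
  val _ := rfl
  ne x h := by
    have := congrArg Fin.val h
    simp only [leftLetter, Fin.val_castAdd] at this
    omega
  le := by simp [leftLetter]

theorem isMarker_right (a : Fin (2 * ΛF)) :
    IsMarker Λ (Fin.castAdd (4 * ΛF) : Fin (2 * Λ) → _) (rightLetter a) where
  val _ := rfl
  ne x h := by
    have := congrArg Fin.val h
    simp only [rightLetter, Fin.val_castAdd] at this
    omega
  le := by
    simp only [rightLetter]
    omega

theorem two_mul_le (Λ ΛF : ℕ) : 2 * Λ ≤ 2 * Λ + 4 * ΛF := Nat.le_add_right _ _

@[simp] theorem kd_left_left (a b : Fin (2 * ΛF)) :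
    kd (leftLetter (Λ := Λ) a) (leftLetter b) = kd a b :=
  kd_congr_iff (by simp [leftLetter, Fin.ext_iff])

@[simp] theorem kd_right_right (a b : Fin (2 * ΛF)) :
    kd (rightLetter (Λ := Λ) a) (rightLetter b) = kd a b :=
  kd_congr_iff (by simp [rightLetter, Fin.ext_iff])

@[simp] theorem kd_left_right (a b : Fin (2 * ΛF)) :
    kd (leftLetter (Λ := Λ) a) (rightLetter b) = 0 :=
  kd_of_ne fun h => by
    have := congrArg Fin.val h
    simp only [leftLetter, rightLetter] at this
    omega

@[simp] theorem kd_right_left (a b : Fin (2 * ΛF)) :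
    kd (rightLetter (Λ := Λ) a) (leftLetter b) = 0 := by
  rw [kd_comm, kd_left_right]

variable (A B : Word (2 * Λ)) (a b c d : Fin (2 * ΛF)) (W : Word (2 * Λ + 4 * ΛF))

@[simp] theorem emb_nil : emb (ΛF := ΛF) ([] : Word (2 * Λ)) = [] := rfl

@[simp] theorem emb_append : emb (ΛF := ΛF) (A ++ B) = emb A ++ emb B := List.map_append

@[simp] theorem emb_eq_nil : emb (ΛF := ΛF) A = [] ↔ A = [] := List.map_eq_nil_iff

@[simp] theorem eps_emb : eps Λ (emb (ΛF := ΛF) A) = eps Λ A := 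
  eps_map Λ (φ := Fin.castAdd (4 * ΛF)) (fun _ => rfl) A

@[simp] theorem eps_left_cons : eps Λ (leftLetter a :: W) = eps Λ W :=
  (isMarker_left a).eps_cons W

@[simp] theorem eps_append_right : eps Λ (W ++ [rightLetter a]) = eps Λ W :=
  (isMarker_right a).eps_append_singleton W

@[simp] theorem kd_emb : kd (emb (ΛF := ΛF) A) (emb B) = kd A B :=
  kd_map (Fin.castAdd_injective _ _) A B

@[simp] theorem kd_emb_left : kd (emb A) (leftLetter a :: W) = 0 :=
  (isMarker_left a).kd_map_cons A W

@[simp] theorem kd_left_emb : kd (leftLetter a :: W) (emb A) = 0 :=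
  (isMarker_left a).kd_cons_map A W

@[simp] theorem kd_emb_right : kd (emb A) (W ++ [rightLetter a]) = 0 :=
  (isMarker_right a).kd_map_append A W

@[simp] theorem kd_right_emb : kd (W ++ [rightLetter a]) (emb A) = 0 :=
  (isMarker_right a).kd_append_map A W

@[simp] theorem kd_append_right_right :
    kd (emb A ++ [rightLetter a]) (emb B ++ [rightLetter b]) = kd A B * kd a b := by
  by_cases h : a = b
  · rw [h, kd_append_append, kd_emb, kd_self, mul_one]
  · rw [kd_of_ne h, mul_zero, kd_of_ne]
    intro h'
    have := (List.append_inj' h' rfl).2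
    simp only [List.cons.injEq, rightLetter, Fin.mk.injEq, and_true] at this
    exact h (Fin.ext (by omega))

@[simp] theorem kd_emb_append_left :
    kd (emb A ++ [rightLetter a]) (leftLetter b :: W) = 0 := by
  cases A with
  | nil => simp
  | cons x A => simp [emb, kd_of_ne ((isMarker_left b).ne x)]

@[simp] theorem kd_left_emb_append :
    kd (leftLetter b :: W) (emb A ++ [rightLetter a]) = 0 := by
  rw [kd_comm, kd_emb_append_left]

@[simp] theorem kd_append_right_nil : kd (W ++ [rightLetter a]) [] = 0 := kd_of_ne (by simp)

@[simp] theorem kd_nil_append_right : kd [] (W ++ [rightLetter a]) = 0 :=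
  kd_of_ne (Ne.symm (by simp))

variable {M : Type} [AddCommGroup M]

theorem sum_cutsDD_emb (F : Word (2 * Λ + 4 * ΛF) × Word (2 * Λ + 4 * ΛF) → M) :
    ∑ p ∈ cutsDD (emb A), F p = ∑ p ∈ cutsDD A, F (emb p.1, emb p.2) := sum_cutsDD_map A F

theorem sum_cutsDN_emb (F : Word (2 * Λ + 4 * ΛF) × Word (2 * Λ + 4 * ΛF) → M) :
    ∑ p ∈ cutsDN (emb A), F p = ∑ p ∈ cutsDN A, F (emb p.1, emb p.2) := sum_cutsDN_map A F

theorem sum_cutsND_emb (F : Word (2 * Λ + 4 * ΛF) × Word (2 * Λ + 4 * ΛF) → M) :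
    ∑ p ∈ cutsND (emb A), F p = ∑ p ∈ cutsND A, F (emb p.1, emb p.2) := sum_cutsND_map A F

theorem sum_cuts_emb (F : Word (2 * Λ + 4 * ΛF) × Word (2 * Λ + 4 * ΛF) → M) :
    ∑ p ∈ cuts (emb A), F p = ∑ p ∈ cuts A, F (emb p.1, emb p.2) := sum_cuts_map A F

end Letters

section Realize

variable {Λ ΛF : ℕ} {M : Type} [AddCommGroup M] [Module ℂ M]

theorem grand_ext {F G : Grand Λ ΛF →ₗ[ℂ] M}
    (h1 : ∀ a b I J c d, F (op1 a b I J c d) = G (op1 a b I J c d))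
    (h2 : ∀ a b I J, F (op2 a b I J) = G (op2 a b I J))
    (h3 : ∀ I J c d, F (op3 I J c d) = G (op3 I J c d))
    (h4 : ∀ I J, I ≠ [] → J ≠ [] → F (op4 I J) = G (op4 I J))
    (h5 : ∀ I J, I ≠ [] → J ≠ [] → F (op5 I J) = G (op5 I J)) : F = G := by
  refine LinearMap.prod_ext (Finsupp.lhom_ext' fun W => LinearMap.ext_ring (h1 _ _ _ _ _ _)) ?_
  refine LinearMap.prod_ext (Finsupp.lhom_ext' fun W => LinearMap.ext_ring (h2 _ _ _ _)) ?_
  refine LinearMap.prod_ext (Finsupp.lhom_ext' fun W => LinearMap.ext_ring (h3 _ _ _ _)) ?_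
  exact LinearMap.prod_ext (fourth_ext h4) (fifth_ext h5)

theorem grand_mem {R : Submodule ℂ M} {F : Grand Λ ΛF →ₗ[ℂ] M}
    (h1 : ∀ a b I J c d, F (op1 a b I J c d) ∈ R)
    (h2 : ∀ a b I J, F (op2 a b I J) ∈ R)
    (h3 : ∀ I J c d, F (op3 I J c d) ∈ R)
    (h4 : ∀ I J, I ≠ [] → J ≠ [] → F (op4 I J) ∈ R)
    (h5 : ∀ I J, I ≠ [] → J ≠ [] → F (op5 I J) ∈ R) (x : Grand Λ ΛF) : F x ∈ R := by
  have : R.mkQ ∘ₗ F = 0 := grand_ext (fun _ _ _ _ _ _ => by simpa using h1 _ _ _ _ _ _)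
    (fun _ _ _ _ => by simpa using h2 _ _ _ _) (fun _ _ _ _ => by simpa using h3 _ _ _ _)
    (fun I J hI hJ => by simpa using h4 I J hI hJ) (fun I J hI hJ => by simpa using h5 I J hI hJ)
  simpa using LinearMap.congr_fun this x

/-- The linear map identifying operators with elements of the heterix superalgebra. -/
def grandIota (Λ ΛF : ℕ) : Grand Λ ΛF →ₗ[ℂ] Heterix Λ (2 * Λ + 4 * ΛF) :=
  LinearMap.coprod
    (Finsupp.lift _ ℂ _ fun p => hetF Λ
      (leftLetter p.1 :: (emb p.2.2.1 ++ [rightLetter p.2.2.2.2.1]))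
      (leftLetter p.2.1 :: (emb p.2.2.2.1 ++ [rightLetter p.2.2.2.2.2])))
  (LinearMap.coprod
    (Finsupp.lift _ ℂ _ fun p => hetL Λ (leftLetter p.1 :: emb p.2.2.1)
      (leftLetter p.2.1 :: emb p.2.2.2))
  (LinearMap.coprod
    (Finsupp.lift _ ℂ _ fun p => hetR Λ (emb p.1 ++ [rightLetter p.2.2.1])
      (emb p.2.1 ++ [rightLetter p.2.2.2]))
  (LinearMap.coprod
    (fourthLift fun I J => hetGamma Λ (emb I) (emb J))
    (fifthLift (fun I J => hetFifth Λ (emb I) (emb J))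
      (fun A B J => Prod.ext (by simp [hetFifth]) (by
        simp [hetFifth, fifthVec_append_comm_left (emb A) (emb B)]))
      (fun I A B => Prod.ext (by simp [hetFifth]) (by
        simp [hetFifth, fifthVec_append_comm_right _ (emb A) (emb B)]))))))

theorem isRealization_grandIota (Λ ΛF : ℕ) : IsRealization Λ ΛF (grandIota Λ ΛF) where
  first a b I J c d := by simp [grandIota, op1]
  second a b I J := by simp [grandIota, op2]
  third I J c d := by simp [grandIota, op3]
  fourth I J hI hJ := by simp [grandIota, op4, fourthLift_fourthVec _ hI hJ]
  fifth I J hI hJ := by simp [grandIota, op5, fifthLift_fifthVec _ _ hI hJ]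

theorem IsRealization.unique {ι ι' : Grand Λ ΛF →ₗ[ℂ] Heterix Λ (2 * Λ + 4 * ΛF)}
    (h : IsRealization Λ ΛF ι) (h' : IsRealization Λ ΛF ι') : ι = ι' :=
  grand_ext (fun a b I J c d => by rw [h.first, h'.first])
    (fun a b I J => by rw [h.second, h'.second]) (fun I J c d => by rw [h.third, h'.third])
    (fun I J hI hJ => by rw [h.fourth I J hI hJ, h'.fourth I J hI hJ])
    (fun I J hI hJ => by rw [h.fifth I J hI hJ, h'.fifth I J hI hJ])

/-- The operators of the grand string superalgebra on the singlet states of the heterix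
superalgebra. -/
def grandRep (Λ ΛF : ℕ) : Grand Λ ΛF →ₗ[ℂ] Module.End ℂ (HetState Λ (2 * Λ + 4 * ΛF)) :=
  hetAct (two_mul_le Λ ΛF) ∘ₗ grandIota Λ ΛF

theorem grandRep_op1 (a b : Fin (2 * ΛF)) (I J : Word (2 * Λ)) (c d : Fin (2 * ΛF)) :
    grandRep Λ ΛF (op1 a b I J c d) = hetAct (two_mul_le Λ ΛF)
      (hetF Λ (leftLetter a :: (emb I ++ [rightLetter c]))
        (leftLetter b :: (emb J ++ [rightLetter d]))) :=
  congrArg _ ((isRealization_grandIota Λ ΛF).first a b I J c d)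

theorem grandRep_op2 (a b : Fin (2 * ΛF)) (I J : Word (2 * Λ)) :
    grandRep Λ ΛF (op2 a b I J) = hetAct (two_mul_le Λ ΛF)
      (hetL Λ (leftLetter a :: emb I) (leftLetter b :: emb J)) :=
  congrArg _ ((isRealization_grandIota Λ ΛF).second a b I J)

theorem grandRep_op3 (I J : Word (2 * Λ)) (c d : Fin (2 * ΛF)) :
    grandRep Λ ΛF (op3 I J c d) = hetAct (two_mul_le Λ ΛF)
      (hetR Λ (emb I ++ [rightLetter c]) (emb J ++ [rightLetter d])) :=
  congrArg _ ((isRealization_grandIota Λ ΛF).third I J c d)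

theorem grandRep_op4 {I J : Word (2 * Λ)} (hI : I ≠ []) (hJ : J ≠ []) :
    grandRep Λ ΛF (op4 I J) = hetAct (two_mul_le Λ ΛF) (hetGamma Λ (emb I) (emb J)) :=
  congrArg _ ((isRealization_grandIota Λ ΛF).fourth I J hI hJ)

theorem grandRep_op5 {I J : Word (2 * Λ)} (hI : I ≠ []) (hJ : J ≠ []) :
    grandRep Λ ΛF (op5 I J) = hetAct (two_mul_le Λ ΛF) (hetFifth Λ (emb I) (emb J)) :=
  congrArg _ ((isRealization_grandIota Λ ΛF).fifth I J hI hJ)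

end Realize

/-! ### Superbrackets of the five kinds of operators -/

section GrandBrackets

variable {Λ ΛF : ℕ}

theorem sum_cutsND_singleton {n : ℕ} {M : Type} [AddCommGroup M] (x : Fin n)
    (F : Word n × Word n → M) : ∑ p ∈ cutsND [x], F p = F ([x], []) := by
  rw [sum_cutsND_cons, sum_cutsDD_nil]

variable (Λ ΛF) in
/-- The supercommutator of operators on the singlet states of the heterix superalgebra. -/
abbrev stateComm := superComm (hetParity Λ (2 * Λ + 4 * ΛF))

variable (I J K L : Word (2 * Λ)) (l₁ l₂ l₃ l₄ l₅ l₆ l₇ l₈ : Fin (2 * ΛF))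

theorem stateComm_first_first :
    stateComm Λ ΛF (grandRep Λ ΛF (op1 l₁ l₂ I J l₃ l₄)) (grandRep Λ ΛF (op1 l₅ l₆ K L l₇ l₈)) =
      grandRep Λ ΛF ((kd l₅ l₂ * kd K J * kd l₇ l₄) • op1 l₁ l₆ I L l₃ l₈
      - (sgn ((eps Λ I + eps Λ J) * (eps Λ K + eps Λ L)) * kd l₁ l₆ * kd I L * kd l₃ l₈) •
        op1 l₅ l₂ K J l₇ l₄) := by
  rw [grandRep_op1, grandRep_op1, superComm_full_full _ (by simp) (by simp) (by simp) (by simp)]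
  refine congrArg (hetAct _) ?_
  simp only [map_sub, map_smul, (isRealization_grandIota Λ ΛF).first, eps_left_cons,
    eps_append_right, eps_emb, kd_cons, kd_left_left, kd_append_right_right, smul_smul, mul_assoc]

theorem stateComm_first_second :
    stateComm Λ ΛF (grandRep Λ ΛF (op1 l₁ l₂ I J l₃ l₄)) (grandRep Λ ΛF (op2 l₅ l₆ K L)) =
      grandRep Λ ΛF (kd l₅ l₂ • ∑ j ∈ cutsDD J, kd K j.1 • op1 l₁ l₆ I (L ++ j.2) l₃ l₄
      - (sgn ((eps Λ I + eps Λ J) * (eps Λ K + eps Λ L)) * kd l₁ l₆) •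
        ∑ i ∈ cutsDD I, kd i.1 L • op1 l₅ l₂ (K ++ i.2) J l₃ l₄) := by
  rw [grandRep_op1, grandRep_op2, superComm_full_left _ (by simp) (by simp) (by simp) (by simp)]
  refine congrArg (hetAct _) ?_
  simp only [map_sub, map_smul, map_sum, (isRealization_grandIota Λ ΛF).first, eps_left_cons,
    eps_append_right, eps_emb, sum_cutsDD_cons, sum_cutsDD_append, sum_cutsND_singleton,
    sum_cutsDD_emb, kd_cons, kd_left_left, kd_cons_nil, kd_nil_cons, kd_emb, kd_emb_right,
    kd_right_emb, mul_zero, zero_smul, zero_add, add_zero, List.cons_append, List.append_assoc,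
    emb_append, Finset.smul_sum, smul_smul, mul_assoc]

theorem stateComm_first_third :
    stateComm Λ ΛF (grandRep Λ ΛF (op1 l₁ l₂ I J l₃ l₄)) (grandRep Λ ΛF (op3 K L l₅ l₆)) =
      grandRep Λ ΛF (kd l₅ l₄ • ∑ j ∈ cutsDD J,
        (sgn (eps Λ j.1 * (eps Λ K + eps Λ L)) * kd K j.2) • op1 l₁ l₂ I (j.1 ++ L) l₃ l₆
      - (sgn ((eps Λ I + eps Λ J) * (eps Λ K + eps Λ L)) * kd l₃ l₆) •
        ∑ i ∈ cutsDD I,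
          (sgn (eps Λ i.1 * (eps Λ K + eps Λ L)) * kd i.2 L) • op1 l₁ l₂ (i.1 ++ K) J l₅ l₄) := by
  rw [grandRep_op1, grandRep_op3, superComm_full_right _ (by simp) (by simp) (by simp) (by simp)]
  refine congrArg (hetAct _) ?_
  simp only [map_sub, map_smul, map_sum, (isRealization_grandIota Λ ΛF).first, eps_left_cons,
    eps_append_right, eps_emb, sum_cutsDD_cons, sum_cutsDD_append, sum_cutsND_singleton,
    sum_cutsDD_emb, kd_emb_append_left, kd_left_emb_append, kd_append_right_right,
    kd_append_right_nil, kd_nil_append_right, zero_mul, zero_smul, zero_add,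
    add_zero, List.cons_append, List.append_assoc, emb_append, Finset.smul_sum, smul_smul,
    mul_assoc,
    mul_comm, mul_left_comm]

theorem stateComm_second_second :
    stateComm Λ ΛF (grandRep Λ ΛF (op2 l₁ l₂ I J)) (grandRep Λ ΛF (op2 l₃ l₄ K L)) =
      grandRep Λ ΛF (kd l₃ l₂ •
        (kd K J • op2 l₁ l₄ I L
          + ∑ j ∈ cutsDN J, kd K j.1 • op2 l₁ l₄ I (L ++ j.2)
          + ∑ k ∈ cutsDN K, kd k.1 J • op2 l₁ l₄ (I ++ k.2) L)
      - (sgn ((eps Λ I + eps Λ J) * (eps Λ K + eps Λ L)) * kd l₁ l₄) •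
        (kd I L • op2 l₃ l₂ K J
          + ∑ l ∈ cutsDN L, kd I l.1 • op2 l₃ l₂ K (J ++ l.2)
          + ∑ i ∈ cutsDN I, kd i.1 L • op2 l₃ l₂ (K ++ i.2) J)) := by
  rw [grandRep_op2, grandRep_op2, superComm_left_left _ (by simp) (by simp) (by simp) (by simp)]
  refine congrArg (hetAct _) ?_
  simp only [map_sub, map_smul, map_add, map_sum, (isRealization_grandIota Λ ΛF).second,
    eps_left_cons, eps_emb, sum_cutsDN_cons, sum_cutsDN_emb, kd_cons, kd_left_left, kd_cons_nil,
    kd_nil_cons, kd_emb, zero_smul, zero_add, List.cons_append,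
    emb_append, smul_add, Finset.smul_sum, smul_smul, mul_assoc]

theorem stateComm_third_third :
    stateComm Λ ΛF (grandRep Λ ΛF (op3 I J l₁ l₂)) (grandRep Λ ΛF (op3 K L l₃ l₄)) =
      grandRep Λ ΛF (kd l₃ l₂ •
        (kd K J • op3 I L l₁ l₄
          + ∑ j ∈ cutsND J,
              (sgn (eps Λ j.1 * (eps Λ K + eps Λ L)) * kd K j.2) • op3 I (j.1 ++ L) l₁ l₄
          + ∑ k ∈ cutsND K,
              (sgn (eps Λ k.1 * (eps Λ I + eps Λ J)) * kd k.2 J) • op3 (k.1 ++ I) L l₁ l₄)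
      - (sgn ((eps Λ I + eps Λ J) * (eps Λ K + eps Λ L)) * kd l₁ l₄) •
        (kd I L • op3 K J l₃ l₂
          + ∑ l ∈ cutsND L,
              (sgn (eps Λ l.1 * (eps Λ I + eps Λ J)) * kd I l.2) • op3 K (l.1 ++ J) l₃ l₂
          + ∑ i ∈ cutsND I,
              (sgn (eps Λ i.1 * (eps Λ K + eps Λ L)) * kd i.2 L) • op3 (i.1 ++ K) J l₃ l₂)) := by
  rw [grandRep_op3, grandRep_op3, superComm_right_right _ (by simp) (by simp) (by simp) (by simp)]
  refine congrArg (hetAct _) ?_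
  simp only [map_sub, map_smul, map_add, map_sum, (isRealization_grandIota Λ ΛF).third,
    eps_append_right, eps_emb, sum_cutsND_append, sum_cutsND_singleton, sum_cutsND_emb,
    kd_append_right_right, kd_append_right_nil, kd_nil_append_right, zero_mul, zero_smul, add_zero,
    List.append_assoc, emb_append, smul_add, Finset.smul_sum, smul_smul, mul_assoc,
    mul_comm, mul_left_comm]

theorem stateComm_second_third :
    stateComm Λ ΛF (grandRep Λ ΛF (op2 l₁ l₂ I J)) (grandRep Λ ΛF (op3 K L l₃ l₄)) =
      grandRep Λ ΛF (∑ j ∈ cutsDD J, ∑ k ∈ cutsDD K,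
        (sgn (eps Λ j.1 * (eps Λ K + eps Λ L)) * kd k.1 j.2) •
          op1 l₁ l₂ (I ++ k.2) (j.1 ++ L) l₃ l₄
      - sgn ((eps Λ I + eps Λ J) * (eps Λ K + eps Λ L)) •
        ∑ i ∈ cutsDD I, ∑ l ∈ cutsDD L,
          (sgn (eps Λ i.1 * (eps Λ K + eps Λ L)) * kd i.2 l.1) •
            op1 l₁ l₂ (i.1 ++ K) (J ++ l.2) l₃ l₄) := by
  rw [grandRep_op2, grandRep_op3, superComm_left_right _ (by simp) (by simp) (by simp) (by simp)]
  refine congrArg (hetAct _) ?_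
  simp only [map_sub, map_smul, map_sum, (isRealization_grandIota Λ ΛF).first, eps_left_cons,
    eps_append_right, eps_emb, sum_cutsDD_cons, sum_cutsDD_append, sum_cutsND_singleton,
    sum_cutsDD_emb, kd_emb_append_left, kd_left_emb_append, kd_emb, kd_right_emb, kd_emb_right,
    kd_emb_left, kd_left_emb, mul_zero, zero_smul, zero_add, add_zero, Finset.sum_const_zero,
    List.cons_append, List.append_assoc, emb_append]

theorem stateComm_first_fourth {K L : Word (2 * Λ)} (hK : K ≠ []) (hL : L ≠ []) :
    stateComm Λ ΛF (grandRep Λ ΛF (op1 l₁ l₂ I J l₃ l₄)) (grandRep Λ ΛF (op4 K L)) =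
      grandRep Λ ΛF (∑ j ∈ cuts3DND J,
        (sgn (eps Λ j.1 * (eps Λ K + eps Λ L)) * kd K j.2.1) •
          op1 l₁ l₂ I (j.1 ++ L ++ j.2.2) l₃ l₄
      - sgn ((eps Λ I + eps Λ J) * (eps Λ K + eps Λ L)) •
        ∑ i ∈ cuts3DND I,
          (sgn (eps Λ i.1 * (eps Λ K + eps Λ L)) * kd i.2.1 L) •
            op1 l₁ l₂ (i.1 ++ K ++ i.2.2) J l₃ l₄) := by
  rw [grandRep_op1, grandRep_op4 hK hL,
    superComm_full_inner _ (by simp) (by simp) (by simpa) (by simpa)]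
  refine congrArg (hetAct _) ?_
  simp only [map_sub, map_smul, map_sum, (isRealization_grandIota Λ ΛF).first, eps_left_cons,
    eps_append_right, eps_emb, sum_cuts3DND, sum_cutsDD_cons, sum_cutsND_cons, sum_cutsDD_append,
    sum_cutsND_append, sum_cutsDD_nil, sum_cutsND_nil,
    sum_cutsDD_emb, sum_cutsND_emb, kd_emb, kd_right_emb, kd_emb_right,
    kd_emb_left, kd_left_emb, mul_zero, zero_smul, zero_add, add_zero, Finset.sum_const_zero,
    List.cons_append, List.append_assoc, emb_append]

/-- The terms in which `j` is the trivial cut are separated from the others. The word `J` may be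
empty, in which case this cut is missing on the left, so `G` and `G'` have to vanish there. -/
theorem sum_cutsDN_triple {n : ℕ} {M : Type} [AddCommGroup M] (J : Word n)
    (G G' : Word n × Word n → M) (T : Word n × Word n → Word n × Word n → M)
    (hG : G ([], []) = 0) (hG' : G' ([], []) = 0) :
    ∑ j ∈ cutsDN J, (G j + G' j + ∑ p ∈ cuts j.2, T j p) =
      G ([], J) + G' ([], J) + ∑ j ∈ cuts J, G j + ∑ p ∈ cuts J, T ([], J) p + ∑ j ∈ cuts J, G' j
        + ∑ j ∈ cuts J, ∑ p ∈ cuts j.2, T j p := by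
  by_cases hJ : J = []
  · subst hJ
    simp only [sum_cutsDN_nil, sum_cuts_nil, hG, hG', add_zero]
  · rw [sum_cutsDN hJ, Finset.sum_add_distrib, Finset.sum_add_distrib]
    abel

/-- The mirror image of `sum_cutsDN_triple`. -/
theorem sum_cutsND_triple {n : ℕ} {M : Type} [AddCommGroup M] (J : Word n)
    (G G' : Word n × Word n → M) (T : Word n × Word n → Word n × Word n → M)
    (hG : G ([], []) = 0) (hG' : G' ([], []) = 0) :
    ∑ j ∈ cutsND J, (G j + G' j + ∑ p ∈ cuts j.1, T j p) =
      G (J, []) + G' (J, []) + ∑ p ∈ cuts J, T (J, []) p + ∑ j ∈ cuts J, G j + ∑ j ∈ cuts J, G' j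
        + ∑ j ∈ cuts J, ∑ p ∈ cuts j.1, T j p := by
  by_cases hJ : J = []
  · subst hJ
    simp only [sum_cutsND_nil, sum_cuts_nil, hG, hG', add_zero]
  · rw [sum_cutsND hJ, Finset.sum_add_distrib, Finset.sum_add_distrib]
    abel

theorem stateComm_second_fourth {K L : Word (2 * Λ)} (hK : K ≠ []) (hL : L ≠ []) :
    stateComm Λ ΛF (grandRep Λ ΛF (op2 l₁ l₂ I J)) (grandRep Λ ΛF (op4 K L)) =
      grandRep Λ ΛF ((kd K J • op2 l₁ l₂ I L
        + ∑ k ∈ cuts K, kd k.1 J • op2 l₁ l₂ (I ++ k.2) L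
        + ∑ j ∈ cuts J,
            (sgn (eps Λ j.1 * (eps Λ K + eps Λ L)) * kd K j.2) • op2 l₁ l₂ I (j.1 ++ L)
        + ∑ j ∈ cuts J, kd K j.1 • op2 l₁ l₂ I (L ++ j.2)
        + ∑ j ∈ cuts J, ∑ k ∈ cuts K,
            (sgn (eps Λ j.1 * (eps Λ K + eps Λ L)) * kd k.1 j.2) •
              op2 l₁ l₂ (I ++ k.2) (j.1 ++ L)
        + ∑ j ∈ cuts3 J,
            (sgn (eps Λ j.1 * (eps Λ K + eps Λ L)) * kd K j.2.1) •
              op2 l₁ l₂ I (j.1 ++ L ++ j.2.2))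
      - sgn ((eps Λ I + eps Λ J) * (eps Λ K + eps Λ L)) •
        (kd I L • op2 l₁ l₂ K J
          + ∑ l ∈ cuts L, kd I l.1 • op2 l₁ l₂ K (J ++ l.2)
          + ∑ i ∈ cuts I,
              (sgn (eps Λ i.1 * (eps Λ K + eps Λ L)) * kd i.2 L) • op2 l₁ l₂ (i.1 ++ K) J
          + ∑ i ∈ cuts I, kd i.1 L • op2 l₁ l₂ (K ++ i.2) J
          + ∑ l ∈ cuts L, ∑ i ∈ cuts I,
              (sgn (eps Λ i.1 * (eps Λ K + eps Λ L)) * kd i.2 l.1) •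
                op2 l₁ l₂ (i.1 ++ K) (J ++ l.2)
          + ∑ i ∈ cuts3 I,
              (sgn (eps Λ i.1 * (eps Λ K + eps Λ L)) * kd i.2.1 L) •
                op2 l₁ l₂ (i.1 ++ K ++ i.2.2) J)) := by
  rw [grandRep_op2, grandRep_op4 hK hL,
    superComm_left_inner _ (by simp) (by simp) (by simpa) (by simpa), Finset.sum_comm (s := cuts L)]
  refine congrArg (hetAct _) ?_
  simp only [map_sub, map_smul, map_add, map_sum, (isRealization_grandIota Λ ΛF).second,
    eps_left_cons, eps_emb, sum_cutsDN_cons, sum_cuts_cons, sum_cutsDN_emb, sum_cuts_emb,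
    sum_cuts3, kd_emb, kd_emb_left, kd_left_emb, mul_zero, zero_smul, zero_add, add_zero,
    Finset.sum_const_zero, List.cons_append, emb_append]
  rw [sum_cutsDN_triple, sum_cutsDN_triple]
  · simp only [eps_nil, zero_mul, sgn_zero, one_mul, emb_nil, List.nil_append]
  · rw [kd_of_ne hL.symm, mul_zero, zero_smul]
  · exact Finset.sum_eq_zero fun l hl => by
      rw [kd_of_ne (mem_cuts.1 hl).2.1.symm, mul_zero, zero_smul]
  · rw [kd_of_ne hK, mul_zero, zero_smul]
  · exact Finset.sum_eq_zero fun k hk => by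
      rw [kd_of_ne (mem_cuts.1 hk).2.1, mul_zero, zero_smul]

theorem stateComm_third_fourth {K L : Word (2 * Λ)} (hK : K ≠ []) (hL : L ≠ []) :
    stateComm Λ ΛF (grandRep Λ ΛF (op3 I J l₁ l₂)) (grandRep Λ ΛF (op4 K L)) =
      grandRep Λ ΛF ((kd K J • op3 I L l₁ l₂
        + ∑ k ∈ cuts K,
            (sgn (eps Λ k.1 * (eps Λ I + eps Λ J)) * kd k.2 J) • op3 (k.1 ++ I) L l₁ l₂
        + ∑ j ∈ cuts J,
            (sgn (eps Λ j.1 * (eps Λ K + eps Λ L)) * kd K j.2) • op3 I (j.1 ++ L) l₁ l₂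
        + ∑ j ∈ cuts J, kd K j.1 • op3 I (L ++ j.2) l₁ l₂
        + ∑ j ∈ cuts J, ∑ k ∈ cuts K,
            (sgn (eps Λ k.1 * (eps Λ I + eps Λ J)) * kd k.2 j.1) •
              op3 (k.1 ++ I) (L ++ j.2) l₁ l₂
        + ∑ j ∈ cuts3 J,
            (sgn (eps Λ j.1 * (eps Λ K + eps Λ L)) * kd K j.2.1) •
              op3 I (j.1 ++ L ++ j.2.2) l₁ l₂)
      - sgn ((eps Λ I + eps Λ J) * (eps Λ K + eps Λ L)) •
        (kd I L • op3 K J l₁ l₂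
          + ∑ l ∈ cuts L,
              (sgn (eps Λ l.1 * (eps Λ I + eps Λ J)) * kd I l.2) • op3 K (l.1 ++ J) l₁ l₂
          + ∑ i ∈ cuts I,
              (sgn (eps Λ i.1 * (eps Λ K + eps Λ L)) * kd i.2 L) • op3 (i.1 ++ K) J l₁ l₂
          + ∑ i ∈ cuts I, kd i.1 L • op3 (K ++ i.2) J l₁ l₂
          + ∑ l ∈ cuts L, ∑ i ∈ cuts I,
              (sgn (eps Λ l.1 * (eps Λ I + eps Λ J)) * kd i.1 l.2) •
                op3 (K ++ i.2) (l.1 ++ J) l₁ l₂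
          + ∑ i ∈ cuts3 I,
              (sgn (eps Λ i.1 * (eps Λ K + eps Λ L)) * kd i.2.1 L) •
                op3 (i.1 ++ K ++ i.2.2) J l₁ l₂)) := by
  rw [grandRep_op3, grandRep_op4 hK hL,
    superComm_right_inner _ (by simp) (by simp) (by simpa) (by simpa),
    Finset.sum_comm (s := cuts L)]
  refine congrArg (hetAct _) ?_
  simp only [map_sub, map_smul, map_add, map_sum, (isRealization_grandIota Λ ΛF).third,
    eps_append_right, eps_emb, sum_cutsND_append, sum_cutsND_singleton, sum_cuts_append_singleton,
    sum_cutsND_emb, sum_cuts_emb,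
    sum_cuts3', kd_emb, kd_emb_right, kd_right_emb, mul_zero, zero_smul, add_zero,
    Finset.sum_const_zero, ← List.append_assoc, emb_append]
  rw [sum_cutsND_triple, sum_cutsND_triple]
  · simp only [emb_nil, List.append_nil]
  · rw [kd_of_ne hL.symm, zero_smul]
  · exact Finset.sum_eq_zero fun l hl => by
      rw [kd_of_ne (mem_cuts.1 hl).2.2.symm, mul_zero, zero_smul]
  · rw [kd_of_ne hK, zero_smul]
  · exact Finset.sum_eq_zero fun k hk => by
      rw [kd_of_ne (mem_cuts.1 hk).2.2, mul_zero, zero_smul]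

theorem stateComm_first_fifth {K L : Word (2 * Λ)} (hK : K ≠ []) (hL : L ≠ []) :
    stateComm Λ ΛF (grandRep Λ ΛF (op1 l₁ l₂ I J l₃ l₄)) (grandRep Λ ΛF (op5 K L)) = 0 := by
  have h := isHeterixAction_hetAct (two_mul_le Λ ΛF)
  rw [grandRep_op1, grandRep_op5 hK hL, ← map_zero (hetAct (two_mul_le Λ ΛF))]
  refine superComm_hetAct_of_states _ (hetF_mem (two_mul_le Λ ΛF) (by simp) (by simp))
    (hetFifth_mem (by simpa) (by simpa)) (fun W hW => ?_) fun W hW => ?_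
  · rw [h.fifth_open _ _ _ (by simpa) (by simpa) hW, hetF_open _ (by simp) (by simp) hW, map_smul,
      h.fifth_open _ _ _ (by simpa) (by simpa) (by simp)]
    simp
  · rw [h.fifth_closed _ _ _ (by simpa) (by simpa) hW, hetF_closed _ (by simp) (by simp) hW,
      map_fifthClosed]
    simp [fifthClosed, hetF_closed, hK]

theorem stateComm_second_fifth {K L : Word (2 * Λ)} (hK : K ≠ []) (hL : L ≠ []) :
    stateComm Λ ΛF (grandRep Λ ΛF (op2 l₁ l₂ I J)) (grandRep Λ ΛF (op5 K L)) = 0 := by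
  have h := isHeterixAction_hetAct (two_mul_le Λ ΛF)
  rw [grandRep_op2, grandRep_op5 hK hL, ← map_zero (hetAct (two_mul_le Λ ΛF))]
  refine superComm_hetAct_of_states _ (hetL_mem (two_mul_le Λ ΛF) (by simp) (by simp))
    (hetFifth_mem (by simpa) (by simpa)) (fun W hW => ?_) fun W hW => ?_
  · rw [h.fifth_open _ _ _ (by simpa) (by simpa) hW, hetL_open _ (by simp) (by simp) hW, map_sum]
    simp [h.fifth_open, hK, hL]
  · rw [h.fifth_closed _ _ _ (by simpa) (by simpa) hW, hetL_closed _ (by simp) (by simp) hW,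
      map_fifthClosed]
    simp [fifthClosed, hetL_closed, hK]

theorem stateComm_third_fifth {K L : Word (2 * Λ)} (hK : K ≠ []) (hL : L ≠ []) :
    stateComm Λ ΛF (grandRep Λ ΛF (op3 I J l₁ l₂)) (grandRep Λ ΛF (op5 K L)) = 0 := by
  have h := isHeterixAction_hetAct (two_mul_le Λ ΛF)
  rw [grandRep_op3, grandRep_op5 hK hL, ← map_zero (hetAct (two_mul_le Λ ΛF))]
  refine superComm_hetAct_of_states _ (hetR_mem (two_mul_le Λ ΛF) (by simp) (by simp))
    (hetFifth_mem (by simpa) (by simpa)) (fun W hW => ?_) fun W hW => ?_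
  · rw [h.fifth_open _ _ _ (by simpa) (by simpa) hW, hetR_open _ (by simp) (by simp) hW, map_sum]
    simp [h.fifth_open, hK, hL]
  · rw [h.fifth_closed _ _ _ (by simpa) (by simpa) hW, hetR_closed _ (by simp) (by simp) hW,
      map_fifthClosed]
    simp [fifthClosed, hetR_closed, hK]

theorem stateComm_fourth_fourth {I J K L : Word (2 * Λ)} (hI : I ≠ []) (hJ : J ≠ []) (hK : K ≠ [])
    (hL : L ≠ []) :
    stateComm Λ ΛF (grandRep Λ ΛF (op4 I J)) (grandRep Λ ΛF (op4 K L)) =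
      grandRep Λ ΛF (gammaGamma Λ op4 op5 I J K L) := by
  rw [grandRep_op4 hI hJ, grandRep_op4 hK hL,
    superComm_gamma_gamma _ (by simpa) (by simpa) (by simpa) (by simpa), emb, emb, emb,
    emb, gammaGamma_map Λ (φ := Fin.castAdd (4 * ΛF)) fun _ => rfl,
    map_gammaGamma Λ (M' := Module.End ℂ (HetState Λ (2 * Λ + 4 * ΛF))),
    map_gammaGamma Λ (M' := Module.End ℂ (HetState Λ (2 * Λ + 4 * ΛF)))]
  exact gammaGamma_congr Λ (fun A B hA hB => (grandRep_op4 hA hB).symm)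
    (fun A B hA hB => (grandRep_op5 hA hB).symm) hI hJ hK hL

theorem stateComm_fourth_fifth {I J K L : Word (2 * Λ)} (hI : I ≠ []) (hJ : J ≠ []) (hK : K ≠ [])
    (hL : L ≠ []) :
    stateComm Λ ΛF (grandRep Λ ΛF (op4 I J)) (grandRep Λ ΛF (op5 K L)) =
      grandRep Λ ΛF (gammaFifth Λ op5 I J K L) := by
  rw [grandRep_op4 hI hJ, grandRep_op5 hK hL,
    superComm_gamma_fifth _ (by simpa) (by simpa) (by simpa) (by simpa), emb, emb, emb,
    emb, gammaFifth_map Λ (φ := Fin.castAdd (4 * ΛF)) fun _ => rfl,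
    map_gammaFifth Λ (M' := Module.End ℂ (HetState Λ (2 * Λ + 4 * ΛF))),
    map_gammaFifth Λ (M' := Module.End ℂ (HetState Λ (2 * Λ + 4 * ΛF)))]
  exact gammaFifth_congr Λ (fun A B hA hB => (grandRep_op5 hA hB).symm) hI hJ hK hL

theorem stateComm_fifth_fifth {I J K L : Word (2 * Λ)} (hI : I ≠ []) (hJ : J ≠ []) (hK : K ≠ [])
    (hL : L ≠ []) :
    stateComm Λ ΛF (grandRep Λ ΛF (op5 I J)) (grandRep Λ ΛF (op5 K L)) =
      grandRep Λ ΛF (fifthFifth Λ op5 I J K L) := by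
  rw [grandRep_op5 hI hJ, grandRep_op5 hK hL,
    superComm_fifth_fifth _ (by simpa) (by simpa) (by simpa) (by simpa), emb, emb, emb, emb,
    fifthFifth_map Λ (φ := Fin.castAdd (4 * ΛF)) fun _ => rfl,
    map_fifthFifth Λ (M' := Module.End ℂ (HetState Λ (2 * Λ + 4 * ΛF))),
    map_fifthFifth Λ (M' := Module.End ℂ (HetState Λ (2 * Λ + 4 * ΛF)))]
  exact fifthFifth_congr Λ (fun A B hA hB => (grandRep_op5 hA hB).symm) hI hJ hK hL

end GrandBrackets

/-! ### The grand string superalgebra as a Lie superalgebra of operators -/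

section GrandBracket

variable {Λ ΛF : ℕ}

theorem op1_mem (a b : Fin (2 * ΛF)) (I J : Word (2 * Λ)) (c d : Fin (2 * ΛF)) :
    op1 a b I J c d ∈ grandGrading Λ ΛF ((eps Λ I + eps Λ J : ℕ) : ZMod 2) :=
  Submodule.subset_span ⟨I, J, rfl, .inl ⟨a, b, c, d, rfl⟩⟩

theorem op2_mem (a b : Fin (2 * ΛF)) (I J : Word (2 * Λ)) :
    op2 a b I J ∈ grandGrading Λ ΛF ((eps Λ I + eps Λ J : ℕ) : ZMod 2) :=
  Submodule.subset_span ⟨I, J, rfl, .inr (.inl ⟨a, b, rfl⟩)⟩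

theorem op3_mem (I J : Word (2 * Λ)) (c d : Fin (2 * ΛF)) :
    op3 I J c d ∈ grandGrading Λ ΛF ((eps Λ I + eps Λ J : ℕ) : ZMod 2) :=
  Submodule.subset_span ⟨I, J, rfl, .inr (.inr (.inl ⟨c, d, rfl⟩))⟩

theorem op4_mem {I J : Word (2 * Λ)} (hI : I ≠ []) (hJ : J ≠ []) :
    op4 I J ∈ grandGrading Λ ΛF ((eps Λ I + eps Λ J : ℕ) : ZMod 2) :=
  Submodule.subset_span ⟨I, J, rfl, .inr (.inr (.inr ⟨hI, hJ, .inl rfl⟩))⟩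

theorem op5_mem {I J : Word (2 * Λ)} (hI : I ≠ []) (hJ : J ≠ []) :
    op5 I J ∈ grandGrading Λ ΛF ((eps Λ I + eps Λ J : ℕ) : ZMod 2) :=
  Submodule.subset_span ⟨I, J, rfl, .inr (.inr (.inr ⟨hI, hJ, .inr rfl⟩))⟩

theorem grandGrading_iSup : ⨆ a, grandGrading Λ ΛF a = ⊤ := by
  refine eq_top_iff.2 fun x _ => ?_
  have h := fun a => le_iSup (grandGrading Λ ΛF) a
  exact grand_mem (F := LinearMap.id) (fun _ _ _ _ _ _ => h _ (op1_mem _ _ _ _ _ _))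
    (fun _ _ _ _ => h _ (op2_mem _ _ _ _)) (fun _ _ _ _ => h _ (op3_mem _ _ _ _))
    (fun _ _ hI hJ => h _ (op4_mem hI hJ)) (fun _ _ hI hJ => h _ (op5_mem hI hJ)) x

theorem grandIota_mem {e : ZMod 2} {x : Grand Λ ΛF} (hx : x ∈ grandGrading Λ ΛF e) :
    grandIota Λ ΛF x ∈ hetGrading Λ (2 * Λ + 4 * ΛF) e := by
  have h := isRealization_grandIota Λ ΛF
  have hn := two_mul_le Λ ΛF
  refine Submodule.span_induction
    (p := fun x _ => grandIota Λ ΛF x ∈ hetGrading Λ (2 * Λ + 4 * ΛF) e) ?_ ?_ ?_ ?_ hx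
  · rintro _ ⟨I, J, rfl, ⟨p, q, r, t, rfl⟩ | ⟨p, q, rfl⟩ | ⟨r, t, rfl⟩ | ⟨hI, hJ, rfl | rfl⟩⟩
    · have := hetF_mem hn (I := leftLetter p :: (emb I ++ [rightLetter r]))
        (J := leftLetter q :: (emb J ++ [rightLetter t])) (by simp) (by simp)
      rwa [eps_left_cons, eps_left_cons, eps_append_right, eps_append_right, eps_emb, eps_emb,
        ← h.first] at this
    · have := hetL_mem hn (I := leftLetter p :: emb I) (J := leftLetter q :: emb J)
        (by simp) (by simp)
      rwa [eps_left_cons, eps_left_cons, eps_emb, eps_emb, ← h.second] at this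
    · have := hetR_mem hn (I := emb I ++ [rightLetter r]) (J := emb J ++ [rightLetter t])
        (by simp) (by simp)
      rwa [eps_append_right, eps_append_right, eps_emb, eps_emb, ← h.third] at this
    · have := hetGamma_mem (Λ := Λ) (I := emb (ΛF := ΛF) I) (J := emb (ΛF := ΛF) J)
        (by simpa) (by simpa)
      rwa [eps_emb, eps_emb, ← h.fourth I J hI hJ] at this
    · have := hetFifth_mem (Λ := Λ) (I := emb (ΛF := ΛF) I) (J := emb (ΛF := ΛF) J)
        (by simpa) (by simpa)
      rwa [eps_emb, eps_emb, ← h.fifth I J hI hJ] at this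
  · rw [map_zero]
    exact Submodule.zero_mem _
  · intro x y _ _ hx hy
    rw [map_add]
    exact Submodule.add_mem _ hx hy
  · intro c x _ hx
    rw [map_smul]
    exact Submodule.smul_mem _ c hx

theorem hasDegree_grandRep {e : ZMod 2} {x : Grand Λ ΛF} (hx : x ∈ grandGrading Λ ΛF e) :
    HasDegree (hetParity Λ (2 * Λ + 4 * ΛF)) e (grandRep Λ ΛF x) :=
  hasDegree_hetAct (two_mul_le Λ ΛF) e _ (grandIota_mem hx)

/-- The values of a bilinear map lie in a subspace if they do for operators whose kinds are in
ascending order, provided that the arguments may be exchanged. -/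
theorem grand_mem₂ {M : Type} [AddCommGroup M] [Module ℂ M]
    {R : Submodule ℂ M} {F : Grand Λ ΛF →ₗ[ℂ] Grand Λ ΛF →ₗ[ℂ] M}
    (hs : ∀ a b : ZMod 2, ∀ x ∈ grandGrading Λ ΛF a, ∀ y ∈ grandGrading Λ ΛF b,
      F x y ∈ R → F y x ∈ R)
    (h11 : ∀ a b I J c d a' b' K L c' d',
      F (op1 a b I J c d) (op1 a' b' K L c' d') ∈ R)
    (h12 : ∀ a b I J c d a' b' K L,
      F (op1 a b I J c d) (op2 a' b' K L) ∈ R)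
    (h13 : ∀ a b I J c d K L c' d',
      F (op1 a b I J c d) (op3 K L c' d') ∈ R)
    (h14 : ∀ a b I J c d K L, K ≠ [] → L ≠ [] →
      F (op1 a b I J c d) (op4 K L) ∈ R)
    (h15 : ∀ a b I J c d K L, K ≠ [] → L ≠ [] →
      F (op1 a b I J c d) (op5 K L) ∈ R)
    (h22 : ∀ a b I J a' b' K L,
      F (op2 a b I J) (op2 a' b' K L) ∈ R)
    (h23 : ∀ a b I J K L c' d',
      F (op2 a b I J) (op3 K L c' d') ∈ R)
    (h24 : ∀ a b I J K L, K ≠ [] → L ≠ [] →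
      F (op2 a b I J) (op4 K L) ∈ R)
    (h25 : ∀ a b I J K L, K ≠ [] → L ≠ [] →
      F (op2 a b I J) (op5 K L) ∈ R)
    (h33 : ∀ I J c d K L c' d',
      F (op3 I J c d) (op3 K L c' d') ∈ R)
    (h34 : ∀ I J c d K L, K ≠ [] → L ≠ [] →
      F (op3 I J c d) (op4 K L) ∈ R)
    (h35 : ∀ I J c d K L, K ≠ [] → L ≠ [] →
      F (op3 I J c d) (op5 K L) ∈ R)
    (h44 : ∀ I J K L, I ≠ [] → J ≠ [] → K ≠ [] → L ≠ [] →
      F (op4 I J) (op4 K L) ∈ R)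
    (h45 : ∀ I J K L, I ≠ [] → J ≠ [] → K ≠ [] → L ≠ [] →
      F (op4 I J) (op5 K L) ∈ R)
    (h55 : ∀ I J K L, I ≠ [] → J ≠ [] → K ≠ [] → L ≠ [] →
      F (op5 I J) (op5 K L) ∈ R) (x y : Grand Λ ΛF) : F x y ∈ R := by
  refine grand_mem (F := F.flip y) ?_ ?_ ?_ ?_ ?_ x <;> simp only [LinearMap.flip_apply]
  · exact fun a b I J c d => grand_mem (F := F _) (h11 _ _ _ _ _ _) (h12 _ _ _ _ _ _)
      (h13 _ _ _ _ _ _) (h14 _ _ _ _ _ _) (h15 _ _ _ _ _ _) y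
  · exact fun a b I J => grand_mem (F := F _)
      (fun _ _ _ _ _ _ => hs _ _ _ (op1_mem _ _ _ _ _ _) _ (op2_mem _ _ _ _)
        (h12 _ _ _ _ _ _ _ _ _ _))
      (h22 _ _ _ _) (h23 _ _ _ _) (h24 _ _ _ _) (h25 _ _ _ _) y
  · exact fun I J c d => grand_mem (F := F _)
      (fun _ _ _ _ _ _ => hs _ _ _ (op1_mem _ _ _ _ _ _) _ (op3_mem _ _ _ _)
        (h13 _ _ _ _ _ _ _ _ _ _))
      (fun _ _ _ _ => hs _ _ _ (op2_mem _ _ _ _) _ (op3_mem _ _ _ _) (h23 _ _ _ _ _ _ _ _))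
      (h33 _ _ _ _) (h34 _ _ _ _) (h35 _ _ _ _) y
  · exact fun I J hI hJ => grand_mem (F := F _)
      (fun _ _ _ _ _ _ => hs _ _ _ (op1_mem _ _ _ _ _ _) _ (op4_mem hI hJ)
        (h14 _ _ _ _ _ _ _ _ hI hJ))
      (fun _ _ _ _ => hs _ _ _ (op2_mem _ _ _ _) _ (op4_mem hI hJ) (h24 _ _ _ _ _ _ hI hJ))
      (fun _ _ _ _ => hs _ _ _ (op3_mem _ _ _ _) _ (op4_mem hI hJ) (h34 _ _ _ _ _ _ hI hJ))
      (fun _ _ hK hL => h44 _ _ _ _ hI hJ hK hL) (fun _ _ hK hL => h45 _ _ _ _ hI hJ hK hL) y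
  · exact fun I J hI hJ => grand_mem (F := F _)
      (fun _ _ _ _ _ _ => hs _ _ _ (op1_mem _ _ _ _ _ _) _ (op5_mem hI hJ)
        (h15 _ _ _ _ _ _ _ _ hI hJ))
      (fun _ _ _ _ => hs _ _ _ (op2_mem _ _ _ _) _ (op5_mem hI hJ) (h25 _ _ _ _ _ _ hI hJ))
      (fun _ _ _ _ => hs _ _ _ (op3_mem _ _ _ _) _ (op5_mem hI hJ) (h35 _ _ _ _ _ _ hI hJ))
      (fun _ _ hK hL => hs _ _ _ (op4_mem hK hL) _ (op5_mem hI hJ) (h45 _ _ _ _ hK hL hI hJ))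
      (fun _ _ hK hL => h55 _ _ _ _ hI hJ hK hL) y

/-- The difference of two bilinear maps, known by its values only: unfolding it is expensive when
`M` is a space of endomorphisms. -/
theorem exists_linear_sub {M : Type} [AddCommGroup M] [Module ℂ M]
    (F G : Grand Λ ΛF →ₗ[ℂ] Grand Λ ΛF →ₗ[ℂ] M) :
    ∃ D : Grand Λ ΛF →ₗ[ℂ] Grand Λ ΛF →ₗ[ℂ] M, ∀ x y, D x y = F x y - G x y :=
  ⟨F - G, fun _ _ => rfl⟩

/-- The defining superbrackets are the supercommutators of the operators. -/
theorem IsGrandBracket.grandRep_apply {br : Grand Λ ΛF →ₗ[ℂ] Grand Λ ΛF →ₗ[ℂ] Grand Λ ΛF}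
    (h : IsGrandBracket Λ ΛF br) (x y : Grand Λ ΛF) :
    grandRep Λ ΛF (br x y) = stateComm Λ ΛF (grandRep Λ ΛF x) (grandRep Λ ΛF y) := by
  obtain ⟨D, hD⟩ := exists_linear_sub (M := Module.End ℂ (HetState Λ (2 * Λ + 4 * ΛF)))
    (br.compr₂ (grandRep Λ ΛF)) ((stateComm Λ ΛF).compl₁₂ (grandRep Λ ΛF) (grandRep Λ ΛF))
  simp only [LinearMap.compr₂_apply, LinearMap.compl₁₂_apply] at hD
  suffices D x y ∈ (⊥ : Submodule ℂ _) from sub_eq_zero.1 ((hD x y).symm.trans this)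
  refine grand_mem₂ (M := Module.End ℂ (HetState Λ (2 * Λ + 4 * ΛF)))
    ?_ ?_ ?_ ?_ ?_ ?_ ?_ ?_ ?_ ?_ ?_ ?_ ?_ ?_ ?_ ?_ x y <;>
    simp only [hD, Submodule.mem_bot, sub_eq_zero]
  · intro a b x hx y hy hxy
    rw [h.skew b a y hy x hx, superComm_skew (hetParity_mul_self _ _) (hasDegree_grandRep hy)
      (hasDegree_grandRep hx), ← hxy, map_neg, map_smul]
  · intros
    rw [h.first_first, stateComm_first_first]
  · intros
    rw [h.first_second, stateComm_first_second]
  · intros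
    rw [h.first_third, stateComm_first_third]
  · intro a b I J c d K L hK hL
    rw [h.first_fourth _ _ _ _ _ _ _ _ hK hL, stateComm_first_fourth _ _ _ _ _ _ hK hL]
  · intro a b I J c d K L hK hL
    rw [h.first_fifth _ _ _ _ _ _ _ _ hK hL, stateComm_first_fifth _ _ _ _ _ _ hK hL, map_zero]
  · intros
    rw [h.second_second, stateComm_second_second]
  · intros
    rw [h.second_third, stateComm_second_third]
  · intro a b I J K L hK hL
    rw [h.second_fourth _ _ _ _ _ _ hK hL, stateComm_second_fourth _ _ _ _ hK hL]
  · intro a b I J K L hK hL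
    rw [h.second_fifth _ _ _ _ _ _ hK hL, stateComm_second_fifth _ _ _ _ hK hL, map_zero]
  · intros
    rw [h.third_third, stateComm_third_third]
  · intro I J c d K L hK hL
    rw [h.third_fourth _ _ _ _ _ _ hK hL, stateComm_third_fourth _ _ _ _ hK hL]
  · intro I J c d K L hK hL
    rw [h.third_fifth _ _ _ _ _ _ hK hL, stateComm_third_fifth _ _ _ _ hK hL, map_zero]
  · intro I J K L hI hJ hK hL
    rw [h.fourth_fourth _ _ _ _ hI hJ hK hL, stateComm_fourth_fourth hI hJ hK hL]
  · intro I J K L hI hJ hK hL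
    rw [h.fourth_fifth _ _ _ _ hI hJ hK hL, stateComm_fourth_fifth hI hJ hK hL]
  · intro I J K L hI hJ hK hL
    rw [h.fifth_fifth _ _ _ _ hI hJ hK hL, stateComm_fifth_fifth hI hJ hK hL]

/-- The operators are closed under supercommutators, so these define a bracket. -/
theorem stateComm_grandRep_mem (x y : Grand Λ ΛF) :
    stateComm Λ ΛF (grandRep Λ ΛF x) (grandRep Λ ΛF y) ∈ LinearMap.range (grandRep Λ ΛF) := by
  refine grand_mem₂ (M := Module.End ℂ (HetState Λ (2 * Λ + 4 * ΛF)))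
    (F := (stateComm Λ ΛF).compl₁₂ (grandRep Λ ΛF) (grandRep Λ ΛF))
    ?_ ?_ ?_ ?_ ?_ ?_ ?_ ?_ ?_ ?_ ?_ ?_ ?_ ?_ ?_ ?_ x y <;>
    simp only [LinearMap.compl₁₂_apply]
  · intro a b x hx y hy hxy
    rw [superComm_skew (hetParity_mul_self _ _) (hasDegree_grandRep hy) (hasDegree_grandRep hx)]
    obtain ⟨z, hz⟩ := hxy
    exact ⟨-(sgn2 b a • z), by rw [map_neg, map_smul, hz]⟩
  · exact fun _ _ _ _ _ _ _ _ _ _ _ _ =>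
      ⟨_, (stateComm_first_first _ _ _ _ _ _ _ _ _ _ _ _).symm⟩
  · exact fun _ _ _ _ _ _ _ _ _ _ => ⟨_, (stateComm_first_second _ _ _ _ _ _ _ _ _ _).symm⟩
  · exact fun _ _ _ _ _ _ _ _ _ _ => ⟨_, (stateComm_first_third _ _ _ _ _ _ _ _ _ _).symm⟩
  · exact fun _ _ _ _ _ _ _ _ hK hL => ⟨_, (stateComm_first_fourth _ _ _ _ _ _ hK hL).symm⟩
  · intro _ _ _ _ _ _ _ _ hK hL
    exact stateComm_first_fifth _ _ _ _ _ _ hK hL ▸ Submodule.zero_mem _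
  · exact fun _ _ _ _ _ _ _ _ => ⟨_, (stateComm_second_second _ _ _ _ _ _ _ _).symm⟩
  · exact fun _ _ _ _ _ _ _ _ => ⟨_, (stateComm_second_third _ _ _ _ _ _ _ _).symm⟩
  · exact fun _ _ _ _ _ _ hK hL => ⟨_, (stateComm_second_fourth _ _ _ _ hK hL).symm⟩
  · intro _ _ _ _ _ _ hK hL
    exact stateComm_second_fifth _ _ _ _ hK hL ▸ Submodule.zero_mem _
  · exact fun _ _ _ _ _ _ _ _ => ⟨_, (stateComm_third_third _ _ _ _ _ _ _ _).symm⟩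
  · exact fun _ _ _ _ _ _ hK hL => ⟨_, (stateComm_third_fourth _ _ _ _ hK hL).symm⟩
  · intro _ _ _ _ _ _ hK hL
    exact stateComm_third_fifth _ _ _ _ hK hL ▸ Submodule.zero_mem _
  · exact fun _ _ _ _ hI hJ hK hL => ⟨_, (stateComm_fourth_fourth hI hJ hK hL).symm⟩
  · exact fun _ _ _ _ hI hJ hK hL => ⟨_, (stateComm_fourth_fifth hI hJ hK hL).symm⟩
  · exact fun _ _ _ _ hI hJ hK hL => ⟨_, (stateComm_fifth_fifth hI hJ hK hL).symm⟩

end GrandBracket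

/-! ### The grand string superalgebra embeds into the heterix superalgebra -/

section Injective

variable {Λ ΛF : ℕ}

/-- On closed states the first three kinds vanish, and the other two act through the heterix
superalgebra over the smaller alphabet. -/
theorem grandRep_closed {W : Word (2 * Λ + 4 * ΛF)} (hW : W ≠ []) (x : Grand Λ ΛF) :
    grandRep Λ ΛF x (hetClosed Λ W) =
      (0, hetRep (φ := Fin.castAdd (4 * ΛF)) (fun _ => rfl) x.2.2.2 (psi Λ W)) := by
  have hn := two_mul_le Λ ΛF
  have hA := isHeterixAction_hetAct hn
  refine LinearMap.congr_fun (f := LinearMap.applyₗ (hetClosed Λ W) ∘ₗ grandRep Λ ΛF)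
    (g := LinearMap.inr ℂ _ _ ∘ₗ LinearMap.applyₗ (psi Λ W) ∘ₗ
      hetRep (φ := Fin.castAdd (4 * ΛF)) (fun _ => rfl) ∘ₗ LinearMap.snd ℂ _ _ ∘ₗ
      LinearMap.snd ℂ _ _ ∘ₗ LinearMap.snd ℂ _ _) (grand_ext ?_ ?_ ?_ ?_ ?_) x <;>
    simp only [LinearMap.comp_apply, LinearMap.applyₗ_apply_apply]
  · intro a b I J c d
    rw [grandRep_op1, hetF_closed hn (by simp) (by simp) hW]
    change 0 = LinearMap.inr ℂ (NWord (2 * Λ + 4 * ΛF) →₀ ℂ) _ (hetRep _ 0 _)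
    rw [map_zero, LinearMap.zero_apply, map_zero]
  · intro a b I J
    rw [grandRep_op2, hetL_closed hn (by simp) (by simp) hW]
    change 0 = LinearMap.inr ℂ (NWord (2 * Λ + 4 * ΛF) →₀ ℂ) _ (hetRep _ 0 _)
    rw [map_zero, LinearMap.zero_apply, map_zero]
  · intro I J c d
    rw [grandRep_op3, hetR_closed hn (by simp) (by simp) hW]
    change 0 = LinearMap.inr ℂ (NWord (2 * Λ + 4 * ΛF) →₀ ℂ) _ (hetRep _ 0 _)
    rw [map_zero, LinearMap.zero_apply, map_zero]
  · intro I J hI hJ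
    change _ = LinearMap.inr ℂ (NWord (2 * Λ + 4 * ΛF) →₀ ℂ) _ (hetRep _ (hetGamma Λ I J) _)
    rw [grandRep_op4 hI hJ, hA.gamma_closed _ _ _ (by simpa) (by simpa) hW, hetRep_gamma hI hJ,
      gOp_psi_eq_gammaClosed Λ _ (by simpa using hJ), map_gammaClosed]
    rfl
  · intro I J hI hJ
    change _ = LinearMap.inr ℂ (NWord (2 * Λ + 4 * ΛF) →₀ ℂ) _ (hetRep _ (hetFifth Λ I J) _)
    rw [grandRep_op5 hI hJ, hA.fifth_closed _ _ _ (by simpa) (by simpa) hW, hetRep_fifth hI hJ,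
      fOp_psi_eq_fifthClosed Λ _ (by simpa using hJ), map_fifthClosed]
    rfl

theorem hetOpen_apply {n : ℕ} (V : Word n) (W : NWord n) : (hetOpen Λ V).1 W = kd V W.1 := by
  rw [hetOpen]
  split_ifs with h
  · simp [kd, Finsupp.single_apply, Subtype.ext_iff]
  · rw [kd_of_ne fun h' => h fun hV => W.2 (h'.symm.trans hV)]
    rfl

variable (Λ ΛF) in
/-- The matrix elements of operators between open states. -/
def matrixElement (W : NWord (2 * Λ + 4 * ΛF)) (V : Word (2 * Λ + 4 * ΛF)) :
    Grand Λ ΛF →ₗ[ℂ] ℂ :=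
  Finsupp.lapply W ∘ₗ LinearMap.fst ℂ _ _ ∘ₗ LinearMap.applyₗ (hetOpen Λ V) ∘ₗ grandRep Λ ΛF

variable (a b c d z : Fin (2 * ΛF)) (I J : Word (2 * Λ)) (W : NWord (2 * Λ + 4 * ΛF))

theorem matrixElement_op1 {V : Word (2 * Λ + 4 * ΛF)} (hV : V ≠ []) :
    matrixElement Λ ΛF W V (op1 a b I J c d) =
      kd V (leftLetter b :: (emb J ++ [rightLetter d])) *
        kd (leftLetter a :: (emb I ++ [rightLetter c])) W.1 := by
  change ((grandRep Λ ΛF _ _).1 : NWord _ →₀ ℂ) W = _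
  rw [grandRep_op1, hetF_open _ (by simp) (by simp) hV, Prod.smul_fst, Finsupp.smul_apply,
    hetOpen_apply, smul_eq_mul]

theorem matrixElement_op2 {V : Word (2 * Λ + 4 * ΛF)} (hV : V ≠ []) :
    matrixElement Λ ΛF W V (op2 a b I J) =
      ∑ v ∈ cutsDD V, kd v.1 (leftLetter b :: emb J) *
        kd (leftLetter a :: emb I ++ v.2) W.1 := by
  change ((grandRep Λ ΛF _ _).1 : NWord _ →₀ ℂ) W = _
  rw [grandRep_op2, hetL_open _ (by simp) (by simp) hV, Prod.fst_sum, Finsupp.finsetSum_apply]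
  simp only [Prod.smul_fst, Finsupp.smul_apply, hetOpen_apply, smul_eq_mul]

theorem matrixElement_op3 {V : Word (2 * Λ + 4 * ΛF)} (hV : V ≠ []) :
    matrixElement Λ ΛF W V (op3 I J c d) =
      ∑ v ∈ cutsDD V, sgn (eps Λ v.1 * (eps Λ I + eps Λ J)) * kd v.2 (emb J ++ [rightLetter d]) *
        kd (v.1 ++ (emb I ++ [rightLetter c])) W.1 := by
  change ((grandRep Λ ΛF _ _).1 : NWord _ →₀ ℂ) W = _
  rw [grandRep_op3, hetR_open _ (by simp) (by simp) hV, Prod.fst_sum, Finsupp.finsetSum_apply]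
  simp only [Prod.smul_fst, Finsupp.smul_apply, hetOpen_apply, smul_eq_mul, eps_append_right,
    eps_emb]

/-- A word that is not longer than `J` has the prefix `J` only if it equals `J`. -/
theorem sum_prefix_of_length_le {n : ℕ} {J J' : Word n} (h : J'.length ≤ J.length)
    (F : Word n → ℂ) : ∑ u ∈ cutsDD J', kd u.1 J * F u.2 = kd J' J * F [] := by
  rw [sum_cutsDD_eq_DN, Finset.sum_eq_zero, zero_add]
  intro u hu
  rw [kd_of_ne, zero_mul]
  rintro rfl
  obtain ⟨rfl, h2⟩ := mem_cutsDN.1 hu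
  rw [List.length_append] at h
  exact h2 (List.eq_nil_of_length_eq_zero (by omega))

/-- A word that is not longer than `J` has the suffix `J` only if it equals `J`. -/
theorem sum_suffix_of_length_le {n : ℕ} {J J' : Word n} (h : J'.length ≤ J.length)
    (F : Word n → ℂ) : ∑ u ∈ cutsDD J', kd u.2 J * F u.1 = kd J' J * F [] := by
  rw [sum_cutsDD_eq_ND, Finset.sum_eq_zero, add_zero]
  intro u hu
  rw [kd_of_ne, zero_mul]
  rintro rfl
  obtain ⟨rfl, h2⟩ := mem_cutsND.1 hu
  rw [List.length_append] at h
  exact h2 (List.eq_nil_of_length_eq_zero (by omega))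

/-- An open state ending in the letter `leftLetter z` is seen by operators of the second kind but
not by those of the first and third kinds. -/
theorem matrixElement_op2_test {I' J' : Word (2 * Λ)} (a' b' : Fin (2 * ΛF))
    (h : J'.length ≤ J.length) :
    matrixElement Λ ΛF ⟨leftLetter a' :: (emb I' ++ [leftLetter z]), by simp⟩
        (leftLetter b' :: (emb J' ++ [leftLetter z])) (op2 a b I J) =
      kd b' b * kd J' J * (kd a a' * kd I I') := by
  have h0 : kd (emb J' ++ [leftLetter z]) (emb J) = 0 := (isMarker_left z).kd_append_map J (emb J')
  rw [matrixElement_op2 _ _ _ _ _ (by simp)]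
  simp only [sum_cutsDD_cons, sum_cutsDD_append, sum_cutsND_singleton, sum_cutsDD_emb, kd_cons,
    kd_nil_cons, kd_left_left, kd_emb, h0, zero_mul, mul_zero,
    zero_add, add_zero, List.cons_append, mul_assoc]
  rw [← Finset.mul_sum, sum_prefix_of_length_le h fun u =>
    kd a a' * kd (emb I ++ (emb u ++ [leftLetter z])) (emb I' ++ [leftLetter z]), emb_nil,
    List.nil_append, kd_append_append, kd_emb]

/-- An open state beginning with the letter `rightLetter z` is seen by operators of the third kind
but not by those of the first and second kinds. -/
theorem matrixElement_op3_test {I' J' : Word (2 * Λ)} (c' d' : Fin (2 * ΛF))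
    (h : J'.length ≤ J.length) :
    matrixElement Λ ΛF ⟨rightLetter z :: (emb I' ++ [rightLetter c']), by simp⟩
        (rightLetter z :: (emb J' ++ [rightLetter d'])) (op3 I J c d) =
      kd d' d * kd J' J * (kd c c' * kd I I') := by
  have h0 : kd (rightLetter z :: (emb J' ++ [rightLetter d'])) (emb J ++ [rightLetter d]) = 0 := by
    cases J with
    | nil => simp
    | cons x J => simp [emb, kd_of_ne ((isMarker_right z).ne x).symm]
  rw [matrixElement_op3 _ _ _ _ _ (by simp)]
  simp only [sum_cutsDD_cons, sum_cutsDD_append, sum_cutsND_singleton, sum_cutsDD_emb, kd_cons,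
    kd_append_right_right, kd_nil_append_right, h0, zero_mul, mul_zero, zero_add, add_zero,
    kd_self, one_mul, List.cons_append, (isMarker_right z).eps_cons, eps_emb]
  have := sum_suffix_of_length_le h fun u => kd d' d * (sgn (eps Λ u * (eps Λ I + eps Λ J)) *
    kd (emb u ++ (emb I ++ [rightLetter c])) (emb I' ++ [rightLetter c']))
  rw [emb_nil, eps_nil, zero_mul, sgn_zero, List.nil_append, kd_append_right_right] at this
  rw [mul_comm (kd d' d), mul_assoc, mul_comm (kd c c'), ← mul_assoc, ← mul_assoc]
  refine (Finset.sum_congr rfl fun u _ => ?_).trans (this.trans ?_) <;> ring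

theorem kd_eq_zero_iff {α : Type} [DecidableEq α] {x y : α} : kd x y = 0 ↔ x ≠ y := by
  simp [kd]

theorem leftLetter_ne_rightLetter : leftLetter (Λ := Λ) a ≠ rightLetter b :=
  kd_eq_zero_iff.1 (kd_left_right a b)

variable (Λ ΛF) in
theorem grandIota_injective (hΛF : 0 < ΛF) : Function.Injective (grandIota Λ ΛF) := by
  let z : Fin (2 * ΛF) := ⟨0, by omega⟩
  rw [← LinearMap.ker_eq_bot, LinearMap.ker_eq_bot']
  intro x hx
  have hx : grandRep Λ ΛF x = 0 := by rw [grandRep, LinearMap.comp_apply, hx, map_zero]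
  have hM : ∀ W V, matrixElement Λ ΛF W V x = 0 := fun W V => by
    change ((grandRep Λ ΛF x _).1 : NWord _ →₀ ℂ) W = 0
    rw [hx]
    rfl
  -- On closed states only the operators of the fourth and fifth kinds act.
  have h45 : x.2.2.2 = 0 := by
    have h : ∀ W : Word (2 * Λ + 4 * ΛF), W ≠ [] →
        hetRep (φ := Fin.castAdd (4 * ΛF)) (fun _ => rfl) x.2.2.2 (psi Λ W) = 0 := fun W hW => by
      have := congrArg Prod.snd (grandRep_closed hW x)
      rwa [hx, eq_comm] at this
    exact (isMarker_left z).het_eq_zero (fun W _ => h _ (by simp)) fun W hW => h _ (by simpa)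
  obtain ⟨x1, x2, x3, x4⟩ := x
  obtain rfl : x4 = 0 := h45
  have hM' : ∀ W V, matrixElement Λ ΛF W V (x1, 0) + matrixElement Λ ΛF W V (0, x2, 0) +
      matrixElement Λ ΛF W V (0, 0, x3, 0) = 0 := fun W V => by
    rw [← map_add, ← map_add, ← hM W V]
    simp
  have h1 : ∀ W : NWord (2 * Λ + 4 * ΛF), ∀ V ≠ [],
      (∀ b J d, kd V (leftLetter b :: (emb J ++ [rightLetter d])) = 0) →
      matrixElement Λ ΛF W V (x1, 0) = 0 := fun W V hV h =>
    LinearMap.congr_fun (f := matrixElement Λ ΛF W V ∘ₗ LinearMap.inl ℂ _ _) (g := 0)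
      (Finsupp.lhom_ext' fun p => LinearMap.ext_ring <|
        (matrixElement_op1 p.1 p.2.1 p.2.2.2.2.1 p.2.2.2.2.2 p.2.2.1 p.2.2.2.1 W hV).trans
          (by rw [h, zero_mul]; rfl)) x1
  have h2 : ∀ W : NWord (2 * Λ + 4 * ΛF), ∀ V ≠ [],
      (∀ b J, ∀ v ∈ cutsDD V, kd v.1 (leftLetter b :: emb J) = 0) →
      matrixElement Λ ΛF W V (0, x2, 0) = 0 := fun W V hV h =>
    LinearMap.congr_fun (f := matrixElement Λ ΛF W V ∘ₗ LinearMap.inr ℂ _ _ ∘ₗ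
      LinearMap.inl ℂ _ _) (g := 0)
      (Finsupp.lhom_ext' fun p => LinearMap.ext_ring <|
        (matrixElement_op2 p.1 p.2.1 p.2.2.1 p.2.2.2 W hV).trans
          (Finset.sum_eq_zero fun v hv => by rw [h _ _ v hv, zero_mul])) x2
  have h3 : ∀ W : NWord (2 * Λ + 4 * ΛF), ∀ V ≠ [],
      (∀ J d, ∀ v ∈ cutsDD V, kd v.2 (emb J ++ [rightLetter d]) = 0) →
      matrixElement Λ ΛF W V (0, 0, x3, 0) = 0 := fun W V hV h =>
    LinearMap.congr_fun (f := matrixElement Λ ΛF W V ∘ₗ LinearMap.inr ℂ _ _ ∘ₗ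
      LinearMap.inr ℂ _ _ ∘ₗ LinearMap.inl ℂ _ _) (g := 0)
      (Finsupp.lhom_ext' fun p => LinearMap.ext_ring <|
        (matrixElement_op3 p.2.2.1 p.2.2.2 p.1 p.2.1 W hV).trans
          (Finset.sum_eq_zero fun v hv => by rw [h _ _ v hv, mul_zero, zero_mul])) x3
  -- Open states ending in a `leftLetter` separate the operators of the second kind.
  have hx2 : x2 = 0 := by
    refine finsupp_eq_zero_of_triangular
      (fun p : Fin (2 * ΛF) × Fin (2 * ΛF) × Word (2 * Λ) × Word (2 * Λ) => p.2.2.2.length)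
      (F := fun p => matrixElement Λ ΛF ⟨leftLetter p.1 :: (emb p.2.2.1 ++ [leftLetter z]), by simp⟩
        (leftLetter p.2.1 :: (emb p.2.2.2 ++ [leftLetter z])) ∘ₗ LinearMap.inr ℂ _ _ ∘ₗ
        LinearMap.inl ℂ _ _) ?_ ?_ ?_
    · intro p
      refine (matrixElement_op2_test _ _ _ _ _ _ _ le_rfl).trans ?_
      simp only [kd_self, mul_one]
    · intro p q hpq hne
      refine (matrixElement_op2_test _ _ _ _ _ _ _ hpq).trans ?_
      simp only [mul_eq_zero, kd_eq_zero_iff]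
      by_contra! h
      exact hne (Prod.ext h.2.1 (Prod.ext h.1.1.symm (Prod.ext h.2.2 h.1.2.symm)))
    · intro p
      have := hM' ⟨leftLetter p.1 :: (emb p.2.2.1 ++ [leftLetter z]), by simp⟩
        (leftLetter p.2.1 :: (emb p.2.2.2 ++ [leftLetter z]))
      rwa [h1 _ _ (by simp), h3 _ _ (by simp), zero_add, add_zero] at this
      · rintro J d v hv
        refine kd_of_ne fun h => leftLetter_ne_rightLetter (Λ := Λ) z d ?_
        have := (mem_cutsDD.1 hv)
        rw [h, ← List.append_assoc, ← List.cons_append] at this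
        exact (List.cons.inj (List.append_inj' this rfl).2).1.symm
      · rintro b J d
        refine kd_of_ne fun h => leftLetter_ne_rightLetter (Λ := Λ) z d ?_
        exact (List.cons.inj (List.append_inj' (List.cons.inj h).2 rfl).2).1
  -- Open states beginning with a `rightLetter` separate those of the third kind.
  have hx3 : x3 = 0 := by
    refine finsupp_eq_zero_of_triangular
      (fun p : Word (2 * Λ) × Word (2 * Λ) × Fin (2 * ΛF) × Fin (2 * ΛF) => p.2.1.length)
      (F := fun p => matrixElement Λ ΛF
        ⟨rightLetter z :: (emb p.1 ++ [rightLetter p.2.2.1]), by simp⟩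
        (rightLetter z :: (emb p.2.1 ++ [rightLetter p.2.2.2])) ∘ₗ LinearMap.inr ℂ _ _ ∘ₗ
        LinearMap.inr ℂ _ _ ∘ₗ LinearMap.inl ℂ _ _) ?_ ?_ ?_
    · intro p
      refine (matrixElement_op3_test _ _ _ _ _ _ _ le_rfl).trans ?_
      simp only [kd_self, mul_one]
    · intro p q hpq hne
      refine (matrixElement_op3_test _ _ _ _ _ _ _ hpq).trans ?_
      simp only [mul_eq_zero, kd_eq_zero_iff]
      by_contra! h
      exact hne (Prod.ext h.2.2 (Prod.ext h.1.2.symm (Prod.ext h.2.1 h.1.1.symm)))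
    · intro p
      have := hM' ⟨rightLetter z :: (emb p.1 ++ [rightLetter p.2.2.1]), by simp⟩
        (rightLetter z :: (emb p.2.1 ++ [rightLetter p.2.2.2]))
      rwa [h1 _ _ (by simp), h2 _ _ (by simp), zero_add, zero_add] at this
      · rintro b J v hv
        refine kd_of_ne fun h => leftLetter_ne_rightLetter (Λ := Λ) b z ?_
        have := (mem_cutsDD.1 hv)
        rw [h, List.cons_append] at this
        exact (List.cons.inj this).1
      · intro b J d
        rw [kd_cons, kd_right_left, zero_mul]
  subst hx2
  subst hx3
  -- The operators of the first kind are matrix units, so no length is needed.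
  have hx1 : x1 = 0 := by
    refine finsupp_eq_zero_of_triangular (X := Fin (2 * ΛF) × Fin (2 * ΛF) × Word (2 * Λ) ×
      Word (2 * Λ) × Fin (2 * ΛF) × Fin (2 * ΛF)) (fun _ => 0)
      (F := fun p => matrixElement Λ ΛF
        ⟨leftLetter p.1 :: (emb p.2.2.1 ++ [rightLetter p.2.2.2.2.1]), by simp⟩
        (leftLetter p.2.1 :: (emb p.2.2.2.1 ++ [rightLetter p.2.2.2.2.2])) ∘ₗ
        LinearMap.inl ℂ _ _) ?_ ?_ fun p => hM _ _
    · intro p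
      refine (matrixElement_op1 _ _ _ _ _ _ _ (by simp)).trans ?_
      simp only [kd_self, mul_one]
    · intro p q hpq hne
      refine (matrixElement_op1 _ _ _ _ _ _ _ (by simp)).trans ?_
      simp only [kd_cons, kd_left_left, kd_append_right_right]
      simp only [mul_eq_zero, kd_eq_zero_iff]
      by_contra! h
      exact hne (Prod.ext h.2.1 (Prod.ext h.1.1.symm (Prod.ext h.2.2.1
        (Prod.ext h.1.2.1.symm (Prod.ext h.2.2.2 h.1.2.2.symm)))))
  rw [hx1]
  rfl

end Injective

/-! ### The grand string superalgebra and its singlet states -/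

section GrandString

variable {Λ ΛF : ℕ}

theorem isFaithfulGraded_grandRep (hΛF : 0 < ΛF) :
    IsFaithfulGraded (hetParity Λ (2 * Λ + 4 * ΛF)) (grandGrading Λ ΛF) (grandRep Λ ΛF) where
  parity := hetParity_mul_self _ _
  injective := (hetAct_injective (two_mul_le Λ ΛF)).comp (grandIota_injective Λ ΛF hΛF)
  degree _ _ hx := hasDegree_grandRep hx
  iSup_eq_top := grandGrading_iSup

variable {br : Grand Λ ΛF →ₗ[ℂ] Grand Λ ΛF →ₗ[ℂ] Grand Λ ΛF}

/-- Conversely, a bracket represented by supercommutators satisfies the defining formulas, because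
the representation is faithful. -/
theorem isGrandBracket_of_grandRep (hΛF : 0 < ΛF)
    (h : ∀ x y, grandRep Λ ΛF (br x y) = stateComm Λ ΛF (grandRep Λ ΛF x) (grandRep Λ ΛF y)) :
    IsGrandBracket Λ ΛF br := by
  have H := isFaithfulGraded_grandRep (Λ := Λ) hΛF
  have key : ∀ {x y z}, stateComm Λ ΛF (grandRep Λ ΛF x) (grandRep Λ ΛF y) = grandRep Λ ΛF z →
      br x y = z := fun hz => H.injective ((h _ _).trans hz)
  exact
    { skew := (H.isLieSuperalgebra h).skew
      first_fifth := fun _ _ _ _ _ _ _ _ hK hL => key <| by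
        rw [stateComm_first_fifth _ _ _ _ _ _ hK hL, map_zero]
      second_fifth := fun _ _ _ _ _ _ hK hL => key <| by
        rw [stateComm_second_fifth _ _ _ _ hK hL, map_zero]
      third_fifth := fun _ _ _ _ _ _ hK hL => key <| by
        rw [stateComm_third_fifth _ _ _ _ hK hL, map_zero]
      first_first := fun _ _ _ _ _ _ _ _ _ _ _ _ => key (stateComm_first_first ..)
      first_second := fun _ _ _ _ _ _ _ _ _ _ => key (stateComm_first_second ..)
      first_third := fun _ _ _ _ _ _ _ _ _ _ => key (stateComm_first_third ..)
      first_fourth := fun _ _ _ _ _ _ _ _ hK hL => key (stateComm_first_fourth _ _ _ _ _ _ hK hL)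
      second_second := fun _ _ _ _ _ _ _ _ => key (stateComm_second_second ..)
      third_third := fun _ _ _ _ _ _ _ _ => key (stateComm_third_third ..)
      second_third := fun _ _ _ _ _ _ _ _ => key (stateComm_second_third ..)
      second_fourth := fun _ _ _ _ _ _ hK hL => key (stateComm_second_fourth _ _ _ _ hK hL)
      third_fourth := fun _ _ _ _ _ _ hK hL => key (stateComm_third_fourth _ _ _ _ hK hL)
      fifth_fifth := fun _ _ _ _ hI hJ hK hL => key (stateComm_fifth_fifth hI hJ hK hL)
      fourth_fifth := fun _ _ _ _ hI hJ hK hL => key (stateComm_fourth_fifth hI hJ hK hL)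
      fourth_fourth := fun _ _ _ _ hI hJ hK hL => key (stateComm_fourth_fourth hI hJ hK hL) }

theorem existsUnique_isGrandBracket (hΛF : 0 < ΛF) : ∃! br, IsGrandBracket Λ ΛF br := by
  have H := isFaithfulGraded_grandRep (Λ := Λ) hΛF
  obtain ⟨br, hbr⟩ := exists_bilinear_lift
    (V := Module.End ℂ (HetState Λ (2 * Λ + 4 * ΛF))) H.injective
    ((stateComm Λ ΛF).compl₁₂ (grandRep Λ ΛF) (grandRep Λ ΛF)) stateComm_grandRep_mem
  refine ⟨br, isGrandBracket_of_grandRep hΛF hbr, fun br' h => ?_⟩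
  refine LinearMap.ext₂ fun x y => H.injective ?_
  rw [h.grandRep_apply, hbr]
  rfl

theorem IsGrandBracket.isLieSuperalgebra (h : IsGrandBracket Λ ΛF br) (hΛF : 0 < ΛF) :
    IsLieSuperalgebra (grandGrading Λ ΛF) br :=
  (isFaithfulGraded_grandRep hΛF).isLieSuperalgebra h.grandRep_apply

theorem IsGrandBracket.grandIota_apply (h : IsGrandBracket Λ ΛF br)
    {brH : Heterix Λ (2 * Λ + 4 * ΛF) →ₗ[ℂ] Heterix Λ (2 * Λ + 4 * ΛF) →ₗ[ℂ]
      Heterix Λ (2 * Λ + 4 * ΛF)} (hH : IsHeterixBracket Λ (2 * Λ + 4 * ΛF) brH)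
    (x y : Grand Λ ΛF) :
    grandIota Λ ΛF (br x y) = brH (grandIota Λ ΛF x) (grandIota Λ ΛF y) :=
  hetAct_injective (two_mul_le Λ ΛF) <| (h.grandRep_apply x y).trans
    ((isHeterixBracket_iff (two_mul_le Λ ΛF)).1 hH _ _).symm

theorem IsGrandBracket.isSubsuperalgebra_range (h : IsGrandBracket Λ ΛF br)
    {brH : Heterix Λ (2 * Λ + 4 * ΛF) →ₗ[ℂ] Heterix Λ (2 * Λ + 4 * ΛF) →ₗ[ℂ]
      Heterix Λ (2 * Λ + 4 * ΛF)} (hH : IsHeterixBracket Λ (2 * Λ + 4 * ΛF) brH) :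
    IsSubsuperalgebra (hetGrading Λ (2 * Λ + 4 * ΛF)) brH (LinearMap.range (grandIota Λ ΛF)) where
  graded := by
    refine le_antisymm ?_ (iSup_le fun _ => inf_le_left)
    refine (LinearMap.range_eq_map (grandIota Λ ΛF)).trans_le ?_
    rw [← grandGrading_iSup, Submodule.map_iSup]
    refine iSup_mono fun a => ?_
    rintro _ ⟨x, hx, rfl⟩
    exact ⟨⟨x, rfl⟩, grandIota_mem hx⟩
  bracket_mem := by
    rintro _ ⟨x, rfl⟩ _ ⟨y, rfl⟩
    exact ⟨br x y, h.grandIota_apply hH x y⟩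

theorem grandState_ext {M : Type} [AddCommGroup M] [Module ℂ M]
    {F G : GrandState Λ ΛF →ₗ[ℂ] M}
    (ho : ∀ a K b, F (openState a K b) = G (openState a K b))
    (hc : ∀ K, K ≠ [] → F (closedState K) = G (closedState K)) : F = G :=
  LinearMap.prod_ext (Finsupp.lhom_ext' fun _ => LinearMap.ext_ring (ho _ _ _)) (closed_ext hc)

theorem grandState_mem {M : Type} [AddCommGroup M] [Module ℂ M] {R : Submodule ℂ M}
    {F : GrandState Λ ΛF →ₗ[ℂ] M} (ho : ∀ a K b, F (openState a K b) ∈ R)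
    (hc : ∀ K, K ≠ [] → F (closedState K) ∈ R) (v : GrandState Λ ΛF) : F v ∈ R := by
  have : R.mkQ ∘ₗ F = 0 := grandState_ext (fun _ _ _ => by simpa using ho _ _ _)
    fun K hK => by simpa using hc K hK
  simpa using LinearMap.congr_fun this v

variable (Λ ΛF) in
/-- The linear map identifying singlet states with singlet states of the heterix superalgebra. -/
def grandKappa : GrandState Λ ΛF →ₗ[ℂ] HetState Λ (2 * Λ + 4 * ΛF) :=
  LinearMap.coprod
    (Finsupp.lift _ ℂ (Fin (2 * ΛF) × Word (2 * Λ) × Fin (2 * ΛF)) fun p =>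
      hetOpen Λ (leftLetter p.1 :: (emb p.2.1 ++ [rightLetter p.2.2])))
    (LinearMap.inr ℂ _ _ ∘ₗ closedLift Λ (fun K => psi Λ (emb K)) fun A B => by
      rw [emb_append, psi_append_comm, eps_emb, eps_emb, emb_append])

theorem isStateRealization_grandKappa : IsStateRealization Λ ΛF (grandKappa Λ ΛF) where
  opened a K b := by simp [grandKappa, openState]
  closed K hK := by simp [grandKappa, closedState, hetClosed, closedLift_psi _ _ _ hK]

theorem IsStateRealization.unique {κ κ' : GrandState Λ ΛF →ₗ[ℂ] HetState Λ (2 * Λ + 4 * ΛF)}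
    (h : IsStateRealization Λ ΛF κ) (h' : IsStateRealization Λ ΛF κ') : κ = κ' :=
  grandState_ext (fun a K b => by rw [h.opened, h'.opened])
    fun K hK => by rw [h.closed K hK, h'.closed K hK]

/-- Open states go to different basis vectors, and closed states are separated by the pairing. -/
theorem grandKappa_injective : Function.Injective (grandKappa Λ ΛF) := by
  rw [← LinearMap.ker_eq_bot, LinearMap.ker_eq_bot']
  intro v hv
  have h := isStateRealization_grandKappa (Λ := Λ) (ΛF := ΛF)
  have h1 : ∀ p : Fin (2 * ΛF) × Word (2 * Λ) × Fin (2 * ΛF),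
      Finsupp.lapply ⟨leftLetter p.1 :: (emb p.2.1 ++ [rightLetter p.2.2]), by simp⟩ ∘ₗ
        LinearMap.fst ℂ _ _ ∘ₗ grandKappa Λ ΛF = Finsupp.lapply p ∘ₗ LinearMap.fst ℂ _ _ :=
    fun p => grandState_ext
      (fun a K b => by
        change (grandKappa Λ ΛF (openState a K b)).1 _ = Finsupp.single (a, K, b) 1 p
        rw [h.opened, hetOpen_apply]
        change kd _ (leftLetter p.1 :: (emb p.2.1 ++ [rightLetter p.2.2])) = _
        rw [kd_cons, kd_left_left, kd_append_right_right, Finsupp.single_apply]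
        split_ifs with hp
        · rw [← hp]
          simp only [kd_self, mul_one]
        · simp only [mul_eq_zero, kd_eq_zero_iff]
          by_contra! hh
          exact hp (Prod.ext hh.1 (Prod.ext hh.2.1 hh.2.2)))
      fun K hK => by
        simp only [LinearMap.comp_apply, h.closed K hK]
        rfl
  have h2 : ∀ U : Word (2 * Λ), pairL Λ (emb U) ∘ₗ LinearMap.snd ℂ _ _ ∘ₗ grandKappa Λ ΛF =
      pairL Λ U ∘ₗ LinearMap.snd ℂ _ _ := fun U => grandState_ext
    (fun a K b => by
      simp only [LinearMap.comp_apply, h.opened]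
      simp [hetOpen, openState])
    (fun K hK => by
      change pairL Λ (emb U) (grandKappa Λ ΛF (closedState K)).2 = pairL Λ U (psi Λ K)
      rw [h.closed K hK, pairL_psi]
      refine (pairL_psi Λ _ _).trans ?_
      exact pair_map Λ (φ := Fin.castAdd (4 * ΛF)) (fun _ => rfl) K U)
  refine Prod.ext (Finsupp.ext fun p => ?_) (closed_eq_zero Λ fun U => ?_)
  · have := LinearMap.congr_fun (h1 p) v
    simp only [LinearMap.comp_apply, hv, map_zero] at this
    exact this.symm
  · have := LinearMap.congr_fun (h2 U) v
    simp only [LinearMap.comp_apply, hv, map_zero] at this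
    exact this.symm

theorem openState_mem (a : Fin (2 * ΛF)) (K : Word (2 * Λ)) (b : Fin (2 * ΛF)) :
    openState a K b ∈ grandStateGrading Λ ΛF ((eps Λ K : ℕ) : ZMod 2) :=
  Submodule.subset_span ⟨K, rfl, .inl ⟨a, b, rfl⟩⟩

theorem closedState_mem {K : Word (2 * Λ)} (hK : K ≠ []) :
    closedState K ∈ grandStateGrading Λ ΛF ((eps Λ K : ℕ) : ZMod 2) :=
  Submodule.subset_span ⟨K, rfl, .inr ⟨hK, rfl⟩⟩

theorem grandStateGrading_iSup : ⨆ a, grandStateGrading Λ ΛF a = ⊤ :=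
  eq_top_iff.2 fun v _ => grandState_mem (F := LinearMap.id)
    (fun _ _ _ => Submodule.mem_iSup_of_mem _ (openState_mem _ _ _))
    (fun _ hK => Submodule.mem_iSup_of_mem _ (closedState_mem hK)) v

theorem grandKappa_mem {e : ZMod 2} {v : GrandState Λ ΛF} (hv : v ∈ grandStateGrading Λ ΛF e) :
    grandKappa Λ ΛF v ∈ hetStateGrading Λ (2 * Λ + 4 * ΛF) e := by
  have h := isStateRealization_grandKappa (Λ := Λ) (ΛF := ΛF)
  refine Submodule.span_induction
    (p := fun v _ => grandKappa Λ ΛF v ∈ hetStateGrading Λ (2 * Λ + 4 * ΛF) e) ?_ ?_ ?_ ?_ hv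
  · rintro _ ⟨K, rfl, ⟨a, b, rfl⟩ | ⟨hK, rfl⟩⟩
    · have := hetOpen_mem (Λ := Λ) (K := leftLetter a :: (emb K ++ [rightLetter b])) (by simp)
      rwa [eps_left_cons, eps_append_right, eps_emb, ← h.opened] at this
    · have := hetClosed_mem (Λ := Λ) (K := emb (ΛF := ΛF) K) (by simpa)
      rwa [eps_emb, ← h.closed K hK] at this
  · rw [map_zero]
    exact Submodule.zero_mem _
  · intro x y _ _ hx hy
    rw [map_add]
    exact Submodule.add_mem _ hx hy
  · intro c x _ hx
    rw [map_smul]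
    exact Submodule.smul_mem _ c hx

end GrandString

/-! ### The action on singlet states -/

section GrandAction

variable {Λ ΛF : ℕ}

section Formulas

variable (a b c d l₁ l₂ : Fin (2 * ΛF)) (I J K : Word (2 * Λ))

theorem grandRep_op1_open :
    grandRep Λ ΛF (op1 a b I J c d) (grandKappa Λ ΛF (openState l₁ K l₂)) =
      grandKappa Λ ΛF ((kd l₁ b * kd K J * kd l₂ d) • openState a I c) := by
  have h := isStateRealization_grandKappa (Λ := Λ) (ΛF := ΛF)
  rw [h.opened, grandRep_op1, hetF_open _ (by simp) (by simp) (by simp), map_smul, h.opened,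
    kd_cons, kd_left_left, kd_append_right_right, mul_assoc]

theorem grandRep_op2_open :
    grandRep Λ ΛF (op2 a b I J) (grandKappa Λ ΛF (openState l₁ K l₂)) =
      grandKappa Λ ΛF (kd l₁ b • ∑ k ∈ cutsDD K, kd k.1 J • openState a (I ++ k.2) l₂) := by
  have h := isStateRealization_grandKappa (Λ := Λ) (ΛF := ΛF)
  rw [h.opened, grandRep_op2, hetL_open _ (by simp) (by simp) (by simp)]
  simp only [map_smul, map_sum, h.opened, sum_cutsDD_cons, sum_cutsDD_append,
    sum_cutsND_singleton, sum_cutsDD_emb, kd_nil_cons, kd_cons, kd_left_left, kd_emb, kd_right_emb,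
    mul_zero, zero_smul, zero_add, add_zero, Finset.smul_sum, smul_smul, List.cons_append,
    List.append_assoc, emb_append]

theorem grandRep_op3_open :
    grandRep Λ ΛF (op3 I J c d) (grandKappa Λ ΛF (openState l₁ K l₂)) =
      grandKappa Λ ΛF (kd l₂ d • ∑ k ∈ cutsDD K,
        (sgn (eps Λ k.1 * (eps Λ I + eps Λ J)) * kd k.2 J) • openState l₁ (k.1 ++ I) c) := by
  have h := isStateRealization_grandKappa (Λ := Λ) (ΛF := ΛF)
  rw [h.opened, grandRep_op3, hetR_open _ (by simp) (by simp) (by simp)]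
  simp only [map_smul, map_sum, h.opened, sum_cutsDD_cons, sum_cutsDD_append,
    sum_cutsND_singleton, sum_cutsDD_emb, kd_nil_append_right, kd_left_emb_append,
    kd_append_right_right, eps_left_cons, eps_append_right, eps_emb,
    mul_zero, zero_smul, zero_add, add_zero, Finset.smul_sum, smul_smul, List.cons_append,
    List.append_assoc, emb_append]
  exact Finset.sum_congr rfl fun k _ => congrArg (· • _) (by ring)

variable {I J K}

theorem grandRep_op4_open (hI : I ≠ []) (hJ : J ≠ []) (K : Word (2 * Λ)) :
    grandRep Λ ΛF (op4 I J) (grandKappa Λ ΛF (openState l₁ K l₂)) =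
      grandKappa Λ ΛF (gammaOpen Λ (fun W => openState l₁ W l₂) I J K) := by
  have h := isStateRealization_grandKappa (Λ := Λ) (ΛF := ΛF)
  rw [h.opened, grandRep_op4 hI hJ, (isHeterixAction_hetAct _).gamma_open _ _ _ (by simpa)
    (by simpa) (by simp), map_gammaOpen]
  simp only [gammaOpen, h.opened, sum_cuts3DND, sum_cutsDD_cons, sum_cutsND_cons,
    sum_cutsDD_append, sum_cutsND_append, sum_cutsDD_nil, sum_cutsND_nil, sum_cutsDD_emb,
    sum_cutsND_emb, kd_emb, kd_right_emb, kd_left_emb, eps_left_cons, eps_emb,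
    mul_zero, zero_smul, zero_add, add_zero, Finset.sum_const_zero, List.cons_append,
    List.append_assoc, emb_append]

theorem grandRep_op4_closed (hI : I ≠ []) (hJ : J ≠ []) (hK : K ≠ []) :
    grandRep Λ ΛF (op4 I J) (grandKappa Λ ΛF (closedState K)) =
      grandKappa Λ ΛF (gammaClosed Λ closedState I J K) := by
  have h := isStateRealization_grandKappa (Λ := Λ) (ΛF := ΛF)
  rw [h.closed K hK, grandRep_op4 hI hJ, (isHeterixAction_hetAct _).gamma_closed _ _ _ (by simpa)
    (by simpa) (by simpa), map_gammaClosed, emb, emb, emb,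
    gammaClosed_map Λ (φ := Fin.castAdd (4 * ΛF)) fun _ => rfl]
  exact gammaClosed_congr (fun A hA => (h.closed A hA).symm) hI _ _

theorem grandRep_op5_open (hI : I ≠ []) (hJ : J ≠ []) (K : Word (2 * Λ)) :
    grandRep Λ ΛF (op5 I J) (grandKappa Λ ΛF (openState l₁ K l₂)) = 0 := by
  rw [isStateRealization_grandKappa.opened, grandRep_op5 hI hJ,
    (isHeterixAction_hetAct _).fifth_open _ _ _ (by simpa) (by simpa) (by simp)]

theorem grandRep_op5_closed (hI : I ≠ []) (hJ : J ≠ []) (hK : K ≠ []) :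
    grandRep Λ ΛF (op5 I J) (grandKappa Λ ΛF (closedState K)) =
      grandKappa Λ ΛF (fifthClosed Λ closedState I J K) := by
  have h := isStateRealization_grandKappa (Λ := Λ) (ΛF := ΛF)
  rw [h.closed K hK, grandRep_op5 hI hJ, (isHeterixAction_hetAct _).fifth_closed _ _ _ (by simpa)
    (by simpa) (by simpa), map_fifthClosed, emb, emb, emb,
    fifthClosed_map Λ (φ := Fin.castAdd (4 * ΛF)) fun _ => rfl]
  simp only [fifthClosed, h.closed I hI]
  rfl

variable (I J)

theorem grandRep_op1_closed (hK : K ≠ []) :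
    grandRep Λ ΛF (op1 a b I J c d) (grandKappa Λ ΛF (closedState K)) = 0 := by
  rw [isStateRealization_grandKappa.closed K hK, grandRep_op1,
    hetF_closed _ (by simp) (by simp) (by simpa)]

theorem grandRep_op2_closed (hK : K ≠ []) :
    grandRep Λ ΛF (op2 a b I J) (grandKappa Λ ΛF (closedState K)) = 0 := by
  rw [isStateRealization_grandKappa.closed K hK, grandRep_op2,
    hetL_closed _ (by simp) (by simp) (by simpa)]

theorem grandRep_op3_closed (hK : K ≠ []) :
    grandRep Λ ΛF (op3 I J c d) (grandKappa Λ ΛF (closedState K)) = 0 := by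
  rw [isStateRealization_grandKappa.closed K hK, grandRep_op3,
    hetR_closed _ (by simp) (by simp) (by simpa)]

end Formulas

theorem grandRep_grandKappa_mem (x : Grand Λ ΛF) (v : GrandState Λ ΛF) :
    grandRep Λ ΛF x (grandKappa Λ ΛF v) ∈ LinearMap.range (grandKappa Λ ΛF) := by
  let B := (grandRep Λ ΛF).compl₂ (grandKappa Λ ΛF)
  refine grand_mem (F := B.flip v)
    (fun _ _ _ _ _ _ => grandState_mem (F := B _) (fun _ _ _ => ?_) (fun _ hK => ?_) v)
    (fun _ _ _ _ => grandState_mem (F := B _) (fun _ _ _ => ?_) (fun _ hK => ?_) v)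
    (fun _ _ _ _ => grandState_mem (F := B _) (fun _ _ _ => ?_) (fun _ hK => ?_) v)
    (fun _ _ hI hJ => grandState_mem (F := B _) (fun _ _ _ => ?_) (fun _ hK => ?_) v)
    (fun _ _ hI hJ => grandState_mem (F := B _) (fun _ _ _ => ?_) (fun _ hK => ?_) v) x
  · exact ⟨_, (grandRep_op1_open ..).symm⟩
  · exact ⟨0, (map_zero _).trans (grandRep_op1_closed _ _ _ _ _ _ hK).symm⟩
  · exact ⟨_, (grandRep_op2_open ..).symm⟩
  · exact ⟨0, (map_zero _).trans (grandRep_op2_closed _ _ _ _ hK).symm⟩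
  · exact ⟨_, (grandRep_op3_open ..).symm⟩
  · exact ⟨0, (map_zero _).trans (grandRep_op3_closed _ _ _ _ hK).symm⟩
  · exact ⟨_, (grandRep_op4_open _ _ hI hJ _).symm⟩
  · exact ⟨_, (grandRep_op4_closed hI hJ hK).symm⟩
  · exact ⟨0, (map_zero _).trans (grandRep_op5_open _ _ hI hJ _).symm⟩
  · exact ⟨_, (grandRep_op5_closed hI hJ hK).symm⟩

variable {ρ : Grand Λ ΛF →ₗ[ℂ] GrandState Λ ΛF →ₗ[ℂ] GrandState Λ ΛF}

theorem isGrandAction_of_grandKappa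
    (h : ∀ x v, grandKappa Λ ΛF (ρ x v) = grandRep Λ ΛF x (grandKappa Λ ΛF v)) :
    IsGrandAction Λ ΛF ρ := by
  have key : ∀ {x v w}, grandRep Λ ΛF x (grandKappa Λ ΛF v) = grandKappa Λ ΛF w → ρ x v = w :=
    fun hw => grandKappa_injective ((h _ _).trans hw)
  have key0 : ∀ {x v}, grandRep Λ ΛF x (grandKappa Λ ΛF v) = 0 → ρ x v = 0 :=
    fun hw => key (hw.trans (map_zero _).symm)
  exact
    { first_open := fun _ _ _ _ _ _ _ _ _ => key (grandRep_op1_open ..)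
      first_closed := fun _ _ _ _ _ _ _ hK => key0 (grandRep_op1_closed _ _ _ _ _ _ hK)
      second_open := fun _ _ _ _ _ _ _ => key (grandRep_op2_open ..)
      second_closed := fun _ _ _ _ _ hK => key0 (grandRep_op2_closed _ _ _ _ hK)
      third_open := fun _ _ _ _ _ _ _ => key (grandRep_op3_open ..)
      third_closed := fun _ _ _ _ _ hK => key0 (grandRep_op3_closed _ _ _ _ hK)
      fourth_open := fun _ _ _ _ _ hI hJ => key (grandRep_op4_open _ _ hI hJ _)
      fourth_closed := fun _ _ _ hI hJ hK => key (grandRep_op4_closed hI hJ hK)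
      fifth_open := fun _ _ _ _ _ hI hJ => key0 (grandRep_op5_open _ _ hI hJ _)
      fifth_closed := fun _ _ _ hI hJ hK => key (grandRep_op5_closed hI hJ hK) }

theorem IsGrandAction.unique {ρ' : Grand Λ ΛF →ₗ[ℂ] GrandState Λ ΛF →ₗ[ℂ] GrandState Λ ΛF}
    (h : IsGrandAction Λ ΛF ρ) (h' : IsGrandAction Λ ΛF ρ') : ρ = ρ' := by
  refine grand_ext
    (fun _ _ _ _ _ _ => grandState_ext (fun _ _ _ => ?_) fun _ hK => ?_)
    (fun _ _ _ _ => grandState_ext (fun _ _ _ => ?_) fun _ hK => ?_)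
    (fun _ _ _ _ => grandState_ext (fun _ _ _ => ?_) fun _ hK => ?_)
    (fun _ _ hI hJ => grandState_ext (fun _ _ _ => ?_) fun _ hK => ?_)
    (fun _ _ hI hJ => grandState_ext (fun _ _ _ => ?_) fun _ hK => ?_)
  · rw [h.first_open, h'.first_open]
  · rw [h.first_closed _ _ _ _ _ _ _ hK, h'.first_closed _ _ _ _ _ _ _ hK]
  · rw [h.second_open, h'.second_open]
  · rw [h.second_closed _ _ _ _ _ hK, h'.second_closed _ _ _ _ _ hK]
  · rw [h.third_open, h'.third_open]
  · rw [h.third_closed _ _ _ _ _ hK, h'.third_closed _ _ _ _ _ hK]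
  · rw [h.fourth_open _ _ _ _ _ hI hJ, h'.fourth_open _ _ _ _ _ hI hJ]
  · rw [h.fourth_closed _ _ _ hI hJ hK, h'.fourth_closed _ _ _ hI hJ hK]
  · rw [h.fifth_open _ _ _ _ _ hI hJ, h'.fifth_open _ _ _ _ _ hI hJ]
  · rw [h.fifth_closed _ _ _ hI hJ hK, h'.fifth_closed _ _ _ hI hJ hK]

variable (Λ ΛF) in
/-- The states in the range of `grandKappa` are stable, so the action can be transported back. -/
theorem exists_grandAction : ∃ ρ : Grand Λ ΛF →ₗ[ℂ] GrandState Λ ΛF →ₗ[ℂ] GrandState Λ ΛF,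
    ∀ x v, grandKappa Λ ΛF (ρ x v) = grandRep Λ ΛF x (grandKappa Λ ΛF v) :=
  exists_bilinear_lift grandKappa_injective ((grandRep Λ ΛF).compl₂ (grandKappa Λ ΛF))
    grandRep_grandKappa_mem

theorem existsUnique_isGrandAction : ∃! ρ, IsGrandAction Λ ΛF ρ := by
  obtain ⟨ρ, hρ⟩ := exists_grandAction Λ ΛF
  exact ⟨ρ, isGrandAction_of_grandKappa hρ, fun _ h => h.unique (isGrandAction_of_grandKappa hρ)⟩

theorem IsGrandAction.grandKappa_apply (h : IsGrandAction Λ ΛF ρ) (x : Grand Λ ΛF)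
    (v : GrandState Λ ΛF) :
    grandKappa Λ ΛF (ρ x v) = grandRep Λ ΛF x (grandKappa Λ ΛF v) := by
  obtain ⟨ρ', hρ'⟩ := exists_grandAction Λ ΛF
  rw [h.unique (isGrandAction_of_grandKappa hρ'), hρ']

variable (Λ ΛF) in
/-- The parity operator of the heterix states restricts to the range of `grandKappa`. -/
theorem exists_grandParity : ∃ P : Module.End ℂ (GrandState Λ ΛF),
    (∀ v, grandKappa Λ ΛF (P v) = hetParity Λ (2 * Λ + 4 * ΛF) (grandKappa Λ ΛF v)) ∧
    ∀ a, ∀ v ∈ grandStateGrading Λ ΛF a, P v = sgn a.val • v := by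
  have hP := fun a => hetParity_of_mem (Λ := Λ) (n := 2 * Λ + 4 * ΛF) a
  obtain ⟨P, hPκ⟩ := exists_linear_lift (S := GrandState Λ ΛF) grandKappa_injective
    (hetParity Λ (2 * Λ + 4 * ΛF) ∘ₗ grandKappa Λ ΛF) fun v => by
      refine grandState_mem (R := LinearMap.range (grandKappa Λ ΛF))
        (F := hetParity Λ (2 * Λ + 4 * ΛF) ∘ₗ grandKappa Λ ΛF) (fun a K b => ?_) (fun K hK => ?_) v
      · exact ⟨_, (map_smul _ _ _).trans (hP _ _ (grandKappa_mem (openState_mem a K b))).symm⟩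
      · exact ⟨_, (map_smul _ _ _).trans (hP _ _ (grandKappa_mem (closedState_mem hK))).symm⟩
  refine ⟨P, hPκ, fun a v hv => grandKappa_injective ?_⟩
  rw [hPκ, map_smul]
  exact hP a _ (grandKappa_mem hv)

theorem IsGrandAction.isSuperRepresentation {br : Grand Λ ΛF →ₗ[ℂ] Grand Λ ΛF →ₗ[ℂ] Grand Λ ΛF}
    (h : IsGrandAction Λ ΛF ρ) (hbr : IsGrandBracket Λ ΛF br) :
    IsSuperRepresentation (grandGrading Λ ΛF) br (grandStateGrading Λ ΛF) ρ where
  graded := by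
    obtain ⟨P, -, hP⟩ := exists_grandParity Λ ΛF
    exact isInternal_of_parity hP grandStateGrading_iSup
  action_mem a b x hx v hv := by
    obtain ⟨P, hPκ, hP⟩ := exists_grandParity Λ ΛF
    refine mem_of_parity hP grandStateGrading_iSup (grandKappa_injective ?_)
    have hd := LinearMap.congr_fun (hasDegree_grandRep hx) (grandKappa Λ ΛF v)
    rw [Module.End.mul_apply, LinearMap.smul_apply, Module.End.mul_apply, ← hPκ, hP b v hv,
      map_smul, map_smul, smul_smul, ← sgn_val_add, ← h.grandKappa_apply] at hd
    rw [hPκ, hd, map_smul]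
  map_bracket a b x hx y hy v := grandKappa_injective <| by
    rw [h.grandKappa_apply, hbr.grandRep_apply,
      superComm_of_degree (hetParity_mul_self _ _) (hasDegree_grandRep hx) (hasDegree_grandRep hy),
      map_sub, map_smul, h.grandKappa_apply, h.grandKappa_apply, h.grandKappa_apply,
      h.grandKappa_apply]
    rfl

end GrandAction

/-! ### Subalgebras and ideals of the grand string superalgebra -/

section GenericIdeals

variable {V : Type} [AddCommGroup V] [Module ℂ V] {gr : ZMod 2 → Submodule ℂ V}
  {br : V →ₗ[ℂ] V →ₗ[ℂ] V}

theorem SuperSkew.mem_swap (h : SuperSkew gr br) {I : Submodule ℂ V} {a b : ZMod 2} {x y : V}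
    (hx : x ∈ gr a) (hy : y ∈ gr b) (hxy : br x y ∈ I) : br y x ∈ I := by
  rw [h b a y hy x hx]
  exact I.neg_mem (I.smul_mem _ hxy)

/-- The span of homogeneous elements is an ideal if it absorbs brackets from the right. -/
theorem SuperSkew.isSuperideal_span (h : SuperSkew gr br) (htop : ⨆ a, gr a = ⊤) {s : Set V}
    (hs : ∀ x ∈ s, ∃ a, x ∈ gr a) (hb : ∀ x ∈ s, ∀ y, br x y ∈ Submodule.span ℂ s) :
    IsSuperideal gr br (Submodule.span ℂ s) where
  graded := span_eq_iSup_inf hs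
  bracket_mem_left y x hx := by
    have hl : ∀ x ∈ s, ⨆ a, gr a ≤ (Submodule.span ℂ s).comap (br.flip x) := fun x hxs =>
      iSup_le fun b y hy => by
        obtain ⟨a, ha⟩ := hs x hxs
        exact h.mem_swap ha hy (hb x hxs y)
    have : Submodule.span ℂ s ≤ (Submodule.span ℂ s).comap (br y) :=
      Submodule.span_le.2 fun x hxs => hl x hxs (htop ▸ Submodule.mem_top)
    exact this hx
  bracket_mem_right x hx y := by
    have : Submodule.span ℂ s ≤ (Submodule.span ℂ s).comap (br.flip y) :=
      Submodule.span_le.2 fun x hxs => hb x hxs y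
    exact this hx

theorem isSubsuperalgebra_span {s : Set V} (hs : ∀ x ∈ s, ∃ a, x ∈ gr a)
    (hb : ∀ x ∈ s, ∀ y ∈ s, br x y ∈ Submodule.span ℂ s) :
    IsSubsuperalgebra gr br (Submodule.span ℂ s) where
  graded := span_eq_iSup_inf hs
  bracket_mem x hx y hy := by
    have h1 : ∀ x ∈ s, Submodule.span ℂ s ≤ (Submodule.span ℂ s).comap (br x) := fun x hxs =>
      Submodule.span_le.2 fun y hys => hb x hxs y hys
    have h2 : Submodule.span ℂ s ≤ (Submodule.span ℂ s).comap (br.flip y) :=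
      Submodule.span_le.2 fun x hxs => h1 x hxs hy
    exact h2 hx

end GenericIdeals

section GrandIdeals

variable {Λ ΛF : ℕ} {br : Grand Λ ΛF →ₗ[ℂ] Grand Λ ΛF →ₗ[ℂ] Grand Λ ΛF}

theorem IsGrandBracket.isSubsuperalgebra_secondKind (h : IsGrandBracket Λ ΛF br) :
    IsSubsuperalgebra (grandGrading Λ ΛF) br (secondKind Λ ΛF) := by
  have hm : ∀ a b (I J : Word (2 * Λ)), (secondKind Λ ΛF).mkQ (op2 a b I J) = 0 := fun a b I J =>
    (Submodule.Quotient.mk_eq_zero _).2 (Submodule.subset_span ⟨a, b, I, J, rfl⟩)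
  refine isSubsuperalgebra_span ?_ ?_
  · rintro _ ⟨a, b, I, J, rfl⟩
    exact ⟨_, op2_mem _ _ _ _⟩
  · rintro _ ⟨a, b, I, J, rfl⟩ _ ⟨a', b', K, L, rfl⟩
    refine (Submodule.Quotient.mk_eq_zero _).1 (?_ : (secondKind Λ ΛF).mkQ _ = 0)
    simp only [h.second_second, map_sub, map_smul, map_add, map_sum, hm, smul_zero, add_zero,
      Finset.sum_const_zero, sub_zero]

theorem IsGrandBracket.isSubsuperalgebra_thirdKind (h : IsGrandBracket Λ ΛF br) :
    IsSubsuperalgebra (grandGrading Λ ΛF) br (thirdKind Λ ΛF) := by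
  have hm : ∀ (I J : Word (2 * Λ)) c d, (thirdKind Λ ΛF).mkQ (op3 I J c d) = 0 := fun I J c d =>
    (Submodule.Quotient.mk_eq_zero _).2 (Submodule.subset_span ⟨I, J, c, d, rfl⟩)
  refine isSubsuperalgebra_span ?_ ?_
  · rintro _ ⟨I, J, c, d, rfl⟩
    exact ⟨_, op3_mem _ _ _ _⟩
  · rintro _ ⟨I, J, c, d, rfl⟩ _ ⟨K, L, c', d', rfl⟩
    refine (Submodule.Quotient.mk_eq_zero _).1 (?_ : (thirdKind Λ ΛF).mkQ _ = 0)
    simp only [h.third_third, map_sub, map_smul, map_add, map_sum, hm, smul_zero, add_zero,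
      Finset.sum_const_zero, sub_zero]

/-- Brackets with operators of the first kind lie in every subspace containing all of these. -/
theorem IsGrandBracket.op1_apply_mem (h : IsGrandBracket Λ ΛF br) {R : Submodule ℂ (Grand Λ ΛF)}
    (hR : ∀ a b I J c d, op1 a b I J c d ∈ R) (a b : Fin (2 * ΛF)) (I J : Word (2 * Λ))
    (c d : Fin (2 * ΛF)) (y : Grand Λ ΛF) : br (op1 a b I J c d) y ∈ R := by
  have hm : ∀ a b I J c d, R.mkQ (op1 a b I J c d) = 0 := fun a b I J c d =>
    (Submodule.Quotient.mk_eq_zero _).2 (hR a b I J c d)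
  refine (Submodule.Quotient.mk_eq_zero _).1 (?_ : R.mkQ _ = 0)
  refine LinearMap.congr_fun (f := R.mkQ ∘ₗ br (op1 a b I J c d)) (g := 0)
    (grand_ext ?_ ?_ ?_ ?_ ?_) y
  · intros
    simp only [LinearMap.comp_apply, h.first_first, map_sub, map_smul, hm, smul_zero, sub_zero,
      LinearMap.zero_apply]
  · intros
    simp only [LinearMap.comp_apply, h.first_second, map_sub, map_smul, map_sum, hm, smul_zero,
      Finset.sum_const_zero, sub_zero, LinearMap.zero_apply]
  · intros
    simp only [LinearMap.comp_apply, h.first_third, map_sub, map_smul, map_sum, hm, smul_zero,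
      Finset.sum_const_zero, sub_zero, LinearMap.zero_apply]
  · intro K L hK hL
    simp only [LinearMap.comp_apply, h.first_fourth _ _ _ _ _ _ _ _ hK hL, map_sub, map_smul,
      map_sum, hm, smul_zero, Finset.sum_const_zero, sub_zero, LinearMap.zero_apply]
  · intro K L hK hL
    rw [LinearMap.comp_apply, h.first_fifth _ _ _ _ _ _ _ _ hK hL, map_zero]
    rfl

theorem IsGrandBracket.isSuperideal_firstKind (h : IsGrandBracket Λ ΛF br) :
    IsSuperideal (grandGrading Λ ΛF) br (firstKind Λ ΛF) := by
  refine h.skew.isSuperideal_span grandGrading_iSup ?_ ?_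
  · rintro _ ⟨a, b, I, J, c, d, rfl⟩
    exact ⟨_, op1_mem _ _ _ _ _ _⟩
  · rintro _ ⟨a, b, I, J, c, d, rfl⟩ y
    exact h.op1_apply_mem (R := firstKind Λ ΛF)
      (fun a b I J c d => Submodule.subset_span ⟨a, b, I, J, c, d, rfl⟩) a b I J c d y

theorem IsGrandBracket.isSuperideal_openKinds (h : IsGrandBracket Λ ΛF br) :
    IsSuperideal (grandGrading Λ ΛF) br
      (firstKind Λ ΛF ⊔ secondKind Λ ΛF ⊔ thirdKind Λ ΛF) := by
  rw [firstKind, secondKind, thirdKind, ← Submodule.span_union, ← Submodule.span_union]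
  set s : Set (Grand Λ ΛF) := ({x | ∃ a b I J c d, x = op1 a b I J c d} ∪
    {x | ∃ a b I J, x = op2 a b I J}) ∪ {x | ∃ I J c d, x = op3 I J c d} with hs
  set R := Submodule.span ℂ s with hR
  have h1 : ∀ a b I J c d, op1 a b I J c d ∈ R := fun a b I J c d =>
    Submodule.subset_span (.inl (.inl ⟨a, b, I, J, c, d, rfl⟩))
  have h2 : ∀ a b I J, op2 a b I J ∈ R := fun a b I J =>
    Submodule.subset_span (.inl (.inr ⟨a, b, I, J, rfl⟩))
  have h3 : ∀ I J c d, op3 I J c d ∈ R := fun I J c d =>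
    Submodule.subset_span (.inr ⟨I, J, c, d, rfl⟩)
  have m1 : ∀ a b I J c d, R.mkQ (op1 a b I J c d) = 0 := fun a b I J c d =>
    (Submodule.Quotient.mk_eq_zero _).2 (h1 a b I J c d)
  have m2 : ∀ a b I J, R.mkQ (op2 a b I J) = 0 := fun a b I J =>
    (Submodule.Quotient.mk_eq_zero _).2 (h2 a b I J)
  have m3 : ∀ I J c d, R.mkQ (op3 I J c d) = 0 := fun I J c d =>
    (Submodule.Quotient.mk_eq_zero _).2 (h3 I J c d)
  have h23 : ∀ a b I J K L c d, br (op2 a b I J) (op3 K L c d) ∈ R := by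
    intro a b I J K L c d
    refine (Submodule.Quotient.mk_eq_zero _).1 (?_ : R.mkQ _ = 0)
    simp only [h.second_third, map_sub, map_smul, map_sum, m1, smul_zero, Finset.sum_const_zero,
      sub_zero]
  refine h.skew.isSuperideal_span grandGrading_iSup ?_ ?_
  · rintro _ ((⟨a, b, I, J, c, d, rfl⟩ | ⟨a, b, I, J, rfl⟩) | ⟨I, J, c, d, rfl⟩)
    exacts [⟨_, op1_mem _ _ _ _ _ _⟩, ⟨_, op2_mem _ _ _ _⟩, ⟨_, op3_mem _ _ _ _⟩]
  · rintro _ ((⟨a, b, I, J, c, d, rfl⟩ | ⟨a, b, I, J, rfl⟩) | ⟨I, J, c, d, rfl⟩) y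
    · exact h.op1_apply_mem h1 a b I J c d y
    · refine grand_mem (F := br (op2 a b I J)) ?_ ?_ ?_ ?_ ?_ y
      · exact fun _ _ _ _ _ _ => h.skew.mem_swap (op1_mem _ _ _ _ _ _) (op2_mem _ _ _ _)
          (h.op1_apply_mem h1 _ _ _ _ _ _ _)
      · intro a' b' K L
        refine (Submodule.Quotient.mk_eq_zero _).1 (?_ : R.mkQ _ = 0)
        simp only [h.second_second, map_sub, map_smul, map_add, map_sum, m2, smul_zero, add_zero,
          Finset.sum_const_zero, sub_zero]
      · exact fun _ _ _ _ => h23 _ _ _ _ _ _ _ _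
      · intro K L hK hL
        refine (Submodule.Quotient.mk_eq_zero _).1 (?_ : R.mkQ _ = 0)
        simp only [h.second_fourth _ _ _ _ _ _ hK hL, map_sub, map_smul, map_add, map_sum, m2,
          smul_zero, add_zero, Finset.sum_const_zero, sub_zero]
      · intro K L hK hL
        rw [h.second_fifth _ _ _ _ _ _ hK hL]
        exact R.zero_mem
    · refine grand_mem (F := br (op3 I J c d)) ?_ ?_ ?_ ?_ ?_ y
      · exact fun _ _ _ _ _ _ => h.skew.mem_swap (op1_mem _ _ _ _ _ _) (op3_mem _ _ _ _)
          (h.op1_apply_mem h1 _ _ _ _ _ _ _)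
      · exact fun _ _ _ _ => h.skew.mem_swap (op2_mem _ _ _ _) (op3_mem _ _ _ _)
          (h23 _ _ _ _ _ _ _ _)
      · intro K L c' d'
        refine (Submodule.Quotient.mk_eq_zero _).1 (?_ : R.mkQ _ = 0)
        simp only [h.third_third, map_sub, map_smul, map_add, map_sum, m3, smul_zero, add_zero,
          Finset.sum_const_zero, sub_zero]
      · intro K L hK hL
        refine (Submodule.Quotient.mk_eq_zero _).1 (?_ : R.mkQ _ = 0)
        simp only [h.third_fourth _ _ _ _ _ _ hK hL, map_sub, map_smul, map_add, map_sum, m3,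
          smul_zero, add_zero, Finset.sum_const_zero, sub_zero]
      · intro K L hK hL
        rw [h.third_fifth _ _ _ _ _ _ hK hL]
        exact R.zero_mem

theorem IsGrandBracket.isSuperideal_fifthKind (h : IsGrandBracket Λ ΛF br) :
    IsSuperideal (grandGrading Λ ΛF) br (fifthKind Λ ΛF) := by
  have hm : ∀ I J : Word (2 * Λ), (fifthKind Λ ΛF).mkQ (op5 I J) = 0 := fun I J => by
    refine (Submodule.Quotient.mk_eq_zero _).2 ?_
    by_cases hIJ : I ≠ [] ∧ J ≠ []
    · exact Submodule.subset_span ⟨I, J, hIJ.1, hIJ.2, rfl⟩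
    · rw [op5, fifthVec, dif_neg hIJ]
      exact Submodule.zero_mem _
  refine h.skew.isSuperideal_span grandGrading_iSup ?_ ?_
  · rintro _ ⟨I, J, hI, hJ, rfl⟩
    exact ⟨_, op5_mem hI hJ⟩
  · rintro _ ⟨I, J, hI, hJ, rfl⟩ y
    refine grand_mem (R := fifthKind Λ ΛF) (F := br (op5 I J)) ?_ ?_ ?_ ?_ ?_ y
    · refine fun _ _ _ _ _ _ => h.skew.mem_swap (op1_mem _ _ _ _ _ _) (op5_mem hI hJ) ?_
      rw [h.first_fifth _ _ _ _ _ _ _ _ hI hJ]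
      exact Submodule.zero_mem _
    · refine fun _ _ _ _ => h.skew.mem_swap (op2_mem _ _ _ _) (op5_mem hI hJ) ?_
      rw [h.second_fifth _ _ _ _ _ _ hI hJ]
      exact Submodule.zero_mem _
    · refine fun _ _ _ _ => h.skew.mem_swap (op3_mem _ _ _ _) (op5_mem hI hJ) ?_
      rw [h.third_fifth _ _ _ _ _ _ hI hJ]
      exact Submodule.zero_mem _
    · refine fun K L hK hL => h.skew.mem_swap (op4_mem hK hL) (op5_mem hI hJ) ?_
      refine (Submodule.Quotient.mk_eq_zero _).1 (?_ : (fifthKind Λ ΛF).mkQ _ = 0)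
      rw [h.fourth_fifth _ _ _ _ hK hL hI hJ, map_gammaFifth]
      simp only [hm, gammaFifth, smul_zero, add_zero, Finset.sum_const_zero, sub_zero]
    · intro K L hK hL
      refine (Submodule.Quotient.mk_eq_zero _).1 (?_ : (fifthKind Λ ΛF).mkQ _ = 0)
      rw [h.fifth_fifth _ _ _ _ hI hJ hK hL, map_fifthFifth]
      simp only [hm, fifthFifth, fifthFifthHalf, smul_zero, add_zero, Finset.sum_const_zero,
        sub_zero]

theorem firstKind_le_ker : firstKind Λ ΛF ≤ LinearMap.ker (LinearMap.snd ℂ _ _) :=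
  Submodule.span_le.2 <| by
    rintro _ ⟨a, b, I, J, c, d, rfl⟩
    rfl

/-- Operators of the first three kinds have no component of the fourth kind. -/
theorem openKinds_le_ker : firstKind Λ ΛF ⊔ secondKind Λ ΛF ⊔ thirdKind Λ ΛF ≤
    LinearMap.ker (LinearMap.snd ℂ _ _ ∘ₗ LinearMap.snd ℂ _ _ ∘ₗ LinearMap.snd ℂ _ _) := by
  refine sup_le (sup_le ?_ ?_) ?_ <;> refine Submodule.span_le.2 ?_
  · rintro _ ⟨a, b, I, J, c, d, rfl⟩
    rfl
  · rintro _ ⟨a, b, I, J, rfl⟩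
    rfl
  · rintro _ ⟨I, J, c, d, rfl⟩
    rfl

theorem fifthKind_le_ker : fifthKind Λ ΛF ≤ LinearMap.ker (LinearMap.fst ℂ _ _) :=
  Submodule.span_le.2 <| by
    rintro _ ⟨I, J, hI, hJ, rfl⟩
    rfl

theorem op1_notMem_fifthKind (a b : Fin (2 * ΛF)) (I J : Word (2 * Λ)) (c d : Fin (2 * ΛF)) :
    op1 a b I J c d ∉ fifthKind Λ ΛF := fun h =>
  one_ne_zero (Finsupp.single_eq_zero.1 (LinearMap.mem_ker.1 (fifthKind_le_ker h)))

theorem op2_notMem_firstKind (a b : Fin (2 * ΛF)) (I J : Word (2 * Λ)) :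
    op2 a b I J ∉ firstKind Λ ΛF := fun h =>
  one_ne_zero (Finsupp.single_eq_zero.1
    (congrArg Prod.fst (LinearMap.mem_ker.1 (firstKind_le_ker h))))

theorem op4_notMem_openKinds {I J : Word (2 * Λ)} (hI : I ≠ []) (hJ : J ≠ []) :
    op4 I J ∉ firstKind Λ ΛF ⊔ secondKind Λ ΛF ⊔ thirdKind Λ ΛF := fun h => by
  have := congrArg Prod.fst (LinearMap.mem_ker.1 (openKinds_le_ker h))
  change fourthVec I J = 0 at this
  rw [fourthVec, dif_pos ⟨hI, hJ⟩] at this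
  exact one_ne_zero (Finsupp.single_eq_zero.1 this)

/-- Words of one letter have no nontrivial rotation, so `f̃` does not vanish on the state `Ψ^y`. -/
theorem fifthVec_singleton_ne_zero {n : ℕ} (x y : Fin n) : fifthVec Λ [x] [y] ≠ 0 := fun h => by
  have h1 : hetRep (φ := id) (fun _ => rfl) (hetFifth Λ [x] [y]) (psi Λ [y]) = 0 := by
    rw [hetFifth, h]
    change hetRep _ 0 _ = 0
    rw [map_zero, LinearMap.zero_apply]
  rw [hetRep_fifth (by simp) (by simp), List.map_id, List.map_id, fOp_psi] at h1
  have h2 := congrArg (pairL Λ [x]) h1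
  rw [map_smul, pairL_psi, pair_eq Λ (by simp), pair_eq Λ (by simp)] at h2
  simp [sum_cuts_cons, sum_cutsDN_nil] at h2

end GrandIdeals

end

end GrandString

theorem mainTheorem7 (Λ ΛF : ℕ) (hΛ : 0 < Λ) (hΛF : 0 < ΛF) :
    -- The defining formulas are consistent and determine all brackets, actions and embeddings.
    (∃! br, IsGrandBracket Λ ΛF br) ∧
    (∃! brH, IsHeterixBracket Λ (2 * Λ + 4 * ΛF) brH) ∧
    (∃! ρ, IsGrandAction Λ ΛF ρ) ∧
    (∃! ρH, IsHeterixAction Λ (2 * Λ + 4 * ΛF) ρH) ∧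
    (∃! ι, IsRealization Λ ΛF ι) ∧
    (∃! κ, IsStateRealization Λ ΛF κ) ∧
    ∀ br brH ρ ρH ι κ,
      IsGrandBracket Λ ΛF br →
      IsHeterixBracket Λ (2 * Λ + 4 * ΛF) brH →
      IsGrandAction Λ ΛF ρ →
      IsHeterixAction Λ (2 * Λ + 4 * ΛF) ρH →
      IsRealization Λ ΛF ι →
      IsStateRealization Λ ΛF κ →
      -- The grand string superalgebra and the heterix superalgebra are Lie superalgebras.
      IsLieSuperalgebra (grandGrading Λ ΛF) br ∧
      IsLieSuperalgebra (hetGrading Λ (2 * Λ + 4 * ΛF)) brH ∧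
      -- The former is embedded into the latter as a sub-superalgebra.
      Function.Injective ι ∧
      (∀ e, ∀ x ∈ grandGrading Λ ΛF e, ι x ∈ hetGrading Λ (2 * Λ + 4 * ΛF) e) ∧
      (∀ x y, ι (br x y) = brH (ι x) (ι y)) ∧
      IsSubsuperalgebra (hetGrading Λ (2 * Λ + 4 * ΛF)) brH (LinearMap.range ι) ∧
      -- Open plus closed singlet states represent both, compatibly with the embedding.
      IsSuperRepresentation (grandGrading Λ ΛF) br (grandStateGrading Λ ΛF) ρ ∧
      IsSuperRepresentation (hetGrading Λ (2 * Λ + 4 * ΛF)) brH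
        (hetStateGrading Λ (2 * Λ + 4 * ΛF)) ρH ∧
      Function.Injective κ ∧
      (∀ e, ∀ v ∈ grandStateGrading Λ ΛF e, κ v ∈ hetStateGrading Λ (2 * Λ + 4 * ΛF) e) ∧
      (∀ x v, κ (ρ x v) = ρH (ι x) (κ v)) ∧
      -- Subalgebras and proper ideals.
      IsSubsuperalgebra (grandGrading Λ ΛF) br (secondKind Λ ΛF) ∧
      IsSubsuperalgebra (grandGrading Λ ΛF) br (thirdKind Λ ΛF) ∧
      IsSuperideal (grandGrading Λ ΛF) br (firstKind Λ ΛF) ∧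
      IsSuperideal (grandGrading Λ ΛF) br
        (firstKind Λ ΛF ⊔ secondKind Λ ΛF ⊔ thirdKind Λ ΛF) ∧
      IsSuperideal (grandGrading Λ ΛF) br (fifthKind Λ ΛF) ∧
      firstKind Λ ΛF ≠ ⊥ ∧
      firstKind Λ ΛF < firstKind Λ ΛF ⊔ secondKind Λ ΛF ⊔ thirdKind Λ ΛF ∧
      firstKind Λ ΛF ⊔ secondKind Λ ΛF ⊔ thirdKind Λ ΛF < ⊤ ∧
      fifthKind Λ ΛF ≠ ⊥ ∧
      fifthKind Λ ΛF < ⊤ := by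
  have hn := two_mul_le Λ ΛF
  refine ⟨existsUnique_isGrandBracket hΛF, existsUnique_isHeterixBracket hn,
    existsUnique_isGrandAction,
    ⟨hetAct hn, isHeterixAction_hetAct hn, fun _ h => h.unique (isHeterixAction_hetAct hn)⟩,
    ⟨grandIota Λ ΛF, isRealization_grandIota Λ ΛF,
      fun _ h => h.unique (isRealization_grandIota Λ ΛF)⟩,
    ⟨grandKappa Λ ΛF, isStateRealization_grandKappa,
      fun _ h => h.unique isStateRealization_grandKappa⟩, ?_⟩
  intro br brH ρ ρH ι κ hbr hH hρ hρH hι hκ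
  obtain rfl := hι.unique (isRealization_grandIota Λ ΛF)
  obtain rfl := hκ.unique isStateRealization_grandKappa
  obtain rfl := hρH.unique (isHeterixAction_hetAct hn)
  let z : Fin (2 * ΛF) := ⟨0, by omega⟩
  let w : Fin (2 * Λ) := ⟨0, by omega⟩
  refine ⟨hbr.isLieSuperalgebra hΛF,
    (isFaithfulGraded_hetAct hn).isLieSuperalgebra ((isHeterixBracket_iff hn).1 hH),
    grandIota_injective Λ ΛF hΛF, fun _ _ => grandIota_mem, hbr.grandIota_apply hH,
    hbr.isSubsuperalgebra_range hH, hρ.isSuperRepresentation hbr,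
    isSuperRepresentation_hetAct hn hH, grandKappa_injective, fun _ _ => grandKappa_mem,
    hρ.grandKappa_apply, hbr.isSubsuperalgebra_secondKind, hbr.isSubsuperalgebra_thirdKind,
    hbr.isSuperideal_firstKind, hbr.isSuperideal_openKinds, hbr.isSuperideal_fifthKind,
    ?_, ?_, ?_, ?_, ?_⟩
  · refine fun h => one_ne_zero (α := ℂ) (Finsupp.single_eq_zero.1 (congrArg Prod.fst
      ((Submodule.mem_bot ℂ).1 (h ▸ ?_ : op1 z z [] [] z z ∈ (⊥ : Submodule ℂ (Grand Λ ΛF))))))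
    exact Submodule.subset_span ⟨z, z, [], [], z, z, rfl⟩
  · refine lt_of_le_of_ne (le_sup_left.trans le_sup_left) fun h =>
      op2_notMem_firstKind z z [] [] (h.symm.le ?_)
    exact Submodule.mem_sup_left
      (Submodule.mem_sup_right (Submodule.subset_span ⟨z, z, [], [], rfl⟩))
  · exact lt_top_iff_ne_top.2 fun h =>
      op4_notMem_openKinds (I := [w]) (J := [w]) (List.cons_ne_nil _ _) (List.cons_ne_nil _ _)
        (h ▸ Submodule.mem_top)
  · refine fun h => fifthVec_singleton_ne_zero w w (congrArg (fun x => x.2.2.2.2)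
      ((Submodule.mem_bot ℂ).1 (h ▸ ?_ : op5 [w] [w] ∈ (⊥ : Submodule ℂ (Grand Λ ΛF)))))
    exact Submodule.subset_span ⟨[w], [w], List.cons_ne_nil _ _, List.cons_ne_nil _ _, rfl⟩
  · exact lt_top_iff_ne_top.2 fun h =>
      op1_notMem_fifthKind z z [] [] z z (h ▸ Submodule.mem_top)
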